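/- **Definitions.** A *cone* is a pair $(N,\sigma)$ of a finitely generated free abelian group $N$ and a strictly convex finite intersection $\sigma$ of rational half-spaces of $N_{\mathbb R}=N\otimes\mathbb R$ spanning $N_{\mathbb R}$; a morphism $(N,\sigma)\to(N',\sigma')$ is a homomorphism $f\colon N\to N'$ with $f(\sigma)\subseteq\sigma'$. A *face morphism* is a morphism inducing an isomorphism of its source onto a face $F$ of its target (with lattice $N\cap\operatorname{span}F$). Let $\mathbf{RPC}$ be the category of cones and $\mathbf{RPC}^f$ the category of cones with face morphisms. A *combinatorial cone space* is a family of cones $(\sigma_\alpha)$ with a collection $\mathcal F$ of face morphisms $\sigma_\alpha\to\sigma_\beta$, closed under composition and containing all identities, such that every face of every $\sigma_\beta$ is the image of exactly one morphism of $\mathcal F$ with target $\sigma_\beta$. It is a *cone complex* if moreover $\mathcal F$ contains at most one morphism $\sigma_\alpha\to\sigma_\beta$ for all $\alpha,\beta$. A morphism $f$ of these assigns to each $\alpha$ an index $f(\alpha)$ and a morphism $f_\alpha\colon\sigma_\alpha\to\sigma_{f(\alpha)}$ whose image is contained in no proper face, such that for each $\phi\colon\sigma_\alpha\to\sigma_\beta$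 in $\mathcal F$ there is $\psi\colon\sigma_{f(\alpha)}\to\sigma_{f(\beta)}$ in the target collection with $f_\beta\phi=\psi f_\alpha$. It is *strict* if all $f_\alpha$ are isomorphisms. Let $\mathbf{RPCC}$ be the category of cone complexes, with the Grothendieck topology (*face topology*) generated by the families $(\sigma_\alpha\to\Sigma)_\alpha$, for all cone complexes $\Sigma$, where $\sigma_\alpha$ is regarded as the complex of its faces. A *cone space* is a sheaf of sets $X$ on $\mathbf{RPCC}$ whose diagonal is representable by cone complexes and which admits a strict covering $U\to X$ by a cone complex $U$. A *cone stack* is a stack $\mathcal C$ (in groupoids) over $\mathbf{RPCC}$ whose diagonal is representable by cone spaces and which admits a strict covering $U\to\mathcal C$ by a cone space $U$. (Covering: locally surjective. Strict: all base changes to cone complexes are strict, where a morphism from a cone space $R$ to a cone complex is strict if its composite with some strict covering of $R$ by a cone complex is.) Cone stacks form a full sub-2-category of the 2-category of categories fibred in groupoids over $\mathbf{RPCC}$; a cone space $X$ is identified with the cone stack $\mathbf{RPCC}/X$. A *combinatorial cone stack* is a category fibred in (essentially small) groupoids $\sigma\colon\Sigma\to\mathbf{RPC}^f$. A morphism $(\Sigma,\sigma)\to(T,\tau)$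 is a functor $\Phi\colon\Sigma\to T$ with morphisms of cones $\phi_\alpha\colon\sigma_\alpha\to\tau_{\Phi(\alpha)}$, natural in $\alpha\in\Sigma$, whose images are contained in no proper face. A 2-morphism $(\Phi,\phi)\Rightarrow(\Phi',\phi')$ is a natural transformation $\eta\colon\Phi\Rightarrow\Phi'$ with $\tau(\eta_\alpha)\circ\phi_\alpha=\phi'_\alpha$ for all $\alpha$. A combinatorial cone space $Z=((\sigma_\alpha),\mathcal F)$ is identified with the combinatorial cone stack whose objects are triples $(\rho,\alpha,\rho\cong\sigma_\alpha)$, with $\rho$ a cone, whose morphisms $(\rho,\alpha,\cdot)\to(\rho',\beta,\cdot)$ are the elements $\sigma_\alpha\to\sigma_\beta$ of $\mathcal F$, and whose projection to $\mathbf{RPC}^f$ sends the triple to $\rho$. **Proposition.** The 2-category of combinatorial cone stacks is equivalent to the 2-category of cone stacks: there is a pseudofunctor $F$ from the former to the latter which is an equivalence on all categories of morphisms and such that every cone stack is equivalent to some $F(\Sigma)$. Moreover $F$ can be chosen so that, for every combinatorial cone stack $\Sigma$, the cone stack $F(\Sigma)$ is equivalent to a cone space if and only if $\Sigma$ is equivalent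 to a combinatorial cone space. -/

import Mathlib

open CategoryTheory
open scoped TensorProduct

universe u

namespace ConeStacks

noncomputable section

/-! ### Rational polyhedral cones -/

/-- The linear form on `N_ℝ = ℝ ⊗ N` induced by an integral linear form on `N`. -/
def pairing {N : Type u} [AddCommGroup N] (m : N →ₗ[ℤ] ℤ) : (ℝ ⊗[ℤ] N) →ₗ[ℝ] ℝ :=
  (TensorProduct.AlgebraTensorModule.rid ℤ ℝ ℝ).toLinearMap ∘ₗ m.baseChange ℝ

lemma pairing_baseChange {N N' : Type u} [AddCommGroup N] [AddCommGroup N']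
    (f : N →ₗ[ℤ] N') (m : N' →ₗ[ℤ] ℤ) (x : ℝ ⊗[ℤ] N) :
    pairing m (f.baseChange ℝ x) = pairing (m ∘ₗ f) x := by
  simp [pairing, LinearMap.baseChange_comp]

/-- The integral points `S_σ = σ^∨ ∩ M` of the dual cone, where `M = Hom(N, ℤ)`. -/
def dualMonoid {N : Type u} [AddCommGroup N] (σ : PointedCone ℝ (ℝ ⊗[ℤ] N)) :
    AddSubmonoid (N →ₗ[ℤ] ℤ) where
  carrier := {m | ∀ x ∈ σ, 0 ≤ pairing m x}
  zero_mem' := by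
    intro x _
    simp [pairing]
  add_mem' := by
    intro a b ha hb x hx
    have := add_nonneg (ha x hx) (hb x hx)
    simpa [pairing, LinearMap.baseChange_add] using this

/-- A rational polyhedral cone `(N, σ)`: a finitely generated free abelian group `N` and a finite
intersection `σ` of rational half spaces in `N_ℝ`, strictly convex, and such that the monoid `S_σ`
is sharp (equivalently, `σ` spans `N_ℝ`). -/
structure RPC : Type (u + 1) where
  /-- The lattice. -/
  N : Type u
  [addCommGroup : AddCommGroup N]
  [free : Module.Free ℤ N]
  [finite : Module.Finite ℤ N]
  /-- The cone in `N_ℝ`. -/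
  cone : PointedCone ℝ (ℝ ⊗[ℤ] N)
  polyhedral : ∃ s : Finset (N →ₗ[ℤ] ℤ), ∀ x, x ∈ cone ↔ ∀ m ∈ s, 0 ≤ pairing m x
  strictlyConvex : ∀ x ∈ cone, -x ∈ cone → x = 0
  sharp : ∀ m ∈ dualMonoid cone, -m ∈ dualMonoid cone → m = 0

attribute [instance] RPC.addCommGroup RPC.free RPC.finite

/-- A `ℤ`-linear morphism of cones: a homomorphism of lattices `N → N'` mapping `σ` into `σ'`. -/
@[ext]
structure RPC.Hom (σ τ : RPC.{u}) : Type u where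
  lin : σ.N →ₗ[ℤ] τ.N
  maps : ∀ x ∈ σ.cone, lin.baseChange ℝ x ∈ τ.cone

instance : Category.{u} RPC.{u} where
  Hom := RPC.Hom
  id σ := ⟨LinearMap.id, fun x hx => by simpa using hx⟩
  comp f g := ⟨g.lin ∘ₗ f.lin, fun x hx => by
    rw [LinearMap.baseChange_comp]
    exact g.maps _ (f.maps x hx)⟩

@[simp] lemma RPC.id_lin (σ : RPC.{u}) : RPC.Hom.lin (𝟙 σ) = LinearMap.id := rfl

@[simp] lemma RPC.comp_lin {σ τ ρ : RPC.{u}} (f : σ ⟶ τ) (g : τ ⟶ ρ) :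
    RPC.Hom.lin (f ≫ g) = RPC.Hom.lin g ∘ₗ RPC.Hom.lin f := rfl

lemma RPC.hom_ext {σ τ : RPC.{u}} {f g : σ ⟶ τ} (h : RPC.Hom.lin f = RPC.Hom.lin g) : f = g :=
  RPC.Hom.ext h

/-- The map `N_ℝ → N'_ℝ` underlying a morphism of cones. -/
def RPC.real {σ τ : RPC.{u}} (f : σ ⟶ τ) : (ℝ ⊗[ℤ] σ.N) →ₗ[ℝ] (ℝ ⊗[ℤ] τ.N) :=
  (RPC.Hom.lin f).baseChange ℝ

/-- The image of the source cone under a morphism of cones. -/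
def RPC.image {σ τ : RPC.{u}} (f : σ ⟶ τ) : PointedCone ℝ (ℝ ⊗[ℤ] τ.N) :=
  σ.cone.map (RPC.real f)

@[simp] lemma RPC.real_id (σ : RPC.{u}) : RPC.real (𝟙 σ) = LinearMap.id := by
  simp [RPC.real]

lemma RPC.real_comp {σ τ ρ : RPC.{u}} (f : σ ⟶ τ) (g : τ ⟶ ρ) :
    RPC.real (f ≫ g) = RPC.real g ∘ₗ RPC.real f := by
  simp [RPC.real, LinearMap.baseChange_comp]

@[simp] lemma RPC.image_id (σ : RPC.{u}) : RPC.image (𝟙 σ) = σ.cone := by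
  simp [RPC.image]

lemma RPC.image_comp {σ τ ρ : RPC.{u}} (f : σ ⟶ τ) (g : τ ⟶ ρ) :
    RPC.image (f ≫ g) = (RPC.image f).map (RPC.real g) := by
  simp [RPC.image, RPC.real_comp, PointedCone.map_map]

lemma RPC.image_le {σ τ : RPC.{u}} (f : σ ⟶ τ) : RPC.image f ≤ τ.cone := by
  rintro _ ⟨x, hx, rfl⟩
  exact RPC.Hom.maps f x hx

/-- A face morphism `τ → σ`: it induces an isomorphism of `τ` onto a face `F` of `σ`, the lattice of
the face `F` being the saturated sublattice `N ∩ span F` of `N`. -/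
structure IsFaceMorphism {τ σ : RPC.{u}} (f : τ ⟶ σ) : Prop where
  face : (RPC.image f).IsFaceOf σ.cone
  injective : Function.Injective (RPC.Hom.lin f)
  saturated : ∀ (k : ℤ) (n : σ.N), k ≠ 0 → k • n ∈ LinearMap.range (RPC.Hom.lin f) →
    n ∈ LinearMap.range (RPC.Hom.lin f)

/-- The image of `f : σ → τ` is not contained in any proper face of `τ`; equivalently, `f` does not
factor through any proper face morphism. -/
def IsDominant {σ τ : RPC.{u}} (f : σ ⟶ τ) : Prop :=
  ∀ F : PointedCone ℝ (ℝ ⊗[ℤ] τ.N), F.IsFaceOf τ.cone → RPC.image f ≤ F → F = τ.cone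

lemma IsFaceMorphism.real_injective {τ σ : RPC.{u}} {f : τ ⟶ σ} (hf : IsFaceMorphism f) :
    Function.Injective (RPC.real f) :=
  Module.Flat.lTensor_preserves_injective_linearMap (M := ℝ) _ hf.injective

lemma IsFaceMorphism.of_isIso {τ σ : RPC.{u}} (f : τ ⟶ σ) [IsIso f] : IsFaceMorphism f := by
  have h1 : RPC.Hom.lin (inv f) ∘ₗ RPC.Hom.lin f = LinearMap.id := by
    rw [← RPC.comp_lin, IsIso.hom_inv_id, RPC.id_lin]
  have h2 : RPC.Hom.lin f ∘ₗ RPC.Hom.lin (inv f) = LinearMap.id := by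
    rw [← RPC.comp_lin, IsIso.inv_hom_id, RPC.id_lin]
  refine ⟨?_, Function.LeftInverse.injective (g := RPC.Hom.lin (inv f)) fun x => ?_,
    fun k n _ _ => ⟨RPC.Hom.lin (inv f) n, ?_⟩⟩
  · have : RPC.image f = σ.cone := by
      refine le_antisymm (RPC.image_le f) fun x hx => ?_
      refine ⟨RPC.real (inv f) x, RPC.Hom.maps (inv f) x hx, ?_⟩
      change (RPC.real f ∘ₗ RPC.real (inv f)) x = x
      rw [← RPC.real_comp, IsIso.inv_hom_id, RPC.real_id, LinearMap.id_apply]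
    rw [this]
  · exact LinearMap.congr_fun h1 x
  · exact LinearMap.congr_fun h2 n

lemma IsFaceMorphism.comp {ρ τ σ : RPC.{u}} {f : ρ ⟶ τ} {g : τ ⟶ σ} (hf : IsFaceMorphism f)
    (hg : IsFaceMorphism g) : IsFaceMorphism (f ≫ g) := by
  refine ⟨?_, ?_, ?_⟩
  · rw [RPC.image_comp]
    exact (hf.face.map _ hg.real_injective).trans hg.face
  · exact hg.injective.comp hf.injective
  · rintro k n hk ⟨x, hx⟩
    obtain ⟨y, rfl⟩ := hg.saturated k n hk ⟨RPC.Hom.lin f x, hx⟩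
    obtain ⟨z, rfl⟩ := hf.saturated k y hk ⟨x, hg.injective (by simpa using hx)⟩
    exact ⟨z, rfl⟩

lemma IsDominant.id (σ : RPC.{u}) : IsDominant (𝟙 σ) := fun F hF h =>
  le_antisymm hF.le (by simpa using h)

lemma IsDominant.comp {ρ τ σ : RPC.{u}} {f : ρ ⟶ τ} {g : τ ⟶ σ} (hf : IsDominant f)
    (hg : IsDominant g) : IsDominant (f ≫ g) := by
  intro F hF h
  have hle : τ.cone ≤ σ.cone.comap (RPC.real g) := fun x hx => RPC.Hom.maps g x hx
  have hface : (F.comap (RPC.real g) ⊓ τ.cone).IsFaceOf τ.cone := by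
    have := (hF.comap (RPC.real g)).inf (PointedCone.IsFaceOf.refl τ.cone)
    rwa [inf_eq_right.mpr hle] at this
  have key := hf _ hface (le_inf (fun x hx => ?_) (RPC.image_le f))
  · refine hg F hF ?_
    rintro _ ⟨x, hx, rfl⟩
    have hx' : x ∈ F.comap (RPC.real g) ⊓ τ.cone := by rwa [key]
    exact hx'.1
  · refine h ?_
    rw [RPC.image_comp]
    exact ⟨x, hx, rfl⟩

/-- If the image of `f` is contained in the image of a face morphism `g`, then `f` factors
through `g`. -/
lemma IsFaceMorphism.exists_lift {ρ τ σ : RPC.{u}} (f : ρ ⟶ σ) {g : τ ⟶ σ}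
    (hg : IsFaceMorphism g) (h : RPC.image f ≤ RPC.image g) : ∃ k : ρ ⟶ τ, k ≫ g = f := by
  have hmem : ∀ n, RPC.Hom.lin f n ∈ LinearMap.range (RPC.Hom.lin g) := by
    intro n
    by_contra hn
    set R := LinearMap.range (RPC.Hom.lin g) with hR
    have : Module.IsTorsionFree ℤ (σ.N ⧸ R) := by
      refine Module.IsTorsionFree.of_smul_eq_zero (R := ℤ) (M := σ.N ⧸ R) fun k x hx => ?_
      obtain ⟨x, rfl⟩ := R.mkQ_surjective x
      by_cases hk : k = 0
      · exact Or.inl hk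
      · right
        rw [← map_smul, Submodule.mkQ_apply, Submodule.Quotient.mk_eq_zero] at hx
        rw [Submodule.mkQ_apply, Submodule.Quotient.mk_eq_zero]
        exact hg.saturated k x hk hx
    have hne : R.mkQ (RPC.Hom.lin f n) ≠ 0 := by
      rwa [Ne, Submodule.mkQ_apply, Submodule.Quotient.mk_eq_zero]
    apply hne
    rw [← Module.forall_dual_apply_eq_zero_iff ℤ]
    intro φ
    have hzero : ∀ x ∈ ρ.cone, pairing ((φ ∘ₗ R.mkQ) ∘ₗ RPC.Hom.lin f) x = 0 := by
      intro x hx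
      rw [← pairing_baseChange]
      obtain ⟨y, _, hy⟩ := h ⟨x, hx, rfl⟩
      have hy' : (RPC.Hom.lin g).baseChange ℝ y = (RPC.Hom.lin f).baseChange ℝ x := hy
      rw [← hy', pairing_baseChange]
      have : (φ ∘ₗ R.mkQ) ∘ₗ RPC.Hom.lin g = 0 := by
        ext z
        have : R.mkQ (RPC.Hom.lin g z) = 0 := by
          rw [Submodule.mkQ_apply, Submodule.Quotient.mk_eq_zero]
          exact ⟨z, rfl⟩
        simp only [LinearMap.comp_apply, this, map_zero, LinearMap.zero_apply]
      rw [this]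
      simp [pairing]
    have := ρ.sharp ((φ ∘ₗ R.mkQ) ∘ₗ RPC.Hom.lin f) (fun x hx => (hzero x hx).ge) (fun x hx => by
      have h0 : pairing (-((φ ∘ₗ R.mkQ) ∘ₗ RPC.Hom.lin f)) x
          = -pairing ((φ ∘ₗ R.mkQ) ∘ₗ RPC.Hom.lin f) x := by
        simp [pairing, LinearMap.baseChange_neg]
      rw [h0, hzero x hx, neg_zero])
    exact LinearMap.congr_fun this n
  let e := LinearEquiv.ofInjective (RPC.Hom.lin g) hg.injective
  let l : ρ.N →ₗ[ℤ] τ.N := e.symm.toLinearMap ∘ₗ (RPC.Hom.lin f).codRestrict _ hmem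
  have hl : RPC.Hom.lin g ∘ₗ l = RPC.Hom.lin f := by
    ext n
    have := e.apply_symm_apply ((RPC.Hom.lin f).codRestrict _ hmem n)
    exact congrArg Subtype.val this
  refine ⟨⟨l, fun x hx => ?_⟩, RPC.hom_ext hl⟩
  obtain ⟨y, hy, hxy⟩ := h ⟨x, hx, rfl⟩
  have : RPC.real g (l.baseChange ℝ x) = RPC.real g y := by
    change ((RPC.Hom.lin g).baseChange ℝ ∘ₗ l.baseChange ℝ) x = _
    rw [← LinearMap.baseChange_comp, hl]
    exact hxy.symm
  rw [hg.real_injective this]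
  exact hy

lemma IsFaceMorphism.cancel {ρ τ σ : RPC.{u}} {f f' : ρ ⟶ τ} {g : τ ⟶ σ} (hg : IsFaceMorphism g)
    (h : f ≫ g = f' ≫ g) : f = f' := by
  refine RPC.hom_ext (LinearMap.ext fun x => hg.injective ?_)
  exact LinearMap.congr_fun (congrArg RPC.Hom.lin h) x

/-- Two face morphisms with the same image differ by an isomorphism. -/
lemma IsFaceMorphism.exists_iso {ρ τ σ : RPC.{u}} {f : ρ ⟶ σ} {g : τ ⟶ σ}
    (hf : IsFaceMorphism f) (hg : IsFaceMorphism g) (h : RPC.image f = RPC.image g) :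
    ∃ k : ρ ≅ τ, k.hom ≫ g = f := by
  obtain ⟨a, ha⟩ := hg.exists_lift f h.le
  obtain ⟨b, hb⟩ := hf.exists_lift g h.ge
  exact ⟨⟨a, b, hf.cancel (by rw [Category.assoc, hb, ha, Category.id_comp]),
    hg.cancel (by rw [Category.assoc, ha, hb, Category.id_comp])⟩, ha⟩

/-- The class of face morphisms. -/
def faceMorphisms : MorphismProperty RPC.{u} := fun _ _ f => IsFaceMorphism f

instance : faceMorphisms.{u}.IsMultiplicative where
  id_mem σ := IsFaceMorphism.of_isIso (𝟙 σ)
  comp_mem _ _ hf hg := IsFaceMorphism.comp hf hg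

/-- The category `RPC^f` of cones with face morphisms. -/
abbrev RPCf : Type (u + 1) := WideSubcategory faceMorphisms.{u}

/-- The inclusion of `RPC^f` into `RPC`. -/
abbrev RPCf.incl : RPCf.{u} ⥤ RPC.{u} := wideSubcategoryInclusion faceMorphisms.{u}

/-! ### Combinatorial cone spaces and cone complexes -/

/-- A combinatorial cone space: a family of cones with a collection of face morphisms between them,
closed under composition, containing the identities, and such that every face of a cone of the
family is the image of exactly one morphism of the collection. -/
structure CombConeSpace : Type (u + 1) where
  ι : Type u
  cone : ι → RPC.{u}
  mor : ∀ α β, Set (cone α ⟶ cone β)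
  isFace : ∀ {α β} (φ : cone α ⟶ cone β), φ ∈ mor α β → IsFaceMorphism φ
  comp_mem : ∀ {α β γ} (φ : cone α ⟶ cone β) (ψ : cone β ⟶ cone γ),
    φ ∈ mor α β → ψ ∈ mor β γ → φ ≫ ψ ∈ mor α γ
  id_mem : ∀ α, 𝟙 (cone α) ∈ mor α α
  existsUnique_face : ∀ (β : ι) (F : PointedCone ℝ (ℝ ⊗[ℤ] (cone β).N)),
    F.IsFaceOf (cone β).cone →
      ∃! p : Σ α, cone α ⟶ cone β, p.2 ∈ mor p.1 β ∧ RPC.image p.2 = F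

/-- A morphism of combinatorial cone spaces (and of cone complexes). -/
structure CombConeSpace.Hom (X Y : CombConeSpace.{u}) : Type u where
  idx : X.ι → Y.ι
  map : ∀ α, X.cone α ⟶ Y.cone (idx α)
  dominant : ∀ α, IsDominant (map α)
  compat : ∀ {α β} (φ : X.cone α ⟶ X.cone β), φ ∈ X.mor α β →
    ∃ ψ ∈ Y.mor (idx α) (idx β), φ ≫ map β = map α ≫ ψ

lemma CombConeSpace.Hom.ext_map {X Y : CombConeSpace.{u}} {f g : CombConeSpace.Hom X Y}
    (h : ∀ α, (⟨f.idx α, f.map α⟩ : Σ β, X.cone α ⟶ Y.cone β) = ⟨g.idx α, g.map α⟩) : f = g := by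
  obtain ⟨i, m, _, _⟩ := f
  obtain ⟨j, n, _, _⟩ := g
  obtain rfl : i = j := funext fun α => congrArg Sigma.fst (h α)
  obtain rfl : m = n := funext fun α => by simpa using h α
  rfl

instance : Category.{u} CombConeSpace.{u} where
  Hom := CombConeSpace.Hom
  id X := ⟨_root_.id, fun α => 𝟙 _, fun α => IsDominant.id _, fun φ hφ => ⟨φ, hφ, by simp⟩⟩
  comp f g := ⟨g.idx ∘ f.idx, fun α => f.map α ≫ g.map _,
    fun α => (f.dominant α).comp (g.dominant _), fun φ hφ => by
      obtain ⟨ψ, hψ, h⟩ := f.compat φ hφ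
      obtain ⟨χ, hχ, h'⟩ := g.compat ψ hψ
      exact ⟨χ, hχ, by rw [← Category.assoc, h, Category.assoc, h', Category.assoc]⟩⟩
  id_comp f := CombConeSpace.Hom.ext_map fun α => by simp
  comp_id f := CombConeSpace.Hom.ext_map fun α => by simp
  assoc f g h := CombConeSpace.Hom.ext_map fun α => by simp

/-- A cone complex is a combinatorial cone space with at most one morphism between any two of its
cones. -/
def IsConeComplex : ObjectProperty CombConeSpace.{u} := fun X =>
  ∀ α β, (X.mor α β).Subsingleton

/-- The category of cone complexes. -/
abbrev RPCC : Type (u + 1) := IsConeComplex.{u}.FullSubcategory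

/-- The cone `σ_α` of a cone complex, viewed as the cone complex consisting of all the faces
of `σ_α`. -/
def RPCC.face (X : RPCC.{u}) (α : X.obj.ι) : RPCC.{u} where
  obj :=
    { ι := {β : X.obj.ι // (X.obj.mor β α).Nonempty}
      cone := fun β => X.obj.cone β.1
      mor := fun β γ => X.obj.mor β.1 γ.1
      isFace := fun φ hφ => X.obj.isFace φ hφ
      comp_mem := fun φ ψ hφ hψ => X.obj.comp_mem φ ψ hφ hψ
      id_mem := fun β => X.obj.id_mem β.1
      existsUnique_face := by
        rintro ⟨β, χ, hχ⟩ F hF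
        obtain ⟨⟨γ, φ⟩, ⟨hφ, hφF⟩, huniq⟩ := X.obj.existsUnique_face β F hF
        refine ⟨⟨⟨γ, φ ≫ χ, X.obj.comp_mem _ _ hφ hχ⟩, φ⟩, ⟨hφ, hφF⟩, ?_⟩
        rintro ⟨⟨δ, hδ⟩, ψ⟩ ⟨hψ, hψF⟩
        have := huniq ⟨δ, ψ⟩ ⟨hψ, hψF⟩
        cases this
        rfl }
  property := fun β γ => X.property β.1 γ.1

/-- The canonical morphism `σ_α → X`. -/
def RPCC.faceIncl (X : RPCC.{u}) (α : X.obj.ι) : X.face α ⟶ X :=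
  ObjectProperty.homMk
    { idx := Subtype.val
      map := fun _ => 𝟙 _
      dominant := fun _ => IsDominant.id _
      compat := fun φ hφ => ⟨φ, hφ, (Category.comp_id φ).trans (Category.id_comp φ).symm⟩ }

/-- The face topology: the Grothendieck topology generated by the families `(σ_α → X)_α`. -/
def faceTopology : GrothendieckTopology RPCC.{u} :=
  sInf {J | ∀ X : RPCC.{u}, Sieve.generate (Presieve.ofArrows X.face X.faceIncl) ∈ J X}

/-- Strict morphisms of cone complexes. -/
def strict : MorphismProperty RPCC.{u} := fun _ _ f => ∀ α, IsIso (f.hom.map α)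

/-! ### Categories fibred in groupoids, stacks, geometric spaces and geometric stacks -/

section Geometric

variable {C : Type (u + 1)} [Category.{u} C]

/-- A category fibred in groupoids over `C`. -/
structure IsFiberedInGroupoids (𝒳 : BasedCategory.{u, u + 1} C) : Prop where
  exists_lift : ∀ (a : 𝒳.obj) {R : C} (f : R ⟶ 𝒳.p.obj a),
    ∃ (b : 𝒳.obj) (φ : b ⟶ a), 𝒳.p.IsHomLift f φ
  cartesian : ∀ {a b : 𝒳.obj} (φ : a ⟶ b), 𝒳.p.IsStronglyCartesian (𝒳.p.map φ) φ

/-- The category `C/T` over `C`. -/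
def overBased (T : C) : BasedCategory.{u, u + 1} C := BasedCategory.ofFunctor (Over.forget T)

/-- A sieve on `T`, as a full subcategory of `C/T`. -/
def sieveBased {T : C} (S : Sieve T) : BasedCategory.{u, u + 1} C :=
  BasedCategory.ofFunctor S.arrows.diagram

/-- The inclusion of a sieve on `T` into `C/T`. -/
def sieveIncl {T : C} (S : Sieve T) : sieveBased S ⟶ overBased T :=
  ({ toFunctor := ObjectProperty.ι _
     w := rfl } : BasedFunctor (sieveBased S) (overBased T))

/-- A stack for the topology `J`: a category fibred in groupoids `𝒳` such that, for every covering
sieve `S` of every object `T`, restriction from `𝒳(T) = Hom_C(C/T, 𝒳)` to the category of descent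
data `Hom_C(S, 𝒳)` is an equivalence. -/
structure IsStack (J : GrothendieckTopology C) (𝒳 : BasedCategory.{u, u + 1} C) : Prop where
  fibered : IsFiberedInGroupoids 𝒳
  descent : ∀ (T : C) (S : Sieve T), S ∈ J T → (Bicategory.precomp 𝒳 (sieveIncl S)).IsEquivalence

/-- A geometric space for the topology `J` and the class `P` of morphisms. -/
structure IsGeometricSpace (J : GrothendieckTopology C) (P : MorphismProperty C)
    (X : Cᵒᵖ ⥤ Type u) : Prop where
  isSheaf : Presheaf.IsSheaf J X
  diag : (yoneda (C := C)).relativelyRepresentable (Limits.diag X)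
  cover : ∃ (U : C) (f : yoneda.obj U ⟶ X), P.presheaf f ∧ Presheaf.IsLocallySurjective J f

/-- A morphism from a geometric space `R` to an object `V` of `C` belongs to `P` if its composite
with some covering of `R` by an object of `C`, itself belonging to `P`, does. -/
def SpaceMorphismIn (J : GrothendieckTopology C) (P : MorphismProperty C)
    {R : Cᵒᵖ ⥤ Type u} {V : C} (q : R ⟶ yoneda.obj V) : Prop :=
  ∃ (W : C) (g : yoneda.obj W ⟶ R), P.presheaf g ∧ Presheaf.IsLocallySurjective J g ∧
    P (yonedaEquiv (g ≫ q))

/-- The category `C/X` of all morphisms from objects of `C` to a presheaf `X`, over `C`. -/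
def elements (X : Cᵒᵖ ⥤ Type u) : BasedCategory.{u, u + 1} C :=
  BasedCategory.ofFunctor (CostructuredArrow.proj yoneda X)

/-- The morphism `C/X ⟶ C/Y` given by a morphism of presheaves `X ⟶ Y`. -/
def elementsMap {X Y : Cᵒᵖ ⥤ Type u} (q : X ⟶ Y) : elements X ⟶ elements Y :=
  ({ toFunctor := CostructuredArrow.map q
     w := rfl } : BasedFunctor (elements X) (elements Y))

/-- An object of the 2-fibre product of `F : 𝒳 ⟶ 𝒵` and `G : 𝒴 ⟶ 𝒵`: objects `x` and `y` over the
same object of `C` and an isomorphism `F x ≅ G y` over the identity. -/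
structure FiberProdObj {𝒳 𝒴 𝒵 : BasedCategory.{u, u + 1} C} (F : 𝒳 ⟶ 𝒵) (G : 𝒴 ⟶ 𝒵) :
    Type (u + 1) where
  fst : 𝒳.obj
  snd : 𝒴.obj
  iso : (F : BasedFunctor 𝒳 𝒵).obj fst ≅ (G : BasedFunctor 𝒴 𝒵).obj snd
  isHomLift : 𝒵.p.IsHomLift (𝟙 (𝒳.p.obj fst)) iso.hom

/-- A morphism of the 2-fibre product: morphisms `x ⟶ x'` and `y ⟶ y'` over the same morphism
of `C`, compatible with the given isomorphisms. -/
@[ext]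
structure FiberProdHom {𝒳 𝒴 𝒵 : BasedCategory.{u, u + 1} C} {F : 𝒳 ⟶ 𝒵} {G : 𝒴 ⟶ 𝒵}
    (a b : FiberProdObj F G) : Type u where
  fst : a.fst ⟶ b.fst
  snd : a.snd ⟶ b.snd
  isHomLift : 𝒴.p.IsHomLift (𝒳.p.map fst) snd
  comm : (F : BasedFunctor 𝒳 𝒵).map fst ≫ b.iso.hom = a.iso.hom ≫ (G : BasedFunctor 𝒴 𝒵).map snd

lemma FiberProdObj.base_eq {𝒳 𝒴 𝒵 : BasedCategory.{u, u + 1} C} {F : 𝒳 ⟶ 𝒵} {G : 𝒴 ⟶ 𝒵}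
    (a : FiberProdObj F G) : 𝒴.p.obj a.snd = 𝒳.p.obj a.fst := by
  have := a.isHomLift
  have h := IsHomLift.codomain_eq 𝒵.p (𝟙 (𝒳.p.obj a.fst)) a.iso.hom
  rwa [BasedFunctor.w_obj] at h

instance {𝒳 𝒴 𝒵 : BasedCategory.{u, u + 1} C} (F : 𝒳 ⟶ 𝒵) (G : 𝒴 ⟶ 𝒵) :
    Category.{u} (FiberProdObj F G) where
  Hom := FiberProdHom
  id a := ⟨𝟙 _, 𝟙 _, by
    rw [CategoryTheory.Functor.map_id]; exact IsHomLift.id a.base_eq, by simp⟩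
  comp {a b c} f g := ⟨f.fst ≫ g.fst, f.snd ≫ g.snd, by
    have := f.isHomLift
    have := g.isHomLift
    rw [Functor.map_comp]
    infer_instance, by
    rw [Functor.map_comp, Functor.map_comp, Category.assoc, g.comm, ← Category.assoc, f.comm,
      Category.assoc]⟩
  id_comp f := FiberProdHom.ext (Category.id_comp _) (Category.id_comp _)
  comp_id f := FiberProdHom.ext (Category.comp_id _) (Category.comp_id _)
  assoc f g h := FiberProdHom.ext (Category.assoc _ _ _) (Category.assoc _ _ _)

/-- The 2-fibre product `𝒳 ×_𝒵 𝒴`. -/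
def fiberProd {𝒳 𝒴 𝒵 : BasedCategory.{u, u + 1} C} (F : 𝒳 ⟶ 𝒵) (G : 𝒴 ⟶ 𝒵) :
    BasedCategory.{u, u + 1} C :=
  BasedCategory.ofFunctor (𝒳 := FiberProdObj F G)
    { obj := fun a => 𝒳.p.obj a.fst
      map := fun f => 𝒳.p.map (FiberProdHom.fst f)
      map_id := fun a => 𝒳.p.map_id a.fst
      map_comp := fun f g => 𝒳.p.map_comp (FiberProdHom.fst f) (FiberProdHom.fst g) }

/-- The second projection `𝒳 ×_𝒵 𝒴 ⟶ 𝒴`. -/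
def fiberProdSnd {𝒳 𝒴 𝒵 : BasedCategory.{u, u + 1} C} (F : 𝒳 ⟶ 𝒵) (G : 𝒴 ⟶ 𝒵) :
    fiberProd F G ⟶ 𝒴 :=
  ({ toFunctor :=
      { obj := fun a => FiberProdObj.snd a
        map := fun f => FiberProdHom.snd f
        map_id := fun _ => rfl
        map_comp := fun _ _ => rfl }
     w := CategoryTheory.Functor.ext (fun a => FiberProdObj.base_eq a) (fun a b f => by
      have := FiberProdHom.isHomLift f
      exact IsHomLift.fac' 𝒴.p (𝒳.p.map (FiberProdHom.fst f)) (FiberProdHom.snd f)) } :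
    BasedFunctor (fiberProd F G) 𝒴)

variable (C) in
/-- The terminal category over `C`: the category `C` itself. -/
def baseBased : BasedCategory.{u, u + 1} C := BasedCategory.ofFunctor (𝟭 C)

/-- The structure morphism of a category over `C`. -/
def toBase (𝒳 : BasedCategory.{u, u + 1} C) : 𝒳 ⟶ baseBased C :=
  ({ toFunctor := 𝒳.p
     w := rfl } : BasedFunctor 𝒳 (baseBased C))

/-- The product `𝒳 × 𝒴` of categories over `C`. -/
abbrev prodBased (𝒳 𝒴 : BasedCategory.{u, u + 1} C) : BasedCategory.{u, u + 1} C :=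
  fiberProd (toBase 𝒳) (toBase 𝒴)

/-- The diagonal `𝒳 ⟶ 𝒳 × 𝒳`. -/
def diagBased (𝒳 : BasedCategory.{u, u + 1} C) : 𝒳 ⟶ prodBased 𝒳 𝒳 :=
  ({ toFunctor :=
      { obj := fun x => (⟨x, x, Iso.refl _, IsHomLift.id rfl⟩ :
          FiberProdObj (toBase 𝒳) (toBase 𝒳))
        map := fun f => (⟨f, f, inferInstance, by
          exact (Category.comp_id _).trans (Category.id_comp _).symm⟩ : FiberProdHom _ _)
        map_id := fun _ => rfl
        map_comp := fun _ _ => rfl }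
     w := rfl } : BasedFunctor 𝒳 (prodBased 𝒳 𝒳))

/-- `𝒳` is representable by a geometric space. -/
def IsRepresentable (J : GrothendieckTopology C) (P : MorphismProperty C)
    (𝒳 : BasedCategory.{u, u + 1} C) : Prop :=
  ∃ X : Cᵒᵖ ⥤ Type u, IsGeometricSpace J P X ∧ Nonempty (Bicategory.Equivalence 𝒳 (elements X))

/-- A morphism of categories over `C` is representable by geometric spaces. -/
def IsRepresentableMorphism (J : GrothendieckTopology C) (P : MorphismProperty C)
    {𝒳 𝒴 : BasedCategory.{u, u + 1} C} (F : 𝒳 ⟶ 𝒴) : Prop :=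
  ∀ (V : Cᵒᵖ ⥤ Type u), IsGeometricSpace J P V → ∀ G : elements V ⟶ 𝒴,
    IsRepresentable J P (fiberProd F G)

/-- A morphism of categories over `C` belongs to `P`: its base change along any morphism from an
object `V` of `C` is a morphism from a geometric space to `V` which belongs to `P`. -/
def MorphismIn (J : GrothendieckTopology C) (P : MorphismProperty C)
    {𝒳 𝒴 : BasedCategory.{u, u + 1} C} (F : 𝒳 ⟶ 𝒴) : Prop :=
  ∀ (V : C) (G : elements (yoneda.obj V) ⟶ 𝒴), ∃ R : Cᵒᵖ ⥤ Type u, IsGeometricSpace J P R ∧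
    ∃ (e : Bicategory.Equivalence (elements R) (fiberProd F G)) (q : R ⟶ yoneda.obj V),
      Nonempty (e.hom ≫ fiberProdSnd F G ≅ elementsMap q) ∧ SpaceMorphismIn J P q

/-- A morphism of categories over `C` is a covering: every object of the target lies, locally for
the topology `J`, in the essential image. -/
def IsCovering (J : GrothendieckTopology C) {𝒳 𝒴 : BasedCategory.{u, u + 1} C} (F : 𝒳 ⟶ 𝒴) :
    Prop :=
  ∀ y : 𝒴.obj, Sieve.generate (fun (T : C) (h : T ⟶ 𝒴.p.obj y) =>
    ∃ (x : 𝒳.obj) (ψ : (F : BasedFunctor 𝒳 𝒴).obj x ⟶ y), 𝒴.p.IsHomLift h ψ) ∈ J (𝒴.p.obj y)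

/-- A geometric stack for the topology `J` and the class `P` of morphisms. -/
structure IsGeometricStack (J : GrothendieckTopology C) (P : MorphismProperty C)
    (𝒳 : BasedCategory.{u, u + 1} C) : Prop where
  isStack : IsStack J 𝒳
  diag : IsRepresentableMorphism J P (diagBased 𝒳)
  cover : ∃ U : Cᵒᵖ ⥤ Type u, IsGeometricSpace J P U ∧
    ∃ f : elements U ⟶ 𝒳, IsCovering J f ∧ MorphismIn J P f

end Geometric

/-! ### Cone spaces and cone stacks -/

/-- A cone space: a geometric space for the face topology and strict morphisms. -/
def IsConeSpace (X : RPCC.{u}ᵒᵖ ⥤ Type u) : Prop := IsGeometricSpace faceTopology strict X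

/-- A cone stack: a geometric stack for the face topology and strict morphisms. -/
def IsConeStack (𝒳 : BasedCategory.{u, u + 1} RPCC.{u}) : Prop :=
  IsGeometricStack faceTopology strict 𝒳

/-- The 2-category of cone stacks: the full sub-2-category of the 2-category of categories over
`RPCC` (functors and natural transformations over `RPCC`) on the cone stacks. -/
abbrev ConeStack : Type (u + 2) :=
  Bicategory.InducedBicategory (BasedCategory.{u, u + 1} RPCC.{u})
    (Subtype.val : {𝒳 : BasedCategory.{u, u + 1} RPCC.{u} // IsConeStack 𝒳} → _)

/-- The cone stack `𝒳` is (representable by) a cone space. -/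
def ConeStack.IsSpace (𝒳 : ConeStack.{u}) : Prop :=
  ∃ X : RPCC.{u}ᵒᵖ ⥤ Type u, IsConeSpace X ∧ Nonempty (Bicategory.Equivalence 𝒳.1 (elements X))

/-! ### Combinatorial cone stacks -/

/-- A combinatorial cone stack: a category fibred in groupoids over `RPC^f`. As usual its fibres are
(essentially) small; since `RPC^f` is essentially small, this says that the total category is. -/
structure CombConeStack : Type (u + 2) where
  based : BasedCategory.{u, u + 1} RPCf.{u}
  fibered : IsFiberedInGroupoids based
  small : EssentiallySmall.{u} based.obj

/-- The functor `α ↦ σ_α` to `RPC`. -/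
def CombConeStack.cone (S : CombConeStack.{u}) : S.based.obj ⥤ RPC.{u} :=
  S.based.p ⋙ RPCf.incl

/-- A morphism `(Φ, φ)` of combinatorial cone stacks. -/
structure CombConeStack.Hom (S T : CombConeStack.{u}) : Type (u + 1) where
  functor : S.based.obj ⥤ T.based.obj
  map : ∀ α, S.cone.obj α ⟶ T.cone.obj (functor.obj α)
  naturality : ∀ {α β : S.based.obj} (v : α ⟶ β),
    S.cone.map v ≫ map β = map α ≫ T.cone.map (functor.map v)
  dominant : ∀ α, IsDominant (map α)

/-- A 2-morphism `(Φ, φ) ⟶ (Φ', φ')` of combinatorial cone stacks: a natural transformation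
`η : Φ ⟶ Φ'` such that `φ'_α` is the composite of `φ_α` with the face morphism underlying `η_α`. -/
@[ext]
structure CombConeStack.Hom₂ {S T : CombConeStack.{u}} (f g : CombConeStack.Hom S T) :
    Type (u + 1) where
  nat : f.functor ⟶ g.functor
  comm : ∀ α, f.map α ≫ T.cone.map (nat.app α) = g.map α

instance (S T : CombConeStack.{u}) : Category.{u + 1} (CombConeStack.Hom S T) where
  Hom := CombConeStack.Hom₂
  id f := ⟨𝟙 _, fun α => by simp⟩
  comp η θ := ⟨η.nat ≫ θ.nat, fun α => by
    rw [NatTrans.comp_app, Functor.map_comp, ← Category.assoc, η.comm, θ.comm]⟩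
  id_comp η := CombConeStack.Hom₂.ext (Category.id_comp _)
  comp_id η := CombConeStack.Hom₂.ext (Category.comp_id _)
  assoc η θ κ := CombConeStack.Hom₂.ext (Category.assoc _ _ _)

/-- Composition of morphisms of combinatorial cone stacks. -/
def CombConeStack.Hom.comp {S T U : CombConeStack.{u}} (f : CombConeStack.Hom S T)
    (g : CombConeStack.Hom T U) : CombConeStack.Hom S U where
  functor := f.functor ⋙ g.functor
  map := fun α => f.map α ≫ g.map (f.functor.obj α)
  naturality := fun {α β} v => by
    rw [← Category.assoc, f.naturality, Category.assoc, g.naturality]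
    exact (Category.assoc _ _ _).symm
  dominant := fun α => (f.dominant α).comp (g.dominant _)

/-- The identity morphism of a combinatorial cone stack. -/
def CombConeStack.Hom.id (S : CombConeStack.{u}) : CombConeStack.Hom S S where
  functor := 𝟭 _
  map := fun _ => 𝟙 _
  naturality := fun _ => (Category.comp_id _).trans (Category.id_comp _).symm
  dominant := fun _ => IsDominant.id _

lemma CombConeStack.Hom₂.ext_app {S T : CombConeStack.{u}} {f g : CombConeStack.Hom S T}
    {η θ : f ⟶ g} (h : ∀ α, (CombConeStack.Hom₂.nat η).app α = (CombConeStack.Hom₂.nat θ).app α) :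
    η = θ :=
  CombConeStack.Hom₂.ext (NatTrans.ext (funext h))

/-- A 2-isomorphism of combinatorial cone stacks from a natural isomorphism. -/
def CombConeStack.Hom.isoMk {S T : CombConeStack.{u}} {f g : CombConeStack.Hom S T}
    (e : f.functor ≅ g.functor) (h : ∀ α, f.map α ≫ T.cone.map (e.hom.app α) = g.map α) :
    f ≅ g where
  hom := ⟨e.hom, h⟩
  inv := ⟨e.inv, fun α => by
    rw [← h α, Category.assoc, ← Functor.map_comp, Iso.hom_inv_id_app,
      CategoryTheory.Functor.map_id]
    exact Category.comp_id _⟩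
  hom_inv_id := CombConeStack.Hom₂.ext e.hom_inv_id
  inv_hom_id := CombConeStack.Hom₂.ext e.inv_hom_id

/-- The 2-category of combinatorial cone stacks. -/
instance : Bicategory CombConeStack.{u} where
  Hom := CombConeStack.Hom
  id := CombConeStack.Hom.id
  comp := CombConeStack.Hom.comp
  homCategory S T := inferInstanceAs (Category (CombConeStack.Hom S T))
  whiskerLeft f _ _ η := ⟨Functor.whiskerLeft f.functor η.nat, fun α =>
    (Category.assoc _ _ _).trans (congrArg (f.map α ≫ ·) (η.comm (f.functor.obj α)))⟩
  whiskerRight {S T U f g} η k := ⟨Functor.whiskerRight η.nat k.functor, fun α =>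
    (Category.assoc _ _ _).trans <|
      (congrArg (f.map α ≫ ·) (k.naturality (η.nat.app α)).symm).trans <|
        (Category.assoc _ _ _).symm.trans (congrArg (· ≫ k.map _) (η.comm α))⟩
  associator {_ _ _ U} f g h := CombConeStack.Hom.isoMk (Functor.associator _ _ _) fun α =>
    (congrArg (_ ≫ ·) (U.cone.map_id _)).trans <|
      (Category.comp_id _).trans (Category.assoc _ _ _)
  leftUnitor {_ T} f := CombConeStack.Hom.isoMk (Functor.leftUnitor _) fun α =>
    (congrArg (_ ≫ ·) (T.cone.map_id _)).trans <|
      (Category.comp_id _).trans (Category.id_comp _)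
  rightUnitor {_ T} f := CombConeStack.Hom.isoMk (Functor.rightUnitor _) fun α =>
    (congrArg (_ ≫ ·) (T.cone.map_id _)).trans <|
      (Category.comp_id _).trans (Category.comp_id _)
  whiskerLeft_id _ _ := CombConeStack.Hom₂.ext_app fun _ => rfl
  whiskerLeft_comp _ _ _ _ _ _ := CombConeStack.Hom₂.ext_app fun _ => rfl
  id_whiskerLeft _ := CombConeStack.Hom₂.ext_app fun _ =>
    ((Category.id_comp _).trans (Category.comp_id _)).symm
  comp_whiskerLeft _ _ _ _ _ := CombConeStack.Hom₂.ext_app fun _ =>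
    ((Category.id_comp _).trans (Category.comp_id _)).symm
  id_whiskerRight _ g := CombConeStack.Hom₂.ext_app fun _ => g.functor.map_id _
  comp_whiskerRight _ _ g := CombConeStack.Hom₂.ext_app fun _ => g.functor.map_comp _ _
  whiskerRight_id _ := CombConeStack.Hom₂.ext_app fun _ =>
    ((Category.id_comp _).trans (Category.comp_id _)).symm
  whiskerRight_comp _ _ _ := CombConeStack.Hom₂.ext_app fun _ =>
    ((Category.id_comp _).trans (Category.comp_id _)).symm
  whisker_assoc _ _ _ _ _ := CombConeStack.Hom₂.ext_app fun _ =>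
    ((Category.id_comp _).trans (Category.comp_id _)).symm
  whisker_exchange η θ := CombConeStack.Hom₂.ext_app fun _ => (θ.nat.naturality (η.nat.app _)).symm
  pentagon _ _ _ k := CombConeStack.Hom₂.ext_app fun _ => by
    refine (congrArg₂ (· ≫ ·) (k.functor.map_id _) rfl).trans ?_
    exact (Category.id_comp _).trans rfl
  triangle _ g := CombConeStack.Hom₂.ext_app fun _ => by
    exact (Category.id_comp _).trans (g.functor.map_id _).symm

/-! ### Combinatorial cone spaces as combinatorial cone stacks -/

/-- An object of the category fibred in groupoids over `RPC^f` given by a combinatorial cone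
space: a cone together with an isomorphism to one of the cones of the family. -/
structure CombConeSpace.Point (X : CombConeSpace.{u}) : Type (u + 1) where
  base : RPC.{u}
  idx : X.ι
  iso : base ≅ X.cone idx

instance (X : CombConeSpace.{u}) : Category.{u} X.Point where
  Hom a b := X.mor a.idx b.idx
  id _ := ⟨𝟙 _, X.id_mem _⟩
  comp f g := ⟨f.1 ≫ g.1, X.comp_mem _ _ f.2 g.2⟩
  id_comp _ := Subtype.ext (Category.id_comp _)
  comp_id _ := Subtype.ext (Category.comp_id _)
  assoc _ _ _ := Subtype.ext (Category.assoc _ _ _)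

/-- The projection of a combinatorial cone space to `RPC^f`. -/
def CombConeSpace.proj (X : CombConeSpace.{u}) : X.Point ⥤ RPCf.{u} where
  obj a := ⟨a.base⟩
  map {a b} f := ⟨a.iso.hom ≫ f.1 ≫ b.iso.inv, (IsFaceMorphism.of_isIso _).comp
    ((X.isFace _ f.2).comp (IsFaceMorphism.of_isIso _))⟩
  map_id a := WideSubcategory.hom_ext _ (by
    change a.iso.hom ≫ 𝟙 _ ≫ a.iso.inv = 𝟙 _
    simp)
  map_comp {a b c} f g := WideSubcategory.hom_ext _ (by
    change a.iso.hom ≫ (f.1 ≫ g.1) ≫ c.iso.inv =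
      (a.iso.hom ≫ f.1 ≫ b.iso.inv) ≫ b.iso.hom ≫ g.1 ≫ c.iso.inv
    simp)

lemma CombConeSpace.mem_of_comp_mem (X : CombConeSpace.{u}) {α β γ : X.ι}
    (g : X.cone α ⟶ X.cone β) (hg : IsFaceMorphism g) (φ : X.cone β ⟶ X.cone γ)
    (hφ : φ ∈ X.mor β γ) (h : g ≫ φ ∈ X.mor α γ) : g ∈ X.mor α β := by
  obtain ⟨⟨δ, ψ⟩, ⟨hψ, him⟩, _⟩ := X.existsUnique_face β _ hg.face
  have key := (X.existsUnique_face γ _ (X.isFace _ h).face).unique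
    (y₁ := ⟨δ, ψ ≫ φ⟩) (y₂ := ⟨α, g ≫ φ⟩)
    ⟨X.comp_mem _ _ hψ hφ, by rw [RPC.image_comp, RPC.image_comp]; exact congrArg _ him⟩ ⟨h, rfl⟩
  obtain rfl : δ = α := congrArg Sigma.fst key
  have h2 : ψ ≫ φ = g ≫ φ := by simpa using key
  rwa [← (X.isFace φ hφ).cancel h2]

lemma CombConeSpace.exists_lift (X : CombConeSpace.{u}) (a : X.Point) {R : RPCf.{u}}
    (f : R ⟶ X.proj.obj a) : ∃ (b : X.Point) (φ : b ⟶ a), X.proj.IsHomLift f φ := by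
  obtain ⟨R⟩ := R
  obtain ⟨f, hf'⟩ := f
  change R ⟶ a.base at f
  change IsFaceMorphism f at hf'
  have hf : IsFaceMorphism (f ≫ a.iso.hom) := hf'.comp (IsFaceMorphism.of_isIso _)
  obtain ⟨⟨γ, φ⟩, ⟨hφ, him⟩, _⟩ := X.existsUnique_face _ _ hf.face
  obtain ⟨k, hk⟩ := hf.exists_iso (X.isFace φ hφ) him.symm
  let b : X.Point := ⟨R, γ, k⟩
  let φ' : b ⟶ a := ⟨φ, hφ⟩
  refine ⟨b, φ', ?_⟩
  have h : X.proj.map φ' = ⟨f, hf'⟩ := WideSubcategory.hom_ext _ (by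
    change k.hom ≫ φ ≫ a.iso.inv = f
    rw [← Category.assoc, hk, Category.assoc, Iso.hom_inv_id, Category.comp_id])
  exact h ▸ IsHomLift.map X.proj φ'

lemma CombConeSpace.cartesian (X : CombConeSpace.{u}) {a b : X.Point} (φ : a ⟶ b) :
    X.proj.IsStronglyCartesian (X.proj.map φ) φ := by
  refine { toIsHomLift := IsHomLift.map X.proj φ, universal_property' := ?_ }
  intro a' g φ' hφ'
  have h1 : g ≫ X.proj.map φ = X.proj.map φ' := IsHomLift.eq_of_isHomLift X.proj _ φ'
  obtain ⟨g, hg'⟩ := g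
  change a'.base ⟶ a.base at g
  change IsFaceMorphism g at hg'
  have h2 : g ≫ a.iso.hom ≫ φ.1 ≫ b.iso.inv = a'.iso.hom ≫ φ'.1 ≫ b.iso.inv :=
    congrArg (fun k => k.hom) h1
  have h3 : (a'.iso.inv ≫ g ≫ a.iso.hom) ≫ φ.1 = φ'.1 := by
    rw [← cancel_mono b.iso.inv, Category.assoc, Category.assoc, Category.assoc,
      h2, Iso.inv_hom_id_assoc]
  have hg : IsFaceMorphism (a'.iso.inv ≫ g ≫ a.iso.hom) :=
    (IsFaceMorphism.of_isIso _).comp (hg'.comp (IsFaceMorphism.of_isIso _))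
  have hmem := X.mem_of_comp_mem _ hg φ.1 φ.2 (by rw [h3]; exact φ'.2)
  let χ : a' ⟶ a := ⟨_, hmem⟩
  have hχ : X.proj.map χ = ⟨g, hg'⟩ := WideSubcategory.hom_ext _ (by
    change a'.iso.hom ≫ (a'.iso.inv ≫ g ≫ a.iso.hom) ≫ a.iso.inv = g
    simp)
  refine ⟨χ, ⟨?_, Subtype.ext h3⟩, ?_⟩
  · exact hχ ▸ IsHomLift.map X.proj χ
  · rintro χ' ⟨_, h⟩
    exact Subtype.ext ((X.isFace _ φ.2).cancel ((congrArg Subtype.val h).trans h3.symm))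

lemma CombConeSpace.fibered (X : CombConeSpace.{u}) :
    IsFiberedInGroupoids (BasedCategory.ofFunctor X.proj) where
  exists_lift a _ f := X.exists_lift a f
  cartesian φ := X.cartesian φ

/-- The category whose objects are the cones of a combinatorial cone space. -/
structure CombConeSpace.Index (X : CombConeSpace.{u}) : Type u where
  idx : X.ι

instance (X : CombConeSpace.{u}) : Category.{u} X.Index where
  Hom a b := X.mor a.idx b.idx
  id _ := ⟨𝟙 _, X.id_mem _⟩
  comp f g := ⟨f.1 ≫ g.1, X.comp_mem _ _ f.2 g.2⟩
  id_comp _ := Subtype.ext (Category.id_comp _)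
  comp_id _ := Subtype.ext (Category.comp_id _)
  assoc _ _ _ := Subtype.ext (Category.assoc _ _ _)

lemma CombConeSpace.small (X : CombConeSpace.{u}) : EssentiallySmall.{u} X.Point := by
  let F : X.Point ⥤ X.Index :=
    { obj := fun a => ⟨a.idx⟩
      map := fun f => f
      map_id := fun _ => rfl
      map_comp := fun _ _ => rfl }
  have : F.Full := ⟨fun f => ⟨f, rfl⟩⟩
  have : F.Faithful := ⟨fun h => h⟩
  have : F.EssSurj := ⟨fun a => ⟨⟨X.cone a.idx, a.idx, Iso.refl _⟩, ⟨Iso.refl _⟩⟩⟩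
  have : F.IsEquivalence := {}
  exact EssentiallySmall.mk' F.asEquivalence

/-- The combinatorial cone stack given by a combinatorial cone space. -/
def CombConeSpace.toCombConeStack (X : CombConeSpace.{u}) : CombConeStack.{u} where
  based := BasedCategory.ofFunctor X.proj
  fibered := X.fibered
  small := X.small

/-- The combinatorial cone stack `S` is (equivalent to one given by) a combinatorial cone space. -/
def CombConeStack.IsSpace (S : CombConeStack.{u}) : Prop :=
  ∃ X : CombConeSpace.{u}, Nonempty (Bicategory.Equivalence S X.toCombConeStack)

/-! ### Equivalences of 2-categories -/

/-- A pseudofunctor is an equivalence of 2-categories if it is an equivalence on all categories of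
morphisms and every object of the target is equivalent to one in the image. -/
structure IsBiequivalence {B C : Type*} [Bicategory B] [Bicategory C] (F : Pseudofunctor B C) :
    Prop where
  isEquivalence : ∀ a b : B, (F.mapFunctor a b).IsEquivalence
  essSurj : ∀ c : C, ∃ b : B, Nonempty (Bicategory.Equivalence (F.obj b) c)

end

end ConeStacks

namespace ConeStacks

noncomputable section

open Category
open CategoryTheory.Functor (map_comp map_id)

/-! ### Geometry of rational polyhedral cones -/

section Cones

variable {ρ τ σ ξ : RPC.{u}}

/-- The smallest face of `σ` containing the image of `f`. -/
def RPC.hull (f : τ ⟶ σ) : PointedCone ℝ (ℝ ⊗[ℤ] σ.N) where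
  carrier := {x | x ∈ σ.cone ∧ ∃ t ∈ τ.cone, RPC.real f t - x ∈ σ.cone}
  zero_mem' := ⟨zero_mem _, 0, zero_mem _, by simp⟩
  add_mem' := by
    rintro x y ⟨hx, s, hs, hsx⟩ ⟨hy, t, ht, hty⟩
    refine ⟨add_mem hx hy, s + t, add_mem hs ht, ?_⟩
    rw [map_add, add_sub_add_comm]
    exact add_mem hsx hty
  smul_mem' := by
    rintro c x ⟨hx, s, hs, hsx⟩
    refine ⟨Submodule.smul_mem _ c hx, c • s, Submodule.smul_mem _ c hs, ?_⟩
    have : RPC.real f (c • s) - c • x = (c : ℝ) • (RPC.real f s - x) := by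
      rw [smul_sub]
      congr 1
      exact (RPC.real f).map_smul (c : ℝ) s
    rw [this]
    exact PointedCone.smul_mem _ c.2 hsx

lemma RPC.real_mem (f : τ ⟶ σ) {x : ℝ ⊗[ℤ] τ.N} (hx : x ∈ τ.cone) : RPC.real f x ∈ σ.cone :=
  RPC.Hom.maps f x hx

lemma RPC.image_le_hull (f : τ ⟶ σ) : RPC.image f ≤ RPC.hull f := by
  rintro _ ⟨x, hx, rfl⟩
  exact ⟨RPC.real_mem f hx, x, hx, by
    change RPC.real f x - RPC.real f x ∈ σ.cone
    rw [sub_self]; exact zero_mem _⟩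

lemma RPC.hull_isFaceOf (f : τ ⟶ σ) : (RPC.hull f).IsFaceOf σ.cone := by
  refine ⟨fun x hx => hx.1, ?_⟩
  rintro x y a hx hy ha ⟨-, t, ht, h⟩
  refine ⟨hx, a⁻¹ • t, PointedCone.smul_mem _ (inv_nonneg.2 ha.le) ht, ?_⟩
  have : RPC.real f (a⁻¹ • t) - x = a⁻¹ • ((RPC.real f t - (a • x + y)) + y) := by
    rw [map_smul, sub_add_eq_add_sub, add_sub_add_right_eq_sub, smul_sub, smul_smul,
      inv_mul_cancel₀ ha.ne', one_smul]
  rw [this]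
  exact PointedCone.smul_mem _ (inv_nonneg.2 ha.le) (add_mem h hy)

lemma RPC.hull_le {f : τ ⟶ σ} {F : PointedCone ℝ (ℝ ⊗[ℤ] σ.N)} (hF : F.IsFaceOf σ.cone)
    (h : RPC.image f ≤ F) : RPC.hull f ≤ F := by
  rintro x ⟨hx, t, ht, htx⟩
  refine hF.mem_of_add_mem_left hx htx ?_
  rw [add_sub_cancel]
  exact h ⟨t, ht, rfl⟩

lemma isDominant_iff (f : τ ⟶ σ) :
    IsDominant f ↔ ∀ x ∈ σ.cone, ∃ t ∈ τ.cone, RPC.real f t - x ∈ σ.cone := by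
  constructor
  · intro h x hx
    have := h _ (RPC.hull_isFaceOf f) (RPC.image_le_hull f)
    rw [← this] at hx
    exact hx.2
  · intro h F hF hle
    exact le_antisymm hF.le fun x hx => RPC.hull_le hF hle ⟨hx, h x hx⟩

lemma RPC.real_comp_apply (f : ρ ⟶ τ) (g : τ ⟶ σ) (x : ℝ ⊗[ℤ] ρ.N) :
    RPC.real (f ≫ g) x = RPC.real g (RPC.real f x) := by
  rw [RPC.real_comp]; rfl

lemma IsDominant.of_isIso (f : τ ⟶ σ) [IsIso f] : IsDominant f := by
  rw [isDominant_iff]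
  intro x hx
  refine ⟨RPC.real (inv f) x, RPC.real_mem _ hx, ?_⟩
  rw [← RPC.real_comp_apply, IsIso.inv_hom_id, RPC.real_id, LinearMap.id_apply, sub_self]
  exact zero_mem _

lemma IsDominant.of_comp {f : ρ ⟶ τ} {g : τ ⟶ σ} (h : IsDominant (f ≫ g)) : IsDominant g := by
  intro F hF hle
  refine h F hF (le_trans ?_ hle)
  rintro _ ⟨x, hx, rfl⟩
  exact ⟨RPC.real f x, RPC.real_mem f hx, (RPC.real_comp_apply f g x).symm⟩

lemma IsFaceMorphism.isIso_of_isDominant {f : τ ⟶ σ} (hf : IsFaceMorphism f)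
    (hd : IsDominant f) : IsIso f := by
  have h := hd _ hf.face le_rfl
  obtain ⟨k, hk⟩ := hf.exists_iso (IsFaceMorphism.of_isIso (𝟙 σ)) (by rw [h, RPC.image_id])
  rw [comp_id] at hk
  rw [← hk]
  infer_instance

lemma IsFaceMorphism.of_comp {f : ρ ⟶ τ} {g : τ ⟶ σ} (h : IsFaceMorphism (f ≫ g))
    (hg : IsFaceMorphism g) : IsFaceMorphism f := by
  have hle : RPC.image f ≤ τ.cone := RPC.image_le f
  refine ⟨⟨hle, ?_⟩, ?_, ?_⟩
  · intro x y a hx hy ha hxy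
    have hx' : RPC.real g x ∈ RPC.image (f ≫ g) := by
      refine h.face.mem_of_smul_add_mem (RPC.real_mem g hx) (RPC.real_mem g hy) ha ?_
      obtain ⟨z, hz, hz'⟩ := hxy
      refine ⟨z, hz, ?_⟩
      have : RPC.real (f ≫ g) z = RPC.real g (a • x + y) := by
        rw [RPC.real_comp_apply]
        exact congrArg _ hz'
      rw [← map_smul, ← map_add]
      exact this
    obtain ⟨z, hz, hz'⟩ := hx'
    refine ⟨z, hz, hg.real_injective ?_⟩
    rw [← hz']
    exact (RPC.real_comp_apply f g z).symm
  · intro x y hxy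
    exact h.injective (congrArg (RPC.Hom.lin g) hxy)
  · rintro k n hk ⟨x, hx⟩
    obtain ⟨z, hz⟩ := h.saturated k (RPC.Hom.lin g n) hk ⟨x, by
      rw [← map_smul, ← hx]; rfl⟩
    exact ⟨z, hg.injective hz⟩

lemma IsFaceMorphism.image_eq_hull {d : ρ ⟶ τ} {g : τ ⟶ σ} (hd : IsDominant d)
    (hg : IsFaceMorphism g) : RPC.image g = RPC.hull (d ≫ g) := by
  apply le_antisymm
  · rintro _ ⟨x, hx, rfl⟩
    obtain ⟨t, ht, h⟩ := (isDominant_iff d).1 hd x hx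
    refine ⟨RPC.real_mem g hx, t, ht, ?_⟩
    rw [RPC.real_comp_apply]
    change RPC.real g _ - RPC.real g x ∈ _
    rw [← map_sub]
    exact RPC.real_mem g h
  · refine RPC.hull_le hg.face ?_
    rintro _ ⟨x, hx, rfl⟩
    exact ⟨RPC.real d x, RPC.real_mem d hx, (RPC.real_comp_apply d g x).symm⟩

lemma exists_iso_of_factorizations {τ' : RPC.{u}} {d : ρ ⟶ τ} {g : τ ⟶ σ} {d' : ρ ⟶ τ'}
    {g' : τ' ⟶ σ} (hd : IsDominant d) (hg : IsFaceMorphism g) (hd' : IsDominant d')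
    (hg' : IsFaceMorphism g') (h : d ≫ g = d' ≫ g') :
    ∃ e : τ ≅ τ', e.hom ≫ g' = g ∧ d ≫ e.hom = d' := by
  obtain ⟨e, he⟩ := hg.exists_iso hg' (by
    rw [hg.image_eq_hull hd, hg'.image_eq_hull hd', h])
  exact ⟨e, he, hg'.cancel (by rw [assoc, he, h])⟩

lemma IsFaceMorphism.exists_lift_of_isDominant {d : ρ ⟶ τ} (hd : IsDominant d) (f : τ ⟶ σ)
    {g : ξ ⟶ σ} (hg : IsFaceMorphism g) (k : ρ ⟶ ξ) (hk : k ≫ g = d ≫ f) :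
    ∃ l : τ ⟶ ξ, l ≫ g = f ∧ d ≫ l = k := by
  obtain ⟨l, hl⟩ := hg.exists_lift f (by
    rintro _ ⟨x, hx, rfl⟩
    obtain ⟨t, ht, h⟩ := (isDominant_iff d).1 hd x hx
    refine hg.face.mem_of_add_mem_left (RPC.real_mem f hx) (RPC.real_mem f h) ?_
    change RPC.real f x + _ ∈ _
    rw [← map_add, add_sub_cancel, ← RPC.real_comp_apply, ← hk, RPC.real_comp_apply]
    exact ⟨_, RPC.real_mem k ht, rfl⟩)
  exact ⟨l, hl, hg.cancel (by rw [assoc, hl, hk])⟩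

end Cones

set_option linter.unusedSectionVars false

section Pairing

variable {N N' : Type u} [AddCommGroup N] [AddCommGroup N']

@[simp] lemma pairing_tmul (m : N →ₗ[ℤ] ℤ) (r : ℝ) (n : N) : pairing m (r ⊗ₜ n) = r * m n := by
  simp [pairing, mul_comm]

lemma pairing_add (m m' : N →ₗ[ℤ] ℤ) (x : ℝ ⊗[ℤ] N) :
    pairing (m + m') x = pairing m x + pairing m' x := by
  simp [pairing, LinearMap.baseChange_add]

lemma pairing_neg (m : N →ₗ[ℤ] ℤ) (x : ℝ ⊗[ℤ] N) : pairing (-m) x = -pairing m x := by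
  simp [pairing, LinearMap.baseChange_neg]

@[simp] lemma pairing_zero (x : ℝ ⊗[ℤ] N) : pairing (0 : N →ₗ[ℤ] ℤ) x = 0 := by
  simp [pairing]

lemma pairing_smul (k : ℤ) (m : N →ₗ[ℤ] ℤ) (x : ℝ ⊗[ℤ] N) :
    pairing (k • m) x = k * pairing m x := by
  induction x with
  | zero => simp
  | tmul r n => simp; ring
  | add x y hx hy => rw [map_add, map_add, hx, hy]; ring

lemma eq_zero_of_pairing [Module.Free ℤ N] [Module.Finite ℤ N] {x : ℝ ⊗[ℤ] N}
    (h : ∀ m : N →ₗ[ℤ] ℤ, pairing m x = 0) : x = 0 := by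
  let b := Module.Free.chooseBasis ℤ N
  refine (b.baseChange ℝ).ext_elem fun i => ?_
  have key : ∀ y, (b.baseChange ℝ).repr y i = pairing (b.coord i) y := by
    intro y
    induction y with
    | zero => simp
    | tmul r n => simp [Module.Basis.baseChange_repr_tmul, mul_comm]
    | add x y hx hy => rw [map_add, map_add, Finsupp.add_apply, hx, hy]
  rw [key, h, map_zero, Finsupp.zero_apply]

lemma sum_pairing_pos {ι : Type*} (s : Finset ι) (m : ι → N →ₗ[ℤ] ℤ)
    {C : PointedCone ℝ (ℝ ⊗[ℤ] N)} (hm : ∀ i ∈ s, ∀ x ∈ C, 0 ≤ pairing (m i) x)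
    (h : ∀ i ∈ s, ∃ x ∈ C, 0 < pairing (m i) x) :
    ∃ x ∈ C, ∀ i ∈ s, 0 < pairing (m i) x := by
  choose! f hf hf' using h
  refine ⟨∑ i ∈ s, f i, sum_mem hf, fun i hi => ?_⟩
  rw [map_sum]
  exact Finset.sum_pos' (fun j hj => hm i hi _ (hf j hj)) ⟨i, hi, hf' i hi⟩

lemma exists_bound {ι : Type*} (s : Finset ι) (f g : ι → ℝ) (hf : ∀ i ∈ s, 0 < f i) :
    ∃ K : ℝ, 0 < K ∧ ∀ i ∈ s, g i ≤ K * f i := by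
  refine ⟨1 + ∑ i ∈ s, |g i| / f i, ?_, fun i hi => ?_⟩
  · have : 0 ≤ ∑ i ∈ s, |g i| / f i :=
      Finset.sum_nonneg fun i hi => div_nonneg (abs_nonneg _) (hf i hi).le
    linarith
  · have h1 : |g i| / f i ≤ ∑ i ∈ s, |g i| / f i :=
      Finset.single_le_sum (f := fun i => |g i| / f i)
        (fun i hi => div_nonneg (abs_nonneg _) (hf i hi).le) hi
    have h2 : g i ≤ (|g i| / f i) * f i := by
      rw [div_mul_cancel₀ _ (hf i hi).ne']
      exact le_abs_self _
    nlinarith [hf i hi]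

end Pairing

lemma RPC.hom_ext_cone {σ τ : RPC.{u}} {f g : σ ⟶ τ}
    (h : ∀ x ∈ σ.cone, RPC.real f x = RPC.real g x) : f = g := by
  refine RPC.hom_ext (LinearMap.ext fun n => sub_eq_zero.1 ?_)
  rw [← Module.forall_dual_apply_eq_zero_iff ℤ]
  intro φ
  have h0 : ∀ x ∈ σ.cone, pairing (φ ∘ₗ (RPC.Hom.lin f - RPC.Hom.lin g)) x = 0 := by
    intro x hx
    rw [← pairing_baseChange, LinearMap.baseChange_sub]
    have := h x hx
    change pairing φ (RPC.real f x - RPC.real g x) = 0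
    rw [this, sub_self, map_zero]
  have := σ.sharp _ (fun x hx => (h0 x hx).ge) fun x hx => by rw [pairing_neg, h0 x hx, neg_zero]
  exact LinearMap.congr_fun this n

section Subcone

variable {N : Type u} [AddCommGroup N] [Module.Free ℤ N] [Module.Finite ℤ N]

/-- The integral linear forms vanishing on a cone. -/
def annihilator (C : PointedCone ℝ (ℝ ⊗[ℤ] N)) : Submodule ℤ (N →ₗ[ℤ] ℤ) where
  carrier := {m | ∀ x ∈ C, pairing m x = 0}
  zero_mem' x _ := pairing_zero x
  add_mem' {a b} ha hb x hx := by rw [pairing_add, ha x hx, hb x hx, add_zero]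
  smul_mem' k m hm x hx := by rw [pairing_smul, hm x hx, mul_zero]

/-- The lattice points on which all integral forms vanishing on the cone vanish. -/
def sublattice (C : PointedCone ℝ (ℝ ⊗[ℤ] N)) : Submodule ℤ N where
  carrier := {n | ∀ m ∈ annihilator C, m n = 0}
  zero_mem' m _ := map_zero m
  add_mem' {a b} ha hb m hm := by rw [map_add, ha m hm, hb m hm, add_zero]
  smul_mem' k n hn m hm := by rw [map_smul, hn m hm, smul_zero]

lemma exists_sublattice_eq_ker (C : PointedCone ℝ (ℝ ⊗[ℤ] N)) :
    ∃ (k : ℕ) (μ : N →ₗ[ℤ] (ULift.{u} (Fin k) → ℤ)), LinearMap.ker μ = sublattice C ∧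
      ∀ i, (LinearMap.proj i) ∘ₗ μ ∈ annihilator C := by
  obtain ⟨k, f, hf⟩ := Submodule.fg_iff_exists_fin_generating_family.1
    (IsNoetherian.noetherian (annihilator C))
  refine ⟨k, LinearMap.pi fun i => f i.down, ?_, fun i => hf ▸ Submodule.subset_span ⟨i.down, rfl⟩⟩
  ext n
  rw [LinearMap.mem_ker]
  constructor
  · intro hn m hm
    rw [← hf] at hm
    induction hm using Submodule.span_induction with
    | mem x hx =>
      obtain ⟨i, rfl⟩ := hx
      exact congrFun hn ⟨i⟩
    | zero => simp
    | add x y _ _ hx hy => simp [hx, hy]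
    | smul a x _ hx => simp [hx]
  · intro hn
    ext i
    exact hn _ (hf ▸ Submodule.subset_span ⟨i.down, rfl⟩)

lemma mem_range_sublattice {C : PointedCone ℝ (ℝ ⊗[ℤ] N)} {x : ℝ ⊗[ℤ] N} (hx : x ∈ C) :
    ∃ y, (sublattice C).subtype.baseChange ℝ y = x := by
  obtain ⟨k, μ, hμ, hμ'⟩ := exists_sublattice_eq_ker C
  have hex : Function.Exact (sublattice C).subtype μ := by
    rw [LinearMap.exact_iff, hμ, Submodule.range_subtype]
  have := Module.Flat.lTensor_exact (R := ℤ) ℝ hex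
  refine (this x).1 ?_
  change μ.baseChange ℝ x = 0
  refine eq_zero_of_pairing fun m => ?_
  rw [pairing_baseChange]
  suffices h : m ∘ₗ μ ∈ annihilator C from h x hx
  have : m ∘ₗ μ = ∑ i, m (Pi.single i 1) • (LinearMap.proj i ∘ₗ μ) := by
    ext n
    simp only [LinearMap.comp_apply, LinearMap.sum_apply, LinearMap.smul_apply,
      LinearMap.proj_apply]
    conv_lhs => rw [← Finset.univ_sum_single (μ n), map_sum]
    refine Finset.sum_congr rfl fun i _ => ?_
    have : (Pi.single i (μ n i) : ULift.{u} (Fin k) → ℤ) = μ n i • Pi.single i 1 := by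
      ext j; simp [Pi.single_apply]
    rw [this, map_smul, smul_eq_mul, smul_eq_mul, mul_comm]
  rw [this]
  exact sum_mem fun i _ => Submodule.smul_mem _ _ (hμ' i)

lemma sublattice_retract (C : PointedCone ℝ (ℝ ⊗[ℤ] N)) :
    ∃ r : N →ₗ[ℤ] sublattice C, r ∘ₗ (sublattice C).subtype = LinearMap.id := by
  obtain ⟨k, μ, hμ, -⟩ := exists_sublattice_eq_ker C
  obtain ⟨s, hs⟩ := Module.projective_lifting_property μ.rangeRestrict LinearMap.id
    μ.surjective_rangeRestrict
  have hmem : ∀ n, ((LinearMap.id : N →ₗ[ℤ] N) - s ∘ₗ μ.rangeRestrict) n ∈ sublattice C := by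
    intro n
    rw [← hμ, LinearMap.mem_ker]
    have := congrArg Subtype.val (LinearMap.congr_fun hs (μ.rangeRestrict n))
    simp only [LinearMap.comp_apply, LinearMap.id_apply, LinearMap.sub_apply, map_sub] at this ⊢
    exact sub_eq_zero.2 this.symm
  refine ⟨((LinearMap.id : N →ₗ[ℤ] N) - s ∘ₗ μ.rangeRestrict).codRestrict _ hmem,
    LinearMap.ext fun n => Subtype.ext ?_⟩
  have hn : n.1 ∈ LinearMap.ker μ := hμ.ge n.2
  have : μ.rangeRestrict n.1 = 0 := Subtype.ext hn
  simp [this]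

/-- The cone in its own span given by a strictly convex rational polyhedral cone. -/
def RPC.ofCone (C : PointedCone ℝ (ℝ ⊗[ℤ] N))
    (hp : ∃ s : Finset (N →ₗ[ℤ] ℤ), ∀ x, x ∈ C ↔ ∀ m ∈ s, 0 ≤ pairing m x)
    (hc : ∀ x ∈ C, -x ∈ C → x = 0) : RPC.{u} where
  N := sublattice C
  cone := C.comap ((sublattice C).subtype.baseChange ℝ)
  polyhedral := by
    classical
    obtain ⟨s, hs⟩ := hp
    refine ⟨s.image fun m => m ∘ₗ (sublattice C).subtype, fun x => ?_⟩
    rw [PointedCone.mem_comap, hs]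
    simp [pairing_baseChange]
  strictlyConvex x hx hx' := by
    have hinj : Function.Injective ((sublattice C).subtype.baseChange ℝ) :=
      Module.Flat.lTensor_preserves_injective_linearMap (M := ℝ) _ (sublattice C).injective_subtype
    refine hinj ?_
    rw [map_zero]
    exact hc _ hx (by rw [← map_neg]; exact hx')
  sharp m hm hm' := by
    obtain ⟨r, hr⟩ := sublattice_retract C
    have h0 : m ∘ₗ r ∈ annihilator C := by
      intro x hx
      obtain ⟨y, rfl⟩ := mem_range_sublattice hx
      rw [pairing_baseChange, LinearMap.comp_assoc, hr, LinearMap.comp_id]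
      have h2 := hm' y hx
      rw [pairing_neg] at h2
      linarith [hm y hx]
    ext n
    have := n.2 _ h0
    have h3 := LinearMap.congr_fun hr n
    simp only [LinearMap.comp_apply, LinearMap.id_apply, Submodule.subtype_apply] at this h3
    rw [h3] at this
    exact this

variable (C : PointedCone ℝ (ℝ ⊗[ℤ] N))
    (hp : ∃ s : Finset (N →ₗ[ℤ] ℤ), ∀ x, x ∈ C ↔ ∀ m ∈ s, 0 ≤ pairing m x)
    (hc : ∀ x ∈ C, -x ∈ C → x = 0)

lemma RPC.ofCone_lift {τ : RPC.{u}} (l : τ.N →ₗ[ℤ] N) (hl : ∀ x ∈ τ.cone, l.baseChange ℝ x ∈ C) :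
    ∃ f : τ ⟶ RPC.ofCone C hp hc, (sublattice C).subtype ∘ₗ RPC.Hom.lin f = l := by
  have h : ∀ n, l n ∈ sublattice C := by
    intro n m hm
    have h0 : ∀ x ∈ τ.cone, pairing (m ∘ₗ l) x = 0 := fun x hx => by
      rw [← pairing_baseChange]
      exact hm _ (hl x hx)
    have := τ.sharp (m ∘ₗ l) (fun x hx => (h0 x hx).ge)
      fun x hx => by rw [pairing_neg, h0 x hx, neg_zero]
    exact LinearMap.congr_fun this n
  have hfac : (sublattice C).subtype ∘ₗ l.codRestrict _ h = l := by
    ext n; rfl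
  refine ⟨⟨l.codRestrict _ h, fun x hx => ?_⟩, hfac⟩
  change (sublattice C).subtype.baseChange ℝ ((l.codRestrict _ h).baseChange ℝ x) ∈ C
  rw [← LinearMap.comp_apply, ← LinearMap.baseChange_comp, hfac]
  exact hl x hx

end Subcone

section Faces

lemma RPC.mem_face_iff {σ : RPC.{u}} {s : Finset (σ.N →ₗ[ℤ] ℤ)}
    (hs : ∀ x, x ∈ σ.cone ↔ ∀ m ∈ s, 0 ≤ pairing m x) {F : PointedCone ℝ (ℝ ⊗[ℤ] σ.N)}
    (hF : F.IsFaceOf σ.cone) (y : ℝ ⊗[ℤ] σ.N) :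
    y ∈ F ↔ y ∈ σ.cone ∧ ∀ m ∈ s, m ∈ annihilator F → pairing m y = 0 := by
  classical
  refine ⟨fun h => ⟨hF.le h, fun m _ hm => hm y h⟩, fun ⟨hy, h⟩ => ?_⟩
  obtain ⟨x, hx, hpos⟩ := sum_pairing_pos (s.filter fun m => m ∉ annihilator F) id
    (C := F) (fun m hm x hx => (hs x).1 (hF.le hx) m (Finset.mem_filter.1 hm).1) (by
      intro m hm
      obtain ⟨hm, hm'⟩ := Finset.mem_filter.1 hm
      have : ∃ x ∈ F, pairing m x ≠ 0 := by
        by_contra! hcon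
        exact hm' hcon
      obtain ⟨x, hx, hne⟩ := this
      exact ⟨x, hx, lt_of_le_of_ne ((hs x).1 (hF.le hx) m hm) hne.symm⟩)
  obtain ⟨K, hK, hK'⟩ := exists_bound (s.filter fun m => m ∉ annihilator F)
    (fun m => pairing m x) (fun m => pairing m y) hpos
  have hmem : K • x - y ∈ σ.cone := by
    rw [hs]
    intro m hm
    rw [map_sub, map_smul, smul_eq_mul]
    by_cases hmF : m ∈ annihilator F
    · rw [hmF x hx, h m hm hmF]; simp
    · have := hK' m (Finset.mem_filter.2 ⟨hm, hmF⟩)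
      linarith
  refine hF.mem_of_add_mem_left hy hmem ?_
  rw [add_sub_cancel]
  exact F.smul_mem hK.le hx

lemma RPC.face_polyhedral (σ : RPC.{u}) {F : PointedCone ℝ (ℝ ⊗[ℤ] σ.N)} (hF : F.IsFaceOf σ.cone) :
    ∃ s : Finset (σ.N →ₗ[ℤ] ℤ), ∀ x, x ∈ F ↔ ∀ m ∈ s, 0 ≤ pairing m x := by
  classical
  obtain ⟨s, hs⟩ := σ.polyhedral
  refine ⟨s ∪ (s.filter fun m => m ∈ annihilator F).image Neg.neg, fun x => ?_⟩
  rw [RPC.mem_face_iff hs hF, hs]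
  constructor
  · rintro ⟨h1, h2⟩ m hm
    rcases Finset.mem_union.1 hm with hm | hm
    · exact h1 m hm
    · obtain ⟨m', hm1, rfl⟩ := Finset.mem_image.1 hm
      obtain ⟨hm2, hm3⟩ := Finset.mem_filter.1 hm1
      rw [pairing_neg, h2 m' hm2 hm3, neg_zero]
  · intro h
    refine ⟨fun m hm => h m (Finset.mem_union_left _ hm), fun m hm hm' => ?_⟩
    have h1 := h m (Finset.mem_union_left _ hm)
    have h2 := h (-m) (Finset.mem_union_right _
      (Finset.mem_image.2 ⟨m, Finset.mem_filter.2 ⟨hm, hm'⟩, rfl⟩))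
    rw [pairing_neg] at h2
    linarith

/-- A face of a cone, as a cone. -/
def RPC.faceCone (σ : RPC.{u}) (F : PointedCone ℝ (ℝ ⊗[ℤ] σ.N)) (hF : F.IsFaceOf σ.cone) :
    RPC.{u} :=
  RPC.ofCone F (σ.face_polyhedral hF)
    fun x hx hx' => σ.strictlyConvex x (hF.le hx) (hF.le hx')

/-- The inclusion of a face. -/
def RPC.faceHom (σ : RPC.{u}) (F : PointedCone ℝ (ℝ ⊗[ℤ] σ.N)) (hF : F.IsFaceOf σ.cone) :
    σ.faceCone F hF ⟶ σ :=
  ⟨(sublattice F).subtype, fun _ hx => hF.le hx⟩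

lemma RPC.image_faceHom (σ : RPC.{u}) (F : PointedCone ℝ (ℝ ⊗[ℤ] σ.N)) (hF : F.IsFaceOf σ.cone) :
    RPC.image (σ.faceHom F hF) = F := by
  ext x
  constructor
  · rintro ⟨y, hy, rfl⟩
    exact hy
  · intro hx
    obtain ⟨y, rfl⟩ := mem_range_sublattice hx
    exact ⟨y, hx, rfl⟩

lemma RPC.isFaceMorphism_faceHom (σ : RPC.{u}) (F : PointedCone ℝ (ℝ ⊗[ℤ] σ.N))
    (hF : F.IsFaceOf σ.cone) : IsFaceMorphism (σ.faceHom F hF) where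
  face := by rwa [RPC.image_faceHom]
  injective := (sublattice F).injective_subtype
  saturated := by
    rintro k n hk ⟨x, hx⟩
    refine ⟨⟨n, fun m hm => ?_⟩, rfl⟩
    have h := x.2 m hm
    have hx' : (sublattice F).subtype x = k • n := hx
    change m ((sublattice F).subtype x) = 0 at h
    rw [hx', map_smul, smul_eq_mul] at h
    exact (mul_eq_zero.1 h).resolve_left hk

lemma RPC.exists_factorization {τ σ : RPC.{u}} (f : τ ⟶ σ) :
    ∃ (ρ : RPC.{u}) (d : τ ⟶ ρ) (g : ρ ⟶ σ), IsDominant d ∧ IsFaceMorphism g ∧ d ≫ g = f := by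
  have hF := RPC.hull_isFaceOf f
  have hg := σ.isFaceMorphism_faceHom _ hF
  obtain ⟨d, hd⟩ := hg.exists_lift f (by
    rw [RPC.image_faceHom]
    exact RPC.image_le_hull f)
  refine ⟨_, d, _, ?_, hg, hd⟩
  rw [isDominant_iff]
  intro x hx
  have hx' : RPC.real (σ.faceHom _ hF) x ∈ RPC.hull f := hx
  obtain ⟨h1, t, ht, h2⟩ := hx'
  refine ⟨t, ht, ?_⟩
  change RPC.real (σ.faceHom _ hF) (RPC.real d t - x) ∈ RPC.hull f
  rw [map_sub, ← RPC.real_comp_apply, hd]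
  exact ⟨h2, t, ht, by rw [sub_sub_cancel]; exact h1⟩

end Faces

section Pullbacks

/-- A commutative square of cones that is a fibre product, also on real points. -/
structure RPC.IsPB {e σ τ ξ : RPC.{u}} (p : e ⟶ σ) (q : e ⟶ τ) (a : σ ⟶ ξ) (b : τ ⟶ ξ) :
    Prop where
  w : p ≫ a = q ≫ b
  inj : ∀ z z', RPC.real p z = RPC.real p z' → RPC.real q z = RPC.real q z' → z = z'
  points : ∀ x ∈ σ.cone, ∀ y ∈ τ.cone, RPC.real a x = RPC.real b y →
    ∃ z ∈ e.cone, RPC.real p z = x ∧ RPC.real q z = y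
  lift : ∀ {ρ : RPC.{u}} (f : ρ ⟶ σ) (g : ρ ⟶ τ), f ≫ a = g ≫ b → ∃ h : ρ ⟶ e, h ≫ p = f ∧ h ≫ q = g

variable {e σ τ ξ : RPC.{u}} {p : e ⟶ σ} {q : e ⟶ τ} {a : σ ⟶ ξ} {b : τ ⟶ ξ}

lemma RPC.IsPB.ext (H : RPC.IsPB p q a b) {ρ : RPC.{u}} {h h' : ρ ⟶ e} (h1 : h ≫ p = h' ≫ p)
    (h2 : h ≫ q = h' ≫ q) : h = h' :=
  RPC.hom_ext_cone fun x _ => H.inj _ _ (by rw [← RPC.real_comp_apply, ← RPC.real_comp_apply, h1])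
    (by rw [← RPC.real_comp_apply, ← RPC.real_comp_apply, h2])

lemma RPC.exists_isPB (a : σ ⟶ ξ) (b : τ ⟶ ξ) :
    ∃ (e : RPC.{u}) (p : e ⟶ σ) (q : e ⟶ τ), RPC.IsPB p q a b := by
  classical
  let N := σ.N × τ.N
  let P : N →ₗ[ℤ] σ.N := LinearMap.fst ℤ _ _
  let Q : N →ₗ[ℤ] τ.N := LinearMap.snd ℤ _ _
  have hinj : ∀ z : ℝ ⊗[ℤ] N, P.baseChange ℝ z = 0 → Q.baseChange ℝ z = 0 → z = 0 := by
    intro z h1 h2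
    have : (LinearMap.inl ℤ σ.N τ.N ∘ₗ P + LinearMap.inr ℤ σ.N τ.N ∘ₗ Q) = LinearMap.id := by
      ext x <;> simp [P, Q]
    have h3 := LinearMap.congr_fun (congrArg (LinearMap.baseChange ℝ) this) z
    rw [LinearMap.baseChange_add, LinearMap.baseChange_comp, LinearMap.baseChange_comp,
      LinearMap.add_apply, LinearMap.comp_apply, LinearMap.comp_apply, h1, h2, map_zero, map_zero,
      LinearMap.baseChange_id, LinearMap.id_apply, add_zero] at h3
    exact h3.symm
  let d : N →ₗ[ℤ] ξ.N := RPC.Hom.lin a ∘ₗ P - RPC.Hom.lin b ∘ₗ Q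
  have hd : ∀ z, d.baseChange ℝ z =
      RPC.real a (P.baseChange ℝ z) - RPC.real b (Q.baseChange ℝ z) := by
    intro z
    simp [d, LinearMap.baseChange_sub, LinearMap.baseChange_comp, RPC.real]
  let C : PointedCone ℝ (ℝ ⊗[ℤ] N) := σ.cone.comap (P.baseChange ℝ) ⊓ τ.cone.comap (Q.baseChange ℝ) ⊓
    (LinearMap.ker (d.baseChange ℝ)).restrictScalars _
  have hC : ∀ z, z ∈ C ↔ (P.baseChange ℝ z ∈ σ.cone ∧ Q.baseChange ℝ z ∈ τ.cone) ∧
      d.baseChange ℝ z = 0 := fun z => Iff.rfl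
  obtain ⟨s, hs⟩ := σ.polyhedral
  obtain ⟨t, ht⟩ := τ.polyhedral
  let B := Module.Free.chooseBasis ℤ ξ.N
  have hker : ∀ z, d.baseChange ℝ z = 0 ↔ ∀ i, pairing (B.coord i ∘ₗ d) z = 0 := by
    intro z
    constructor
    · intro h i
      rw [← pairing_baseChange, h, map_zero]
    · intro h
      refine (B.baseChange ℝ).ext_elem fun i => ?_
      have key : ∀ y, (B.baseChange ℝ).repr y i = pairing (B.coord i) y := by
        intro y
        induction y with
        | zero => simp
        | tmul r n => simp [Module.Basis.baseChange_repr_tmul, mul_comm]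
        | add x y hx hy => rw [map_add, map_add, Finsupp.add_apply, hx, hy]
      rw [key, pairing_baseChange, h, map_zero, Finsupp.zero_apply]
  have hp : ∃ s : Finset (N →ₗ[ℤ] ℤ), ∀ x, x ∈ C ↔ ∀ m ∈ s, 0 ≤ pairing m x := by
    refine ⟨(s.image (· ∘ₗ P) ∪ t.image (· ∘ₗ Q)) ∪ (Finset.univ.image (fun i => B.coord i ∘ₗ d) ∪
        Finset.univ.image (fun i => -(B.coord i ∘ₗ d))), fun z => ?_⟩
    rw [hC, hs, ht, hker]
    simp only [Finset.mem_union, Finset.mem_image, Finset.mem_univ, true_and, pairing_baseChange]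
    constructor
    · rintro ⟨⟨h1, h2⟩, h3⟩ m ((⟨m, hm, rfl⟩ | ⟨m, hm, rfl⟩) | (⟨i, rfl⟩ | ⟨i, rfl⟩))
      · exact h1 m hm
      · exact h2 m hm
      · exact (h3 i).ge
      · rw [pairing_neg, h3, neg_zero]
    · intro h
      refine ⟨⟨fun m hm => h _ (Or.inl (Or.inl ⟨m, hm, rfl⟩)),
        fun m hm => h _ (Or.inl (Or.inr ⟨m, hm, rfl⟩))⟩, fun i => ?_⟩
      have h1 := h _ (Or.inr (Or.inl ⟨i, rfl⟩))
      have h2 := h _ (Or.inr (Or.inr ⟨i, rfl⟩))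
      rw [pairing_neg] at h2
      linarith
  have hc : ∀ x ∈ C, -x ∈ C → x = 0 := by
    intro x hx hx'
    refine hinj x (σ.strictlyConvex _ hx.1.1 ?_) (τ.strictlyConvex _ hx.1.2 ?_)
    · rw [← map_neg]; exact hx'.1.1
    · rw [← map_neg]; exact hx'.1.2
  let ι := (sublattice C).subtype
  have hP : ∀ x, (P ∘ₗ ι).baseChange ℝ x = P.baseChange ℝ (ι.baseChange ℝ x) := fun x =>
    LinearMap.congr_fun (LinearMap.baseChange_comp (A := ℝ) (f := ι) (g := P)) x
  have hQ : ∀ x, (Q ∘ₗ ι).baseChange ℝ x = Q.baseChange ℝ (ι.baseChange ℝ x) := fun x =>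
    LinearMap.congr_fun (LinearMap.baseChange_comp (A := ℝ) (f := ι) (g := Q)) x
  let p : RPC.ofCone C hp hc ⟶ σ := ⟨P ∘ₗ ι, fun x hx => (congrArg (· ∈ σ.cone) (hP x)).mpr hx.1.1⟩
  let q : RPC.ofCone C hp hc ⟶ τ := ⟨Q ∘ₗ ι, fun x hx => (congrArg (· ∈ τ.cone) (hQ x)).mpr hx.1.2⟩
  have hpr : ∀ x, RPC.real p x = P.baseChange ℝ (ι.baseChange ℝ x) := hP
  have hqr : ∀ x, RPC.real q x = Q.baseChange ℝ (ι.baseChange ℝ x) := hQ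
  have hι : Function.Injective (ι.baseChange ℝ) :=
    Module.Flat.lTensor_preserves_injective_linearMap (M := ℝ) _ (sublattice C).injective_subtype
  refine ⟨_, p, q, ⟨RPC.hom_ext_cone fun x hx => ?_, fun z z' h1 h2 => ?_,
    fun x hx y hy hxy => ?_, fun {ρ} f g hfg => ?_⟩⟩
  · have h := ((hC _).1 hx).2
    rw [hd, sub_eq_zero] at h
    rw [RPC.real_comp_apply, RPC.real_comp_apply, hpr, hqr]
    exact h
  · apply hι
    rw [← sub_eq_zero]
    refine hinj _ ?_ ?_
    · rw [map_sub, ← hpr, ← hpr, h1, sub_self]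
    · rw [map_sub, ← hqr, ← hqr, h2, sub_self]
  · let z : ℝ ⊗[ℤ] N := (LinearMap.inl ℤ σ.N τ.N).baseChange ℝ x +
      (LinearMap.inr ℤ σ.N τ.N).baseChange ℝ y
    have e1 : P ∘ₗ LinearMap.inl ℤ σ.N τ.N = LinearMap.id := by ext; rfl
    have e2 : P ∘ₗ LinearMap.inr ℤ σ.N τ.N = 0 := by ext; rfl
    have e3 : Q ∘ₗ LinearMap.inl ℤ σ.N τ.N = 0 := by ext; rfl
    have e4 : Q ∘ₗ LinearMap.inr ℤ σ.N τ.N = LinearMap.id := by ext; rfl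
    have h1 : P.baseChange ℝ z = x := by
      rw [map_add, ← LinearMap.comp_apply, ← LinearMap.comp_apply, ← LinearMap.baseChange_comp,
        ← LinearMap.baseChange_comp, e1, e2]
      simp
    have h2 : Q.baseChange ℝ z = y := by
      rw [map_add, ← LinearMap.comp_apply, ← LinearMap.comp_apply, ← LinearMap.baseChange_comp,
        ← LinearMap.baseChange_comp, e3, e4]
      simp
    have hz : z ∈ C := (hC z).2 ⟨⟨h1 ▸ hx, h2 ▸ hy⟩, by rw [hd, h1, h2, hxy, sub_self]⟩
    obtain ⟨w, hw⟩ := mem_range_sublattice hz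
    refine ⟨w, ?_, ?_, ?_⟩
    · change ι.baseChange ℝ w ∈ C
      rw [hw]; exact hz
    · exact (hpr w).trans ((congrArg _ hw).trans h1)
    · exact (hqr w).trans ((congrArg _ hw).trans h2)
  · have e1 : P ∘ₗ (RPC.Hom.lin f).prod (RPC.Hom.lin g) = RPC.Hom.lin f := by ext; rfl
    have e2 : Q ∘ₗ (RPC.Hom.lin f).prod (RPC.Hom.lin g) = RPC.Hom.lin g := by ext; rfl
    obtain ⟨h, hh⟩ := RPC.ofCone_lift C hp hc ((RPC.Hom.lin f).prod (RPC.Hom.lin g))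
      fun x hx => by
        have h1 : P.baseChange ℝ (((RPC.Hom.lin f).prod (RPC.Hom.lin g)).baseChange ℝ x) =
          RPC.real f x := by
          rw [← LinearMap.comp_apply, ← LinearMap.baseChange_comp, e1]; rfl
        have h2 : Q.baseChange ℝ (((RPC.Hom.lin f).prod (RPC.Hom.lin g)).baseChange ℝ x) =
          RPC.real g x := by
          rw [← LinearMap.comp_apply, ← LinearMap.baseChange_comp, e2]; rfl
        refine (hC _).2 ⟨⟨h1 ▸ RPC.real_mem f hx, h2 ▸ RPC.real_mem g hx⟩, ?_⟩
        rw [hd, h1, h2, ← RPC.real_comp_apply, ← RPC.real_comp_apply, hfg, sub_self]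
    refine ⟨h, RPC.hom_ext ?_, RPC.hom_ext ?_⟩
    · rw [← e1, ← hh]; rfl
    · rw [← e2, ← hh]; rfl

lemma RPC.IsPB.isDominant (H : RPC.IsPB p q a b) {ρ : RPC.{u}} {h : ρ ⟶ e}
    (h1 : IsDominant (h ≫ p)) (h2 : IsDominant (h ≫ q)) : IsDominant h := by
  rw [isDominant_iff] at *
  intro z hz
  obtain ⟨s, hs, hs'⟩ := h1 _ (RPC.real_mem p hz)
  obtain ⟨t, ht, ht'⟩ := h2 _ (RPC.real_mem q hz)
  refine ⟨s + t, add_mem hs ht, ?_⟩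
  rw [RPC.real_comp_apply] at hs' ht'
  have e1 : RPC.real p (RPC.real h (s + t) - z) ∈ σ.cone := by
    have : RPC.real p (RPC.real h (s + t) - z) =
        (RPC.real p (RPC.real h s) - RPC.real p z) + RPC.real p (RPC.real h t) := by
      rw [map_sub, map_add, map_add]; abel
    rw [this]
    exact add_mem hs' (RPC.real_mem p (RPC.real_mem h ht))
  have e2 : RPC.real q (RPC.real h (s + t) - z) ∈ τ.cone := by
    have : RPC.real q (RPC.real h (s + t) - z) =
        (RPC.real q (RPC.real h t) - RPC.real q z) + RPC.real q (RPC.real h s) := by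
      rw [map_sub, map_add, map_add]; abel
    rw [this]
    exact add_mem ht' (RPC.real_mem q (RPC.real_mem h hs))
  obtain ⟨w, hw, hw1, hw2⟩ := H.points _ e1 _ e2 (by
    rw [← RPC.real_comp_apply, H.w, RPC.real_comp_apply])
  rwa [← H.inj _ _ hw1 hw2]

lemma RPC.IsPB.face (H : RPC.IsPB p q a b) {ρ σ' τ' ξ' : RPC.{u}} {g : ρ ⟶ e} {d₁ : ρ ⟶ σ'}
    {d₂ : ρ ⟶ τ'} {g₁ : σ' ⟶ σ} {g₂ : τ' ⟶ τ} {a' : σ' ⟶ ξ'} {b' : τ' ⟶ ξ'} {g₃ : ξ' ⟶ ξ}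
    (hg : IsFaceMorphism g) (h₁ : IsDominant d₁) (h₂ : IsDominant d₂) (hg₁ : IsFaceMorphism g₁)
    (hg₂ : IsFaceMorphism g₂) (hg₃ : IsFaceMorphism g₃) (w₁ : d₁ ≫ g₁ = g ≫ p)
    (w₂ : d₂ ≫ g₂ = g ≫ q) (wa : a' ≫ g₃ = g₁ ≫ a) (wb : b' ≫ g₃ = g₂ ≫ b) :
    RPC.IsPB d₁ d₂ a' b' := by
  rw [isDominant_iff] at h₁ h₂
  have wp : ∀ r, RPC.real p (RPC.real g r) = RPC.real g₁ (RPC.real d₁ r) := fun r => by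
    rw [← RPC.real_comp_apply, ← RPC.real_comp_apply, w₁]
  have wq : ∀ r, RPC.real q (RPC.real g r) = RPC.real g₂ (RPC.real d₂ r) := fun r => by
    rw [← RPC.real_comp_apply, ← RPC.real_comp_apply, w₂]
  have key : ∀ x ∈ σ'.cone, ∀ y ∈ τ'.cone, RPC.real a' x = RPC.real b' y →
      ∃ r ∈ ρ.cone, RPC.real d₁ r = x ∧ RPC.real d₂ r = y := by
    intro x hx y hy hxy
    have hab : RPC.real a (RPC.real g₁ x) = RPC.real b (RPC.real g₂ y) := by
      rw [← RPC.real_comp_apply, ← RPC.real_comp_apply, ← wa, ← wb, RPC.real_comp_apply,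
        RPC.real_comp_apply, hxy]
    obtain ⟨z, hz, hz1, hz2⟩ := H.points _ (RPC.real_mem g₁ hx) _ (RPC.real_mem g₂ hy) hab
    obtain ⟨s, hs, hs'⟩ := h₁ x hx
    obtain ⟨t, ht, ht'⟩ := h₂ y hy
    have k1 : RPC.real g₁ (RPC.real d₁ (s + t) - x) ∈ σ.cone := by
      refine RPC.real_mem g₁ ?_
      have : RPC.real d₁ (s + t) - x = (RPC.real d₁ s - x) + RPC.real d₁ t := by
        rw [map_add]; abel
      rw [this]
      exact add_mem hs' (RPC.real_mem d₁ ht)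
    have k2 : RPC.real g₂ (RPC.real d₂ (s + t) - y) ∈ τ.cone := by
      refine RPC.real_mem g₂ ?_
      have : RPC.real d₂ (s + t) - y = (RPC.real d₂ t - y) + RPC.real d₂ s := by
        rw [map_add]; abel
      rw [this]
      exact add_mem ht' (RPC.real_mem d₂ hs)
    obtain ⟨z', hz', hz1', hz2'⟩ := H.points _ k1 _ k2 (by
      rw [map_sub, map_sub, map_sub, map_sub, hab, ← wp, ← wq, ← RPC.real_comp_apply p a, H.w,
        RPC.real_comp_apply])
    have hsum : z + z' = RPC.real g (s + t) := by
      refine H.inj _ _ ?_ ?_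
      · rw [map_add, hz1, hz1', wp, ← map_add, add_sub_cancel]
      · rw [map_add, hz2, hz2', wq, ← map_add, add_sub_cancel]
    obtain ⟨r, hr, hrz⟩ := hg.face.mem_of_add_mem_left hz hz' (hsum ▸ ⟨s + t, add_mem hs ht, rfl⟩)
    have hrz : RPC.real g r = z := hrz
    refine ⟨r, hr, hg₁.real_injective ?_, hg₂.real_injective ?_⟩
    · rw [← wp, hrz, hz1]
    · rw [← wq, hrz, hz2]
  refine ⟨?_, ?_, key, ?_⟩
  · refine hg₃.cancel ?_
    rw [assoc, assoc, wa, wb, ← assoc, ← assoc, w₁, w₂, assoc, assoc, H.w]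
  · intro z z' hz hz'
    refine hg.real_injective (H.inj _ _ ?_ ?_)
    · rw [wp, wp, hz]
    · rw [wq, wq, hz']
  · intro π f f' hff
    obtain ⟨h, hh1, hh2⟩ := H.lift (f ≫ g₁) (f' ≫ g₂) (by
      rw [assoc, assoc, ← wa, ← wb, reassoc_of% hff])
    obtain ⟨k, hk⟩ := hg.exists_lift h (by
      rintro _ ⟨x, hx, rfl⟩
      obtain ⟨r, hr, hr1, hr2⟩ := key _ (RPC.real_mem f hx) _ (RPC.real_mem f' hx) (by
        rw [← RPC.real_comp_apply, ← RPC.real_comp_apply, hff])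
      refine ⟨r, hr, H.inj _ _ ?_ ?_⟩
      · change RPC.real p (RPC.real g r) = RPC.real p (RPC.real h x)
        rw [wp, hr1, ← RPC.real_comp_apply, ← RPC.real_comp_apply, hh1]
      · change RPC.real q (RPC.real g r) = RPC.real q (RPC.real h x)
        rw [wq, hr2, ← RPC.real_comp_apply, ← RPC.real_comp_apply, hh2])
    refine ⟨k, hg₁.cancel ?_, hg₂.cancel ?_⟩
    · rw [assoc, w₁, reassoc_of% hk, hh1]
    · rw [assoc, w₂, reassoc_of% hk, hh2]

end Pullbacks

section ZeroCone

/-- The zero cone. -/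
def RPC.zero : RPC.{u} where
  N := PUnit
  cone := ⊤
  polyhedral := ⟨∅, by simp⟩
  strictlyConvex x _ _ := eq_zero_of_pairing fun m => by
    have : m = 0 := LinearMap.ext fun n => by
      rw [Subsingleton.elim n 0, map_zero, map_zero]
    rw [this, pairing_zero]
  sharp m _ _ := LinearMap.ext fun n => by
    rw [Subsingleton.elim n 0, map_zero, map_zero]

def RPC.toZero (σ : RPC.{u}) : σ ⟶ RPC.zero := ⟨0, fun _ _ => trivial⟩

lemma RPC.hom_zero_ext {σ : RPC.{u}} (f g : σ ⟶ RPC.zero) : f = g :=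
  RPC.hom_ext (LinearMap.ext fun _ => Subsingleton.elim (α := PUnit) _ _)

lemma RPC.isDominant_toZero {σ : RPC.{u}} (f : σ ⟶ RPC.zero) : IsDominant f := by
  rw [isDominant_iff]
  exact fun x _ => ⟨0, zero_mem _, trivial⟩

end ZeroCone

section FiniteOrder

variable {σ : RPC.{u}}

/-- The face of a cone on which a nonnegative linear form vanishes. -/
def RPC.kerFace (σ : RPC.{u}) (m : σ.N →ₗ[ℤ] ℤ) : PointedCone ℝ (ℝ ⊗[ℤ] σ.N) :=
  σ.cone ⊓ (LinearMap.ker (pairing m)).restrictScalars _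

lemma RPC.kerFace_isFaceOf {m : σ.N →ₗ[ℤ] ℤ} (hm : ∀ x ∈ σ.cone, 0 ≤ pairing m x) :
    (σ.kerFace m).IsFaceOf σ.cone := by
  refine ⟨fun x hx => hx.1, fun {x y a} hx hy ha h => ⟨hx, ?_⟩⟩
  have h2 : pairing m (a • x + y) = 0 := h.2
  rw [map_add, map_smul, smul_eq_mul] at h2
  have h3 := hm x hx
  have h4 := hm y hy
  have h5 : a * pairing m x = 0 := by nlinarith [mul_nonneg ha.le h3]
  exact (mul_eq_zero.1 h5).resolve_left ha.ne'

lemma RPC.exists_irredundant (σ : RPC.{u}) : ∃ s : Finset (σ.N →ₗ[ℤ] ℤ),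
    (∀ x, x ∈ σ.cone ↔ ∀ m ∈ s, 0 ≤ pairing m x) ∧ ∀ m ∈ s, ∃ y, pairing m y < 0 ∧
      ∀ m' ∈ s, m' ≠ m → 0 ≤ pairing m' y := by
  classical
  obtain ⟨s, hs, hmin⟩ := WellFounded.has_min (measure (Finset.card : Finset (σ.N →ₗ[ℤ] ℤ) → ℕ)).wf
    {s | ∀ x, x ∈ σ.cone ↔ ∀ m ∈ s, 0 ≤ pairing m x} σ.polyhedral
  refine ⟨s, hs, fun m hm => ?_⟩
  by_contra! hcon
  refine hmin (s.erase m) (fun x => ⟨fun hx m' hm' => (hs x).1 hx m' (Finset.mem_of_mem_erase hm'),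
    fun hx => (hs x).2 fun m' hm' => ?_⟩) (Finset.card_erase_lt_of_mem hm)
  by_cases h : m' = m
  · subst h
    by_contra! hneg
    obtain ⟨m'', hm'', hne, hlt⟩ := hcon x hneg
    exact hlt.not_ge (hx m'' (Finset.mem_erase.2 ⟨hne, hm''⟩))
  · exact hx m' (Finset.mem_erase.2 ⟨h, hm'⟩)

lemma exists_min_pos {N : Type u} [AddCommGroup N] {m : N →ₗ[ℤ] ℤ} (hm : m ≠ 0) :
    ∃ n, 0 < m n ∧ ∀ n', 0 < m n' → m n ≤ m n' := by
  have hex : ∃ k : ℕ, 0 < k ∧ ∃ n, m n = k := by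
    obtain ⟨n, hn⟩ : ∃ n, m n ≠ 0 := by
      by_contra! h
      exact hm (LinearMap.ext h)
    rcases lt_or_gt_of_ne hn with h | h
    · exact ⟨(m (-n)).toNat, by rw [map_neg]; omega, -n, by rw [map_neg]; omega⟩
    · exact ⟨(m n).toNat, by omega, n, by omega⟩
  classical
  obtain ⟨hpos, n, hn⟩ := Nat.find_spec hex
  refine ⟨n, by omega, fun n' hn' => ?_⟩
  have := Nat.find_min' hex ⟨(by omega : 0 < (m n').toNat), n', by omega⟩
  omega

lemma RPC.eq_id_of_preserves_faces (g : σ ⟶ σ) [IsIso g]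
    (hg : ∀ F : PointedCone ℝ (ℝ ⊗[ℤ] σ.N), F.IsFaceOf σ.cone → ∀ x ∈ F, RPC.real g x ∈ F) :
    g = 𝟙 σ := by
  classical
  obtain ⟨s, hs, hirr⟩ := σ.exists_irredundant
  have hpos : ∀ m ∈ s, ∀ x ∈ σ.cone, 0 ≤ pairing m x := fun m hm x hx => (hs x).1 hx m hm
  have hne : ∀ m ∈ s, m ≠ 0 := by
    rintro m hm rfl
    obtain ⟨y, hy, -⟩ := hirr 0 hm
    simp at hy
  obtain ⟨x, hx, hxpos⟩ := sum_pairing_pos s id (C := σ.cone) hpos (by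
    intro m hm
    by_contra! hcon
    exact hne m hm (σ.sharp m (hpos m hm) fun x hx => by
      rw [pairing_neg]; linarith [hcon x hx, show pairing (id m) x = pairing m x from rfl]))
  have key : ∀ m ∈ s, ∀ v, pairing m (RPC.real g v) = pairing m v := by
    intro m hm
    obtain ⟨y, hy, hy'⟩ := hirr m hm
    have hmx : 0 < pairing m x := hxpos m hm
    let z := pairing m x • y - pairing m y • x
    have hz : pairing m z = 0 := by
      simp only [z, map_sub, map_smul, smul_eq_mul]; ring
    have hz' : ∀ m' ∈ s.filter (· ≠ m), 0 < pairing m' z := by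
      intro m' hm'
      obtain ⟨h1, h2⟩ := Finset.mem_filter.1 hm'
      simp only [z, map_sub, map_smul, smul_eq_mul]
      have h3 : 0 < pairing m' x := hxpos m' h1
      nlinarith [hy' m' h1 h2, mul_nonneg hmx.le (hy' m' h1 h2), mul_pos_of_neg_of_neg hy
        (neg_lt_zero.2 h3)]
    have hker : ∀ v, pairing m v = 0 → pairing m (RPC.real g v) = 0 := by
      intro v hv
      obtain ⟨K, hK, hK'⟩ := exists_bound (s.filter (· ≠ m)) (fun m' => pairing m' z)
        (fun m' => |pairing m' v|) hz'
      have hmem : ∀ w, pairing m w = 0 → (∀ m' ∈ s.filter (· ≠ m), 0 ≤ pairing m' w) →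
          pairing m (RPC.real g w) = 0 := by
        intro w hw hw'
        refine (hg _ (RPC.kerFace_isFaceOf (hpos m hm)) w ⟨(hs w).2 fun m' hm' => ?_, hw⟩).2
        by_cases h : m' = m
        · rw [h, hw]
        · exact hw' m' (Finset.mem_filter.2 ⟨hm', h⟩)
      have h1 := hmem (K • z + v) (by rw [map_add, map_smul, hz, hv]; simp) fun m' hm' => by
        rw [map_add, map_smul, smul_eq_mul]
        linarith [hK' m' hm', neg_abs_le (pairing m' v)]
      have h2 := hmem (K • z - v) (by rw [map_sub, map_smul, hz, hv]; simp) fun m' hm' => by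
        rw [map_sub, map_smul, smul_eq_mul]
        linarith [hK' m' hm', le_abs_self (pairing m' v)]
      rw [map_add, map_add] at h1
      rw [map_sub, map_sub] at h2
      linarith
    obtain ⟨c, hc⟩ : ∃ c, ∀ v, pairing m (RPC.real g v) = c * pairing m v := by
      refine ⟨pairing m (RPC.real g x) / pairing m x, fun v => ?_⟩
      have h := hker (v - (pairing m v / pairing m x) • x) (by
        rw [map_sub, map_smul, smul_eq_mul, div_mul_cancel₀ _ hmx.ne', sub_self])
      rw [map_sub, map_sub, map_smul, map_smul, smul_eq_mul, sub_eq_zero] at h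
      rw [h]
      field_simp
    have hint : ∀ n, (m (RPC.Hom.lin g n) : ℝ) = c * m n := by
      intro n
      have := hc ((1 : ℝ) ⊗ₜ n)
      rw [show RPC.real g ((1 : ℝ) ⊗ₜ n) = (1 : ℝ) ⊗ₜ RPC.Hom.lin g n from
        LinearMap.baseChange_tmul .., pairing_tmul, pairing_tmul, one_mul, one_mul] at this
      exact this
    have hc0 : 0 ≤ c := by
      have h1 := hc x
      have h2 := hpos m hm _ (RPC.real_mem g hx)
      by_contra! hneg
      nlinarith
    obtain ⟨n, hn, hmin⟩ := exists_min_pos (hne m hm)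
    have hn' : (0 : ℝ) < m n := by exact_mod_cast hn
    obtain ⟨n₁, rfl⟩ : ∃ n₁, RPC.Hom.lin g n₁ = n := ⟨RPC.Hom.lin (inv g) n, LinearMap.congr_fun
        (congrArg RPC.Hom.lin (IsIso.inv_hom_id g)) n⟩
    have e1 := hint n₁
    have hcpos : 0 < c := lt_of_le_of_ne hc0 fun h => by
      rw [← h, zero_mul] at e1
      linarith
    have h1 : 0 < m n₁ := by
      by_contra! hneg
      have : (m n₁ : ℝ) ≤ 0 := by exact_mod_cast hneg
      nlinarith
    have h2 : (m (RPC.Hom.lin g n₁) : ℝ) ≤ m n₁ := by exact_mod_cast hmin n₁ h1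
    have e2 := hint (RPC.Hom.lin g n₁)
    have h3 : 0 < m (RPC.Hom.lin g (RPC.Hom.lin g n₁)) := by
      have : (0 : ℝ) < m (RPC.Hom.lin g (RPC.Hom.lin g n₁)) := by rw [e2]; positivity
      exact_mod_cast this
    have h4 : (m (RPC.Hom.lin g n₁) : ℝ) ≤ m (RPC.Hom.lin g (RPC.Hom.lin g n₁)) := by
      exact_mod_cast hmin _ h3
    have hc1 : c = 1 := by
      have h1' : (0 : ℝ) < m n₁ := by exact_mod_cast h1
      apply le_antisymm
      · by_contra! h; nlinarith
      · by_contra! h; nlinarith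
    intro v
    rw [hc, hc1, one_mul]
  refine RPC.hom_ext_cone fun v _ => ?_
  rw [RPC.real_id, LinearMap.id_apply, ← sub_eq_zero]
  refine σ.strictlyConvex _ ((hs _).2 fun m hm => ?_) ((hs _).2 fun m hm => ?_)
  · rw [map_sub, key m hm, sub_self]
  · rw [map_neg, map_sub, key m hm, sub_self, neg_zero]

/-- The powers of an endomorphism of a cone. -/
def RPC.iter (h : σ ⟶ σ) : ℕ → (σ ⟶ σ)
  | 0 => 𝟙 σ
  | n + 1 => h ≫ RPC.iter h n

lemma RPC.iter_comm (h : σ ⟶ σ) (n : ℕ) : h ≫ RPC.iter h n = RPC.iter h n ≫ h := by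
  induction n with
  | zero => simp [RPC.iter]
  | succ n ih => simp only [RPC.iter]; rw [assoc, ← ih]

instance RPC.isIso_iter (h : σ ⟶ σ) [IsIso h] (n : ℕ) : IsIso (RPC.iter h n) := by
  induction n with
  | zero => exact inferInstanceAs (IsIso (𝟙 σ))
  | succ n ih => exact inferInstanceAs (IsIso (h ≫ RPC.iter h n))

lemma RPC.finite_faces (σ : RPC.{u}) :
    Finite {F : PointedCone ℝ (ℝ ⊗[ℤ] σ.N) // F.IsFaceOf σ.cone} := by
  classical
  obtain ⟨s, hs⟩ := σ.polyhedral
  refine Finite.of_injective (β := s.powerset)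
    (fun F => ⟨s.filter fun m => m ∈ annihilator F.1, by simp⟩) fun F G h => Subtype.ext ?_
  have h' : (s.filter fun m => m ∈ annihilator F.1) = s.filter fun m => m ∈ annihilator G.1 :=
    congrArg Subtype.val h
  ext x
  rw [RPC.mem_face_iff hs F.2, RPC.mem_face_iff hs G.2]
  have : ∀ m ∈ s, (m ∈ annihilator F.1 ↔ m ∈ annihilator G.1) := fun m hm => by
    have := congrArg (m ∈ ·) h'
    simpa [hm] using this
  exact and_congr_right fun _ => forall₂_congr fun m hm => by rw [this m hm]

lemma RPC.exists_iter_eq_id (h : σ ⟶ σ) [IsIso h] : ∃ n, 0 < n ∧ RPC.iter h n = 𝟙 σ := by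
  have := σ.finite_faces
  have hcone : ∀ (k : σ ⟶ σ) [IsIso k] (F : PointedCone ℝ (ℝ ⊗[ℤ] σ.N)), F.IsFaceOf σ.cone →
      (F.map (RPC.real k)).IsFaceOf σ.cone := by
    intro k _ F hF
    have h1 := hF.map (RPC.real k) (IsFaceMorphism.of_isIso k).real_injective
    exact h1.trans (IsFaceMorphism.of_isIso k).face
  let f : {F : PointedCone ℝ (ℝ ⊗[ℤ] σ.N) // F.IsFaceOf σ.cone} →
      {F : PointedCone ℝ (ℝ ⊗[ℤ] σ.N) // F.IsFaceOf σ.cone} :=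
    fun F => ⟨F.1.map (RPC.real h), hcone h F.1 F.2⟩
  have hf : Function.Injective f := by
    intro F G hFG
    apply Subtype.ext
    exact Submodule.map_injective_of_injective (f := (RPC.real h).restrictScalars {c : ℝ // 0 ≤ c})
      (IsFaceMorphism.of_isIso h).real_injective (congrArg Subtype.val hFG)
  let e : Equiv.Perm _ := Equiv.ofBijective f (Finite.injective_iff_bijective.1 hf)
  obtain ⟨n, hn, hen⟩ := isOfFinOrder_iff_pow_eq_one.1 (isOfFinOrder_of_finite e)
  refine ⟨n, hn, RPC.eq_id_of_preserves_faces _ fun F hF x hx => ?_⟩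
  have key : ∀ (k : ℕ) (F : {F : PointedCone ℝ (ℝ ⊗[ℤ] σ.N) // F.IsFaceOf σ.cone}),
      ∀ x ∈ F.1, RPC.real (RPC.iter h k) x ∈ ((e ^ k) F).1 := by
    intro k
    induction k with
    | zero => intro F x hx; simpa [RPC.iter] using hx
    | succ k ih =>
      intro F x hx
      rw [RPC.iter, RPC.real_comp_apply, pow_succ, Equiv.Perm.mul_apply]
      exact ih _ _ ⟨x, hx, rfl⟩
  have := key n ⟨F, hF⟩ x hx
  rwa [hen] at this

lemma RPC.exists_isDominant_comp_eq (h : σ ⟶ σ) [IsIso h] :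
    ∃ d : σ ⟶ σ, IsDominant d ∧ d ≫ h = d := by
  obtain ⟨n, hn, hid⟩ := RPC.exists_iter_eq_id h
  let d : σ ⟶ σ := ⟨∑ k ∈ Finset.range n, RPC.Hom.lin (RPC.iter h k), fun x hx => by
    have : (∑ k ∈ Finset.range n, RPC.Hom.lin (RPC.iter h k)).baseChange ℝ x =
        ∑ k ∈ Finset.range n, RPC.real (RPC.iter h k) x := by
      rw [← LinearMap.sum_apply]
      exact congrArg (· x) (map_sum (LinearMap.baseChangeHom ℤ ℝ σ.N σ.N) _ _)
    rw [this]
    exact sum_mem fun k _ => RPC.real_mem _ hx⟩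
  have hd : ∀ x, RPC.real d x = ∑ k ∈ Finset.range n, RPC.real (RPC.iter h k) x := fun x => by
    rw [← LinearMap.sum_apply]
    exact congrArg (· x) (map_sum (LinearMap.baseChangeHom ℤ ℝ σ.N σ.N) _ _)
  obtain ⟨n, rfl⟩ : ∃ m, n = m + 1 := ⟨n - 1, by omega⟩
  refine ⟨d, ?_, RPC.hom_ext_cone fun x hx => ?_⟩
  · rw [isDominant_iff]
    intro x hx
    refine ⟨x, hx, ?_⟩
    rw [hd, Finset.sum_range_succ', RPC.iter, RPC.real_id, LinearMap.id_apply, add_sub_cancel_right]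
    exact sum_mem fun k _ => RPC.real_mem _ hx
  · rw [RPC.real_comp_apply, hd, map_sum, Finset.sum_range_succ, Finset.sum_range_succ']
    congr 1
    · refine Finset.sum_congr rfl fun k _ => ?_
      rw [← RPC.real_comp_apply, ← RPC.iter_comm]; rfl
    · rw [← RPC.real_comp_apply, ← RPC.iter_comm]
      change RPC.real (RPC.iter h (n + 1)) x = _
      rw [hid]; rfl

end FiniteOrder

section Sum

end Sum

section CombConeSpaces

variable {X Y : CombConeSpace.{u}}

lemma CombConeSpace.exists_factorization {τ : RPC.{u}} {i : X.ι} (g : τ ⟶ X.cone i) :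
    ∃ (α : X.ι) (d : τ ⟶ X.cone α) (ψ : X.cone α ⟶ X.cone i),
      IsDominant d ∧ ψ ∈ X.mor α i ∧ d ≫ ψ = g := by
  obtain ⟨ρ, d, h, hd, hh, rfl⟩ := RPC.exists_factorization g
  obtain ⟨⟨α, ψ⟩, ⟨hψ, him⟩, _⟩ := X.existsUnique_face i _ hh.face
  obtain ⟨k, hk⟩ := hh.exists_iso (X.isFace ψ hψ) him.symm
  exact ⟨α, d ≫ k.hom, ψ, hd.comp (.of_isIso _), hψ, by rw [assoc, hk]⟩

lemma CombConeSpace.factorization_unique {τ : RPC.{u}} {i α α' : X.ι} {d : τ ⟶ X.cone α}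
    {d' : τ ⟶ X.cone α'} {ψ : X.cone α ⟶ X.cone i} {ψ' : X.cone α' ⟶ X.cone i}
    (hd : IsDominant d) (hd' : IsDominant d') (hψ : ψ ∈ X.mor α i) (hψ' : ψ' ∈ X.mor α' i)
    (h : d ≫ ψ = d' ≫ ψ') :
    (⟨α, d, ψ⟩ : Σ β, (τ ⟶ X.cone β) × (X.cone β ⟶ X.cone i)) = ⟨α', d', ψ'⟩ := by
  have key := (X.existsUnique_face i _ (X.isFace ψ hψ).face).unique
    (y₁ := ⟨α, ψ⟩) (y₂ := ⟨α', ψ'⟩) ⟨hψ, rfl⟩ ⟨hψ', by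
      change RPC.image ψ' = RPC.image ψ
      rw [(X.isFace ψ hψ).image_eq_hull hd, (X.isFace ψ' hψ').image_eq_hull hd', h]⟩
  obtain rfl : α = α' := congrArg Sigma.fst key
  obtain rfl : ψ = ψ' := by simpa using key
  rw [(X.isFace ψ hψ).cancel h]

end CombConeSpaces

instance (T : RPCC.{u}) (α β : T.obj.Index) : Subsingleton (α ⟶ β) :=
  ⟨fun f g => Subtype.ext (T.property α.idx β.idx f.2 g.2)⟩

/-- The index `t` is the cone of dimension maximal: all cones are faces of it. -/
def RPCC.IsTop (T : RPCC.{u}) (t : T.obj.ι) : Prop := ∀ β, (T.obj.mor β t).Nonempty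

lemma CombConeSpace.Hom.congr_map {X Y : CombConeSpace.{u}} {f g : X ⟶ Y} (h : f = g) (α : X.ι) :
    (⟨Hom.idx f α, Hom.map f α⟩ : Σ β, X.cone α ⟶ Y.cone β) = ⟨Hom.idx g α, Hom.map g α⟩ := by
  rw [h]

section TopHoms

variable {T T' : RPCC.{u}} {X : CombConeSpace.{u}} {t : T.obj.ι} {t' : T'.obj.ι}

lemma RPCC.IsTop.hom_ext (ht : T.IsTop t) {f g : T.obj ⟶ X} {i : X.ι}
    {ψ : X.cone (CombConeSpace.Hom.idx f t) ⟶ X.cone i}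
    {ψ' : X.cone (CombConeSpace.Hom.idx g t) ⟶ X.cone i}
    (hψ : ψ ∈ X.mor _ _) (hψ' : ψ' ∈ X.mor _ _)
    (h : CombConeSpace.Hom.map f t ≫ ψ = CombConeSpace.Hom.map g t ≫ ψ') : f = g := by
  refine CombConeSpace.Hom.ext_map fun α => ?_
  obtain ⟨φ, hφ⟩ := ht α
  obtain ⟨χ, hχ, e⟩ := CombConeSpace.Hom.compat f φ hφ
  obtain ⟨χ', hχ', e'⟩ := CombConeSpace.Hom.compat g φ hφ
  have := CombConeSpace.factorization_unique (CombConeSpace.Hom.dominant f α)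
    (CombConeSpace.Hom.dominant g α) (X.comp_mem _ _ hχ hψ) (X.comp_mem _ _ hχ' hψ') (by
      rw [← reassoc_of% e, ← reassoc_of% e', h])
  generalize CombConeSpace.Hom.map f α = a at *
  generalize CombConeSpace.Hom.map g α = b at *
  generalize CombConeSpace.Hom.idx f α = a' at *
  generalize CombConeSpace.Hom.idx g α = b' at *
  obtain rfl : a' = b' := congrArg Sigma.fst this
  simp only [Sigma.mk.injEq, heq_eq_eq, Prod.mk.injEq, true_and] at this
  rw [this.1]

lemma RPCC.IsTop.exists_hom (ht : T.IsTop t) {i : X.ι} (g : T.obj.cone t ⟶ X.cone i) :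
    ∃ (f : T.obj ⟶ X) (ψ : X.cone (CombConeSpace.Hom.idx f t) ⟶ X.cone i),
      ψ ∈ X.mor _ _ ∧ CombConeSpace.Hom.map f t ≫ ψ = g := by
  choose φ hφ using ht
  choose a d ψ hd hψ e using fun α => X.exists_factorization (φ α ≫ g)
  refine ⟨⟨a, d, hd, fun {α β} v hv => ?_⟩, ψ t, hψ t, ?_⟩
  · obtain ⟨γ, d', ψ', hd', hψ', e'⟩ := X.exists_factorization (v ≫ d β)
    have hv' : v ≫ φ β = φ α := T.property _ _ (T.obj.comp_mem _ _ hv (hφ β)) (hφ α)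
    have := CombConeSpace.factorization_unique (hd α) hd' (hψ α) (X.comp_mem _ _ hψ' (hψ β)) (by
      rw [e, ← assoc, e', assoc, e, reassoc_of% hv'])
    obtain rfl : a α = γ := congrArg Sigma.fst this
    simp only [Sigma.mk.injEq, heq_eq_eq, Prod.mk.injEq, true_and] at this
    exact ⟨ψ', hψ', by rw [← e', this.1]⟩
  · have : φ t = 𝟙 _ := T.property _ _ (hφ t) (T.obj.id_mem t)
    change d t ≫ ψ t = g
    rw [e, this, id_comp]

end TopHoms

/-- A cone complex consisting of the faces of one of its cones. -/
structure Topped : Type (u + 1) where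
  cx : RPCC.{u}
  top : cx.obj.ι
  isTop : cx.IsTop top

instance : Category.{u} Topped.{u} where
  Hom A B := A.cx ⟶ B.cx
  id A := 𝟙 A.cx
  comp f g := f ≫ g
  id_comp _ := id_comp _
  comp_id _ := comp_id _
  assoc _ _ _ := assoc _ _ _

/-- The underlying morphism of complexes. -/
def Topped.hom {A B : Topped.{u}} (f : A ⟶ B) : A.cx ⟶ B.cx := f

lemma RPCC.IsTop.choose_eq {T : RPCC.{u}} {t : T.obj.ι} (ht : T.IsTop t) {β : T.obj.ι}
    {φ : T.obj.cone β ⟶ T.obj.cone t} (hφ : φ ∈ T.obj.mor β t) : (ht β).choose = φ :=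
  T.property _ _ (ht β).choose_spec hφ

lemma Topped.map_choose {A B : Topped.{u}} (f : A.cx ⟶ B.cx) (β : A.cx.obj.ι) :
    (A.isTop β).choose ≫ f.hom.map A.top ≫ (B.isTop (f.hom.idx A.top)).choose =
      f.hom.map β ≫ (B.isTop (f.hom.idx β)).choose := by
  obtain ⟨ψ, hψ, e⟩ := f.hom.compat _ (A.isTop β).choose_spec
  rw [reassoc_of% e]
  congr 1
  exact (B.isTop.choose_eq (B.cx.obj.comp_mem _ _ hψ (B.isTop _).choose_spec)).symm

/-- The largest cone of a complex which has one. -/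
def Topped.ev : Topped.{u} ⥤ RPC.{u} where
  obj A := A.cx.obj.cone A.top
  map {A B} f := f.hom.map A.top ≫ (B.isTop (f.hom.idx A.top)).choose
  map_id A := by
    rw [A.isTop.choose_eq (A.cx.obj.id_mem _)]
    exact comp_id _
  map_comp {A B C} f g := by
    have := Topped.map_choose g (f.hom.idx A.top)
    rw [assoc, this]
    exact assoc _ _ _

lemma Topped.ev_map {A B : Topped.{u}} (f : A ⟶ B)
    {ψ : B.cx.obj.cone (f.hom.idx A.top) ⟶ B.cx.obj.cone B.top} (hψ : ψ ∈ B.cx.obj.mor _ _) :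
    Topped.ev.map f = f.hom.map A.top ≫ ψ := by
  rw [← B.isTop.choose_eq hψ]; rfl

instance : Topped.ev.{u}.Faithful where
  map_injective {A B _ _} h := ObjectProperty.hom_ext _
    (A.isTop.hom_ext (B.isTop _).choose_spec (B.isTop _).choose_spec h)

instance : Topped.ev.{u}.Full where
  map_surjective {A B} g := by
    obtain ⟨f, ψ, hψ, rfl⟩ := A.isTop.exists_hom (X := B.cx.obj) g
    exact ⟨ObjectProperty.homMk f, Topped.ev_map _ hψ⟩

/-- The compatible morphisms between the faces of a cone. -/
def faceMor (σ : RPC.{u}) (F G : {F : PointedCone ℝ (ℝ ⊗[ℤ] σ.N) // F.IsFaceOf σ.cone}) :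
    Set (σ.faceCone F.1 F.2 ⟶ σ.faceCone G.1 G.2) :=
  {φ | φ ≫ σ.faceHom G.1 G.2 = σ.faceHom F.1 F.2}

lemma existsUnique_faceMor (σ : RPC.{u}) (G : {F : PointedCone ℝ (ℝ ⊗[ℤ] σ.N) // F.IsFaceOf σ.cone})
    (F : PointedCone ℝ (ℝ ⊗[ℤ] (σ.faceCone G.1 G.2).N)) (hF : F.IsFaceOf (σ.faceCone G.1 G.2).cone) :
    ∃! p : Σ α : {F : PointedCone ℝ (ℝ ⊗[ℤ] σ.N) // F.IsFaceOf σ.cone},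
      σ.faceCone α.1 α.2 ⟶ σ.faceCone G.1 G.2,
      p.2 ∈ faceMor σ p.1 G ∧ RPC.image p.2 = F := by
  have hG := σ.isFaceMorphism_faceHom G.1 G.2
  have hF' : (F.map (RPC.real (σ.faceHom G.1 G.2))).IsFaceOf σ.cone :=
    (hF.map _ hG.real_injective).trans hG.face
  obtain ⟨φ, hφ⟩ := hG.exists_lift (σ.faceHom _ hF') (by
    rw [RPC.image_faceHom]
    exact Submodule.map_mono hF.le)
  have inj : Function.Injective (PointedCone.map (RPC.real (σ.faceHom G.1 G.2))) :=
    Submodule.map_injective_of_injective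
      (f := (RPC.real (σ.faceHom G.1 G.2)).restrictScalars {c : ℝ // 0 ≤ c})
      hG.real_injective
  refine ⟨⟨⟨_, hF'⟩, φ⟩, ⟨hφ, inj ?_⟩, ?_⟩
  · rw [← RPC.image_comp]
    exact (congrArg RPC.image hφ).trans (RPC.image_faceHom ..)
  · rintro ⟨⟨F₂, hF₂⟩, φ₂⟩ ⟨h1, h2⟩
    obtain rfl : F₂ = F.map (RPC.real (σ.faceHom G.1 G.2)) := by
      rw [← h2, ← RPC.image_comp]
      exact (RPC.image_faceHom ..).symm.trans (congrArg RPC.image h1).symm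
    exact congrArg (Sigma.mk _) (hG.cancel (Eq.trans h1 hφ.symm))

/-- The combinatorial cone space of faces of a cone. -/
def faceSpace (σ : RPC.{u}) : CombConeSpace.{u} where
  ι := {F : PointedCone ℝ (ℝ ⊗[ℤ] σ.N) // F.IsFaceOf σ.cone}
  cone F := σ.faceCone F.1 F.2
  mor := faceMor σ
  isFace {_ G} _ hφ := IsFaceMorphism.of_comp (g := σ.faceHom G.1 G.2)
    (Eq.subst (motive := IsFaceMorphism) (Eq.symm hφ) (σ.isFaceMorphism_faceHom _ _))
    (σ.isFaceMorphism_faceHom _ _)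
  comp_mem φ _ hφ hψ := (assoc _ _ _).trans ((congrArg (φ ≫ ·) hψ).trans hφ)
  id_mem _ := id_comp _
  existsUnique_face := existsUnique_faceMor σ

/-- The complex of faces of a cone. -/
def faceComplex (σ : RPC.{u}) : Topped.{u} where
  cx := ⟨faceSpace σ, fun _ G _ hφ _ hψ =>
    (σ.isFaceMorphism_faceHom G.1 G.2).cancel (Eq.trans hφ (Eq.symm hψ))⟩
  top := ⟨σ.cone, .refl _⟩
  isTop F := (σ.isFaceMorphism_faceHom σ.cone (.refl _)).exists_lift
    (σ.faceHom F.1 F.2) (by rw [RPC.image_faceHom, RPC.image_faceHom]; exact F.2.le)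

instance : Topped.ev.{u}.EssSurj where
  mem_essImage σ := by
    have h := σ.isFaceMorphism_faceHom σ.cone (.refl _)
    have : IsIso (σ.faceHom σ.cone (.refl _)) := h.isIso_of_isDominant (by
      intro F hF hle
      rw [RPC.image_faceHom] at hle
      exact le_antisymm hF.le hle)
    exact ⟨faceComplex σ, ⟨@asIso _ _ _ _ (σ.faceHom σ.cone (.refl _)) this⟩⟩

/-- The face of a complex, with its largest cone. -/
def RPCC.faceTop (T : RPCC.{u}) (α : T.obj.ι) : Topped.{u} where
  cx := T.face α
  top := ⟨α, ⟨𝟙 _, T.obj.id_mem α⟩⟩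
  isTop β := β.2

section Charts

variable {T T' : RPCC.{u}}

lemma RPCC.exists_face_map (f : T ⟶ T') (α : T.obj.ι) :
    ∃ k : T.face α ⟶ T'.face (f.hom.idx α), k ≫ T'.faceIncl _ = T.faceIncl α ≫ f := by
  refine ⟨ObjectProperty.homMk
    { idx := fun β => ⟨f.hom.idx β.1, ?_⟩
      map := fun β => f.hom.map β.1
      dominant := fun β => f.hom.dominant β.1
      compat := fun φ hφ => f.hom.compat φ hφ }, ?_⟩
  · obtain ⟨φ, hφ⟩ := β.2
    obtain ⟨ψ, hψ, -⟩ := f.hom.compat φ hφ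
    exact ⟨ψ, hψ⟩
  · refine ObjectProperty.hom_ext _ (CombConeSpace.Hom.ext_map fun β => ?_)
    exact congrArg (Sigma.mk _) ((comp_id (f.hom.map β.1)).trans (id_comp _).symm)

lemma RPCC.IsTop.exists_section {t : T.obj.ι} (ht : T.IsTop t) :
    ∃ s : T ⟶ T.face t, s ≫ T.faceIncl t = 𝟙 T :=
  ⟨ObjectProperty.homMk
    { idx := fun β => ⟨β, ht β⟩
      map := fun _ => 𝟙 _
      dominant := fun _ => .id _
      compat := fun φ hφ => ⟨φ, hφ, (comp_id φ).trans (id_comp φ).symm⟩ },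
    ObjectProperty.hom_ext _ (CombConeSpace.Hom.ext_map fun β =>
      congrArg (Sigma.mk _) (comp_id (𝟙 (T.obj.cone β))))⟩

lemma Topped.exists_face_factorization (c : Topped.{u}) (r : c.cx ⟶ T) :
    ∃ k : c.cx ⟶ T.face (r.hom.idx c.top), k ≫ T.faceIncl _ = r := by
  obtain ⟨s, hs⟩ := c.isTop.exists_section
  obtain ⟨k, hk⟩ := RPCC.exists_face_map r c.top
  exact ⟨s ≫ k, by rw [assoc, hk, reassoc_of% hs]⟩

lemma mem_faceTopology_iff {S : Sieve T} :
    S ∈ faceTopology T ↔ ∀ α, S (T.faceIncl α) := by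
  constructor
  · let J : GrothendieckTopology RPCC.{u} :=
      { sieves := fun T => {S | ∀ α, S (T.faceIncl α)}
        top_mem' := fun T α => trivial
        pullback_stable' := fun {X Y} S f hS β => by
          obtain ⟨k, hk⟩ := RPCC.exists_face_map f β
          change S (Y.faceIncl β ≫ f)
          rw [← hk]
          exact S.downward_closed (hS _) k
        transitive' := fun {X} S hS R hR α => by
          have h := hR (hS α) (X.faceTop α).top
          obtain ⟨s, hs⟩ := (X.faceTop α).isTop.exists_section
          have h2 := R.downward_closed h s
          have h3 : s ≫ (X.face α).faceIncl (X.faceTop α).top ≫ X.faceIncl α = X.faceIncl α :=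
            (assoc _ _ _).symm.trans ((congrArg (· ≫ X.faceIncl α) hs).trans (id_comp _))
          exact Eq.mp (congrArg (fun f => R.arrows f) h3) h2 }
    have : faceTopology ≤ J := sInf_le fun X α =>
      ⟨_, 𝟙 _, X.faceIncl α, Presieve.ofArrows.mk α, id_comp _⟩
    exact fun h => this _ h
  · intro h
    refine (GrothendieckTopology.mem_sInf _ _).2 fun J hJ => J.superset_covering ?_ (hJ T)
    rw [Sieve.generate_le_iff]
    rintro _ _ ⟨α⟩
    exact h α

lemma Topped.mem_of_covering {S : Sieve T} (hS : S ∈ faceTopology T) (c : Topped.{u})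
    (r : c.cx ⟶ T) : S r := by
  obtain ⟨k, hk⟩ := c.exists_face_factorization r
  exact hk ▸ S.downward_closed (mem_faceTopology_iff.1 hS _) k

/-- The sieve generated by the faces of a complex. -/
def faceSieve (T : RPCC.{u}) : Sieve T where
  arrows U f := ∃ (c : Topped.{u}) (k : U ⟶ c.cx) (r : c.cx ⟶ T), k ≫ r = f
  downward_closed := by
    rintro _ _ _ ⟨c, k, r, rfl⟩ g
    exact ⟨c, g ≫ k, r, assoc _ _ _⟩

lemma faceSieve_mem (T : RPCC.{u}) : faceSieve T ∈ faceTopology T :=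
  mem_faceTopology_iff.2 fun α => ⟨T.faceTop α, 𝟙 _, T.faceIncl α, id_comp _⟩

/-- The restriction of a morphism to the largest cone. -/
def Topped.atTop (c : Topped.{u}) (r : c.cx ⟶ T) :
    Topped.ev.obj c ⟶ T.obj.cone (r.hom.idx c.top) := r.hom.map c.top

lemma Topped.ev_comp_atTop {c c' : Topped.{u}} (k : c ⟶ c') (r : c'.cx ⟶ T) {i : T.obj.ι}
    {ψ : T.obj.cone (r.hom.idx c'.top) ⟶ T.obj.cone i} (hψ : ψ ∈ T.obj.mor _ _)
    {ψ' : T.obj.cone ((Topped.hom k ≫ r).hom.idx c.top) ⟶ T.obj.cone i}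
    (hψ' : ψ' ∈ T.obj.mor _ _) :
    Topped.ev.map k ≫ c'.atTop r ≫ ψ = c.atTop (Topped.hom k ≫ r) ≫ ψ' := by
  obtain ⟨χ, hχ⟩ := c'.isTop ((Topped.hom k).hom.idx c.top)
  obtain ⟨χ', hχ', e⟩ := r.hom.compat _ hχ
  rw [Topped.ev_map k hχ]
  have h : χ' ≫ ψ = ψ' := T.property _ _ (T.obj.comp_mem _ _ hχ' hψ) hψ'
  calc _ = (Topped.hom k).hom.map c.top ≫ (χ ≫ r.hom.map c'.top) ≫ ψ := by
        exact (assoc _ _ _).trans (congrArg _ (assoc _ _ _).symm)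
    _ = (Topped.hom k).hom.map c.top ≫ (r.hom.map _ ≫ χ') ≫ ψ := by rw [e]
    _ = (Topped.hom k).hom.map c.top ≫ r.hom.map _ ≫ χ' ≫ ψ := by rw [assoc]
    _ = (Topped.hom k).hom.map c.top ≫ r.hom.map _ ≫ ψ' := by rw [h]
    _ = _ := (assoc _ _ _).symm

lemma Topped.exists_hom_over {c c' : Topped.{u}} (r : c.cx ⟶ T) (r' : c'.cx ⟶ T)
    [IsIso (c'.atTop r')] (h : (T.obj.mor (r.hom.idx c.top) (r'.hom.idx c'.top)).Nonempty) :
    ∃ k : c ⟶ c', Topped.hom k ≫ r' = r := by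
  obtain ⟨ψ, hψ⟩ := h
  obtain ⟨k, hk⟩ := Topped.ev.map_surjective (X := c) (Y := c') (c.atTop r ≫ ψ ≫ inv (c'.atTop r'))
  refine ⟨k, ObjectProperty.hom_ext _ ?_⟩
  obtain ⟨χ, hχ, -⟩ := r'.hom.compat _ (c'.isTop ((Topped.hom k).hom.idx c.top)).choose_spec
  refine c.isTop.hom_ext (i := r'.hom.idx c'.top) hχ hψ ?_
  have := Topped.ev_comp_atTop k r' (T.obj.id_mem _) hχ
  refine this.symm.trans ?_
  rw [hk, comp_id, assoc, assoc, IsIso.inv_hom_id, comp_id]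
  rfl

lemma Topped.hom_over_ext {c c' : Topped.{u}} (r' : c'.cx ⟶ T)
    [IsIso (c'.atTop r')] {k k' : c ⟶ c'}
    (h : Topped.hom k ≫ r' = Topped.hom k' ≫ r') : k = k' := by
  apply Topped.ev.map_injective
  rw [← cancel_mono (c'.atTop r')]
  obtain ⟨χ, hχ, -⟩ := r'.hom.compat _ (c'.isTop ((Topped.hom k).hom.idx c.top)).choose_spec
  obtain ⟨χ', hχ', -⟩ := r'.hom.compat _ (c'.isTop ((Topped.hom k').hom.idx c.top)).choose_spec
  have h1 := Topped.ev_comp_atTop k r' (T.obj.id_mem _) hχ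
  have h2 := Topped.ev_comp_atTop k' r' (T.obj.id_mem _) hχ'
  rw [comp_id] at h1 h2
  rw [h1, h2]
  clear h1 h2
  revert χ χ'
  change ∀ χ : T.obj.cone ((Topped.hom k ≫ r').hom.idx c.top) ⟶ _, χ ∈ T.obj.mor _ _ →
    ∀ χ' : T.obj.cone ((Topped.hom k' ≫ r').hom.idx c.top) ⟶ _, χ' ∈ T.obj.mor _ _ → _
  rw [h]
  intro χ hχ χ' hχ'
  rw [T.property _ _ hχ hχ']

end Charts

section Based

/-- Categories over the category of cone complexes. -/
abbrev Based : Type (u + 2) := BasedCategory.{u, u + 1} RPCC.{u}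

notation "⟪" K "⟫" => (K : BasedFunctor _ _)

variable {C : Type (u + 1)} [Category.{u} C] {𝒜 𝒳 𝒴 𝒵 : BasedCategory.{u, u + 1} C}

/-- The image of an object under a functor over `C` lies over the same object of `C`. -/
def baseIso (K : 𝒳 ⟶ 𝒴) (x : 𝒳.obj) :
    𝒴.p.obj (⟪K⟫.obj x) ≅ 𝒳.p.obj x :=
  eqToIso (BasedFunctor.w_obj K x)

lemma baseIso_comp_hom (K : 𝒳 ⟶ 𝒴) (L : 𝒴 ⟶ 𝒵) (x : 𝒳.obj) : (baseIso (K ≫ L) x).hom =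
    (baseIso L (⟪K⟫.obj x)).hom ≫ (baseIso K x).hom :=
  (eqToHom_trans (BasedFunctor.w_obj L _) (BasedFunctor.w_obj K x)).symm

lemma baseIso_comp_inv (K : 𝒳 ⟶ 𝒴) (L : 𝒴 ⟶ 𝒵) (x : 𝒳.obj) : (baseIso (K ≫ L) x).inv =
    (baseIso K x).inv ≫ (baseIso L (⟪K⟫.obj x)).inv :=
  (eqToHom_trans (BasedFunctor.w_obj K x).symm (BasedFunctor.w_obj L _).symm).symm

lemma p_map_map (K : 𝒳 ⟶ 𝒴) {x y : 𝒳.obj} (f : x ⟶ y) :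
    𝒴.p.map (⟪K⟫.map f) = (baseIso K x).hom ≫ 𝒳.p.map f ≫ (baseIso K y).inv := by
  have := IsHomLift.fac' 𝒴.p (𝒳.p.map f) (⟪K⟫.map f)
  simpa [baseIso] using this

lemma isHomLift_id_iff {a b : 𝒴.obj} {R : C} (ha : 𝒴.p.obj a = R) (hb : 𝒴.p.obj b = R)
    (φ : a ⟶ b) : 𝒴.p.IsHomLift (𝟙 R) φ ↔ 𝒴.p.map φ = eqToHom (ha.trans hb.symm) := by
  constructor
  · intro h
    simpa using IsHomLift.fac' 𝒴.p (𝟙 R) φ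
  · intro h
    exact IsHomLift.of_fac _ _ _ ha hb (by simp [h])

lemma p_map_app {K K' : 𝒳 ⟶ 𝒴} (η : K ⟶ K') (x : 𝒳.obj) :
    𝒴.p.map ((η : BasedNatTrans K K').app x) = (baseIso K x).hom ≫ (baseIso K' x).inv := by
  have := (isHomLift_id_iff (BasedFunctor.w_obj K x) (BasedFunctor.w_obj K' x) _).1
    ((η : BasedNatTrans K K').app_isHomLift x)
  simpa [baseIso] using this

/-- Construction of morphisms of functors over `C`. -/
def mkTrans {K K' : 𝒳 ⟶ 𝒴}
    (app : ∀ x, ⟪K⟫.obj x ⟶ ⟪K'⟫.obj x)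
    (naturality : ∀ {x y} (f : x ⟶ y), ⟪K⟫.map f ≫ app y = app x ≫ ⟪K'⟫.map f)
    (base : ∀ x, 𝒴.p.map (app x) = (baseIso K x).hom ≫ (baseIso K' x).inv) : K ⟶ K' :=
  ({ app := app
     naturality := fun _ _ f => naturality f
     isHomLift' := fun x => (isHomLift_id_iff (BasedFunctor.w_obj K x)
      (BasedFunctor.w_obj K' x) _).2 (by rw [base]; simp [baseIso]) } : BasedNatTrans K K')

/-- The components of a morphism of functors over `C`. -/
def appAt {K K' : 𝒳 ⟶ 𝒴} (η : K ⟶ K') (x : 𝒳.obj) :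
    ⟪K⟫.obj x ⟶ ⟪K'⟫.obj x :=
  (η : BasedNatTrans K K').app x

@[simp] lemma appAt_mkTrans {K K' : 𝒳 ⟶ 𝒴} (app naturality base) (x : 𝒳.obj) :
    appAt (mkTrans (K := K) (K' := K') app naturality base) x = app x := rfl

@[simp] lemma appAt_id (K : 𝒳 ⟶ 𝒴) (x : 𝒳.obj) : appAt (𝟙 K) x = 𝟙 _ := rfl

@[simp] lemma appAt_comp {K K' K'' : 𝒳 ⟶ 𝒴} (η : K ⟶ K') (θ : K' ⟶ K'') (x : 𝒳.obj) :
    appAt (η ≫ θ) x = appAt η x ≫ appAt θ x := rfl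

lemma appAt_naturality {K K' : 𝒳 ⟶ 𝒴} (η : K ⟶ K') {x y : 𝒳.obj} (f : x ⟶ y) :
    ⟪K⟫.map f ≫ appAt η y = appAt η x ≫ ⟪K'⟫.map f :=
  (η : BasedNatTrans K K').naturality f

lemma trans_ext {K K' : 𝒳 ⟶ 𝒴} {η θ : K ⟶ K'} (h : ∀ x, appAt η x = appAt θ x) : η = θ :=
  BasedNatTrans.ext _ _ (NatTrans.ext (funext h))

lemma p_map_appAt {K K' : 𝒳 ⟶ 𝒴} (η : K ⟶ K') (x : 𝒳.obj) :
    𝒴.p.map (appAt η x) = (baseIso K x).hom ≫ (baseIso K' x).inv := p_map_app η x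

instance isIso_appAt {K K' : 𝒳 ⟶ 𝒴} (η : K ⟶ K') [IsIso η] (x : 𝒳.obj) : IsIso (appAt η x) :=
  ⟨appAt (inv η) x, by rw [← appAt_comp, IsIso.hom_inv_id, appAt_id],
    by rw [← appAt_comp, IsIso.inv_hom_id, appAt_id]⟩

lemma isIso_of_appAt {K K' : 𝒳 ⟶ 𝒴} (η : K ⟶ K') [∀ x, IsIso (appAt η x)] : IsIso η := by
  refine ⟨mkTrans (fun x => inv (appAt η x)) (fun {x y} f => ?_) (fun x => ?_),
    trans_ext fun x => by simp, trans_ext fun x => by simp⟩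
  · rw [IsIso.comp_inv_eq, assoc, IsIso.eq_inv_comp]
    exact (appAt_naturality η f).symm
  · rw [Functor.map_inv, IsIso.inv_eq_of_hom_inv_id]
    rw [p_map_appAt]
    simp

namespace IsFiberedInGroupoids

lemma exists_pullback (h : IsFiberedInGroupoids 𝒳) (a : 𝒳.obj) {R : C} (f : R ⟶ 𝒳.p.obj a) :
    ∃ (b : 𝒳.obj) (φ : b ⟶ a) (e : 𝒳.p.obj b = R), 𝒳.p.map φ = eqToHom e ≫ f := by
  obtain ⟨b, φ, hφ⟩ := h.exists_lift a f
  exact ⟨b, φ, IsHomLift.domain_eq 𝒳.p f φ, by simpa using IsHomLift.fac' 𝒳.p f φ⟩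

lemma exists_hom (h : IsFiberedInGroupoids 𝒳) {a b a' : 𝒳.obj} (φ : a ⟶ b) (φ' : a' ⟶ b)
    (k : 𝒳.p.obj a' ⟶ 𝒳.p.obj a) (hk : k ≫ 𝒳.p.map φ = 𝒳.p.map φ') :
    ∃ χ : a' ⟶ a, 𝒳.p.map χ = k ∧ χ ≫ φ = φ' := by
  have := h.cartesian φ
  refine ⟨Functor.IsStronglyCartesian.map 𝒳.p _ φ hk.symm φ', ?_,
    Functor.IsStronglyCartesian.fac ..⟩
  exact (IsHomLift.eq_of_isHomLift 𝒳.p _ _).symm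

lemma hom_cancel (h : IsFiberedInGroupoids 𝒳) {a b a' : 𝒳.obj} (φ : a ⟶ b) {χ χ' : a' ⟶ a}
    (hp : 𝒳.p.map χ = 𝒳.p.map χ') (hφ : χ ≫ φ = χ' ≫ φ) : χ = χ' := by
  have := h.cartesian φ
  have h1 : 𝒳.p.IsHomLift (𝒳.p.map χ) χ' := hp ▸ IsHomLift.map 𝒳.p χ'
  exact Functor.IsStronglyCartesian.ext 𝒳.p (𝒳.p.map φ) φ (𝒳.p.map χ) hφ

lemma isIso (h : IsFiberedInGroupoids 𝒳) {a b : 𝒳.obj} (φ : a ⟶ b) [IsIso (𝒳.p.map φ)] :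
    IsIso φ := by
  have := h.cartesian φ
  exact Functor.IsStronglyCartesian.isIso_of_base_isIso 𝒳.p (𝒳.p.map φ) φ

lemma exists_functor_lift (h : IsFiberedInGroupoids 𝒳) (Φ : 𝒳 ⟶ 𝒴)
    [⟪Φ⟫.Full] [⟪Φ⟫.Faithful] (H : 𝒜 ⟶ 𝒴)
    (hH : ∀ a, ∃ x, Nonempty (⟪Φ⟫.obj x ≅ ⟪H⟫.obj a)) :
    ∃ H' : 𝒜 ⟶ 𝒳, Nonempty (H' ≫ Φ ≅ H) := by
  have key : ∀ a, ∃ (x : 𝒳.obj) (e : 𝒳.p.obj x = 𝒜.p.obj a) (i : ⟪Φ⟫.obj x ≅ ⟪H⟫.obj a),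
      𝒴.p.map i.hom = (baseIso Φ x).hom ≫ eqToHom e ≫ (baseIso H a).inv := by
    intro a
    obtain ⟨x, ⟨i⟩⟩ := hH a
    obtain ⟨x', φ, e, hφ⟩ := h.exists_pullback x
      ((baseIso H a).inv ≫ 𝒴.p.map i.inv ≫ (baseIso Φ x).hom)
    have : IsIso (𝒳.p.map φ) := by rw [hφ]; infer_instance
    have : IsIso φ := h.isIso φ
    refine ⟨x', e, ⟪Φ⟫.mapIso (asIso φ) ≪≫ i, ?_⟩
    simp only [Iso.trans_hom, Functor.mapIso_hom, asIso_hom, map_comp]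
    rw [p_map_map, hφ]
    simp [← map_comp]
  choose x e i hi using key
  have hmap : ∀ (a b : 𝒜.obj) (f : a ⟶ b), ∃ g : x a ⟶ x b, ⟪Φ⟫.map g =
      (i a).hom ≫ ⟪H⟫.map f ≫ (i b).inv := fun _ _ _ =>
    ⟪Φ⟫.map_surjective _
  choose m hm using hmap
  have hinv : ∀ a, 𝒴.p.map (i a).inv =
      (baseIso H a).hom ≫ eqToHom (e a).symm ≫ (baseIso Φ (x a)).inv := by
    intro a
    rw [← cancel_epi (𝒴.p.map (i a).hom), ← map_comp, Iso.hom_inv_id, hi]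
    simp
  let H' : 𝒜 ⟶ 𝒳 :=
    ({ obj := x
       map := m _ _
       map_id := fun a => ⟪Φ⟫.map_injective (by rw [hm]; simp)
       map_comp := fun f g => ⟪Φ⟫.map_injective (by simp [hm])
       w := CategoryTheory.Functor.ext e fun a b f => by
        have h1 := p_map_map Φ (m _ _ f)
        rw [hm, map_comp, map_comp, hi, p_map_map, hinv] at h1
        simp only [assoc, Iso.inv_hom_id_assoc, Iso.cancel_iso_hom_left] at h1
        simp only [← assoc, Iso.cancel_iso_inv_right] at h1
        exact h1.symm.trans (by simp) } : BasedFunctor 𝒜 𝒳)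
  refine ⟨H', ⟨?_⟩⟩
  let α : H' ≫ Φ ⟶ H := mkTrans (fun a => (i a).hom) (fun {a b} f => by
      change ⟪Φ⟫.map (m _ _ f) ≫ _ = _
      rw [hm, assoc, assoc, Iso.inv_hom_id]
      exact congrArg _ (comp_id _)) (fun a => (hi a).trans
      ((assoc _ _ _).symm.trans (congrArg (· ≫ (baseIso H a).inv) (baseIso_comp_hom H' Φ a).symm)))
  have : ∀ a, IsIso (appAt α a) := fun a => inferInstanceAs (IsIso (i a).hom)
  have := isIso_of_appAt α
  exact asIso α

lemma exists_equivalence (h : IsFiberedInGroupoids 𝒳) (Φ : 𝒳 ⟶ 𝒴)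
    [⟪Φ⟫.Full] [⟪Φ⟫.Faithful]
    (hΦ : ∀ y, ∃ x, Nonempty (⟪Φ⟫.obj x ≅ y)) :
    ∃ e : Bicategory.Equivalence 𝒳 𝒴, e.hom = Φ := by
  obtain ⟨Ψ, ⟨ε⟩⟩ := h.exists_functor_lift Φ (𝟙 𝒴) hΦ
  have key : ∀ x : 𝒳.obj, ∃ g : x ⟶ ⟪Ψ⟫.obj (⟪Φ⟫.obj x),
      ⟪Φ⟫.map g = appAt ε.inv (⟪Φ⟫.obj x) := fun x =>
    ⟪Φ⟫.map_surjective _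
  choose g hg using key
  let α : 𝟙 𝒳 ⟶ Φ ≫ Ψ := mkTrans g (fun {x y} f => ⟪Φ⟫.map_injective (by
      have := appAt_naturality ε.inv (⟪Φ⟫.map f)
      refine (⟪Φ⟫.map_comp f (g y)).trans ?_
      refine Eq.trans ?_ (⟪Φ⟫.map_comp (g x) _).symm
      rw [hg, hg]
      exact this)) (fun x => by
      have h1 := p_map_map Φ (g x)
      rw [hg] at h1
      replace h1 := (p_map_appAt ε.inv _).symm.trans h1
      replace h1 : (baseIso Ψ (⟪Φ⟫.obj x)).inv ≫ (baseIso Φ _).inv =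
          (baseIso Φ x).hom ≫ 𝒳.p.map (g x) ≫ (baseIso Φ _).inv :=
        ((baseIso_comp_inv Ψ Φ _).symm.trans (id_comp _).symm).trans h1
      rw [← assoc, cancel_mono, ← Iso.inv_comp_eq] at h1
      exact h1.symm.trans ((baseIso_comp_inv Φ Ψ x).symm.trans (id_comp _).symm))
  have : ∀ x, IsIso (appAt α x) := fun x => by
    have : IsIso (⟪Φ⟫.map (appAt α x)) := by
      change IsIso (⟪Φ⟫.map (g x))
      rw [hg]
      exact isIso_appAt ε.inv _
    exact isIso_of_reflects_iso _ ⟪Φ⟫.toFunctor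
  have := isIso_of_appAt α
  exact ⟨Bicategory.Equivalence.mkOfAdjointifyCounit (asIso α) ε, rfl⟩

lemma exists_functor (h : IsFiberedInGroupoids 𝒳) (x : 𝒳.obj)
    (w : ∀ a : 𝒜.obj, 𝒜.p.obj a ⟶ 𝒳.p.obj x)
    (hw : ∀ {a b : 𝒜.obj} (f : a ⟶ b), 𝒜.p.map f ≫ w b = w a) :
    ∃ (Y : 𝒜 ⟶ 𝒳) (φ : ∀ a, ⟪Y⟫.obj a ⟶ x), (∀ a, 𝒳.p.map (φ a) = (baseIso Y a).hom ≫ w a) ∧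
      ∀ {a b : 𝒜.obj} (f : a ⟶ b), ⟪Y⟫.map f ≫ φ b = φ a := by
  choose b φ e hφ using fun a : 𝒜.obj => h.exists_pullback x (w a)
  have key : ∀ (u v : 𝒜.obj) (k : u ⟶ v), ∃ χ : b u ⟶ b v,
      𝒳.p.map χ = eqToHom (e u) ≫ 𝒜.p.map k ≫ eqToHom (e v).symm ∧ χ ≫ φ v = φ u := fun u v k =>
    h.exists_hom (φ v) (φ u) _ (by rw [hφ, hφ]; simp [hw])
  choose m hm hmφ using key
  exact ⟨({ obj := b
            map := m _ _
            map_id := fun u => h.hom_cancel (φ u) (by rw [hm]; simp) (by rw [hmφ]; simp)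
            map_comp := fun f g => h.hom_cancel (φ _) (by rw [hm]; simp [hm]) (by
              rw [hmφ, assoc, hmφ, hmφ])
            w := CategoryTheory.Functor.ext e fun u v k => hm _ _ k } :
          BasedFunctor 𝒜 𝒳), φ, hφ, hmφ _ _⟩

end IsFiberedInGroupoids

end Based

section Stacks

variable {C : Type (u + 1)} [Category.{u} C] {𝒜 𝒳 𝒴 𝒵 : BasedCategory.{u, u + 1} C}
  {J : GrothendieckTopology C}

lemma IsFiberedInGroupoids.exists_trans (h : IsFiberedInGroupoids 𝒳) {K K' : 𝒜 ⟶ 𝒳} {y : 𝒳.obj}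
    (w : ∀ a : 𝒜.obj, 𝒜.p.obj a ⟶ 𝒳.p.obj y)
    (φ : ∀ a, ⟪K'⟫.obj a ⟶ y)
    (hφ : ∀ a, 𝒳.p.map (φ a) = (baseIso K' a).hom ≫ w a)
    (hφn : ∀ {a b : 𝒜.obj} (k : a ⟶ b), ⟪K'⟫.map k ≫ φ b = φ a)
    (f : ∀ a, ⟪K⟫.obj a ⟶ y)
    (hf : ∀ a, 𝒳.p.map (f a) = (baseIso K a).hom ≫ w a)
    (hfn : ∀ {a b : 𝒜.obj} (k : a ⟶ b), ⟪K⟫.map k ≫ f b = f a) :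
    ∃ η : K ⟶ K', ∀ a, appAt η a ≫ φ a = f a := by
  choose η hη hηφ using fun a => h.exists_hom (φ a) (f a)
    ((baseIso K a).hom ≫ (baseIso K' a).inv) (by rw [hφ, hf]; simp)
  refine ⟨mkTrans η (fun {a b} k => h.hom_cancel (φ b) ?_ ?_) hη, hηφ⟩
  · rw [map_comp, map_comp, hη, hη, p_map_map, p_map_map]
    simp
  · rw [assoc, assoc, hηφ, hφn, hηφ, hfn]

/-- The structure morphism of an object of `C/T`. -/
def overHom {T : C} (u : (overBased T).obj) : (overBased T).p.obj u ⟶ T := Over.hom u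

lemma overHom_w {T : C} {u v : (overBased T).obj} (k : u ⟶ v) :
    (overBased T).p.map k ≫ overHom v = overHom u := Over.w k

/-- The terminal object of `C/T`. -/
def overId (T : C) : (overBased T).obj := Over.mk (𝟙 T)

instance (T : C) : IsIso (overHom (overId T)) := inferInstanceAs (IsIso (𝟙 T))

/-- The morphism to the terminal object of `C/T`. -/
def overTo {T : C} (u : (overBased T).obj) : u ⟶ overId T := Over.homMk (Over.hom u) (comp_id _)

/-- An object of a sieve, as an object of `C/T`. -/
def sieveObj {T : C} {S : Sieve T} (u : (sieveBased S).obj) : (overBased T).obj :=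
  (sieveIncl S : BasedFunctor _ _).obj u

lemma sieveObj_mem {T : C} {S : Sieve T} (u : (sieveBased S).obj) : S (overHom (sieveObj u)) :=
  u.property

lemma IsStack.mk' (h : IsFiberedInGroupoids 𝒳)
    (ext : ∀ (T : C) (S : Sieve T), S ∈ J T → ∀ {K K' : overBased T ⟶ 𝒳} {η θ : K ⟶ K'},
      (∀ u : (sieveBased S).obj, appAt η (sieveObj u) = appAt θ (sieveObj u)) → η = θ)
    (full : ∀ (T : C) (S : Sieve T), S ∈ J T → ∀ {K K' : overBased T ⟶ 𝒳}
      (η : sieveIncl S ≫ K ⟶ sieveIncl S ≫ K'), ∃ θ : K ⟶ K',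
        ∀ u : (sieveBased S).obj, appAt θ (sieveObj u) = appAt η u)
    (ess : ∀ (T : C) (S : Sieve T), S ∈ J T → ∀ (D : sieveBased S ⟶ 𝒳),
      ∃ K : overBased T ⟶ 𝒳, Nonempty (sieveIncl S ≫ K ≅ D)) : IsStack J 𝒳 where
  fibered := h
  descent T S hS :=
    { faithful := ⟨fun {K K'} η θ e => ext T S hS fun u => congrArg (appAt · u) e⟩
      full := ⟨fun {K K'} η => by
        obtain ⟨θ, hθ⟩ := full T S hS η
        exact ⟨θ, trans_ext fun u => hθ u⟩⟩
      essSurj := ⟨fun D => ess T S hS D⟩ }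

namespace IsStack

lemma trans_ext (h : IsStack J 𝒳) {T : C} {S : Sieve T} (hS : S ∈ J T) {K K' : overBased T ⟶ 𝒳}
    {η θ : K ⟶ K'} (H : ∀ u : (sieveBased S).obj, appAt η (sieveObj u) = appAt θ (sieveObj u)) : η = θ := by
  have := h.descent T S hS
  exact (Bicategory.precomp 𝒳 (sieveIncl S)).map_injective (ConeStacks.trans_ext fun u => H u)

lemma exists_trans (h : IsStack J 𝒳) {T : C} {S : Sieve T} (hS : S ∈ J T)
    {K K' : overBased T ⟶ 𝒳} (η : sieveIncl S ≫ K ⟶ sieveIncl S ≫ K') : ∃ θ : K ⟶ K',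
      ∀ u : (sieveBased S).obj, appAt θ (sieveObj u) = appAt η u := by
  have := h.descent T S hS
  obtain ⟨θ, hθ⟩ := (Bicategory.precomp 𝒳 (sieveIncl S)).map_surjective η
  exact ⟨θ, fun u => congrArg (appAt · u) hθ⟩

lemma exists_functor (h : IsStack J 𝒳) {T : C} {S : Sieve T} (hS : S ∈ J T)
    (D : sieveBased S ⟶ 𝒳) : ∃ K : overBased T ⟶ 𝒳, Nonempty (sieveIncl S ≫ K ≅ D) := by
  have := h.descent T S hS
  exact ⟨(Bicategory.precomp 𝒳 (sieveIncl S)).objPreimage D,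
    ⟨(Bicategory.precomp 𝒳 (sieveIncl S)).objObjPreimageIso D⟩⟩

lemma hom_ext (h : IsStack J 𝒳) {x y : 𝒳.obj} {f g : x ⟶ y} (hp : 𝒳.p.map f = 𝒳.p.map g)
    {S : Sieve (𝒳.p.obj x)} (hS : S ∈ J _)
    (H : ∀ (z : 𝒳.obj) (m : z ⟶ x), S (𝒳.p.map m) → m ≫ f = m ≫ g) : f = g := by
  obtain ⟨Y, φ, hφ, hφn⟩ := h.fibered.exists_functor (𝒜 := overBased (𝒳.p.obj x)) x
    overHom overHom_w
  obtain ⟨Y', φ', hφ', hφn'⟩ := h.fibered.exists_functor (𝒜 := overBased (𝒳.p.obj x)) y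
    (fun u => overHom u ≫ 𝒳.p.map f) (fun k => by rw [← assoc, overHom_w])
  obtain ⟨η, hη⟩ := h.fibered.exists_trans (K := Y) _ φ' hφ' hφn' (fun u => φ u ≫ f)
    (fun u => by rw [map_comp, hφ, assoc])
    (fun k => by rw [← assoc, hφn])
  obtain ⟨θ, hθ⟩ := h.fibered.exists_trans (K := Y) _ φ' hφ' hφn' (fun u => φ u ≫ g)
    (fun u => by rw [map_comp, hφ, assoc, hp])
    (fun k => by rw [← assoc, hφn])
  have key : η = θ := h.trans_ext hS fun u => by
    refine h.fibered.hom_cancel (φ' (sieveObj u)) (by rw [p_map_appAt, p_map_appAt]) ?_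
    rw [hη, hθ]
    refine H _ _ ?_
    rw [hφ]
    exact S.downward_closed (sieveObj_mem u) _
  have : IsIso (𝒳.p.map (φ (overId _))) := by
    rw [hφ]
    infer_instance
  have : IsIso (φ (overId _)) := h.fibered.isIso _
  rw [← cancel_epi (φ (overId _)), ← hη, ← hθ, key]

lemma exists_glue (h : IsStack J 𝒳) {x y : 𝒳.obj} (k : 𝒳.p.obj x ⟶ 𝒳.p.obj y)
    {S : Sieve (𝒳.p.obj x)} (hS : S ∈ J _)
    (F : ∀ (z : 𝒳.obj) (m : z ⟶ x), S (𝒳.p.map m) → (z ⟶ y))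
    (hF : ∀ z m hm, 𝒳.p.map (F z m hm) = 𝒳.p.map m ≫ k)
    (hFn : ∀ z z' (n : z' ⟶ z) (m : z ⟶ x) (hm : S (𝒳.p.map m)) (hm' : S (𝒳.p.map (n ≫ m))),
      F z' (n ≫ m) hm' = n ≫ F z m hm) :
    ∃ f : x ⟶ y, 𝒳.p.map f = k ∧ ∀ z m hm, m ≫ f = F z m hm := by
  obtain ⟨Y, φ, hφ, hφn⟩ := h.fibered.exists_functor (𝒜 := overBased (𝒳.p.obj x)) x
    overHom overHom_w
  obtain ⟨Y', φ', hφ', hφn'⟩ := h.fibered.exists_functor (𝒜 := overBased (𝒳.p.obj x)) y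
    (fun u => overHom u ≫ k) (fun k => by rw [← assoc, overHom_w])
  have hS' : ∀ u : (sieveBased S).obj, S (𝒳.p.map (φ (sieveObj u))) := fun u => by
    rw [hφ]
    exact S.downward_closed (sieveObj_mem u) _
  obtain ⟨η, hη⟩ := h.fibered.exists_trans (K := sieveIncl S ≫ Y) (K' := sieveIncl S ≫ Y')
    (fun u => overHom (sieveObj u) ≫ k) (fun u => φ' (sieveObj u)) (fun u => hφ' (sieveObj u))
    (fun k => hφn' ((sieveIncl S : BasedFunctor _ _).map k))
    (fun u => F _ (φ (sieveObj u)) (hS' u))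
    (fun u => (hF _ _ _).trans ((congrArg (· ≫ k) (hφ (sieveObj u))).trans (assoc _ _ _)))
    (fun {u v} k => by
      have e := hφn ((sieveIncl S : BasedFunctor _ _).map k)
      refine (hFn _ _ (⟪Y⟫.map ((sieveIncl S : BasedFunctor _ _).map k))
        (φ (sieveObj v)) (hS' v) (e ▸ hS' u)).symm.trans ?_
      congr 1)
  obtain ⟨θ, hθ⟩ := h.exists_trans hS η
  have : IsIso (𝒳.p.map (φ (overId _))) := by
    rw [hφ]
    infer_instance
  have : IsIso (φ (overId _)) := h.fibered.isIso _
  have hf : 𝒳.p.map (inv (φ (overId _)) ≫ appAt θ (overId _) ≫ φ' (overId _)) = k := by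
    rw [map_comp, Functor.map_inv, IsIso.inv_comp_eq, map_comp, p_map_appAt, hφ, hφ']
    simp
  refine ⟨inv (φ (overId _)) ≫ appAt θ (overId _) ≫ φ' (overId _), hf, fun z m hm => ?_⟩
  let v : (sieveBased S).obj := ⟨Over.mk (𝒳.p.map m), hm⟩
  obtain ⟨n, hn, hnm⟩ := h.fibered.exists_hom (φ (sieveObj v)) m (baseIso Y (sieveObj v)).inv (by
    rw [hφ]
    exact Iso.inv_hom_id_assoc _ _)
  have h1 : m ≫ inv (φ (overId _)) = n ≫ ⟪Y⟫.map (overTo (sieveObj v)) := by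
    rw [IsIso.comp_inv_eq, assoc, hφn, hnm]
  rw [← assoc, h1, assoc]
  have h2 : ⟪Y⟫.map (overTo (sieveObj v)) ≫ appAt θ (overId _) ≫
      φ' (overId _) = F _ (φ (sieveObj v)) (hS' v) := by
    rw [← assoc, appAt_naturality, assoc, hφn', hθ]
    exact hη v
  rw [h2, ← hFn _ _ _ _ _ (by rwa [hnm])]
  congr 1

end IsStack

end Stacks

section FiberProducts

variable {C : Type (u + 1)} [Category.{u} C] {𝒜 𝒳 𝒴 𝒵 : BasedCategory.{u, u + 1} C}
  {J : GrothendieckTopology C}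

lemma IsFiberedInGroupoids.mk'
    (h1 : ∀ (a : 𝒳.obj) {R : C} (f : R ⟶ 𝒳.p.obj a), ∃ (b : 𝒳.obj) (φ : b ⟶ a)
      (e : 𝒳.p.obj b = R), 𝒳.p.map φ = eqToHom e ≫ f)
    (h2 : ∀ {a b a' : 𝒳.obj} (φ : a ⟶ b) (φ' : a' ⟶ b) (k : 𝒳.p.obj a' ⟶ 𝒳.p.obj a),
      k ≫ 𝒳.p.map φ = 𝒳.p.map φ' → ∃ χ : a' ⟶ a, 𝒳.p.map χ = k ∧ χ ≫ φ = φ')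
    (h3 : ∀ {a b a' : 𝒳.obj} (φ : a ⟶ b) (χ χ' : a' ⟶ a), 𝒳.p.map χ = 𝒳.p.map χ' →
      χ ≫ φ = χ' ≫ φ → χ = χ') : IsFiberedInGroupoids 𝒳 where
  exists_lift a _ f := by
    obtain ⟨b, φ, rfl, h⟩ := h1 a f
    rw [eqToHom_refl, id_comp] at h
    exact ⟨b, φ, h ▸ IsHomLift.map 𝒳.p φ⟩
  cartesian {a b} φ :=
    { toIsHomLift := IsHomLift.map 𝒳.p φ
      universal_property' := by
        intro a' g φ' hφ'
        obtain ⟨χ, hχ, e⟩ := h2 φ φ' g (IsHomLift.eq_of_isHomLift 𝒳.p _ φ')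
        refine ⟨χ, ⟨hχ ▸ IsHomLift.map 𝒳.p χ, e⟩, fun χ' ⟨h, e'⟩ => h3 φ _ _ ?_ (e'.trans e.symm)⟩
        rw [hχ]
        exact (IsHomLift.eq_of_isHomLift 𝒳.p _ _).symm }

lemma IsFiberedInGroupoids.isIso_trans (h : IsFiberedInGroupoids 𝒴) {K K' : 𝒳 ⟶ 𝒴}
    (η : K ⟶ K') : IsIso η := by
  have : ∀ x, IsIso (appAt η x) := fun x => by
    have : IsIso (𝒴.p.map (appAt η x)) := by
      rw [p_map_appAt]
      infer_instance
    exact h.isIso _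
  exact isIso_of_appAt η

lemma isHomLift_map_of {R S : C} (f : R ⟶ S) {x x' : 𝒳.obj} {y y' : 𝒴.obj} (φ : x ⟶ x')
    (ψ : y ⟶ y') (h : 𝒳.p.IsHomLift f φ) (h' : 𝒴.p.IsHomLift f ψ) :
    𝒴.p.IsHomLift (𝒳.p.map φ) ψ := by
  obtain ⟨⟩ := h
  exact h'

variable (F : 𝒳 ⟶ 𝒵) (G : 𝒴 ⟶ 𝒵)

/-- The first projection of a 2-fibre product. -/
def fiberProdFst : fiberProd F G ⟶ 𝒳 :=
  ({ toFunctor :=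
      { obj := fun a => FiberProdObj.fst a
        map := fun f => FiberProdHom.fst f
        map_id := fun _ => rfl
        map_comp := fun _ _ => rfl }
     w := rfl } : BasedFunctor (fiberProd F G) 𝒳)

variable {F G}

/-- The two components of an object of the fibre product lie over the same object. -/
def FiberProdObj.bi (a : FiberProdObj F G) : 𝒴.p.obj a.snd ≅ 𝒳.p.obj a.fst := eqToIso a.base_eq

lemma FiberProdHom.p_snd {a b : FiberProdObj F G} (f : FiberProdHom a b) :
    𝒴.p.map (FiberProdHom.snd f) = a.bi.hom ≫ 𝒳.p.map (FiberProdHom.fst f) ≫ b.bi.inv := by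
  have := FiberProdHom.isHomLift f
  simpa [FiberProdObj.bi] using
    IsHomLift.fac' 𝒴.p (𝒳.p.map (FiberProdHom.fst f)) (FiberProdHom.snd f)

lemma FiberProdObj.p_iso (a : FiberProdObj F G) : 𝒵.p.map a.iso.hom =
    (baseIso F a.fst).hom ≫ a.bi.inv ≫ (baseIso G a.snd).inv := by
  have := (isHomLift_id_iff (BasedFunctor.w_obj F a.fst)
    ((BasedFunctor.w_obj G a.snd).trans a.base_eq) a.iso.hom).1 a.isHomLift
  simpa [baseIso, FiberProdObj.bi] using this

/-- Construction of morphisms of a 2-fibre product. -/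
def FiberProdHom.mk' {a b : FiberProdObj F G} (f : a.fst ⟶ b.fst) (g : a.snd ⟶ b.snd)
    (h : 𝒴.p.map g = a.bi.hom ≫ 𝒳.p.map f ≫ b.bi.inv)
    (comm : ⟪F⟫.map f ≫ b.iso.hom = a.iso.hom ≫ ⟪G⟫.map g) : a ⟶ b :=
  ({ fst := f
     snd := g
     isHomLift := IsHomLift.of_fac' _ _ _ a.base_eq b.base_eq (by
      rw [h]; simp [FiberProdObj.bi])
     comm := comm } : FiberProdHom a b)

lemma exists_fiberProdObj (x : 𝒳.obj) (y : 𝒴.obj) (e : 𝒴.p.obj y = 𝒳.p.obj x)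
    (i : ⟪F⟫.obj x ⟶ ⟪G⟫.obj y)
    (hi : 𝒵.p.map i = (baseIso F x).hom ≫ eqToHom e.symm ≫ (baseIso G y).inv)
    (h𝒵 : IsFiberedInGroupoids 𝒵) :
    ∃ (hi' : IsIso i) (h : 𝒵.p.IsHomLift (𝟙 (𝒳.p.obj x)) i),
      𝒵.p.IsHomLift (𝟙 (𝒳.p.obj x)) (asIso i).hom := by
  have : IsIso (𝒵.p.map i) := by rw [hi]; infer_instance
  have h : 𝒵.p.IsHomLift (𝟙 (𝒳.p.obj x)) i :=
    (isHomLift_id_iff (BasedFunctor.w_obj F x) ((BasedFunctor.w_obj G y).trans e) i).2 (by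
      rw [hi]; simp [baseIso])
  exact ⟨h𝒵.isIso i, h, h⟩

lemma fiberProd_fibered (h𝒳 : IsFiberedInGroupoids 𝒳) (h𝒴 : IsFiberedInGroupoids 𝒴)
    (h𝒵 : IsFiberedInGroupoids 𝒵) : IsFiberedInGroupoids (fiberProd F G) := by
  refine IsFiberedInGroupoids.mk' (fun a {R} f => ?_) (fun {a b a'} φ φ' k hk => ?_)
    (fun {a b a'} φ χ χ' h1 h2 => ?_)
  · change FiberProdObj F G at a
    change R ⟶ 𝒳.p.obj a.fst at f
    obtain ⟨x, φ, rfl, hφ⟩ := h𝒳.exists_pullback a.fst f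
    rw [eqToHom_refl, id_comp] at hφ
    obtain ⟨y, ψ, e, hψ⟩ := h𝒴.exists_pullback a.snd (f ≫ a.bi.inv)
    obtain ⟨i, hi, hi'⟩ := h𝒵.exists_hom (⟪G⟫.map ψ) (⟪F⟫.map φ ≫ a.iso.hom)
      ((baseIso F x).hom ≫ eqToHom e.symm ≫ (baseIso G y).inv) (by
        rw [map_comp, p_map_map, p_map_map, a.p_iso, hφ, hψ]
        simp)
    obtain ⟨h1, h2, h3⟩ := exists_fiberProdObj x y e i hi h𝒵
    let b : FiberProdObj F G := ⟨x, y, asIso i, h3⟩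
    have hb : b.bi.hom = eqToHom e := rfl
    refine ⟨b, FiberProdHom.mk' (a := b) (b := a) φ ψ (by rw [hb, hφ, hψ]) hi'.symm, rfl, ?_⟩
    exact hφ.trans (id_comp _).symm
  · change FiberProdObj F G at a b a'
    change 𝒳.p.obj a'.fst ⟶ 𝒳.p.obj a.fst at k
    obtain ⟨φ₁, φ₂, hφ, hc⟩ := φ
    obtain ⟨φ₁', φ₂', hφ', hc'⟩ := φ'
    have p1 := FiberProdHom.p_snd ⟨φ₁, φ₂, hφ, hc⟩
    have p2 := FiberProdHom.p_snd ⟨φ₁', φ₂', hφ', hc'⟩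
    change k ≫ 𝒳.p.map φ₁ = 𝒳.p.map φ₁' at hk
    change 𝒴.p.map φ₂ = _ ≫ 𝒳.p.map φ₁ ≫ _ at p1
    change 𝒴.p.map φ₂' = _ ≫ 𝒳.p.map φ₁' ≫ _ at p2
    obtain ⟨χ₁, h1, e1⟩ := h𝒳.exists_hom φ₁ φ₁' k hk
    obtain ⟨χ₂, h2, e2⟩ := h𝒴.exists_hom φ₂ φ₂' (a'.bi.hom ≫ k ≫ a.bi.inv) (by
        rw [p1, p2, ← hk]
        simp)
    refine ⟨FiberProdHom.mk' χ₁ χ₂ (by rw [h1, h2]) ?_, h1, FiberProdHom.ext e1 e2⟩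
    refine h𝒵.hom_cancel (⟪G⟫.map φ₂) ?_ ?_
    · rw [map_comp, map_comp, p_map_map, p_map_map, a.p_iso, a'.p_iso, h1, h2]
      simp
    · rw [assoc, ← hc, ← Functor.map_comp_assoc, e1, assoc,
        ← map_comp, e2]
      exact hc'
  · change FiberProdObj F G at a b a'
    have h1' : 𝒳.p.map (FiberProdHom.fst χ) = 𝒳.p.map (FiberProdHom.fst χ') := h1
    have p1 := FiberProdHom.p_snd χ
    have p2 := FiberProdHom.p_snd χ'
    exact FiberProdHom.ext (h𝒳.hom_cancel (FiberProdHom.fst φ) h1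
        (congrArg (fun f => FiberProdHom.fst f) h2))
      (h𝒴.hom_cancel (FiberProdHom.snd φ)
        (p1.trans ((congrArg (fun f => _ ≫ f ≫ _) h1').trans p2.symm))
        (congrArg (fun f => FiberProdHom.snd f) h2))

variable (F G) in
/-- The canonical 2-isomorphism of a 2-fibre product. -/
def fiberProdTrans : fiberProdFst F G ≫ F ⟶ fiberProdSnd F G ≫ G :=
  ({ app := fun a => (FiberProdObj.iso a).hom
     naturality := fun _ _ f => FiberProdHom.comm f
     isHomLift' := fun a => FiberProdObj.isHomLift a } :
    BasedNatTrans (fiberProdFst F G ≫ F) (fiberProdSnd F G ≫ G))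

/-- The universal property of the 2-fibre product, on objects. -/
def fiberProdLiftObj (K : 𝒜 ⟶ 𝒳) (L : 𝒜 ⟶ 𝒴) (α : K ≫ F ⟶ L ≫ G) [IsIso α] (a : 𝒜.obj) :
    FiberProdObj F G :=
  ⟨⟪K⟫.obj a, ⟪L⟫.obj a, @asIso _ _ _ _ (appAt α a) (isIso_appAt α a), by
      have := (α : BasedNatTrans _ _).app_isHomLift a
      rw [BasedFunctor.w_obj]
      exact this⟩

/-- The universal property of the 2-fibre product. -/
def fiberProdLift (K : 𝒜 ⟶ 𝒳) (L : 𝒜 ⟶ 𝒴) (α : K ≫ F ⟶ L ≫ G) [IsIso α] :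
    𝒜 ⟶ fiberProd F G :=
  ({ obj := fiberProdLiftObj K L α
     map := fun {a b} f => (⟨⟪K⟫.map f, ⟪L⟫.map f,
        isHomLift_map_of (𝒜.p.map f) _ _ (BasedFunctor.preserves_isHomLift K (𝒜.p.map f) f)
          (BasedFunctor.preserves_isHomLift L (𝒜.p.map f) f),
        appAt_naturality α f⟩ : FiberProdHom (fiberProdLiftObj K L α a) (fiberProdLiftObj K L α b))
     map_id := fun a => FiberProdHom.ext (⟪K⟫.map_id a) (⟪L⟫.map_id a)
     map_comp := fun f g => FiberProdHom.ext (⟪K⟫.map_comp f g) (⟪L⟫.map_comp f g)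
     w := ⟪K⟫.w } : BasedFunctor 𝒜 (fiberProd F G))

lemma exists_trans_fiberProd {K K' : 𝒜 ⟶ fiberProd F G}
    (η : K ≫ fiberProdFst F G ⟶ K' ≫ fiberProdFst F G)
    (θ : K ≫ fiberProdSnd F G ⟶ K' ≫ fiberProdSnd F G)
    (h : ∀ a, ⟪F⟫.map (appAt η a) ≫ appAt (fiberProdTrans F G) (⟪K'⟫.obj a) =
      appAt (fiberProdTrans F G) (⟪K⟫.obj a) ≫ ⟪G⟫.map (appAt θ a)) :
    ∃ κ : K ⟶ K', ∀ a, FiberProdHom.fst (appAt κ a) = appAt η a ∧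
      FiberProdHom.snd (appAt κ a) = appAt θ a := by
  refine ⟨({ app := fun a => (⟨appAt η a, appAt θ a,
        isHomLift_map_of (𝟙 (𝒜.p.obj a)) _ _ ((η : BasedNatTrans _ _).app_isHomLift a)
          ((θ : BasedNatTrans _ _).app_isHomLift a), h a⟩ : FiberProdHom _ _)
             naturality := fun _ _ f => FiberProdHom.ext (appAt_naturality η f)
              (appAt_naturality θ f)
             isHomLift' := fun a => ?_ } : BasedNatTrans K K'), fun a => ⟨rfl, rfl⟩⟩
  have h1 := (isHomLift_id_iff (𝒴 := 𝒳) (BasedFunctor.w_obj (K ≫ fiberProdFst F G) a)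
    (BasedFunctor.w_obj (K' ≫ fiberProdFst F G) a) _).1 ((η : BasedNatTrans _ _).app_isHomLift a)
  exact (isHomLift_id_iff (𝒴 := fiberProd F G) (BasedFunctor.w_obj K a)
    (BasedFunctor.w_obj K' a) _).2 h1

open Bicategory in
lemma fiberProd_isStack (h𝒳 : IsStack J 𝒳) (h𝒴 : IsStack J 𝒴) (h𝒵 : IsStack J 𝒵) :
    IsStack J (fiberProd F G) := by
  have hf : IsFiberedInGroupoids (fiberProd F G) :=
    fiberProd_fibered h𝒳.fibered h𝒴.fibered h𝒵.fibered
  refine IsStack.mk' hf (fun T S hS {K K' η θ} H => ?_) (fun T S hS {K K'} η => ?_)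
    (fun T S hS D => ?_)
  · have h1 : η ▷ fiberProdFst F G = θ ▷ fiberProdFst F G := h𝒳.trans_ext hS fun u =>
      congrArg (fun f => FiberProdHom.fst f) (H u)
    have h2 : η ▷ fiberProdSnd F G = θ ▷ fiberProdSnd F G := h𝒴.trans_ext hS fun u =>
      congrArg (fun f => FiberProdHom.snd f) (H u)
    exact ConeStacks.trans_ext fun a => FiberProdHom.ext (congrArg (appAt · a) h1)
      (congrArg (appAt · a) h2)
  · obtain ⟨θ₁, h1⟩ := h𝒳.exists_trans hS (K := K ≫ fiberProdFst F G)
      (K' := K' ≫ fiberProdFst F G) (η ▷ fiberProdFst F G)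
    obtain ⟨θ₂, h2⟩ := h𝒴.exists_trans hS (K := K ≫ fiberProdSnd F G)
      (K' := K' ≫ fiberProdSnd F G) (η ▷ fiberProdSnd F G)
    have key : (θ₁ ▷ F) ≫ (K' ◁ fiberProdTrans F G : (K' ≫ fiberProdFst F G) ≫ F ⟶
          (K' ≫ fiberProdSnd F G) ≫ G) =
        (K ◁ fiberProdTrans F G : (K ≫ fiberProdFst F G) ≫ F ⟶
          (K ≫ fiberProdSnd F G) ≫ G) ≫ (θ₂ ▷ G) := h𝒵.trans_ext hS fun u => by
      have h3 := FiberProdHom.comm (appAt η u)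
      have e1 : appAt θ₁ (sieveObj u) = FiberProdHom.fst (appAt η u) := h1 u
      have e2 : appAt θ₂ (sieveObj u) = FiberProdHom.snd (appAt η u) := h2 u
      change ⟪F⟫.map (appAt θ₁ (sieveObj u)) ≫ _ = _ ≫ ⟪G⟫.map (appAt θ₂ (sieveObj u))
      rw [e1, e2]
      exact h3
    obtain ⟨κ, hκ⟩ := exists_trans_fiberProd θ₁ θ₂ fun a => congrArg (appAt · a) key
    exact ⟨κ, fun u => FiberProdHom.ext ((hκ _).1.trans (h1 u)) ((hκ _).2.trans (h2 u))⟩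
  · obtain ⟨K₁, ⟨ε₁⟩⟩ := h𝒳.exists_functor hS (D ≫ fiberProdFst F G)
    obtain ⟨K₂, ⟨ε₂⟩⟩ := h𝒴.exists_functor hS (D ≫ fiberProdSnd F G)
    let β : sieveIncl S ≫ K₁ ≫ F ⟶ sieveIncl S ≫ K₂ ≫ G :=
      (show (sieveIncl S ≫ K₁) ≫ F ⟶ (D ≫ fiberProdFst F G) ≫ F from ε₁.hom ▷ F) ≫
      (show (D ≫ fiberProdFst F G) ≫ F ⟶ (D ≫ fiberProdSnd F G) ≫ G from
        D ◁ fiberProdTrans F G) ≫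
      (show (D ≫ fiberProdSnd F G) ≫ G ⟶ (sieveIncl S ≫ K₂) ≫ G from ε₂.inv ▷ G)
    obtain ⟨γ, hγ⟩ := h𝒵.exists_trans hS β
    have := h𝒵.fibered.isIso_trans γ
    refine ⟨fiberProdLift K₁ K₂ γ, ?_⟩
    obtain ⟨κ, -⟩ := exists_trans_fiberProd (K := sieveIncl S ≫ fiberProdLift K₁ K₂ γ) (K' := D)
      ε₁.hom ε₂.hom fun u => by
        refine Eq.trans ?_ (congrArg (· ≫ ⟪G⟫.map (appAt ε₂.hom u)) (hγ u)).symm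
        have e : ⟪G⟫.map (appAt ε₂.inv u) ≫ ⟪G⟫.map (appAt ε₂.hom u) = 𝟙 _ := by
          rw [← map_comp]
          exact (congrArg ⟪G⟫.map (congrArg (appAt · u) ε₂.inv_hom_id)).trans (map_id _ _)
        refine Eq.symm ((assoc _ _ _).trans (congrArg (⟪F⟫.map (appAt ε₁.hom u) ≫ ·) ?_))
        exact (assoc _ _ _).trans ((congrArg (_ ≫ ·) e).trans (comp_id _))
    have := hf.isIso_trans κ
    exact ⟨asIso κ⟩

end FiberProducts

section Charts

variable {𝒳 𝒴 : Based.{u}}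

/-- An object of `𝒳` over a complex with a largest cone. -/
structure Chart (𝒳 : Based.{u}) : Type (u + 1) where
  pt : 𝒳.obj
  dom : Topped.{u}
  iso : dom.cx ≅ 𝒳.p.obj pt

instance : Category.{u} (Chart 𝒳) where
  Hom a b := a.pt ⟶ b.pt
  id a := 𝟙 a.pt
  comp f g := f ≫ g
  id_comp _ := id_comp _
  comp_id _ := comp_id _
  assoc _ _ _ := assoc _ _ _

/-- The morphism of `𝒳` underlying a morphism of charts. -/
def Chart.hom {a b : Chart 𝒳} (f : a ⟶ b) : a.pt ⟶ b.pt := f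

/-- The morphism of charts given by a morphism of `𝒳`. -/
def Chart.mkHom {a b : Chart 𝒳} (f : a.pt ⟶ b.pt) : a ⟶ b := f

@[simp] lemma Chart.hom_mkHom {a b : Chart 𝒳} (f : a.pt ⟶ b.pt) : Chart.hom (mkHom f : a ⟶ b) = f :=
  rfl

@[simp] lemma Chart.hom_comp {a b c : Chart 𝒳} (f : a ⟶ b) (g : b ⟶ c) :
    Chart.hom (f ≫ g) = Chart.hom f ≫ Chart.hom g := rfl

@[simp] lemma Chart.hom_id (a : Chart 𝒳) : Chart.hom (𝟙 a) = 𝟙 a.pt := rfl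

lemma Chart.hom_ext {a b : Chart 𝒳} {f g : a ⟶ b} (h : Chart.hom f = Chart.hom g) : f = g := h

variable (𝒳) in
/-- The complex underlying a chart. -/
def Chart.domain : Chart 𝒳 ⥤ Topped.{u} where
  obj a := a.dom
  map {a b} f := (a.iso.hom ≫ 𝒳.p.map (Chart.hom f) ≫ b.iso.inv : a.dom.cx ⟶ b.dom.cx)
  map_id a := by
    rw [Chart.hom_id, map_id, id_comp, Iso.hom_inv_id]
    rfl
  map_comp {a b c} f g := by
    change _ = (a.iso.hom ≫ 𝒳.p.map (Chart.hom f) ≫ b.iso.inv) ≫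
      b.iso.hom ≫ 𝒳.p.map (Chart.hom g) ≫ c.iso.inv
    simp

lemma Chart.p_map {a b : Chart 𝒳} (f : a ⟶ b) : 𝒳.p.map (Chart.hom f) =
    a.iso.inv ≫ Topped.hom ((Chart.domain 𝒳).map f) ≫ b.iso.hom := by
  change _ = a.iso.inv ≫ (a.iso.hom ≫ 𝒳.p.map (Chart.hom f) ≫ b.iso.inv) ≫ b.iso.hom
  simp

variable (𝒳) in
/-- The cone underlying a chart. -/
abbrev Chart.cone : Chart 𝒳 ⥤ RPC.{u} := Chart.domain 𝒳 ⋙ Topped.ev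

lemma Chart.p_map_eq {a b : Chart 𝒳} {f g : a ⟶ b}
    (h : (Chart.cone 𝒳).map f = (Chart.cone 𝒳).map g) :
    𝒳.p.map (Chart.hom f) = 𝒳.p.map (Chart.hom g) := by
  rw [Chart.p_map, Chart.p_map, Topped.ev.map_injective h]

/-- Functors over `RPCC` act on charts. -/
def Chart.map (K : 𝒳 ⟶ 𝒴) : Chart 𝒳 ⥤ Chart 𝒴 where
  obj a := ⟨⟪K⟫.obj a.pt, a.dom, a.iso ≪≫ (baseIso K a.pt).symm⟩
  map f := ⟪K⟫.map (Chart.hom f)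
  map_id a := ⟪K⟫.map_id a.pt
  map_comp f g := ⟪K⟫.map_comp (Chart.hom f) (Chart.hom g)

lemma Chart.hom_map (K : 𝒳 ⟶ 𝒴) {a b : Chart 𝒳} (f : a ⟶ b) :
    Chart.hom ((Chart.map K).map f) = ⟪K⟫.map (Chart.hom f) := rfl

lemma Chart.domain_map (K : 𝒳 ⟶ 𝒴) {a b : Chart 𝒳} (f : a ⟶ b) :
    (Chart.domain 𝒴).map ((Chart.map K).map f) = (Chart.domain 𝒳).map f := by
  change (a.iso ≪≫ (baseIso K a.pt).symm).hom ≫ 𝒴.p.map (⟪K⟫.map (Chart.hom f)) ≫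
    (b.iso ≪≫ (baseIso K b.pt).symm).inv = _
  rw [p_map_map]
  simp only [Iso.trans_hom, Iso.symm_hom, Iso.trans_inv, Iso.symm_inv, assoc, Iso.inv_hom_id_assoc]
  rfl

lemma Chart.cone_map (K : 𝒳 ⟶ 𝒴) {a b : Chart 𝒳} (f : a ⟶ b) :
    (Chart.cone 𝒴).map ((Chart.map K).map f) = (Chart.cone 𝒳).map f :=
  congrArg Topped.ev.map (Chart.domain_map K f)

/-- Transformations over `RPCC` act on charts. -/
def Chart.mapTrans {K K' : 𝒳 ⟶ 𝒴} (η : K ⟶ K') : Chart.map K ⟶ Chart.map K' where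
  app a := Chart.mkHom (a := (Chart.map K).obj a) (b := (Chart.map K').obj a) (appAt η a.pt)
  naturality a b f := appAt_naturality η (Chart.hom f)

lemma Chart.domain_mapTrans {K K' : 𝒳 ⟶ 𝒴} (η : K ⟶ K') (a : Chart 𝒳) :
    (Chart.domain 𝒴).map ((Chart.mapTrans η).app a) = 𝟙 a.dom := by
  change (a.iso ≪≫ (baseIso K a.pt).symm).hom ≫ 𝒴.p.map (appAt η a.pt) ≫
    (a.iso ≪≫ (baseIso K' a.pt).symm).inv = 𝟙 a.dom.cx
  rw [p_map_appAt]
  simp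

lemma Chart.cone_mapTrans {K K' : 𝒳 ⟶ 𝒴} (η : K ⟶ K') (a : Chart 𝒳) :
    (Chart.cone 𝒴).map ((Chart.mapTrans η).app a) = 𝟙 ((Chart.cone 𝒳).obj a) :=
  (congrArg Topped.ev.map (Chart.domain_mapTrans η a)).trans (Topped.ev.map_id _)

namespace IsFiberedInGroupoids

lemma exists_chart (h : IsFiberedInGroupoids 𝒳) (x : 𝒳.obj) (c : Topped.{u})
    (r : c.cx ⟶ 𝒳.p.obj x) : ∃ (b : 𝒳.obj) (i : c.cx ≅ 𝒳.p.obj b) (m : b ⟶ x),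
      i.hom ≫ 𝒳.p.map m = r := by
  obtain ⟨b, φ, e, hφ⟩ := h.exists_pullback x r
  exact ⟨b, eqToIso e.symm, φ, by rw [hφ]; simp⟩

lemma exists_hom_chart (h : IsFiberedInGroupoids 𝒳) {a a' : Chart 𝒳} {y : 𝒳.obj} (m : a.pt ⟶ y)
    (m' : a'.pt ⟶ y) (k : a'.dom ⟶ a.dom)
    (hk : Topped.hom k ≫ a.iso.hom ≫ 𝒳.p.map m = a'.iso.hom ≫ 𝒳.p.map m') :
    ∃ χ : a' ⟶ a, (Chart.domain 𝒳).map χ = k ∧ Chart.hom χ ≫ m = m' := by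
  obtain ⟨χ, hχ, e⟩ := h.exists_hom m m' (a'.iso.inv ≫ Topped.hom k ≫ a.iso.hom) (by
    rw [assoc, assoc, hk, Iso.inv_hom_id_assoc])
  refine ⟨Chart.mkHom χ, ?_, e⟩
  change a'.iso.hom ≫ 𝒳.p.map χ ≫ a.iso.inv = Topped.hom k
  rw [hχ]
  simp

lemma exists_chart_over (h : IsFiberedInGroupoids 𝒳) (a : Chart 𝒳) {σ : RPC.{u}}
    (f : σ ⟶ (Chart.cone 𝒳).obj a) : ∃ (b : Chart 𝒳) (φ : b ⟶ a) (e : (Chart.cone 𝒳).obj b ≅ σ),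
      (Chart.cone 𝒳).map φ = e.hom ≫ f := by
  let e := Topped.ev.objObjPreimageIso σ
  let k : Topped.ev.objPreimage σ ⟶ a.dom := Topped.ev.preimage (e.hom ≫ f)
  obtain ⟨x, i, m, hm⟩ := h.exists_chart a.pt (Topped.ev.objPreimage σ) (Topped.hom k ≫ a.iso.hom)
  let b : Chart 𝒳 := ⟨x, _, i⟩
  refine ⟨b, Chart.mkHom m, e, ?_⟩
  have : (Chart.domain 𝒳).map (Chart.mkHom m : b ⟶ a) = k := by
    change i.hom ≫ 𝒳.p.map m ≫ a.iso.inv = Topped.hom k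
    rw [reassoc_of% hm, Iso.hom_inv_id, comp_id]
  exact (congrArg Topped.ev.map this).trans (Topped.ev.map_preimage _)

lemma exists_chart_hom (h : IsFiberedInGroupoids 𝒳) {a b a' : Chart 𝒳} (φ : a ⟶ b) (φ' : a' ⟶ b)
    (k : (Chart.cone 𝒳).obj a' ⟶ (Chart.cone 𝒳).obj a)
    (hk : k ≫ (Chart.cone 𝒳).map φ = (Chart.cone 𝒳).map φ') :
    ∃ χ : a' ⟶ a, (Chart.cone 𝒳).map χ = k ∧ χ ≫ φ = φ' := by
  obtain ⟨k, rfl⟩ := Topped.ev.map_surjective (X := a'.dom) (Y := a.dom) k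
  have hk' : k ≫ (Chart.domain 𝒳).map φ = (Chart.domain 𝒳).map φ' :=
    Topped.ev.map_injective ((Topped.ev.map_comp _ _).trans hk)
  obtain ⟨χ, h1, h2⟩ := h.exists_hom_chart (Chart.hom φ) (Chart.hom φ') k (by
    have := congrArg (fun f => Topped.hom f ≫ b.iso.hom) hk'
    change (Topped.hom k ≫ a.iso.hom ≫ 𝒳.p.map (Chart.hom φ) ≫ b.iso.inv) ≫ b.iso.hom =
      (a'.iso.hom ≫ 𝒳.p.map (Chart.hom φ') ≫ b.iso.inv) ≫ b.iso.hom at this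
    simpa using this)
  exact ⟨χ, congrArg Topped.ev.map h1, h2⟩

lemma chart_cancel (h : IsFiberedInGroupoids 𝒳) {a b a' : Chart 𝒳} (φ : a ⟶ b) {χ χ' : a' ⟶ a}
    (hp : (Chart.cone 𝒳).map χ = (Chart.cone 𝒳).map χ') (hφ : χ ≫ φ = χ' ≫ φ) : χ = χ' :=
  h.hom_cancel (Chart.hom φ) (Chart.p_map_eq hp) hφ

lemma chart_isIso (h : IsFiberedInGroupoids 𝒳) {a b : Chart 𝒳} (φ : a ⟶ b)
    [IsIso ((Chart.cone 𝒳).map φ)] : IsIso φ := by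
  obtain ⟨χ, h1, h2⟩ := h.exists_chart_hom φ (𝟙 b) (inv ((Chart.cone 𝒳).map φ)) (by simp)
  exact ⟨χ, h.chart_cancel φ (by rw [map_comp, h1]; simp) (by simp [h2]), h2⟩

end IsFiberedInGroupoids

/-- The underlying isomorphism of an isomorphism of charts. -/
def Chart.isoPt {a b : Chart 𝒳} (e : a ≅ b) : a.pt ≅ b.pt :=
  ⟨Chart.hom e.hom, Chart.hom e.inv, e.hom_inv_id, e.inv_hom_id⟩

end Charts

section CombConeStacks

namespace CombConeStack

variable (S : CombConeStack.{u}) {a b a' : S.based.obj}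

lemma isFace (f : a ⟶ b) : IsFaceMorphism (S.cone.map f) := (S.based.p.map f).property

lemma exists_hom (φ : a ⟶ b) (φ' : a' ⟶ b) (k : S.cone.obj a' ⟶ S.cone.obj a)
    (hk : k ≫ S.cone.map φ = S.cone.map φ') : ∃ χ : a' ⟶ a, S.cone.map χ = k ∧ χ ≫ φ = φ' := by
  have hf : IsFaceMorphism k := IsFaceMorphism.of_comp (by rw [hk]; exact S.isFace φ') (S.isFace φ)
  obtain ⟨χ, h1, h2⟩ := S.fibered.exists_hom φ φ' ⟨k, hf⟩ (WideSubcategory.hom_ext _ hk)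
  exact ⟨χ, congrArg (fun f => f.hom) h1, h2⟩

lemma cancel (φ : a ⟶ b) {χ χ' : a' ⟶ a} (h : χ ≫ φ = χ' ≫ φ) : χ = χ' := by
  refine S.fibered.hom_cancel φ (WideSubcategory.hom_ext _ ((S.isFace φ).cancel ?_)) h
  have := congrArg S.cone.map h
  rw [map_comp, map_comp] at this
  exact this

lemma isIso_of_isIso (f : a ⟶ b) [IsIso (S.cone.map f)] : IsIso f := by
  obtain ⟨χ, h1, h2⟩ := S.exists_hom f (𝟙 b) (inv (S.cone.map f)) (by simp)
  exact ⟨χ, S.cancel f (by rw [assoc, h2]; simp), h2⟩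

lemma isIso_of_isDominant (f : a ⟶ b) (h : IsDominant (S.cone.map f)) : IsIso f := by
  have := (S.isFace f).isIso_of_isDominant h
  exact S.isIso_of_isIso f

lemma exists_pullback (a : S.based.obj) {σ : RPC.{u}} (f : σ ⟶ S.cone.obj a)
    (hf : IsFaceMorphism f) : ∃ (b : S.based.obj) (φ : b ⟶ a) (e : S.cone.obj b ≅ σ),
      S.cone.map φ = e.hom ≫ f := by
  obtain ⟨b, φ, e, h⟩ := S.fibered.exists_pullback a (R := ⟨σ⟩) ⟨f, hf⟩
  refine ⟨b, φ, RPCf.incl.mapIso (eqToIso e), ?_⟩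
  exact congrArg (fun f => f.hom) h

end CombConeStack

end CombConeStacks

section Indices

variable {T T' T'' : RPCC.{u}}

/-- The cones of a complex, as a functor. -/
def RPCC.cones (T : RPCC.{u}) : T.obj.Index ⥤ RPC.{u} where
  obj α := T.obj.cone α.idx
  map v := v.1
  map_id _ := rfl
  map_comp _ _ := rfl

/-- The image of a cone of `T` under a morphism of cone complexes. -/
def RPCC.im (f : T ⟶ T') (α : T.obj.Index) : T'.obj.Index := ⟨f.hom.idx α.idx⟩

/-- The map of cones given by a morphism of cone complexes. -/
def RPCC.mapAt (f : T ⟶ T') (α : T.obj.Index) : T.cones.obj α ⟶ T'.cones.obj (RPCC.im f α) :=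
  f.hom.map α.idx

lemma RPCC.isDominant_mapAt (f : T ⟶ T') (α : T.obj.Index) : IsDominant (RPCC.mapAt f α) :=
  f.hom.dominant α.idx

/-- The map on indices induced by a morphism of cone complexes is functorial. -/
def RPCC.imMap (f : T ⟶ T') {α β : T.obj.Index} (v : α ⟶ β) : RPCC.im f α ⟶ RPCC.im f β :=
  ⟨(f.hom.compat v.1 v.2).choose, (f.hom.compat v.1 v.2).choose_spec.1⟩

lemma RPCC.mapAt_naturality (f : T ⟶ T') {α β : T.obj.Index} (v : α ⟶ β)
    (w : RPCC.im f α ⟶ RPCC.im f β) :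
    T.cones.map v ≫ RPCC.mapAt f β = RPCC.mapAt f α ≫ T'.cones.map w := by
  rw [Subsingleton.elim w (RPCC.imMap f v)]
  exact (f.hom.compat v.1 v.2).choose_spec.2

/-- The functor on indices induced by a morphism of cone complexes. -/
def RPCC.idxFunctor (f : T ⟶ T') : T.obj.Index ⥤ T'.obj.Index where
  obj := RPCC.im f
  map := RPCC.imMap f
  map_id _ := Subsingleton.elim _ _
  map_comp _ _ := Subsingleton.elim _ _

/-- The unique morphism to the largest cone. -/
def RPCC.IsTop.to {t : T.obj.Index} (ht : T.IsTop t.idx) (β : T.obj.Index) : β ⟶ t :=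
  ⟨(ht β.idx).choose, (ht β.idx).choose_spec⟩

end Indices

namespace CombConeStack

/-- A family over a cone complex `T` with values in a combinatorial cone stack `S`: objects of `S`
indexed functorially by the cones of `T`, with compatible dominant maps of cones. -/
structure Fam (S : CombConeStack.{u}) : Type (u + 1) where
  base : RPCC.{u}
  fn : base.obj.Index ⥤ S.based.obj
  map : ∀ α : base.obj.Index, base.cones.obj α ⟶ S.cone.obj (fn.obj α)
  naturality : ∀ {α β : base.obj.Index} (v : α ⟶ β),
    base.cones.map v ≫ map β = map α ≫ S.cone.map (fn.map v)
  dominant : ∀ α, IsDominant (map α)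

variable {S : CombConeStack.{u}}

/-- A morphism of families. -/
structure Fam.Hom (x y : S.Fam) : Type u where
  base : x.base ⟶ y.base
  app : ∀ α : x.base.obj.Index, x.fn.obj α ⟶ y.fn.obj (RPCC.im base α)
  natural : ∀ {α β : x.base.obj.Index} (v : α ⟶ β) (w : RPCC.im base α ⟶ RPCC.im base β),
    x.fn.map v ≫ app β = app α ≫ y.fn.map w
  comm : ∀ α : x.base.obj.Index, x.map α ≫ S.cone.map (app α) =
    RPCC.mapAt base α ≫ y.map (RPCC.im base α)

lemma Fam.Hom.ext' {x y : S.Fam} {f g : Fam.Hom x y} (h : f.base = g.base)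
    (h' : ∀ α (w : RPCC.im f.base α ⟶ RPCC.im g.base α), f.app α ≫ y.fn.map w = g.app α) :
    f = g := by
  obtain ⟨b, a, _, _⟩ := f
  obtain ⟨b', a', _, _⟩ := g
  obtain rfl : b = b' := h
  obtain rfl : a = a' := funext fun α => by simpa using h' α (𝟙 _)
  rfl

/-- The identity of a family. -/
def Fam.Hom.id (x : S.Fam) : Fam.Hom x x where
  base := 𝟙 x.base
  app α := 𝟙 (x.fn.obj α)
  natural {α β} v w := by
    have e : w = v := Subsingleton.elim (α := α ⟶ β) w v
    rw [e]
    exact (comp_id _).trans (id_comp _).symm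
  comm α := (congrArg (x.map α ≫ ·) (S.cone.map_id _)).trans ((comp_id _).trans (id_comp _).symm)

/-- The composition of morphisms of families. -/
def Fam.Hom.comp {x y z : S.Fam} (f : Fam.Hom x y) (g : Fam.Hom y z) : Fam.Hom x z where
  base := f.base ≫ g.base
  app α := f.app α ≫ g.app (RPCC.im f.base α)
  natural {α β} v w := by
    have h (w' : RPCC.im g.base (RPCC.im f.base α) ⟶ RPCC.im g.base (RPCC.im f.base β)) :
        x.fn.map v ≫ f.app β ≫ g.app (RPCC.im f.base β) =
          (f.app α ≫ g.app (RPCC.im f.base α)) ≫ z.fn.map w' := by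
      rw [← assoc, f.natural v (RPCC.imMap f.base v), assoc, assoc, g.natural _ w']
    exact h w
  comm α := by
    have h : x.map α ≫ S.cone.map (f.app α ≫ g.app (RPCC.im f.base α)) =
        (RPCC.mapAt f.base α ≫ RPCC.mapAt g.base _) ≫ z.map (RPCC.im g.base _) := by
      rw [map_comp, ← assoc, f.comm, assoc, g.comm, ← assoc]
    exact h

lemma Fam.Hom.ext_of_app {x y : S.Fam} {f g : Fam.Hom x y} (h : f.base = g.base)
    (h' : ∀ α (e : RPCC.im f.base α = RPCC.im g.base α), f.app α ≫ eqToHom (by rw [e]) = g.app α) :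
    f = g := by
  refine Fam.Hom.ext' h fun α w => ?_
  have e : RPCC.im f.base α = RPCC.im g.base α := by rw [h]
  rw [← h' α e, Subsingleton.elim w (eqToHom e), eqToHom_map]

instance : Category.{u} S.Fam where
  Hom := Fam.Hom
  id := Fam.Hom.id
  comp := Fam.Hom.comp
  id_comp f := Fam.Hom.ext_of_app (id_comp _) fun α _ => (comp_id _).trans (id_comp _)
  comp_id f := Fam.Hom.ext_of_app (comp_id _) fun α _ => (comp_id _).trans (comp_id _)
  assoc f g h := Fam.Hom.ext_of_app (assoc _ _ _) fun α _ => (comp_id _).trans (assoc _ _ _)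

/-- The underlying morphism of complexes of a morphism of families. -/
def Fam.hb {x y : S.Fam} (f : x ⟶ y) : x.base ⟶ y.base := Fam.Hom.base f

/-- The components of a morphism of families. -/
def Fam.ha {x y : S.Fam} (f : x ⟶ y) (α : x.base.obj.Index) :
    x.fn.obj α ⟶ y.fn.obj (RPCC.im (Fam.hb f) α) := Fam.Hom.app f α

lemma Fam.ha_natural {x y : S.Fam} (f : x ⟶ y) {α β : x.base.obj.Index} (v : α ⟶ β)
    (w : RPCC.im (Fam.hb f) α ⟶ RPCC.im (Fam.hb f) β) :
    x.fn.map v ≫ Fam.ha f β = Fam.ha f α ≫ y.fn.map w := Fam.Hom.natural f v w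

lemma Fam.ha_comm {x y : S.Fam} (f : x ⟶ y) (α : x.base.obj.Index) :
    x.map α ≫ S.cone.map (Fam.ha f α) =
      RPCC.mapAt (Fam.hb f) α ≫ y.map (RPCC.im (Fam.hb f) α) := Fam.Hom.comm f α

instance Fam.isIso_ha {x y : S.Fam} (f : x ⟶ y) (α : x.base.obj.Index) : IsIso (Fam.ha f α) :=
  S.isIso_of_isDominant _ (IsDominant.of_comp (f := x.map α) (by
    rw [Fam.ha_comm]
    exact (RPCC.isDominant_mapAt _ _).comp (y.dominant _)))

variable (S) in
/-- The category over `RPCC` associated with a combinatorial cone stack. -/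
def geom : Based.{u} := BasedCategory.ofFunctor (𝒳 := S.Fam)
    { obj := fun x => x.base
      map := fun f => Fam.hb f
      map_id := fun _ => rfl
      map_comp := fun _ _ => rfl }

lemma Fam.hom_ext_top {x y : S.Fam} {t : x.base.obj.Index} (ht : x.base.IsTop t.idx) {f g : x ⟶ y}
    (hb : Fam.hb f = Fam.hb g) (h : ∀ w : RPCC.im (Fam.hb f) t ⟶ RPCC.im (Fam.hb g) t,
      Fam.ha f t ≫ y.fn.map w = Fam.ha g t) : f = g := by
  obtain ⟨b, a, n, c⟩ := f
  obtain ⟨b', a', n', c'⟩ := g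
  obtain rfl : b = b' := hb
  have h' : a t = a' t := by
    have := h (𝟙 (RPCC.im b t))
    exact (comp_id _).symm.trans ((congrArg (a t ≫ ·) (y.fn.map_id _)).symm.trans this)
  obtain rfl : a = a' := funext fun β => by
    have e := n (ht.to β) (RPCC.imMap b (ht.to β))
    have e' := n' (ht.to β) (RPCC.imMap b (ht.to β))
    rw [h'] at e
    exact S.cancel _ (e.symm.trans e')
  rfl

lemma Fam.exists_hom_top {x y : S.Fam} {t : x.base.obj.Index} (ht : x.base.IsTop t.idx)
    (b : x.base ⟶ y.base) (e : x.fn.obj t ⟶ y.fn.obj (RPCC.im b t))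
    (he : x.map t ≫ S.cone.map e = RPCC.mapAt b t ≫ y.map (RPCC.im b t)) :
    ∃ f : x ⟶ y, ∃ _ : Fam.hb f = b, ∀ w : RPCC.im (Fam.hb f) t ⟶ RPCC.im b t,
      Fam.ha f t ≫ y.fn.map w = e := by
  have key : ∀ β : x.base.obj.Index, ∃ a : x.fn.obj β ⟶ y.fn.obj (RPCC.im b β),
      x.map β ≫ S.cone.map a = RPCC.mapAt b β ≫ y.map (RPCC.im b β) ∧
      a ≫ y.fn.map (RPCC.imMap b (ht.to β)) = x.fn.map (ht.to β) ≫ e := by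
    intro β
    have hg := S.isFace (y.fn.map (RPCC.imMap b (ht.to β)))
    obtain ⟨l, hl, hl'⟩ := hg.exists_lift_of_isDominant (x.dominant β)
      (S.cone.map (x.fn.map (ht.to β) ≫ e)) (RPCC.mapAt b β ≫ y.map (RPCC.im b β)) (by
        rw [assoc, ← y.naturality, ← assoc,
          ← RPCC.mapAt_naturality b (ht.to β) (RPCC.imMap b (ht.to β)), S.cone.map_comp,
          ← assoc (x.map β), ← x.naturality, assoc, assoc, he])
    obtain ⟨a, ha, ha'⟩ := S.exists_hom _ _ l hl
    exact ⟨a, by rw [ha, hl'], ha'⟩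
  choose a ha ha' using key
  let f : x ⟶ y := (⟨b, a, fun {α β} w w' => by
    refine S.cancel (y.fn.map (RPCC.imMap b (ht.to β))) ?_
    rw [assoc, ha', assoc, ← map_comp,
      Subsingleton.elim (w' ≫ RPCC.imMap b (ht.to β)) (RPCC.imMap b (ht.to α)), ha',
      ← Functor.map_comp_assoc, Subsingleton.elim (w ≫ ht.to β) (ht.to α)], ha⟩ : Fam.Hom x y)
  refine ⟨f, rfl, fun w => ?_⟩
  have := ha' t
  rw [Subsingleton.elim (ht.to t) (𝟙 t), map_id, id_comp] at this
  rw [← this, Subsingleton.elim w (RPCC.imMap b (𝟙 t))]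
  rfl

lemma geom_fibered (S : CombConeStack.{u}) : IsFiberedInGroupoids S.geom := by
  refine IsFiberedInGroupoids.mk' (fun x {R} f => ?_) (fun {x y z} φ φ' k hk => ?_)
    (fun {x y z} φ χ χ' h1 h2 => ?_)
  · change S.Fam at x
    change R ⟶ x.base at f
    let y : S.Fam :=
      { base := R
        fn := RPCC.idxFunctor f ⋙ x.fn
        map := fun α => RPCC.mapAt f α ≫ x.map (RPCC.im f α)
        naturality := fun {α β} v => by
          have h : R.cones.map v ≫ RPCC.mapAt f β ≫ x.map (RPCC.im f β) =
              (RPCC.mapAt f α ≫ x.map (RPCC.im f α)) ≫ S.cone.map (x.fn.map (RPCC.imMap f v)) := by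
            rw [← assoc, RPCC.mapAt_naturality f v (RPCC.imMap f v), assoc, x.naturality, assoc]
          exact h
        dominant := fun α => (RPCC.isDominant_mapAt f α).comp (x.dominant _) }
    let φ : y ⟶ x := (⟨f, fun α => 𝟙 (x.fn.obj (RPCC.im f α)), fun {α β} v w => by
        rw [Subsingleton.elim w (RPCC.imMap f v)]
        exact (comp_id _).trans (id_comp _).symm, fun α =>
        (congrArg (y.map α ≫ ·) (S.cone.map_id _)).trans (comp_id _)⟩ : Fam.Hom y x)
    exact ⟨y, φ, rfl, (id_comp f).symm⟩
  · change S.Fam at x y z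
    change z.base ⟶ x.base at k
    change k ≫ Fam.hb φ = Fam.hb φ' at hk
    obtain ⟨b, a, n, c⟩ := φ'
    obtain rfl : k ≫ Fam.hb φ = b := hk
    let e : ∀ α, x.fn.obj (RPCC.im k α) ≅ y.fn.obj (RPCC.im (k ≫ Fam.hb φ) α) := fun α =>
      @asIso _ _ _ _ (Fam.ha φ (RPCC.im k α)) (Fam.isIso_ha φ _)
    have hen : ∀ {α β} (v : RPCC.im k α ⟶ RPCC.im k β)
        (w : RPCC.im (k ≫ Fam.hb φ) α ⟶ RPCC.im (k ≫ Fam.hb φ) β),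
        x.fn.map v ≫ (e β).hom = (e α).hom ≫ y.fn.map w := fun v w => Fam.ha_natural φ v w
    have hec : ∀ α, RPCC.mapAt k α ≫ x.map (RPCC.im k α) ≫ S.cone.map (e α).hom =
        RPCC.mapAt (k ≫ Fam.hb φ) α ≫ y.map (RPCC.im (k ≫ Fam.hb φ) α) := fun α =>
      (congrArg (RPCC.mapAt k α ≫ ·) (Fam.ha_comm φ (RPCC.im k α))).trans (assoc _ _ _).symm
    let χ : z ⟶ x := (⟨k, fun α => a α ≫ (e α).inv, fun {α β} v w => by
        have h1 := n v (RPCC.imMap (k ≫ Fam.hb φ) v)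
        have h2 := hen w (RPCC.imMap (k ≫ Fam.hb φ) v)
        rw [← assoc, h1, assoc, assoc]
        congr 1
        rw [Iso.comp_inv_eq, assoc, h2, Iso.inv_hom_id_assoc], fun α => by
        have h1 := c α
        rw [← hec, ← assoc] at h1
        rw [map_comp, ← assoc, h1, assoc, ← map_comp,
          Iso.hom_inv_id, map_id, comp_id]⟩ : Fam.Hom z x)
    exact ⟨χ, rfl, Fam.Hom.ext_of_app rfl fun α _ => (comp_id _).trans
      ((assoc _ _ _).trans ((congrArg (a α ≫ ·) (e α).inv_hom_id).trans (comp_id _)))⟩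
  · change S.Fam at x y z
    obtain ⟨b, a, n, c⟩ := χ
    obtain ⟨b', a', n', c'⟩ := χ'
    obtain rfl : b = b' := h1
    obtain rfl : a = a' := funext fun α => by
      have : a α ≫ Fam.ha φ (RPCC.im b α) = a' α ≫ Fam.ha φ (RPCC.im b α) := by
        injection h2 with _ h
        exact congrFun h α
      exact S.cancel (Fam.ha φ (RPCC.im b α)) this
    rfl

lemma exists_fam (c : RPCC.{u}) (t : c.obj.Index) (ht : c.IsTop t.idx) (s : S.based.obj)
    (ψ : c.cones.obj t ⟶ S.cone.obj s) (hψ : IsDominant ψ) :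
    ∃ (fn : c.obj.Index ⥤ S.based.obj) (map : ∀ α, c.cones.obj α ⟶ S.cone.obj (fn.obj α)),
      (∀ {α β : c.obj.Index} (v : α ⟶ β), c.cones.map v ≫ map β = map α ≫ S.cone.map (fn.map v)) ∧
      (∀ α, IsDominant (map α)) ∧ ∃ e : fn.obj t ≅ s, map t ≫ S.cone.map e.hom = ψ := by
  have key : ∀ β : c.obj.Index, ∃ (b : S.based.obj) (φ : b ⟶ s) (d : c.cones.obj β ⟶ S.cone.obj b),
      IsDominant d ∧ d ≫ S.cone.map φ = c.cones.map (ht.to β) ≫ ψ := by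
    intro β
    obtain ⟨ρ, d, g, hd, hg, h⟩ := RPC.exists_factorization (c.cones.map (ht.to β) ≫ ψ)
    obtain ⟨b, φ, e, hφ⟩ := S.exists_pullback s g hg
    exact ⟨b, φ, d ≫ e.inv, hd.comp (.of_isIso _), by rw [hφ]; simpa using h⟩
  choose b φ d hd hφ using key
  have hm : ∀ (α β : c.obj.Index) (v : α ⟶ β), ∃ χ : b α ⟶ b β,
      c.cones.map v ≫ d β = d α ≫ S.cone.map χ ∧ χ ≫ φ β = φ α := by
    intro α β v
    obtain ⟨l, hl, hl'⟩ := (S.isFace (φ β)).exists_lift_of_isDominant (hd α) (S.cone.map (φ α))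
      (c.cones.map v ≫ d β) (by
        rw [assoc, hφ, hφ, ← Functor.map_comp_assoc, Subsingleton.elim (v ≫ _) (ht.to α)])
    obtain ⟨χ, h1, h2⟩ := S.exists_hom _ _ l hl
    exact ⟨χ, by rw [h1, hl'], h2⟩
  choose m hm hmφ using hm
  have hdom : IsDominant (S.cone.map (φ t)) := IsDominant.of_comp (f := d t) (by
    rw [hφ, Subsingleton.elim (ht.to t) (𝟙 t), map_id, id_comp]
    exact hψ)
  have := S.isIso_of_isDominant _ hdom
  refine ⟨{ obj := b, map := m _ _, map_id := fun α => S.cancel (φ α) (by rw [hmφ]; simp),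
            map_comp := fun v w => S.cancel (φ _) (by
              rw [hmφ, assoc, hmφ, hmφ]) }, d, fun v => hm _ _ v, hd, asIso (φ t), ?_⟩
  rw [asIso_hom, hφ, Subsingleton.elim (ht.to t) (𝟙 t), map_id, id_comp]

end CombConeStack

section Tops

variable {T T' : RPCC.{u}}

lemma RPCC.isIso_mapAt_of_eq {h : T ⟶ T} (e : h = 𝟙 T) (α : T.obj.Index) :
    IsIso (RPCC.mapAt h α) := by
  subst e
  exact inferInstanceAs (IsIso (𝟙 (T.obj.cone α.idx)))

instance RPCC.isIso_mapAt (f : T ⟶ T') [IsIso f] (α : T.obj.Index) : IsIso (RPCC.mapAt f α) := by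
  have key : ∀ {T T' : RPCC.{u}} (f : T ⟶ T') (g : T' ⟶ T) (_ : f ≫ g = 𝟙 T) (α : T.obj.Index),
      IsIso (RPCC.mapAt f α ≫ RPCC.mapAt g (RPCC.im f α)) := fun f g e α =>
    RPCC.isIso_mapAt_of_eq e α
  have h1 := key f (inv f) (by simp) α
  have h2 := key (inv f) f (by simp) (RPCC.im f α)
  have : IsSplitEpi (RPCC.mapAt (inv f) (RPCC.im f α)) :=
    ⟨⟨inv (RPCC.mapAt f α ≫ RPCC.mapAt (inv f) (RPCC.im f α)) ≫ RPCC.mapAt f α, by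
      rw [assoc, IsIso.inv_hom_id]⟩⟩
  have : Mono (RPCC.mapAt (inv f) (RPCC.im f α)) :=
    mono_of_mono _ (RPCC.mapAt f (RPCC.im (inv f) (RPCC.im f α)))
  have : IsIso (RPCC.mapAt (inv f) (RPCC.im f α)) := isIso_of_mono_of_isSplitEpi _
  exact IsIso.of_isIso_comp_right _ (RPCC.mapAt (inv f) (RPCC.im f α))

lemma RPCC.im_of_eq {h : T ⟶ T} (e : h = 𝟙 T) (α : T.obj.Index) : RPCC.im h α = α := by
  subst e; rfl

lemma RPCC.isTop_im (e : T ≅ T') {t : T.obj.Index} (ht : T.IsTop t.idx) :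
    T'.IsTop (RPCC.im e.hom t).idx := by
  intro β
  have h : RPCC.im e.hom (RPCC.im e.inv ⟨β⟩) = ⟨β⟩ :=
    RPCC.im_of_eq (h := e.inv ≫ e.hom) e.inv_hom_id _
  have w : (⟨β⟩ : T'.obj.Index) ⟶ RPCC.im e.hom t := eqToHom h.symm ≫ RPCC.imMap e.hom (ht.to _)
  exact ⟨w.1, w.2⟩

variable {𝒳 : Based.{u}}

/-- The largest cone of the domain of a chart. -/
def Topped.topIdx (c : Topped.{u}) : c.cx.obj.Index := ⟨c.top⟩

lemma Topped.isTop_topIdx (c : Topped.{u}) : c.cx.IsTop c.topIdx.idx := c.isTop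

/-- The largest cone of the complex over which a chart lives. -/
def Chart.t (a : Chart 𝒳) : (𝒳.p.obj a.pt).obj.Index := RPCC.im a.iso.hom a.dom.topIdx

lemma Chart.isTop (a : Chart 𝒳) : (𝒳.p.obj a.pt).IsTop a.t.idx :=
  RPCC.isTop_im a.iso a.dom.isTop_topIdx

/-- The identification of the cone of a chart with a largest cone. -/
def Chart.atTop (a : Chart 𝒳) : (Chart.cone 𝒳).obj a ⟶ (𝒳.p.obj a.pt).cones.obj a.t :=
  RPCC.mapAt a.iso.hom a.dom.topIdx

instance (a : Chart 𝒳) : IsIso a.atTop :=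
  inferInstanceAs (IsIso (RPCC.mapAt a.iso.hom a.dom.topIdx))

lemma Topped.ev_comp_mapAt {c c' : Topped.{u}} (k : c ⟶ c') (r : c'.cx ⟶ T) (r' : c.cx ⟶ T)
    (h : Topped.hom k ≫ r = r') {i : T.obj.Index} (v : RPCC.im r c'.topIdx ⟶ i)
    (v' : RPCC.im r' c.topIdx ⟶ i) :
    Topped.ev.map k ≫ RPCC.mapAt r c'.topIdx ≫ T.cones.map v =
      RPCC.mapAt r' c.topIdx ≫ T.cones.map v' := by
  subst h
  exact Topped.ev_comp_atTop k r v.2 v'.2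

lemma Chart.hom_domain_comp {a b : Chart 𝒳} (f : a ⟶ b) :
    Topped.hom ((Chart.domain 𝒳).map f) ≫ b.iso.hom = a.iso.hom ≫ 𝒳.p.map (Chart.hom f) := by
  have : (a.iso.hom ≫ 𝒳.p.map (Chart.hom f) ≫ b.iso.inv) ≫ b.iso.hom =
    a.iso.hom ≫ 𝒳.p.map (Chart.hom f) := by simp
  exact this

lemma Chart.atTop_naturality {a b : Chart 𝒳} (f : a ⟶ b)
    (w : RPCC.im (𝒳.p.map (Chart.hom f)) a.t ⟶ b.t) :
    (Chart.cone 𝒳).map f ≫ b.atTop =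
      a.atTop ≫ RPCC.mapAt (𝒳.p.map (Chart.hom f)) a.t ≫ (𝒳.p.obj b.pt).cones.map w := by
  have := Topped.ev_comp_mapAt ((Chart.domain 𝒳).map f) b.iso.hom
    (a.iso.hom ≫ 𝒳.p.map (Chart.hom f)) (Chart.hom_domain_comp f) (𝟙 b.t) w
  exact ((congrArg ((Chart.cone 𝒳).map f ≫ ·) ((congrArg (b.atTop ≫ ·)
    ((𝒳.p.obj b.pt).cones.map_id b.t)).trans (comp_id b.atTop))).symm.trans this).trans
    (assoc _ _ _)

end Tops

namespace CombConeStack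

variable {S : CombConeStack.{u}}

/-- The category of cones with a dominant map to a cone of `S`. -/
structure Mark (S : CombConeStack.{u}) : Type (u + 1) where
  cone : RPC.{u}
  pt : S.based.obj
  map : cone ⟶ S.cone.obj pt
  dominant : IsDominant map

/-- A morphism of cones with dominant maps to cones of `S`. -/
@[ext]
structure Mark.Hom (x y : S.Mark) : Type u where
  cone : x.cone ⟶ y.cone
  pt : x.pt ⟶ y.pt
  comm : cone ≫ y.map = x.map ≫ S.cone.map pt

instance : Category.{u} S.Mark where
  Hom := Mark.Hom
  id x := ⟨𝟙 _, 𝟙 _, by simp⟩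
  comp f g := ⟨f.cone ≫ g.cone, f.pt ≫ g.pt, by
    rw [assoc, g.comm, ← assoc, f.comm, assoc, map_comp]⟩
  id_comp f := Mark.Hom.ext (id_comp _) (id_comp _)
  comp_id f := Mark.Hom.ext (comp_id _) (comp_id _)
  assoc f g h := Mark.Hom.ext (assoc _ _ _) (assoc _ _ _)

variable (S) in
/-- The underlying cone. -/
@[simps] def Mark.coneFunctor : S.Mark ⥤ RPC.{u} where
  obj x := x.cone
  map f := Mark.Hom.cone f

variable (S) in
/-- The underlying object of `S`. -/
@[simps] def Mark.ptFunctor : S.Mark ⥤ S.based.obj where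
  obj x := x.pt
  map f := Mark.Hom.pt f

lemma Mark.hom_ext {x y : S.Mark} {f g : x ⟶ y} (h : Mark.Hom.cone f = Mark.Hom.cone g)
    (h' : Mark.Hom.pt f = Mark.Hom.pt g) : f = g := Mark.Hom.ext h h'

lemma Mark.isIso {x y : S.Mark} (f : x ⟶ y) [IsIso (Mark.Hom.cone f)] [IsIso (Mark.Hom.pt f)] :
    IsIso f := by
  let g : y ⟶ x := (⟨inv (Mark.Hom.cone f), inv (Mark.Hom.pt f), by
    rw [IsIso.inv_comp_eq, ← assoc, f.comm, assoc, ← map_comp,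
      IsIso.hom_inv_id, map_id, comp_id]⟩ : Mark.Hom y x)
  exact ⟨g, Mark.hom_ext (IsIso.hom_inv_id (Mark.Hom.cone f)) (IsIso.hom_inv_id (Mark.Hom.pt f)),
    Mark.hom_ext (IsIso.inv_hom_id (Mark.Hom.cone f)) (IsIso.inv_hom_id (Mark.Hom.pt f))⟩

/-- The object of `S` at a cone of a family, together with the map to it from the value at a chart
mapping to the family. -/
def Fam.at {z x : S.Fam} (m : z ⟶ x) {t : z.base.obj.Index} {α : x.base.obj.Index}
    (v : RPCC.im (Fam.hb m) t ⟶ α) : z.fn.obj t ⟶ x.fn.obj α := Fam.ha m t ≫ x.fn.map v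

lemma Fam.at_fn {z x : S.Fam} (m : z ⟶ x) {t : z.base.obj.Index} {α β : x.base.obj.Index}
    (v : RPCC.im (Fam.hb m) t ⟶ α) (w : α ⟶ β) :
    Fam.at m v ≫ x.fn.map w = Fam.at m (v ≫ w) := by
  rw [Fam.at, Fam.at, map_comp, assoc]

lemma Fam.fn_at {z x : S.Fam} (m : z ⟶ x) {s t : z.base.obj.Index} {α : x.base.obj.Index}
    (v : RPCC.im (Fam.hb m) t ⟶ α) (w : s ⟶ t) (v' : RPCC.im (Fam.hb m) s ⟶ α) :
    z.fn.map w ≫ Fam.at m v = Fam.at m v' := by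
  rw [Fam.at, Fam.at, ← assoc, Fam.ha_natural m w (RPCC.imMap _ w), assoc,
    ← map_comp, Subsingleton.elim (_ ≫ v) v']

lemma Fam.at_comp {z x y : S.Fam} (m : z ⟶ x) (f : x ⟶ y) {t : z.base.obj.Index}
    {α : x.base.obj.Index} {β : y.base.obj.Index} (v : RPCC.im (Fam.hb m) t ⟶ α)
    (w : RPCC.im (Fam.hb f) α ⟶ β) (w' : RPCC.im (Fam.hb (m ≫ f)) t ⟶ β) :
    Fam.at m v ≫ Fam.at f w = Fam.at (m ≫ f) w' := by
  have h1 : Fam.at (m ≫ f) w' = Fam.ha m t ≫ Fam.at f (t := RPCC.im (Fam.hb m) t) (α := β) w' :=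
    assoc _ _ _
  rw [h1, Fam.at, assoc, Fam.fn_at f w v (w' :)]

lemma Fam.at_id (z : S.Fam) {t : z.base.obj.Index} (v : RPCC.im (Fam.hb (𝟙 z)) t ⟶ t) :
    Fam.at (𝟙 z) v = 𝟙 _ := by
  have h : z.fn.map (show t ⟶ t from v) = 𝟙 (z.fn.obj t) := by
    rw [Subsingleton.elim (show t ⟶ t from v) (𝟙 t), map_id]
  exact (congrArg (𝟙 (z.fn.obj t) ≫ ·) h).trans (comp_id _)

lemma Fam.at_comm {z x : S.Fam} (m : z ⟶ x) {t : z.base.obj.Index} {α : x.base.obj.Index}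
    (v : RPCC.im (Fam.hb m) t ⟶ α) :
    z.map t ≫ S.cone.map (Fam.at m v) = RPCC.mapAt (Fam.hb m) t ≫ x.base.cones.map v ≫ x.map α := by
  rw [Fam.at, map_comp, ← assoc, Fam.ha_comm, assoc, x.naturality]

lemma Fam.isIso_at {z x : S.Fam} (m : z ⟶ x) {t : z.base.obj.Index} {α : x.base.obj.Index}
    (v : RPCC.im (Fam.hb m) t ⟶ α) (w : α ⟶ RPCC.im (Fam.hb m) t) : IsIso (Fam.at m v) := by
  have := Fam.isIso_ha m t
  have h : IsIso v := ⟨w, Subsingleton.elim _ _, Subsingleton.elim _ _⟩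
  unfold Fam.at
  infer_instance

lemma Fam.at_injective {x y : S.Fam} (f g : x ⟶ y) (h : Fam.hb f = Fam.hb g) 
    (H : ∀ α, ∃ (β : y.base.obj.Index) (v : RPCC.im (Fam.hb f) α ⟶ β)
      (w : RPCC.im (Fam.hb g) α ⟶ β), Fam.at f v = Fam.at g w) : f = g := by
  refine Fam.Hom.ext' h fun α w => ?_
  obtain ⟨β, v, v', e⟩ := H α
  refine S.cancel (y.fn.map v') ?_
  refine Eq.trans ?_ e
  have (w : RPCC.im (Fam.hb f) α ⟶ RPCC.im (Fam.hb g) α) :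
      (Fam.ha f α ≫ y.fn.map w) ≫ y.fn.map v' = Fam.ha f α ≫ y.fn.map v := by
    rw [assoc, ← map_comp, Subsingleton.elim (w ≫ v') v]
  exact this w

/-- The family underlying a chart. -/
def fam (a : Chart S.geom) : S.Fam := a.pt

/-- The morphism of families underlying a morphism of charts. -/
def famHom {a b : Chart S.geom} (f : a ⟶ b) : fam a ⟶ fam b := Chart.hom f

/-- The largest cone of the family underlying a chart. -/
def famTop (a : Chart S.geom) : (fam a).base.obj.Index := a.t

lemma famTop_isTop (a : Chart S.geom) : (fam a).base.IsTop (famTop a).idx := a.isTop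

/-- The value of a morphism of charts at the largest cones. -/
def valMap {a b : Chart S.geom} (f : a ⟶ b) :
    (fam a).fn.obj (famTop a) ⟶ (fam b).fn.obj (famTop b) :=
  Fam.at (famHom f) ((famTop_isTop b).to _)

lemma valMap_eq {a b : Chart S.geom} (f : a ⟶ b) (v : RPCC.im (Fam.hb (famHom f)) (famTop a) ⟶
    famTop b) : valMap f = Fam.at (famHom f) v := by
  rw [valMap, Subsingleton.elim v]

/-- The identification of the cone of a chart with the largest cone. -/
def famCone (a : Chart S.geom) :
    (Chart.cone S.geom).obj a ⟶ (fam a).base.cones.obj (famTop a) := a.atTop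

instance (a : Chart S.geom) : IsIso (famCone a) := inferInstanceAs (IsIso a.atTop)

lemma famCone_naturality {a b : Chart S.geom} (f : a ⟶ b)
    (w : RPCC.im (Fam.hb (famHom f)) (famTop a) ⟶ famTop b) :
    (Chart.cone S.geom).map f ≫ famCone b =
      famCone a ≫ RPCC.mapAt (Fam.hb (famHom f)) (famTop a) ≫ (fam b).base.cones.map w :=
  Chart.atTop_naturality f w

/-- The cone of a chart with its dominant map to a cone of `S`. -/
def markMap (a : Chart S.geom) :
    (Chart.cone S.geom).obj a ⟶ S.cone.obj ((fam a).fn.obj (famTop a)) :=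
  famCone a ≫ (fam a).map (famTop a)

lemma markMap_naturality {a b : Chart S.geom} (f : a ⟶ b) :
    (Chart.cone S.geom).map f ≫ markMap b = markMap a ≫ S.cone.map (valMap f) := by
  rw [markMap, markMap, ← assoc, famCone_naturality f ((famTop_isTop b).to _), valMap,
    assoc, assoc, assoc, Fam.at_comm]

variable (S) in
/-- The functor from charts of the category associated with `S` to cones marked by cones of `S`. -/
def mark : Chart S.geom ⥤ S.Mark where
  obj a := ⟨(Chart.cone S.geom).obj a, (fam a).fn.obj (famTop a), markMap a,
    (IsDominant.of_isIso _).comp ((fam a).dominant _)⟩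
  map f := ⟨(Chart.cone S.geom).map f, valMap f, markMap_naturality f⟩
  map_id a := Mark.hom_ext ((Chart.cone S.geom).map_id a) (Fam.at_id (fam a) _)
  map_comp {a b c} f g := Mark.hom_ext ((Chart.cone S.geom).map_comp f g)
    (Fam.at_comp (famHom f) (famHom g) ((famTop_isTop b).to _) ((famTop_isTop c).to _) _).symm

lemma mark_map_cone {a b : Chart S.geom} (f : a ⟶ b) :
    Mark.Hom.cone ((mark S).map f) = (Chart.cone S.geom).map f := rfl

instance : (mark S).Faithful where
  map_injective {a b f g} h := by
    have h1 : (Chart.cone S.geom).map f = (Chart.cone S.geom).map g := congrArg Mark.Hom.cone h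
    have h2 : valMap f = valMap g := congrArg Mark.Hom.pt h
    have hb : Fam.hb (famHom f) = Fam.hb (famHom g) := Chart.p_map_eq h1
    refine Chart.hom_ext (Fam.hom_ext_top (x := fam a) (famTop_isTop a) (f := famHom f)
      (g := famHom g) hb fun w => ?_)
    refine S.cancel ((fam b).fn.map ((famTop_isTop b).to _)) ?_
    rw [assoc, ← map_comp, Subsingleton.elim (w ≫ _) ((famTop_isTop b).to _)]
    exact h2

instance : (mark S).Full where
  map_surjective {a b} := by
    rintro ⟨k, e, h⟩
    change (fam a).fn.obj (famTop a) ⟶ (fam b).fn.obj (famTop b) at e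
    obtain ⟨k, rfl⟩ := Topped.ev.map_surjective (X := a.dom) (Y := b.dom) k
    let r : (fam a).base ⟶ (fam b).base := a.iso.inv ≫ Topped.hom k ≫ b.iso.hom
    let k' : (Chart.cone S.geom).obj a ⟶ (Chart.cone S.geom).obj b := Topped.ev.map k
    have hr : k' ≫ famCone b ≫ (fam b).base.cones.map (𝟙 (famTop b)) =
        (famCone a ≫ RPCC.mapAt r (famTop a)) ≫ (fam b).base.cones.map ((famTop_isTop b).to _) :=
      Topped.ev_comp_mapAt k b.iso.hom (a.iso.hom ≫ r)
        (a.iso.hom_inv_id_assoc (Topped.hom k ≫ b.iso.hom)).symm (𝟙 b.t) ((famTop_isTop b).to _)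
    rw [map_id, comp_id, assoc] at hr
    have h1 : RPCC.mapAt r (famTop a) ≫ (fam b).base.cones.map ((famTop_isTop b).to _) ≫
        (fam b).map (famTop b) = (fam a).map (famTop a) ≫ S.cone.map e := by
      have : k' ≫ famCone b ≫ (fam b).map (famTop b) =
          (famCone a ≫ (fam a).map (famTop a)) ≫ S.cone.map e := h
      rw [← assoc, hr, assoc, assoc, assoc] at this
      exact (cancel_epi (famCone a)).1 this
    obtain ⟨l, hl, hl'⟩ := (S.isFace ((fam b).fn.map ((famTop_isTop b).to
      (RPCC.im r (famTop a))))).exists_lift_of_isDominant ((fam a).dominant (famTop a))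
      (S.cone.map e) (RPCC.mapAt r (famTop a) ≫ (fam b).map (RPCC.im r (famTop a))) (by
        rw [assoc, ← Fam.naturality, h1])
    obtain ⟨e', he', he⟩ := S.exists_hom _ _ l hl
    obtain ⟨f, hf, hf'⟩ := Fam.exists_hom_top (famTop_isTop a) r e' (by rw [he', hl'])
    refine ⟨Chart.mkHom f, Mark.hom_ext ?_ ?_⟩
    · have : a.iso.hom ≫ (a.iso.inv ≫ Topped.hom k ≫ b.iso.hom) ≫ b.iso.inv = Topped.hom k := by
        simp
      exact congrArg (fun k : a.dom ⟶ b.dom => Topped.ev.map k)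
        ((congrArg (fun r => a.iso.hom ≫ r ≫ b.iso.inv) hf).trans this)
    · refine Eq.trans ?_ he
      rw [← hf' (eqToHom (by rw [hf])), assoc, ← map_comp]
      exact valMap_eq (a := a) (b := b) (Chart.mkHom f) _

instance : (mark S).EssSurj where
  mem_essImage x := by
    let c := Topped.ev.objPreimage x.cone
    let e : c.cx.cones.obj c.topIdx ≅ x.cone := Topped.ev.objObjPreimageIso x.cone
    obtain ⟨fn, map, hn, hd, i, hi⟩ := exists_fam c.cx c.topIdx c.isTop x.pt (e.hom ≫ x.map)
      ((IsDominant.of_isIso _).comp x.dominant)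
    let a : Chart S.geom := ⟨(⟨c.cx, fn, map, hn, hd⟩ : S.Fam), c, Iso.refl _⟩
    let f : (mark S).obj a ⟶ x := (⟨e.hom, i.hom, by
      refine hi.symm.trans (congrArg (· ≫ S.cone.map i.hom) ?_)
      exact (id_comp _).symm⟩ : Mark.Hom _ _)
    have h1 : IsIso (Mark.Hom.cone f) := inferInstanceAs (IsIso e.hom)
    have h2 : IsIso (Mark.Hom.pt f) := inferInstanceAs (IsIso i.hom)
    exact ⟨a, ⟨@asIso _ _ _ _ f (Mark.isIso f)⟩⟩

instance : (mark S).IsEquivalence where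

end CombConeStack

section ChartsAt

variable {T T' T'' : RPCC.{u}}

lemma RPCC.mapAt_congr {f g : T ⟶ T'} (h : f = g) (α : T.obj.Index) {β : T'.obj.Index}
    (v : RPCC.im f α ⟶ β) (w : RPCC.im g α ⟶ β) :
    RPCC.mapAt f α ≫ T'.cones.map v = RPCC.mapAt g α ≫ T'.cones.map w := by
  subst h
  rw [Subsingleton.elim v w]

lemma RPCC.mapAt_comp (f : T ⟶ T') (g : T' ⟶ T'') {α : T.obj.Index} {β : T'.obj.Index}
    {γ : T''.obj.Index} (v : RPCC.im f α ⟶ β) (w : RPCC.im g β ⟶ γ)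
    (w' : RPCC.im (f ≫ g) α ⟶ γ) :
    (RPCC.mapAt f α ≫ T'.cones.map v) ≫ RPCC.mapAt g β ≫ T''.cones.map w =
      RPCC.mapAt (f ≫ g) α ≫ T''.cones.map w' := by
  have h (w' : RPCC.im g (RPCC.im f α) ⟶ γ) :
      (RPCC.mapAt f α ≫ T'.cones.map v) ≫ RPCC.mapAt g β ≫ T''.cones.map w =
      (RPCC.mapAt f α ≫ RPCC.mapAt g (RPCC.im f α)) ≫ T''.cones.map w' := by
    rw [assoc, ← assoc (T'.cones.map v), RPCC.mapAt_naturality g v (RPCC.imMap g v), assoc, assoc,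
      ← map_comp, Subsingleton.elim (RPCC.imMap g v ≫ w) w']
  exact h w'

lemma RPCC.im_congr {f g : T ⟶ T'} (h : f = g) (α : T.obj.Index) : RPCC.im f α = RPCC.im g α := by
  rw [h]

variable {𝒳 𝒴 : Based.{u}}

/-- The map of cones induced by a morphism from a chart. -/
def Chart.coneTo (a : Chart 𝒳) {x : 𝒳.obj} (f : a.pt ⟶ x) {α : (𝒳.p.obj x).obj.Index}
    (v : RPCC.im (𝒳.p.map f) a.t ⟶ α) : (Chart.cone 𝒳).obj a ⟶ (𝒳.p.obj x).cones.obj α :=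
  a.atTop ≫ RPCC.mapAt (𝒳.p.map f) a.t ≫ (𝒳.p.obj x).cones.map v

lemma Chart.comp_coneTo {a b : Chart 𝒳} (n : b ⟶ a) {x : 𝒳.obj} (f : a.pt ⟶ x)
    {α : (𝒳.p.obj x).obj.Index} (v : RPCC.im (𝒳.p.map f) a.t ⟶ α) {f' : b.pt ⟶ x}
    (hf : Chart.hom n ≫ f = f') (v' : RPCC.im (𝒳.p.map f') b.t ⟶ α) :
    (Chart.cone 𝒳).map n ≫ a.coneTo f v = b.coneTo f' v' := by
  have h : 𝒳.p.map (Chart.hom n) ≫ 𝒳.p.map f = 𝒳.p.map f' := by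
    rw [← hf, map_comp]
  rw [Chart.coneTo, ← assoc, Chart.atTop_naturality n (a.isTop.to _), assoc,
    RPCC.mapAt_comp _ _ (a.isTop.to _) v (RPCC.imMap (𝒳.p.map f) (a.isTop.to _) ≫ v),
    RPCC.mapAt_congr h b.t _ v']
  rfl

lemma Chart.coneTo_comp (a : Chart 𝒳) {x y : 𝒳.obj} (f : a.pt ⟶ x)
    {α : (𝒳.p.obj x).obj.Index} (v : RPCC.im (𝒳.p.map f) a.t ⟶ α) (g : x ⟶ y) {f' : a.pt ⟶ y}
    (hf : f ≫ g = f') {β : (𝒳.p.obj y).obj.Index} (w : RPCC.im (𝒳.p.map g) α ⟶ β)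
    (v' : RPCC.im (𝒳.p.map f') a.t ⟶ β) :
    a.coneTo f v ≫ RPCC.mapAt (𝒳.p.map g) α ≫ (𝒳.p.obj y).cones.map w = a.coneTo f' v' := by
  have h : 𝒳.p.map f ≫ 𝒳.p.map g = 𝒳.p.map f' := by rw [← hf, map_comp]
  rw [Chart.coneTo, assoc, 
    RPCC.mapAt_comp _ _ v w (RPCC.imMap (𝒳.p.map g) v ≫ w), RPCC.mapAt_congr h a.t _ v']
  rfl

namespace IsFiberedInGroupoids

variable (h : IsFiberedInGroupoids 𝒳) (x : 𝒳.obj) (α : (𝒳.p.obj x).obj.Index)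

/-- The restriction of an object to a cone of the underlying complex. -/
def chartAt : Chart 𝒳 :=
  ⟨(h.exists_chart x ((𝒳.p.obj x).faceTop α.idx) ((𝒳.p.obj x).faceIncl α.idx)).choose, _,
    (h.exists_chart x ((𝒳.p.obj x).faceTop α.idx) ((𝒳.p.obj x).faceIncl α.idx)).choose_spec.choose⟩

/-- The canonical map from the restriction. -/
def chartTo : (h.chartAt x α).pt ⟶ x := (h.exists_chart x ((𝒳.p.obj x).faceTop α.idx)
    ((𝒳.p.obj x).faceIncl α.idx)).choose_spec.choose_spec.choose

lemma chartTo_spec : (h.chartAt x α).iso.hom ≫ 𝒳.p.map (h.chartTo x α) =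
    (𝒳.p.obj x).faceIncl α.idx :=
  (h.exists_chart x ((𝒳.p.obj x).faceTop α.idx)
    ((𝒳.p.obj x).faceIncl α.idx)).choose_spec.choose_spec.choose_spec

lemma im_chartTo : RPCC.im (𝒳.p.map (h.chartTo x α)) (h.chartAt x α).t = α :=
  RPCC.im_congr (h.chartTo_spec x α) _

/-- The largest cone of the restriction to `α` maps to `α`. -/
def chartIdx : RPCC.im (𝒳.p.map (h.chartTo x α)) (h.chartAt x α).t ⟶ α := eqToHom (h.im_chartTo x α)

/-- The identification of the cone of the restriction to `α` with the cone at `α`. -/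
def chartCone : (Chart.cone 𝒳).obj (h.chartAt x α) ⟶ (𝒳.p.obj x).cones.obj α :=
  (h.chartAt x α).coneTo (h.chartTo x α) (h.chartIdx x α)

instance : IsIso (h.chartCone x α) := by
  have e : h.chartCone x α = 𝟙 ((𝒳.p.obj x).cones.obj α) := by
    refine (assoc _ _ _).symm.trans ((RPCC.mapAt_congr (h.chartTo_spec x α) _ _ (𝟙 α)).trans
      ((congrArg (𝟙 ((𝒳.p.obj x).cones.obj α) ≫ ·) ((𝒳.p.obj x).cones.map_id α)).trans (comp_id _)))
  rw [e]
  exact inferInstanceAs (IsIso (𝟙 ((𝒳.p.obj x).cones.obj α)))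

instance (T : RPCC.{u}) (i : T.obj.ι) : IsIso ((T.faceTop i).atTop (T.faceIncl i)) :=
  inferInstanceAs (IsIso (𝟙 (T.obj.cone i)))

variable {x α}

lemma exists_chartLift {a : Chart 𝒳} (f : a.pt ⟶ x) (v : RPCC.im (𝒳.p.map f) a.t ⟶ α) :
    ∃ n : a ⟶ h.chartAt x α, Chart.hom n ≫ h.chartTo x α = f := by
  obtain ⟨k, hk⟩ := Topped.exists_hom_over (c := a.dom) (c' := (𝒳.p.obj x).faceTop α.idx)
    (a.iso.hom ≫ 𝒳.p.map f) ((𝒳.p.obj x).faceIncl α.idx) ⟨v.1, v.2⟩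
  obtain ⟨n, -, hn⟩ := h.exists_hom_chart (a := h.chartAt x α) (a' := a) (h.chartTo x α) f k
    ((congrArg (Topped.hom k ≫ ·) (h.chartTo_spec x α)).trans hk)
  exact ⟨n, hn⟩

/-- Maps from charts to an object factor through restrictions. -/
def chartLift {a : Chart 𝒳} (f : a.pt ⟶ x) (v : RPCC.im (𝒳.p.map f) a.t ⟶ α) :
    a ⟶ h.chartAt x α := (h.exists_chartLift f v).choose

lemma chartLift_chartTo {a : Chart 𝒳} (f : a.pt ⟶ x) (v : RPCC.im (𝒳.p.map f) a.t ⟶ α) :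
    Chart.hom (h.chartLift f v) ≫ h.chartTo x α = f := (h.exists_chartLift f v).choose_spec

lemma chartLift_chartTo_assoc {a : Chart 𝒳} (f : a.pt ⟶ x) (v : RPCC.im (𝒳.p.map f) a.t ⟶ α)
    {y : 𝒳.obj} (k : x ⟶ y) : Chart.hom (h.chartLift f v) ≫ h.chartTo x α ≫ k = f ≫ k := by
  rw [← assoc, chartLift_chartTo]

lemma chartTo_cancel {a : Chart 𝒳} {n n' : a ⟶ h.chartAt x α}
    (e : Chart.hom n ≫ h.chartTo x α = Chart.hom n' ≫ h.chartTo x α) : n = n' := by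
  have key (n : a ⟶ h.chartAt x α) : Topped.hom ((Chart.domain 𝒳).map n) ≫
      (𝒳.p.obj x).faceIncl α.idx = a.iso.hom ≫ 𝒳.p.map (Chart.hom n ≫ h.chartTo x α) := by
    have h1 := congrArg (· ≫ 𝒳.p.map (h.chartTo x α)) (Chart.hom_domain_comp n)
    refine (congrArg (Topped.hom ((Chart.domain 𝒳).map n) ≫ ·) (h.chartTo_spec x α)).symm.trans
      ((assoc _ _ _).symm.trans (h1.trans ?_))
    rw [map_comp]
    exact assoc _ _ _
  have hd : (Chart.domain 𝒳).map n = (Chart.domain 𝒳).map n' :=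
    Topped.hom_over_ext (c := a.dom) (c' := (𝒳.p.obj x).faceTop α.idx)
      ((𝒳.p.obj x).faceIncl α.idx) (((key n).trans (by rw [e])).trans (key n').symm)
  exact h.hom_cancel (h.chartTo x α) (Chart.p_map_eq (congrArg Topped.ev.map hd)) e

lemma cone_chartLift {a : Chart 𝒳} (f : a.pt ⟶ x) (v : RPCC.im (𝒳.p.map f) a.t ⟶ α) :
    (Chart.cone 𝒳).map (h.chartLift f v) ≫ h.chartCone x α = a.coneTo f v :=
  Chart.comp_coneTo _ _ _ (h.chartLift_chartTo f v) v

end IsFiberedInGroupoids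

end ChartsAt

namespace CombConeStack

variable {S : CombConeStack.{u}}

lemma Fam.at_congr {z x : S.Fam} {m m' : z ⟶ x} (h : m = m') {t : z.base.obj.Index}
    {α : x.base.obj.Index} (v : RPCC.im (Fam.hb m) t ⟶ α) (v' : RPCC.im (Fam.hb m') t ⟶ α) :
    Fam.at m v = Fam.at m' v' := by
  subst h
  rw [Subsingleton.elim v v']

lemma Fam.hom_ext_at {x y : S.Fam} {t : x.base.obj.Index} (ht : x.base.IsTop t.idx) {f g : x ⟶ y}
    (hb : Fam.hb f = Fam.hb g) {β : y.base.obj.Index} (v : RPCC.im (Fam.hb f) t ⟶ β)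
    (v' : RPCC.im (Fam.hb g) t ⟶ β) (h : Fam.at f v = Fam.at g v') : f = g := by
  refine Fam.hom_ext_top ht hb fun w => S.cancel (y.fn.map v') ?_
  rw [assoc, ← map_comp, Subsingleton.elim (w ≫ v') v]
  exact h

lemma Fam.hom_ext_charts {x y : S.Fam} {f g : x ⟶ y} (hb : Fam.hb f = Fam.hb g)
    (H : ∀ α, ∃ (z : S.Fam) (m : z ⟶ x) (t : z.base.obj.Index) (_ : RPCC.im (Fam.hb m) t = α),
      m ≫ f = m ≫ g) : f = g := by
  refine Fam.at_injective f g hb fun α => ?_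
  obtain ⟨z, m, t, rfl, e⟩ := H α
  have h := Fam.isIso_at m (𝟙 (RPCC.im (Fam.hb m) t)) (𝟙 _)
  refine ⟨_, 𝟙 _, eqToHom (by rw [hb]), ?_⟩
  rw [← cancel_epi (Fam.at m (𝟙 (RPCC.im (Fam.hb m) t))),
    Fam.at_comp m f _ _ (𝟙 (RPCC.im (Fam.hb f) (RPCC.im (Fam.hb m) t))),
    Fam.at_comp m g _ _ (eqToHom (by rw [hb]) :
      RPCC.im (Fam.hb g) (RPCC.im (Fam.hb m) t) ⟶ _)]
  exact Fam.at_congr e _ _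

lemma Fam.exists_glue {x y : S.Fam} (b : x.base ⟶ y.base) (z : x.base.obj.Index → Chart S.geom)
    (m : ∀ α, fam (z α) ⟶ x) (e : ∀ α, RPCC.im (Fam.hb (m α)) (famTop (z α)) = α)
    (he : ∀ α, IsIso (RPCC.mapAt (Fam.hb (m α)) (famTop (z α))))
    (F : ∀ α, fam (z α) ⟶ y) (hF : ∀ α, Fam.hb (F α) = Fam.hb (m α) ≫ b)
    (n : ∀ α β (_ : α ⟶ β), z α ⟶ z β) (hm : ∀ α β v, famHom (n α β v) ≫ m β = m α)
    (hn : ∀ α β v, famHom (n α β v) ≫ F β = F α) :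
    ∃ f : x ⟶ y, Fam.hb f = b ∧ ∀ α, m α ≫ f = F α := by
  let w : ∀ α, RPCC.im (Fam.hb (F α)) (famTop (z α)) ⟶ RPCC.im b α := fun α =>
    eqToHom ((RPCC.im_congr (hF α) _).trans (congrArg (RPCC.im b) (e α)))
  let A : ∀ α, (fam (z α)).fn.obj (famTop (z α)) ⟶ x.fn.obj α := fun α =>
    Fam.at (m α) (eqToHom (e α))
  have hA : ∀ α, IsIso (A α) := fun α => Fam.isIso_at _ _ (eqToHom (e α).symm)
  let app : ∀ α, x.fn.obj α ⟶ y.fn.obj (RPCC.im b α) := fun α => inv (A α) ≫ Fam.at (F α) (w α)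
  have hApp : ∀ α, A α ≫ app α = Fam.at (F α) (w α) := fun α => by simp [app]
  let f : x ⟶ y := (⟨b, app, fun {α β} v w' => by
      rw [← cancel_epi (A α)]
      have h1 : A α ≫ x.fn.map v = valMap (n α β v) ≫ A β := by
        rw [valMap, Fam.at_comp _ _ _ _ ((RPCC.imMap (Fam.hb (m β))
          ((famTop_isTop (z β)).to (RPCC.im (Fam.hb (famHom (n α β v))) (famTop (z α)))) ≫
            eqToHom (e β) :)), Fam.at_fn]
        exact Fam.at_congr (hm α β v).symm _ _
      rw [← assoc, h1, assoc, hApp, ← assoc, hApp, valMap,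
        Fam.at_comp _ _ _ _ ((RPCC.imMap (Fam.hb (F β))
          ((famTop_isTop (z β)).to (RPCC.im (Fam.hb (famHom (n α β v))) (famTop (z α)))) ≫ w β :)), Fam.at_fn]
      exact Fam.at_congr (hn α β v) _ _, fun α => by
      have h1 := Fam.at_comm (m α) (eqToHom (e α))
      have h2 := Fam.at_comm (F α) (w α)
      have hi : IsIso (RPCC.mapAt (Fam.hb (m α)) (famTop (z α)) ≫
        x.base.cones.map (eqToHom (e α))) := inferInstance
      rw [← cancel_epi (RPCC.mapAt (Fam.hb (m α)) (famTop (z α)) ≫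
        x.base.cones.map (eqToHom (e α)))]
      have h3 := congrArg (· ≫ S.cone.map (app α)) h1
      have h4 : S.cone.map (A α) ≫ S.cone.map (app α) = S.cone.map (Fam.at (F α) (w α)) := by
        rw [← map_comp, hApp]
      have h5 := RPCC.mapAt_comp (Fam.hb (m α)) b (eqToHom (e α)) (𝟙 _)
        (eqToHom (congrArg (RPCC.im b) (e α)))
      rw [map_id, comp_id] at h5
      have h6 := RPCC.mapAt_congr (hF α) (famTop (z α)) (w α) (eqToHom (congrArg (RPCC.im b) (e α)))
      rw [← assoc _ (RPCC.mapAt b α), h5, ← h6]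
      simp only [assoc] at h3 ⊢
      rw [← h2, ← h4]
      exact h3.symm⟩ : Fam.Hom x y)
  refine ⟨f, rfl, fun α => ?_⟩
  refine Fam.hom_ext_at (famTop_isTop (z α)) (hF α).symm (β := RPCC.im b α)
    (eqToHom (congrArg (RPCC.im b) (e α))) (w α) ?_
  have h1 := Fam.at_comp (m α) f (eqToHom (e α)) (𝟙 (RPCC.im b α))
    (eqToHom (congrArg (RPCC.im b) (e α)))
  have h2 : Fam.at f (𝟙 (RPCC.im b α)) = app α :=
    (congrArg (app α ≫ ·) (y.fn.map_id _)).trans (comp_id _)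
  rw [h2] at h1
  exact h1.symm.trans (hApp α)

end CombConeStack

namespace CombConeStack

variable {S : CombConeStack.{u}} {𝒳 : Based.{u}}

/-- The family which is the value of a functor at an object. -/
def famObj (K : 𝒳 ⟶ S.geom) (x : 𝒳.obj) : S.Fam := ⟪K⟫.obj x

/-- The value of a functor at a morphism. -/
def famMap (K : 𝒳 ⟶ S.geom) {x y : 𝒳.obj} (f : x ⟶ y) : famObj K x ⟶ famObj K y := ⟪K⟫.map f

lemma famMap_comp (K : 𝒳 ⟶ S.geom) {x y z : 𝒳.obj} (f : x ⟶ y) (g : y ⟶ z) :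
    famMap K (f ≫ g) = famMap K f ≫ famMap K g := ⟪K⟫.map_comp f g

/-- The identification of the complexes underlying an object and its value. -/
def famBase (K : 𝒳 ⟶ S.geom) (x : 𝒳.obj) : (famObj K x).base ≅ 𝒳.p.obj x := baseIso K x

lemma hb_famMap (K : 𝒳 ⟶ S.geom) {x y : 𝒳.obj} (f : x ⟶ y) : Fam.hb (famMap K f) =
    (famBase K x).hom ≫ 𝒳.p.map f ≫ (famBase K y).inv := p_map_map K f

/-- The value of a functor at a morphism from a chart. -/
def chartMap (K : 𝒳 ⟶ S.geom) (a : Chart 𝒳) {x : 𝒳.obj} (f : a.pt ⟶ x) :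
    fam ((Chart.map K).obj a) ⟶ famObj K x := famMap K f

lemma famHom_chartMap (K : 𝒳 ⟶ S.geom) {a b : Chart 𝒳} (n : a ⟶ b) {x : 𝒳.obj} (f : b.pt ⟶ x)
    {f' : a.pt ⟶ x} (h : Chart.hom n ≫ f = f') :
    famHom ((Chart.map K).map n) ≫ chartMap K b f = chartMap K a f' := by
  subst h
  exact (famMap_comp K (Chart.hom n) f).symm

lemma chartMap_famMap (K : 𝒳 ⟶ S.geom) (a : Chart 𝒳) {x y : 𝒳.obj} (f : a.pt ⟶ x) (g : x ⟶ y) :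
    chartMap K a f ≫ famMap K g = chartMap K a (f ≫ g) := (famMap_comp K f g).symm

section

variable (h : IsFiberedInGroupoids 𝒳) (K : 𝒳 ⟶ S.geom) (x : 𝒳.obj) (α : (𝒳.p.obj x).obj.Index)

lemma iso_comp_hb_chartMap : ((Chart.map K).obj (h.chartAt x α)).iso.hom ≫
    Fam.hb (chartMap K _ (h.chartTo x α)) = (𝒳.p.obj x).faceIncl α.idx ≫ (famBase K x).inv := by
  have : ((h.chartAt x α).iso.hom ≫ (famBase K _).inv) ≫
      (famBase K _).hom ≫ 𝒳.p.map (h.chartTo x α) ≫ (famBase K x).inv =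
      (𝒳.p.obj x).faceIncl α.idx ≫ (famBase K x).inv := by
    rw [assoc, Iso.inv_hom_id_assoc, ← assoc, h.chartTo_spec]
    rfl
  exact (congrArg (_ ≫ ·) (hb_famMap K (h.chartTo x α))).trans this

lemma im_chartMap : RPCC.im (Fam.hb (chartMap K _ (h.chartTo x α)))
    (famTop ((Chart.map K).obj (h.chartAt x α))) = RPCC.im (famBase K x).inv α :=
  RPCC.im_congr (iso_comp_hb_chartMap h K x α) _

lemma isIso_mapAt_chartMap : IsIso (RPCC.mapAt (Fam.hb (chartMap K _ (h.chartTo x α)))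
    (famTop ((Chart.map K).obj (h.chartAt x α)))) := by
  have e := RPCC.mapAt_congr (iso_comp_hb_chartMap h K x α) _ (eqToHom (im_chartMap h K x α)) (𝟙 _)
  have e' : (famCone ((Chart.map K).obj (h.chartAt x α)) ≫
      RPCC.mapAt (Fam.hb (chartMap K _ (h.chartTo x α))) (famTop _)) ≫
      (famObj K x).base.cones.map (eqToHom (im_chartMap h K x α)) =
        RPCC.mapAt (famBase K x).inv α :=
    e.trans (((congrArg (_ ≫ ·) (map_id _ _)).trans
      (comp_id _)).trans (id_comp (RPCC.mapAt (famBase K x).inv α)))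
  have h1 : IsIso ((famCone ((Chart.map K).obj (h.chartAt x α)) ≫
      RPCC.mapAt (Fam.hb (chartMap K _ (h.chartTo x α))) (famTop _)) ≫
      (famObj K x).base.cones.map (eqToHom (im_chartMap h K x α))) := by
    rw [e']
    exact @RPCC.isIso_mapAt _ _ (famBase K x).inv (Iso.isIso_inv _) α
  have h2 : IsIso (famCone ((Chart.map K).obj (h.chartAt x α)) ≫
      RPCC.mapAt (Fam.hb (chartMap K _ (h.chartTo x α))) (famTop _)) := IsIso.of_isIso_comp_right _
    ((famObj K x).base.cones.map (eqToHom (im_chartMap h K x α)))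
  exact IsIso.of_isIso_comp_left (famCone ((Chart.map K).obj (h.chartAt x α))) _

end

lemma im_famBase (K : 𝒳 ⟶ S.geom) (x : 𝒳.obj) (α : (famObj K x).base.obj.Index) :
    RPCC.im (famBase K x).inv (RPCC.im (famBase K x).hom α) = α :=
  RPCC.im_of_eq (h := (famBase K x).hom ≫ (famBase K x).inv) (famBase K x).hom_inv_id α

lemma famObj_hom_ext (h : IsFiberedInGroupoids 𝒳) (K : 𝒳 ⟶ S.geom) {x : 𝒳.obj} {y : S.Fam}
    {f g : famObj K x ⟶ y} (hb : Fam.hb f = Fam.hb g)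
    (H : ∀ (a : Chart 𝒳) (m : a.pt ⟶ x), chartMap K a m ≫ f = chartMap K a m ≫ g) : f = g :=
  Fam.hom_ext_charts hb fun α => ⟨_, chartMap K _ (h.chartTo x (RPCC.im (famBase K x).hom α)), _,
    (im_chartMap h K x _).trans (im_famBase K x α), H _ _⟩

lemma famHom_domain {K K' : 𝒳 ⟶ S.geom} {a : Chart 𝒳}
    (f : (Chart.map K).obj a ⟶ (Chart.map K').obj a)
    (hf : (Chart.domain S.geom).map f = 𝟙 a.dom) :
    Fam.hb (famHom f) = (famBase K a.pt).hom ≫ (famBase K' a.pt).inv := by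
  have h1 : Fam.hb (famHom f) = ((Chart.map K).obj a).iso.inv ≫
    Topped.hom ((Chart.domain S.geom).map f) ≫ ((Chart.map K').obj a).iso.hom := Chart.p_map f
  have h2 : ((famBase K a.pt).hom ≫ a.iso.inv) ≫ 𝟙 a.dom.cx ≫ a.iso.hom ≫ (famBase K' a.pt).inv =
    (famBase K a.pt).hom ≫ (famBase K' a.pt).inv := by simp
  rw [hf] at h1
  exact h1.trans h2

lemma exists_trans_of_charts (h : IsFiberedInGroupoids 𝒳) {K K' : 𝒳 ⟶ S.geom}
    (θ : Chart.map K ⟶ Chart.map K') (hθ : ∀ a, (Chart.domain _).map (θ.app a) = 𝟙 a.dom) :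
    ∃ η : K ⟶ K', Chart.mapTrans η = θ := by
  have hb : ∀ a, Fam.hb (famHom (θ.app a)) = (famBase K a.pt).hom ≫ (famBase K' a.pt).inv :=
    fun a => famHom_domain _ (hθ a)
  have hn : ∀ {a b : Chart 𝒳} (n : a ⟶ b), famHom ((Chart.map K).map n) ≫ famHom (θ.app b) =
      famHom (θ.app a) ≫ famHom ((Chart.map K').map n) := fun n => θ.naturality n
  have key : ∀ x, ∃ f : famObj K x ⟶ famObj K' x,
      Fam.hb f = (famBase K x).hom ≫ (famBase K' x).inv ∧ ∀ (a : Chart 𝒳) (m : a.pt ⟶ x),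
        chartMap K a m ≫ f = famHom (θ.app a) ≫ chartMap K' a m := by
    intro x
    let i : (famObj K x).base.obj.Index → (𝒳.p.obj x).obj.Index := RPCC.im (famBase K x).hom
    let n : ∀ α β (_ : α ⟶ β), h.chartAt x (i α) ⟶ h.chartAt x (i β) := fun α β v =>
      h.chartLift (h.chartTo x (i α)) (h.chartIdx x (i α) ≫ RPCC.imMap _ v)
    have hnm : ∀ α β (v : α ⟶ β), Chart.hom (n α β v) ≫ h.chartTo x (i β) = h.chartTo x (i α) :=
      fun α β v => h.chartLift_chartTo _ _
    have hbm : ∀ (a : Chart 𝒳) (m : a.pt ⟶ x), Fam.hb (famHom (θ.app a) ≫ chartMap K' a m) =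
        Fam.hb (chartMap K a m) ≫ (famBase K x).hom ≫ (famBase K' x).inv := fun a m => by
      have h1 : Fam.hb (famHom (θ.app a) ≫ chartMap K' a m) =
        Fam.hb (famHom (θ.app a)) ≫ Fam.hb (chartMap K' a m) := rfl
      have h2 : ((famBase K a.pt).hom ≫ (famBase K' a.pt).inv) ≫
          (famBase K' a.pt).hom ≫ 𝒳.p.map m ≫ (famBase K' x).inv =
          ((famBase K a.pt).hom ≫ 𝒳.p.map m ≫ (famBase K x).inv) ≫
            (famBase K x).hom ≫ (famBase K' x).inv := by simp
      rw [h1, hb]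
      exact (congrArg (_ ≫ ·) (hb_famMap K' m)).trans
        (h2.trans (congrArg (· ≫ _) (hb_famMap K m).symm))
    obtain ⟨f, hf, hf'⟩ := Fam.exists_glue ((famBase K x).hom ≫ (famBase K' x).inv)
      (fun α => (Chart.map K).obj (h.chartAt x (i α))) (fun α => chartMap K _ (h.chartTo x (i α)))
      (fun α => (im_chartMap h K x _).trans (im_famBase K x α))
      (fun α => isIso_mapAt_chartMap h K x _)
      (fun α => famHom (θ.app _) ≫ chartMap K' _ (h.chartTo x (i α))) (fun α => hbm _ _)
      (fun α β v => (Chart.map K).map (n α β v))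
      (fun α β v => famHom_chartMap K (n α β v) _ (hnm α β v)) (fun α β v => by
        rw [← assoc, hn, assoc, famHom_chartMap K' (n α β v) _ (hnm α β v)])
    refine ⟨f, hf, fun a m => ?_⟩
    let α : (famObj K x).base.obj.Index := RPCC.im (famBase K x).inv (RPCC.im (𝒳.p.map m) a.t)
    have hα : RPCC.im (𝒳.p.map m) a.t = i α :=
      (RPCC.im_of_eq (h := (famBase K x).inv ≫ (famBase K x).hom) (famBase K x).inv_hom_id _).symm
    have hl := h.chartLift_chartTo (a := a) (α := i α) m (eqToHom hα)
    rw [← famHom_chartMap K _ _ hl, assoc, hf' α, ← assoc, hn, assoc, famHom_chartMap K' _ _ hl]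
  choose η hη hη' using key
  let η' : K ⟶ K' := mkTrans η (fun {x y} f => famObj_hom_ext h K (by
      have h2 : ((famBase K x).hom ≫ 𝒳.p.map f ≫ (famBase K y).inv) ≫ (famBase K y).hom ≫
          (famBase K' y).inv = ((famBase K x).hom ≫ (famBase K' x).inv) ≫
            (famBase K' x).hom ≫ 𝒳.p.map f ≫ (famBase K' y).inv := by simp
      exact (congrArg₂ (· ≫ ·) (hb_famMap K f) (hη y)).trans
        (h2.trans (congrArg₂ (· ≫ ·) (hη x) (hb_famMap K' f)).symm)) fun a m => by
      change chartMap K a m ≫ famMap K f ≫ η y = chartMap K a m ≫ η x ≫ famMap K' f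
      rw [← assoc, chartMap_famMap, hη', ← assoc, hη', assoc, chartMap_famMap]) hη
  refine ⟨η', NatTrans.ext (funext fun a => ?_)⟩
  have h1 := hη' a.pt a (𝟙 a.pt)
  have h2 : ∀ K : 𝒳 ⟶ S.geom, chartMap K a (𝟙 a.pt) = 𝟙 _ := fun K => ⟪K⟫.map_id a.pt
  rw [h2, h2] at h1
  exact (id_comp _).symm.trans (h1.trans (comp_id _))

lemma trans_ext_charts (h : IsFiberedInGroupoids 𝒳) {K K' : 𝒳 ⟶ S.geom} {η θ : K ⟶ K'}
    (H : ∀ a : Chart 𝒳, appAt η a.pt = appAt θ a.pt) : η = θ := by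
  refine trans_ext fun x => famObj_hom_ext h K ((p_map_appAt η x).trans (p_map_appAt θ x).symm)
    fun a m => ?_
  have h1 : ∀ η : K ⟶ K', chartMap K a m ≫ (appAt η x : famObj K x ⟶ famObj K' x) =
    (appAt η a.pt : famObj K a.pt ⟶ famObj K' a.pt) ≫ famMap K' m := fun η => appAt_naturality η m
  rw [h1, h1, H]

section Functors

variable (h : IsFiberedInGroupoids 𝒳) (V : Chart 𝒳 ⥤ S.Mark)
  (e : V ⋙ Mark.coneFunctor S ≅ Chart.cone 𝒳)

/-- The comparison of the cone of a chart and the cone of its value. -/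
def markInv (a : Chart 𝒳) : (Chart.cone 𝒳).obj a ⟶ (V.obj a).cone := e.inv.app a

lemma markInv_naturality {a b : Chart 𝒳} (n : a ⟶ b) : (Chart.cone 𝒳).map n ≫ markInv V e b =
    markInv V e a ≫ Mark.Hom.cone (V.map n) := e.inv.naturality n

instance (a : Chart 𝒳) : IsIso (markInv V e a) := inferInstanceAs (IsIso (e.inv.app a))

/-- The dominant map from the cone of a chart given by a functor to marked cones. -/
def markCone (a : Chart 𝒳) : (Chart.cone 𝒳).obj a ⟶ S.cone.obj (V.obj a).pt :=
  markInv V e a ≫ (V.obj a).map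

lemma markCone_naturality {a b : Chart 𝒳} (n : a ⟶ b) : (Chart.cone 𝒳).map n ≫ markCone V e b =
    markCone V e a ≫ S.cone.map (Mark.Hom.pt (V.map n)) := by
  have h2 : Mark.Hom.cone (V.map n) ≫ (V.obj b).map = _ := (V.map n).comm
  rw [markCone, ← assoc, markInv_naturality, assoc, markCone, assoc, ← h2]

/-- The image of a morphism of charts. -/
def markPt {a b : Chart 𝒳} (n : a ⟶ b) : (V.obj a).pt ⟶ (V.obj b).pt := Mark.Hom.pt (V.map n)

lemma markPt_comp {a b c : Chart 𝒳} (n : a ⟶ b) (n' : b ⟶ c) :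
    markPt V n ≫ markPt V n' = markPt V (n ≫ n') := by
  rw [markPt, markPt, markPt, V.map_comp]
  rfl

lemma markPt_id (a : Chart 𝒳) : markPt V (𝟙 a) = 𝟙 _ := congrArg Mark.Hom.pt (V.map_id a)

lemma markPt_lift_comp {a : Chart 𝒳} {x y : 𝒳.obj} {α : (𝒳.p.obj x).obj.Index}
    {β : (𝒳.p.obj y).obj.Index} (f : a.pt ⟶ x) (v : RPCC.im (𝒳.p.map f) a.t ⟶ α) 
    (g : (h.chartAt x α).pt ⟶ y) (w : RPCC.im (𝒳.p.map g) (h.chartAt x α).t ⟶ β)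
    {k : a.pt ⟶ y} (u' : RPCC.im (𝒳.p.map k) a.t ⟶ β)
    (H : Chart.hom (h.chartLift f v) ≫ g = k) :
    markPt V (h.chartLift f v) ≫ markPt V (h.chartLift g w) = markPt V (h.chartLift k u') := by
  rw [markPt_comp]
  congr 1
  refine h.chartTo_cancel ?_
  rw [Chart.hom_comp, assoc, h.chartLift_chartTo, h.chartLift_chartTo, H]

lemma markPt_lift_self {x : 𝒳.obj} {α : (𝒳.p.obj x).obj.Index} (f : (h.chartAt x α).pt ⟶ x)
    (v : RPCC.im (𝒳.p.map f) (h.chartAt x α).t ⟶ α) (hf : f = h.chartTo x α) :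
    markPt V (h.chartLift f v) = 𝟙 _ := by
  rw [← markPt_id]
  congr 1
  refine h.chartTo_cancel ?_
  rw [h.chartLift_chartTo, Chart.hom_id, id_comp, hf]

lemma _root_.ConeStacks.Chart.coneTo_map (a : Chart 𝒳) {x : 𝒳.obj} (f : a.pt ⟶ x)
    {α β : (𝒳.p.obj x).obj.Index} (v : RPCC.im (𝒳.p.map f) a.t ⟶ α) (w : α ⟶ β)
    (v' : RPCC.im (𝒳.p.map f) a.t ⟶ β) :
    a.coneTo f v ≫ (𝒳.p.obj x).cones.map w = a.coneTo f v' := by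
  rw [Chart.coneTo, Chart.coneTo, assoc, assoc, ← map_comp, Subsingleton.elim (v ≫ w) v']

/-- The family over an object given by a functor from charts to marked cones. -/
def chartFam (x : 𝒳.obj) : S.Fam where
  base := 𝒳.p.obj x
  fn :=
    { obj := fun α => (V.obj (h.chartAt x α)).pt
      map := fun {α β} v => markPt V (h.chartLift (h.chartTo x α) (h.chartIdx x α ≫ v))
      map_id := fun α => markPt_lift_self h V _ _ rfl
      map_comp := fun {α β γ} v w => (markPt_lift_comp h V _ _ _ _ _
        (h.chartLift_chartTo _ _)).symm }
  map α := inv (h.chartCone x α) ≫ markCone V e (h.chartAt x α)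
  naturality {α β} v := by
    have h1 := h.cone_chartLift (h.chartTo x α) (h.chartIdx x α ≫ v)
    have h2 : h.chartCone x α ≫ (𝒳.p.obj x).cones.map v = _ :=
      Chart.coneTo_map _ (h.chartTo x α) (h.chartIdx x α) v (h.chartIdx x α ≫ v)
    have h3 := markCone_naturality V e (h.chartLift (h.chartTo x α) (h.chartIdx x α ≫ v))
    have h4 : (𝒳.p.obj x).cones.map v ≫ inv (h.chartCone x β) =
        inv (h.chartCone x α) ≫ (Chart.cone 𝒳).map
          (h.chartLift (h.chartTo x α) (h.chartIdx x α ≫ v)) := by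
      rw [IsIso.comp_inv_eq, assoc, h1, IsIso.eq_inv_comp, h2]
    have h5 : (𝒳.p.obj x).cones.map v ≫ inv (h.chartCone x β) ≫ markCone V e (h.chartAt x β) =
        (inv (h.chartCone x α) ≫ markCone V e (h.chartAt x α)) ≫
          S.cone.map (markPt V (h.chartLift (h.chartTo x α) (h.chartIdx x α ≫ v))) := by
      rw [← assoc, h4, assoc, h3, assoc]
      rfl
    exact h5
  dominant α := (IsDominant.of_isIso _).comp ((IsDominant.of_isIso _).comp (V.obj _).dominant)

/-- The comparison of restrictions along a morphism. -/
def chartPush {x y : 𝒳.obj} (f : x ⟶ y) (α : (𝒳.p.obj x).obj.Index) :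
    RPCC.im (𝒳.p.map (h.chartTo x α ≫ f)) (h.chartAt x α).t ⟶ RPCC.im (𝒳.p.map f) α :=
  eqToHom ((RPCC.im_congr (𝒳.p.map_comp _ _) _).trans
    (congrArg (RPCC.im (𝒳.p.map f)) (h.im_chartTo x α)))

/-- The components of the morphism of families given by a morphism. -/
def chartPushPt {x y : 𝒳.obj} (f : x ⟶ y) (α : (𝒳.p.obj x).obj.Index) :
    (V.obj (h.chartAt x α)).pt ⟶ (V.obj (h.chartAt y (RPCC.im (𝒳.p.map f) α))).pt :=
  markPt V (h.chartLift (h.chartTo x α ≫ f) (chartPush h f α))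

lemma chartPushPt_naturality {x y : 𝒳.obj} (f : x ⟶ y) {α β : (𝒳.p.obj x).obj.Index} (v : α ⟶ β)
    (w : RPCC.im (𝒳.p.map f) α ⟶ RPCC.im (𝒳.p.map f) β) :
    markPt V (h.chartLift (h.chartTo x α) (h.chartIdx x α ≫ v)) ≫ chartPushPt h V f β =
      chartPushPt h V f α ≫ markPt V (h.chartLift (h.chartTo y _) (h.chartIdx y _ ≫ w)) :=
  (markPt_lift_comp h V _ _ _ _ (chartPush h f α ≫ w) (h.chartLift_chartTo_assoc _ _ _)).trans
    (markPt_lift_comp h V _ _ _ _ (chartPush h f α ≫ w) (h.chartLift_chartTo _ _)).symm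

lemma chartPushPt_comm {x y : 𝒳.obj} (f : x ⟶ y) (α : (𝒳.p.obj x).obj.Index) :
    (inv (h.chartCone x α) ≫ markCone V e (h.chartAt x α)) ≫ S.cone.map (chartPushPt h V f α) =
      RPCC.mapAt (𝒳.p.map f) α ≫ inv (h.chartCone y (RPCC.im (𝒳.p.map f) α)) ≫
        markCone V e (h.chartAt y (RPCC.im (𝒳.p.map f) α)) := by
  have h1 := h.cone_chartLift (h.chartTo x α ≫ f) (chartPush h f α)
  have h2 : h.chartCone x α ≫ RPCC.mapAt (𝒳.p.map f) α ≫
      (𝒳.p.obj y).cones.map (𝟙 (RPCC.im (𝒳.p.map f) α)) = _ :=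
    Chart.coneTo_comp _ (h.chartTo x α) (h.chartIdx x α) f rfl (𝟙 _) (chartPush h f α)
  rw [map_id, comp_id] at h2
  have h3 := markCone_naturality V e (h.chartLift (h.chartTo x α ≫ f) (chartPush h f α))
  have h4 : RPCC.mapAt (𝒳.p.map f) α ≫ inv (h.chartCone y (RPCC.im (𝒳.p.map f) α)) =
      inv (h.chartCone x α) ≫ (Chart.cone 𝒳).map
        (h.chartLift (h.chartTo x α ≫ f) (chartPush h f α)) := by
    rw [IsIso.comp_inv_eq, assoc, h1, IsIso.eq_inv_comp, h2]
  rw [← assoc (RPCC.mapAt (𝒳.p.map f) α), h4, assoc, assoc, h3]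
  rfl

/-- The morphism of families given by a morphism. -/
def chartFamHom {x y : 𝒳.obj} (f : x ⟶ y) : chartFam h V e x ⟶ chartFam h V e y :=
  (⟨𝒳.p.map f, fun α => chartPushPt h V f α, fun v w => chartPushPt_naturality h V f v w,
    fun α => chartPushPt_comm h V e f α⟩ : Fam.Hom (chartFam h V e x) (chartFam h V e y))

/-- The functor to the category associated with a combinatorial cone stack given by a functor from
charts to marked cones. -/
def chartFunctor : 𝒳 ⟶ S.geom :=
  ({ obj := chartFam h V e
     map := chartFamHom h V e
     map_id := fun x => Fam.Hom.ext' (𝒳.p.map_id x) fun α w => by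
      have h1 : markPt V (h.chartLift (h.chartTo x α ≫ 𝟙 x) (chartPush h (𝟙 x) α)) ≫
          markPt V (h.chartLift (h.chartTo x _) (h.chartIdx x _ ≫ w)) =
          markPt V (h.chartLift (h.chartTo x α ≫ 𝟙 x) (chartPush h (𝟙 x) α ≫ w)) :=
        markPt_lift_comp h V _ _ _ _ _ (h.chartLift_chartTo _ _)
      exact h1.trans (markPt_lift_self h V _ _ (comp_id _))
     map_comp := fun {x y z} f g => Fam.Hom.ext' (𝒳.p.map_comp f g) fun α w => by
      have h1 : markPt V (h.chartLift (h.chartTo x α ≫ f ≫ g) (chartPush h (f ≫ g) α)) ≫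
          markPt V (h.chartLift (h.chartTo z _) (h.chartIdx z _ ≫ w)) =
          markPt V (h.chartLift (h.chartTo x α ≫ f ≫ g) (chartPush h (f ≫ g) α ≫ w)) :=
        markPt_lift_comp h V _ _ _ _ _ (h.chartLift_chartTo _ _)
      have h2 : markPt V (h.chartLift (h.chartTo x α ≫ f) (chartPush h f α)) ≫
          markPt V (h.chartLift (h.chartTo y _ ≫ g) (chartPush h g _)) =
          markPt V (h.chartLift (h.chartTo x α ≫ f ≫ g) (chartPush h (f ≫ g) α ≫ w)) :=
        markPt_lift_comp h V _ _ _ _ _ (by rw [h.chartLift_chartTo_assoc, assoc])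
      exact h1.trans h2.symm
     w := rfl } : BasedFunctor 𝒳 S.geom)

/-- The values of the functor constructed from a functor on charts at a chart. -/
def chartFunctorMarkApp (a : Chart 𝒳) :
    Mark.Hom ((mark S).obj ((Chart.map (chartFunctor h V e)).obj a)) (V.obj a) :=
  ⟨markInv V e a, markPt V (Chart.mkHom (h.chartTo a.pt a.t)), by
    let n : h.chartAt a.pt a.t ⟶ a := Chart.mkHom (h.chartTo a.pt a.t)
    have h1 := markCone_naturality V e n
    have h2 : (Chart.cone 𝒳).map n ≫ a.atTop = h.chartCone a.pt a.t :=
      Chart.atTop_naturality n (h.chartIdx a.pt a.t)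
    have h3 : a.atTop ≫ inv (h.chartCone a.pt a.t) ≫ (Chart.cone 𝒳).map n = 𝟙 _ := by
      rw [← cancel_mono a.atTop, assoc, assoc, h2, IsIso.inv_hom_id, id_comp, comp_id]
    have h4 : markInv V e a ≫ (V.obj a).map = (a.atTop ≫ inv (h.chartCone a.pt a.t) ≫
        markCone V e (h.chartAt a.pt a.t)) ≫ S.cone.map (markPt V n) := by
      rw [assoc, assoc]
      have h5 := congrArg (fun k => a.atTop ≫ inv (h.chartCone a.pt a.t) ≫ k) h1
      refine Eq.trans ?_ h5
      have h6 := congrArg (· ≫ markCone V e a) h3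
      simp only [assoc] at h6
      refine Eq.trans ?_ h6.symm
      exact (id_comp _).symm
    exact h4⟩

/-- The values of the functor constructed from a functor on charts. -/
def chartFunctorMark : Chart.map (chartFunctor h V e) ⋙ mark S ⟶ V where
  app a := chartFunctorMarkApp h V e a
  naturality a b f := Mark.hom_ext (markInv_naturality V e f) (by
    have h1 : (markPt V (h.chartLift (h.chartTo a.pt a.t ≫ Chart.hom f)
          (chartPush h (Chart.hom f) a.t)) ≫
        markPt V (h.chartLift (h.chartTo b.pt (RPCC.im (𝒳.p.map (Chart.hom f)) a.t))
          (h.chartIdx b.pt _ ≫ b.isTop.to _))) ≫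
        markPt V (Chart.mkHom (h.chartTo b.pt b.t) : _ ⟶ b) =
        markPt V (Chart.mkHom (h.chartTo a.pt a.t) : _ ⟶ a) ≫ markPt V f := by
      rw [markPt_comp, markPt_comp, markPt_comp]
      congr 1
      refine Chart.hom_ext ?_
      rw [Chart.hom_comp, Chart.hom_comp, Chart.hom_mkHom, assoc, h.chartLift_chartTo,
        h.chartLift_chartTo]
      rfl
    exact h1)

lemma exists_functor_of_charts (h : IsFiberedInGroupoids 𝒳) (V : Chart 𝒳 ⥤ S.Mark)
    (e : V ⋙ Mark.coneFunctor S ≅ Chart.cone 𝒳) : ∃ (K : 𝒳 ⟶ S.geom) (i : Chart.map K ⋙ mark S ≅ V),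
    ∀ a, Mark.Hom.cone (i.hom.app a) = e.inv.app a := by
  have : ∀ a, IsIso ((chartFunctorMark h V e).app a) := fun a => by
    have h1 : IsIso (Mark.Hom.cone ((chartFunctorMark h V e).app a)) :=
      inferInstanceAs (IsIso (markInv V e a))
    let n : h.chartAt a.pt a.t ⟶ a := Chart.mkHom (h.chartTo a.pt a.t)
    have h2 : (Chart.cone 𝒳).map n ≫ a.atTop = h.chartCone a.pt a.t :=
      Chart.atTop_naturality n (h.chartIdx a.pt a.t)
    have h3 : IsIso ((Chart.cone 𝒳).map n ≫ a.atTop) := by rw [h2]; infer_instance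
    have h4 : IsIso ((Chart.cone 𝒳).map n) := IsIso.of_isIso_comp_right _ a.atTop
    have h5 := h.chart_isIso n
    have h6 : IsIso (Mark.Hom.pt ((chartFunctorMark h V e).app a)) :=
      inferInstanceAs (IsIso ((V ⋙ Mark.ptFunctor S).map n))
    exact Mark.isIso _
  have := NatIso.isIso_of_isIso_app (chartFunctorMark h V e)
  exact ⟨chartFunctor h V e, asIso (chartFunctorMark h V e), fun a => rfl⟩

end Functors

end CombConeStack

section Sieves

variable {C : Type (u + 1)} [Category.{u} C] {T : C}

/-- An object of the category of a sieve. -/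
def sieveMk {S : Sieve T} (x : (overBased T).obj) (h : S (overHom x)) : (sieveBased S).obj :=
  (⟨x, h⟩ : S.arrows.category)

/-- A morphism of the category of a sieve. -/
def sieveHomMk {S : Sieve T} {u v : (sieveBased S).obj} (k : sieveObj u ⟶ sieveObj v) : u ⟶ v :=
  (ObjectProperty.homMk k : (show S.arrows.category from u) ⟶ (show S.arrows.category from v))

/-- The underlying morphism of a morphism of the category of a sieve. -/
def sieveHom {S : Sieve T} {u v : (sieveBased S).obj} (k : u ⟶ v) : sieveObj u ⟶ sieveObj v :=
  (sieveIncl S : BasedFunctor _ _).map k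

lemma overBased_hom_ext {u v : (overBased T).obj} {k k' : u ⟶ v}
    (h : (overBased T).p.map k = (overBased T).p.map k') : k = k' := Over.OverMorphism.ext h

lemma sieveBased_hom_ext {S : Sieve T} {u v : (sieveBased S).obj} {k k' : u ⟶ v}
    (h : sieveHom k = sieveHom k') : k = k' := ObjectProperty.hom_ext _ h

lemma overBased_fibered (T : C) : IsFiberedInGroupoids (overBased T) := IsFiberedInGroupoids.mk'
    (fun a {R} f => ⟨Over.mk (f ≫ overHom a), Over.homMk (V := a) f rfl, rfl, (id_comp f).symm⟩)
    (fun {a b a'} φ φ' k hk => ⟨Over.homMk (U := a') (V := a) k (by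
      have h1 : overHom a = _ := (overHom_w φ).symm
      have h2 : overHom a' = _ := (overHom_w φ').symm
      refine (congrArg (k ≫ ·) h1).trans (Eq.trans ?_ h2.symm)
      rw [← hk, assoc]), rfl, overBased_hom_ext (((overBased T).p.map_comp _ _).trans hk)⟩)
    (fun _ _ _ h _ => overBased_hom_ext h)

lemma sieveBased_fibered (S : Sieve T) : IsFiberedInGroupoids (sieveBased S) :=
  IsFiberedInGroupoids.mk' (fun a {R} f => ⟨sieveMk (Over.mk (f ≫ overHom (sieveObj a)))
      (S.downward_closed (sieveObj_mem a) f), sieveHomMk (Over.homMk f rfl), rfl,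
      (id_comp f).symm⟩)
    (fun {a b a'} φ φ' k hk => by
      obtain ⟨χ, h1, h2⟩ := (overBased_fibered T).exists_hom (sieveHom φ) (sieveHom φ') k hk
      exact ⟨sieveHomMk χ, h1, sieveBased_hom_ext h2⟩)
    (fun _ _ _ h _ => sieveBased_hom_ext (overBased_hom_ext h))

end Sieves

section

variable {T : RPCC.{u}} {S : Sieve T}

lemma mem_of_chart (hS : S ∈ faceTopology T) (a : Chart (overBased T)) : S (overHom a.pt) := by
  have := S.downward_closed (Topped.mem_of_covering hS a.dom (a.iso.hom ≫ overHom a.pt)) a.iso.inv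
  rwa [Iso.inv_hom_id_assoc] at this

/-- Charts of a complex lie in each covering sieve. -/
def chartSieve (hS : S ∈ faceTopology T) : Chart (overBased T) ⥤ Chart (sieveBased S) where
  obj a := ⟨sieveMk a.pt (mem_of_chart hS a), a.dom, a.iso⟩
  map {a b} f := Chart.mkHom (sieveHomMk (u := sieveMk a.pt (mem_of_chart hS a))
    (v := sieveMk b.pt (mem_of_chart hS b)) (Chart.hom f))

/-- Restriction of a transformation from charts of a complex to charts of a sieve. -/
def sieveTrans (hS : S ∈ faceTopology T) {𝒴 : Based.{u}} {E : Type*}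
    [Category* E] {G : Chart 𝒴 ⥤ E} {K : overBased T ⟶ 𝒴} {D : sieveBased S ⟶ 𝒴}
    (i : Chart.map K ⋙ G ⟶ chartSieve hS ⋙ Chart.map D ⋙ G) :
    Chart.map (sieveIncl S ≫ K) ⋙ G ⟶ Chart.map D ⋙ G where
  app a := i.app ((Chart.map (sieveIncl S)).obj a)
  naturality _ _ f := i.naturality ((Chart.map (sieveIncl S)).map f)

end

namespace CombConeStack

variable {S : CombConeStack.{u}} {𝒳 : Based.{u}}

lemma exists_trans_of_marks (h : IsFiberedInGroupoids 𝒳) {K K' : 𝒳 ⟶ S.geom}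
    (θ : Chart.map K ⋙ mark S ⟶ Chart.map K' ⋙ mark S)
    (hθ : ∀ a, Mark.Hom.cone (θ.app a) = 𝟙 ((Chart.cone 𝒳).obj a)) :
    ∃ η : K ⟶ K', ∀ a, (mark S).map ((Chart.mapTrans η).app a) = θ.app a := by
  let θ' : Chart.map K ⟶ Chart.map K' :=
    { app := fun a => (mark S).preimage (θ.app a)
      naturality := fun a b f => (mark S).map_injective (by
        rw [map_comp, map_comp, Functor.map_preimage, Functor.map_preimage]
        exact θ.naturality f) }
  obtain ⟨η, hη⟩ := exists_trans_of_charts h θ' fun a => Topped.ev.map_injective (by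
    refine Eq.trans ?_ ((hθ a).trans (Topped.ev.map_id _).symm)
    exact congrArg Mark.Hom.cone ((mark S).map_preimage (θ.app a)))
  exact ⟨η, fun a => by rw [hη]; exact (mark S).map_preimage (θ.app a)⟩

lemma trans_ext_marks (h : IsFiberedInGroupoids 𝒳) {K K' : 𝒳 ⟶ S.geom} {η θ : K ⟶ K'}
    (H : ∀ a : Chart 𝒳, valMap ((Chart.mapTrans η).app a) = valMap ((Chart.mapTrans θ).app a)) :
    η = θ :=
  trans_ext_charts h fun a => by
    have : (Chart.mapTrans η).app a = (Chart.mapTrans θ).app a := (mark S).map_injective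
      (Mark.hom_ext ((Chart.cone_mapTrans η a).trans (Chart.cone_mapTrans θ a).symm) (H a))
    exact this

variable (S) in
lemma geom_isStack : IsStack faceTopology S.geom := by
  refine IsStack.mk' (geom_fibered S) (fun T R hR {K K' η θ} H => ?_)
    (fun T R hR {K K'} η => ?_) (fun T R hR D => ?_)
  · exact trans_ext_charts (overBased_fibered T) fun a => H (sieveMk a.pt (mem_of_chart hR a))
  · let θ : Chart.map K ⟶ Chart.map K' :=
      { app := fun a => (Chart.mapTrans η).app ((chartSieve hR).obj a)
        naturality := fun a b f => (Chart.mapTrans η).naturality ((chartSieve hR).map f) }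
    obtain ⟨ζ, hζ⟩ := exists_trans_of_charts (overBased_fibered T) θ
      fun a => Chart.domain_mapTrans η ((chartSieve hR).obj a)
    refine ⟨ζ, fun u => ?_⟩
    have key : Bicategory.whiskerLeft (sieveIncl R) ζ = η :=
      trans_ext_charts (sieveBased_fibered R) fun a =>
        congrArg (fun θ => NatTrans.app θ ((Chart.map (sieveIncl R)).obj a)) hζ
    exact congrArg (fun θ => appAt θ u) key
  · obtain ⟨K, i, hi⟩ := exists_functor_of_charts (overBased_fibered T)
      (chartSieve hR ⋙ Chart.map D ⋙ mark S)
      (NatIso.ofComponents (fun a => Iso.refl _) fun {a b} f => by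
        refine (comp_id _).trans (Eq.trans ?_ (id_comp _).symm)
        exact Chart.cone_map D ((chartSieve hR).map f))
    let θ : Chart.map (sieveIncl R ≫ K) ⋙ mark S ⟶ Chart.map D ⋙ mark S := sieveTrans hR i.hom
    obtain ⟨η, -⟩ := exists_trans_of_marks (sieveBased_fibered R) θ fun a => hi _
    have := (geom_fibered S).isIso_trans η
    exact ⟨K, ⟨asIso η⟩⟩

end CombConeStack

namespace CombConeStack

variable {S T U W : CombConeStack.{u}}

section Geom

/-- The components of a 2-morphism of combinatorial cone stacks. -/
def natApp {f g : S ⟶ T} (η : f ⟶ g) (s : S.based.obj) :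
    (Hom.functor f).obj s ⟶ (Hom.functor g).obj s :=
  (CombConeStack.Hom₂.nat η).app s

lemma natApp_naturality {f g : S ⟶ T} (η : f ⟶ g) {s s' : S.based.obj} (v : s ⟶ s') :
    (Hom.functor f).map v ≫ natApp η s' =
      natApp η s ≫ (Hom.functor g).map v := (CombConeStack.Hom₂.nat η).naturality v

lemma natApp_comm {f g : S ⟶ T} (η : f ⟶ g) (s : S.based.obj) :
    Hom.map f s ≫ T.cone.map (natApp η s) = Hom.map g s :=
  CombConeStack.Hom₂.comm η s

/-- The image of a family under a morphism of combinatorial cone stacks. -/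
def Fam.push (f : S ⟶ T) (x : S.Fam) : T.Fam where
  base := x.base
  fn := x.fn ⋙ Hom.functor f
  map α := x.map α ≫ Hom.map f (x.fn.obj α)
  naturality {α β} v := by
    have h : x.base.cones.map v ≫ x.map β ≫ Hom.map f (x.fn.obj β) =
        (x.map α ≫ Hom.map f (x.fn.obj α)) ≫ T.cone.map ((Hom.functor f).map (x.fn.map v)) := by
      rw [← assoc, x.naturality, assoc, Hom.naturality, assoc]
    exact h
  dominant α := (x.dominant α).comp (Hom.dominant f _)

lemma Fam.push_naturality (f : S ⟶ T) {x y : S.Fam} (m : x ⟶ y) {α β : x.base.obj.Index}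
    (v : α ⟶ β) (w : RPCC.im (Fam.hb m) α ⟶ RPCC.im (Fam.hb m) β) :
    (Hom.functor f).map (x.fn.map v) ≫ (Hom.functor f).map (Fam.ha m β) =
      (Hom.functor f).map (Fam.ha m α) ≫ (Hom.functor f).map (y.fn.map w) := by
  rw [← map_comp, Fam.ha_natural m v w, map_comp]

lemma Fam.push_comm (f : S ⟶ T) {x y : S.Fam} (m : x ⟶ y) (α : x.base.obj.Index) :
    (x.map α ≫ Hom.map f (x.fn.obj α)) ≫ T.cone.map ((Hom.functor f).map (Fam.ha m α)) =
      RPCC.mapAt (Fam.hb m) α ≫ y.map _ ≫ Hom.map f _ := by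
  rw [assoc, ← Hom.naturality, ← assoc, Fam.ha_comm, assoc]

/-- The image of a morphism of families under a morphism of combinatorial cone stacks. -/
def Fam.pushMap (f : S ⟶ T) {x y : S.Fam} (m : x ⟶ y) : Fam.push f x ⟶ Fam.push f y :=
  (⟨Fam.hb (x := x) (y := y) m, fun α : x.base.obj.Index =>
    (Hom.functor f).map (Fam.ha m α), fun v w => Fam.push_naturality f m v w,
    fun α => Fam.push_comm f m α⟩ : Fam.Hom (Fam.push f x) (Fam.push f y))

/-- The functor associated with a morphism of combinatorial cone stacks. -/
def geomMap (f : S ⟶ T) : S.geom ⟶ T.geom :=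
  ({ obj := Fam.push f
     map := Fam.pushMap f
     map_id := fun x => Fam.Hom.ext_of_app rfl fun α _ =>
      (comp_id ((Hom.functor f).map (𝟙 (x.fn.obj α)))).trans ((Hom.functor f).map_id _)
     map_comp := fun {x y z : S.Fam} m n => Fam.Hom.ext_of_app rfl fun α _ =>
      (comp_id ((Hom.functor f).map (Fam.ha (m ≫ n) α))).trans
        ((Hom.functor f).map_comp (Fam.ha m α) (Fam.ha n _))
     w := rfl } : BasedFunctor S.geom T.geom)

/-- A morphism of families over the identity. -/
def Fam.vert {x : RPCC.{u}} {fn fn' : x.obj.Index ⥤ S.based.obj} {map map' n n' d d'}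
    (a : ∀ α, fn.obj α ⟶ fn'.obj α)
    (ha : ∀ {α β} (v : α ⟶ β), fn.map v ≫ a β = a α ≫ fn'.map v)
    (hm : ∀ α, map α ≫ S.cone.map (a α) = map' α) :
    (⟨x, fn, map, n, d⟩ : S.Fam) ⟶ (⟨x, fn', map', n', d'⟩ : S.Fam) :=
  (⟨𝟙 x, a, fun v w => by
    have e : w = v := Subsingleton.elim (α := _ ⟶ _) w v
    subst e
    exact ha w, fun α => (hm α).trans (id_comp _).symm⟩ : Fam.Hom _ _)

/-- The transformation associated with a 2-morphism of combinatorial cone stacks. -/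
def geomMap₂ {f g : S ⟶ T} (η : f ⟶ g) : geomMap f ⟶ geomMap g :=
  mkTrans (K := geomMap f) (K' := geomMap g)
    (fun x : S.Fam => (Fam.vert (x := x.base) (fun α => natApp η (x.fn.obj α))
      (fun v => natApp_naturality η _) (fun α => (assoc _ _ _).trans
        (congrArg (x.map α ≫ ·) (natApp_comm η _))) : Fam.push f x ⟶ Fam.push g x))
    (fun {x y : S.Fam} m => Fam.Hom.ext_of_app (by
        exact (comp_id (Fam.hb m)).trans (id_comp (Fam.hb m)).symm) fun α _ =>
      (comp_id _).trans (natApp_naturality η (Fam.ha m α)))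
    (fun x : S.Fam => (comp_id (𝟙 x.base)).symm)

lemma geom_trans_ext {𝒳 : Based.{u}} {K K' : 𝒳 ⟶ S.geom} {η θ : K ⟶ K'}
    (H : ∀ (x : 𝒳.obj) (α : (famObj K x).base.obj.Index)
      (_ : RPCC.im (Fam.hb (appAt η x : famObj K x ⟶ famObj K' x)) α =
        RPCC.im (Fam.hb (appAt θ x : famObj K x ⟶ famObj K' x)) α),
      Fam.ha (appAt η x : famObj K x ⟶ famObj K' x) α ≫ eqToHom (by congr) =
        Fam.ha (appAt θ x : famObj K x ⟶ famObj K' x) α) : η = θ :=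
  trans_ext fun x => Fam.Hom.ext_of_app ((p_map_appAt η x).trans (p_map_appAt θ x).symm)
    fun α e => H x α e

/-- The unit comparison. -/
def geomMapId (S : CombConeStack.{u}) : geomMap (𝟙 S) ≅ 𝟙 S.geom where
  hom := mkTrans (K := geomMap (𝟙 S)) (K' := 𝟙 S.geom)
    (fun x : S.Fam => (Fam.vert (x := x.base) (fun α => 𝟙 _)
      (fun v => (comp_id _).trans (id_comp _).symm) (fun α => (congrArg (_ ≫ ·) (map_id _ _)).trans
          ((comp_id _).trans (comp_id _))) : Fam.push (𝟙 S) x ⟶ x))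
    (fun {x y : S.Fam} m => Fam.Hom.ext_of_app (by
        exact (comp_id (Fam.hb m)).trans (id_comp (Fam.hb m)).symm) fun α _ =>
      (comp_id _).trans ((comp_id _).trans (id_comp _).symm))
    (fun x : S.Fam => (comp_id (𝟙 x.base)).symm)
  inv := mkTrans (K := 𝟙 S.geom) (K' := geomMap (𝟙 S))
    (fun x : S.Fam => (Fam.vert (x := x.base) (fun α => 𝟙 _)
      (fun v => (comp_id _).trans (id_comp _).symm) (fun α => (congrArg (_ ≫ ·) (map_id _ _)).trans
          ((comp_id _).trans (comp_id _).symm)) : x ⟶ Fam.push (𝟙 S) x))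
    (fun {x y : S.Fam} m => Fam.Hom.ext_of_app (by
        exact (comp_id (Fam.hb m)).trans (id_comp (Fam.hb m)).symm) fun α _ =>
      (comp_id _).trans ((comp_id _).trans (id_comp _).symm))
    (fun x : S.Fam => (comp_id (𝟙 x.base)).symm)
  hom_inv_id := geom_trans_ext fun x α _ => (comp_id _).trans (comp_id _)
  inv_hom_id := geom_trans_ext fun x α _ => (comp_id _).trans (comp_id _)

/-- The composition comparison. -/
def geomMapComp (f : S ⟶ T) (g : T ⟶ U) : geomMap (f ≫ g) ≅ geomMap f ≫ geomMap g where
  hom := mkTrans (K := geomMap (f ≫ g)) (K' := geomMap f ≫ geomMap g)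
    (fun x : S.Fam => (Fam.vert (x := x.base) (fun α => 𝟙 _)
      (fun v => (comp_id _).trans (id_comp _).symm) (fun α => (congrArg (_ ≫ ·) (map_id _ _)).trans
          ((comp_id _).trans (assoc _ _ _).symm)) : Fam.push (f ≫ g) x ⟶ Fam.push g (Fam.push f x)))
    (fun {x y : S.Fam} m => Fam.Hom.ext_of_app (by
        exact (comp_id (Fam.hb m)).trans (id_comp (Fam.hb m)).symm) fun α _ =>
      (comp_id _).trans ((comp_id _).trans (id_comp _).symm))
    (fun x : S.Fam => (comp_id (𝟙 x.base)).symm)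
  inv := mkTrans (K := geomMap f ≫ geomMap g) (K' := geomMap (f ≫ g))
    (fun x : S.Fam => (Fam.vert (x := x.base) (fun α => 𝟙 _)
      (fun v => (comp_id _).trans (id_comp _).symm) (fun α => (congrArg (_ ≫ ·) (map_id _ _)).trans
          ((comp_id _).trans (assoc _ _ _))) : Fam.push g (Fam.push f x) ⟶ Fam.push (f ≫ g) x))
    (fun {x y : S.Fam} m => Fam.Hom.ext_of_app (by
        exact (comp_id (Fam.hb m)).trans (id_comp (Fam.hb m)).symm) fun α _ =>
      (comp_id _).trans ((comp_id _).trans (id_comp _).symm))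
    (fun x : S.Fam => (comp_id (𝟙 x.base)).symm)
  hom_inv_id := geom_trans_ext fun x α _ => (comp_id _).trans (comp_id _)
  inv_hom_id := geom_trans_ext fun x α _ => (comp_id _).trans (comp_id _)

end Geom

/-- The pseudofunctor to categories over `RPCC`. -/
def geomPseudofunctor : Pseudofunctor CombConeStack.{u} Based.{u} where
  obj S := S.geom
  map f := geomMap f
  map₂ η := geomMap₂ η
  map₂_id f := geom_trans_ext fun x α _ => comp_id _
  map₂_comp η θ := geom_trans_ext fun x α _ => comp_id _
  mapId S := geomMapId S
  mapComp f g := geomMapComp f g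
  map₂_whisker_left f g h η := geom_trans_ext fun x α _ => (comp_id _).trans
    ((id_comp _).trans (comp_id _)).symm
  map₂_whisker_right η h := geom_trans_ext fun x α _ => (comp_id _).trans
    ((id_comp _).trans (comp_id _)).symm
  map₂_associator f g h := geom_trans_ext fun x α _ => by
    refine (comp_id _).trans (Eq.symm ?_)
    refine (id_comp _).trans ?_
    refine (congrArg₂ (· ≫ ·) (map_id _ _) ?_).trans (comp_id _)
    exact (id_comp _).trans (id_comp _)
  map₂_left_unitor f := geom_trans_ext fun x α _ => by
    refine (comp_id _).trans (Eq.symm ?_)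
    refine (id_comp _).trans ?_
    exact (comp_id _).trans (map_id _ _)
  map₂_right_unitor f := geom_trans_ext fun x α _ => by
    refine (comp_id _).trans (Eq.symm ?_)
    exact (id_comp _).trans (id_comp _)

end CombConeStack

namespace CombConeStack

variable {S T : CombConeStack.{u}}

/-- The object of `S` by which a chart is marked. -/
abbrev val (a : Chart S.geom) : S.based.obj := (fam a).fn.obj (famTop a)

lemma markMap_geomMap (f : S ⟶ T) (a : Chart S.geom) : markMap ((Chart.map (geomMap f)).obj a) =
    markMap a ≫ Hom.map f (val a) :=
  (assoc _ _ _).symm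

lemma valMap_geomMap (f : S ⟶ T) {a b : Chart S.geom} (n : a ⟶ b) :
    valMap ((Chart.map (geomMap f)).map n) = (Hom.functor f).map (valMap n) := by
  have h : (Hom.functor f).map (Fam.ha (famHom n) (famTop a) ≫
      (fam b).fn.map ((famTop_isTop b).to _)) = (Hom.functor f).map
        (Fam.ha (famHom n) (famTop a)) ≫ (Hom.functor f).map
          ((fam b).fn.map ((famTop_isTop b).to _)) := map_comp _ _ _
  exact h.symm

lemma valMap_geomMap₂ {f g : S ⟶ T} (η : f ⟶ g) (a : Chart S.geom) :
    valMap ((Chart.mapTrans (geomMap₂ η)).app a) = natApp η (val a) := by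
  refine (valMap_eq _ (𝟙 (famTop a))).trans ?_
  exact (congrArg (natApp η _ ≫ ·) (map_id ((fam a).fn ⋙ Hom.functor g) _)).trans (comp_id _)

lemma valMap_comp {a b c : Chart S.geom} (m : a ⟶ b) (n : b ⟶ c) :
    valMap (m ≫ n) = valMap m ≫ valMap n := congrArg Mark.Hom.pt ((mark S).map_comp m n)

variable (S) in
/-- The marking of an object by its own cone. -/
def selfMark : S.based.obj ⥤ S.Mark where
  obj s := ⟨S.cone.obj s, s, 𝟙 _, .id _⟩
  map v := ⟨S.cone.map v, v, (comp_id _).trans (id_comp _).symm⟩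
  map_id s := Mark.hom_ext (S.cone.map_id s) rfl
  map_comp f g := Mark.hom_ext (S.cone.map_comp f g) rfl

variable (S) in
/-- The universal chart at an object. -/
def sec : S.based.obj ⥤ Chart S.geom := selfMark S ⋙ (mark S).inv

variable (S) in
/-- The universal chart at an object is marked by its own cone. -/
def secIso : sec S ⋙ mark S ≅ selfMark S :=
  Functor.isoWhiskerLeft (selfMark S) (mark S).asEquivalence.counitIso

/-- The marking of a universal chart. -/
def secHom (s : S.based.obj) : (mark S).obj ((sec S).obj s) ≅ (selfMark S).obj s := (secIso S).app s

lemma secHom_naturality {s s' : S.based.obj} (v : s ⟶ s') :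
    (mark S).map ((sec S).map v) ≫ (secHom s').hom = (secHom s).hom ≫ (selfMark S).map v :=
  (secIso S).hom.naturality v

/-- A marked cone maps to the object by which it is marked. -/
def Mark.toSelf (x : S.Mark) : x ⟶ (selfMark S).obj x.pt :=
  (⟨x.map, 𝟙 _, congrArg (x.map ≫ ·) (S.cone.map_id _).symm⟩ :
    Mark.Hom x ((selfMark S).obj x.pt))

lemma Mark.toSelf_naturality {x y : S.Mark} (f : x ⟶ y) :
    f ≫ Mark.toSelf y = Mark.toSelf x ≫ (selfMark S).map (Mark.Hom.pt f) :=
  Mark.hom_ext (Mark.Hom.comm f) ((comp_id _).trans (id_comp _).symm)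

/-- A chart maps to the universal chart at its value. -/
def toSec (a : Chart S.geom) : a ⟶ (sec S).obj (val a) :=
  (mark S).preimage (Mark.toSelf ((mark S).obj a) ≫ (secHom _).inv)

lemma mark_toSec (a : Chart S.geom) : (mark S).map (toSec a) ≫ (secHom _).hom =
    Mark.toSelf ((mark S).obj a) := by
  refine (congrArg (· ≫ (secHom (val a)).hom) ((mark S).map_preimage _)).trans ?_
  exact (assoc _ _ _).trans ((congrArg (_ ≫ ·) (secHom (val a)).inv_hom_id).trans (comp_id _))

lemma toSec_naturality {a b : Chart S.geom} (n : a ⟶ b) :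
    n ≫ toSec b = toSec a ≫ (sec S).map (valMap n) := by
  apply (mark S).map_injective
  have h1 : (mark S).map ((sec S).map (valMap n)) ≫ (secHom (val b)).hom =
    (secHom (val a)).hom ≫ (selfMark S).map (valMap n) := secHom_naturality _
  have h2 : (mark S).map n ≫ Mark.toSelf ((mark S).obj b) = Mark.toSelf ((mark S).obj a) ≫
    (selfMark S).map (valMap n) := Mark.toSelf_naturality ((mark S).map n)
  rw [← cancel_mono (secHom (val b)).hom, map_comp, map_comp, assoc,
    assoc, h1, ← assoc ((mark S).map (toSec a))]
  exact (congrArg ((mark S).map n ≫ ·) (mark_toSec b)).trans (h2.trans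
    (congrArg (· ≫ (selfMark S).map (valMap n)) (mark_toSec a).symm))

/-- The value of a universal chart. -/
def secPt (s : S.based.obj) : val ((sec S).obj s) ⟶ s := Mark.Hom.pt (secHom s).hom

/-- The cone of a universal chart. -/
def secCone (s : S.based.obj) : (Chart.cone S.geom).obj ((sec S).obj s) ⟶ S.cone.obj s :=
  Mark.Hom.cone (secHom s).hom

instance (s : S.based.obj) : IsIso (secPt s) :=
  inferInstanceAs (IsIso ((Mark.ptFunctor S).map (secHom s).hom))

instance (s : S.based.obj) : IsIso (secCone s) :=
  inferInstanceAs (IsIso ((Mark.coneFunctor S).map (secHom s).hom))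

lemma isIso_secCone_inv (s : S.based.obj) : IsIso (Mark.Hom.cone (secHom s).inv) :=
  inferInstanceAs (IsIso ((Mark.coneFunctor S).map (secHom s).inv))

lemma secPt_naturality {s s' : S.based.obj} (v : s ⟶ s') :
    valMap ((sec S).map v) ≫ secPt s' = secPt s ≫ v :=
  congrArg Mark.Hom.pt (secHom_naturality v)

lemma valMap_toSec (a : Chart S.geom) : valMap (toSec a) ≫ secPt _ = 𝟙 _ :=
  congrArg Mark.Hom.pt (mark_toSec a)

lemma geomMap₂_injective {f g : S ⟶ T} {η θ : f ⟶ g} (h : geomMap₂ η = geomMap₂ θ) : η = θ := by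
  refine CombConeStack.Hom₂.ext_app fun s => ?_
  have key : ∀ η : f ⟶ g, (Hom.functor f).map (secPt s) ≫
      natApp η s = valMap ((Chart.mapTrans (geomMap₂ η)).app ((sec S).obj s)) ≫
        (Hom.functor g).map (secPt s) := fun η => by
    rw [valMap_geomMap₂]
    exact natApp_naturality η _
  have h1 := key θ
  rw [← h] at h1
  have h2 := (key η).trans h1.symm
  exact (cancel_epi _).1 h2

/-- The value of a transformation at a chart. -/
def transVal {f g : S ⟶ T} (ζ : geomMap f ⟶ geomMap g) (a : Chart S.geom) :
    (Hom.functor f).obj (val a) ⟶ (Hom.functor g).obj (val a) := valMap ((Chart.mapTrans ζ).app a)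

lemma transVal_naturality {f g : S ⟶ T} (ζ : geomMap f ⟶ geomMap g) {a b : Chart S.geom}
    (n : a ⟶ b) : (Hom.functor f).map (valMap n) ≫ transVal ζ b =
      transVal ζ a ≫ (Hom.functor g).map (valMap n) := by
  have h := congrArg valMap ((Chart.mapTrans ζ).naturality n)
  rw [valMap_comp, valMap_comp, valMap_geomMap, valMap_geomMap] at h
  exact h

lemma transVal_comm {f g : S ⟶ T} (ζ : geomMap f ⟶ geomMap g) (a : Chart S.geom) :
    (markMap a ≫ Hom.map f (val a)) ≫ T.cone.map (transVal ζ a) =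
      markMap a ≫ Hom.map g (val a) := by
  have h := markMap_naturality ((Chart.mapTrans ζ).app a)
  rw [Chart.cone_mapTrans, markMap_geomMap, markMap_geomMap] at h
  exact h.symm.trans (id_comp _)

lemma markMap_sec (s : S.based.obj) : markMap ((sec S).obj s) ≫ S.cone.map (secPt s) = secCone s :=
  (Mark.Hom.comm (secHom s).hom).symm.trans (comp_id (secCone s))

lemma geomMap₂_surjective {f g : S ⟶ T} (ζ : geomMap f ⟶ geomMap g) :
    ∃ η : f ⟶ g, geomMap₂ η = ζ := by
  have happ : ∀ s, ∃ app : (Hom.functor f).obj s ⟶ (Hom.functor g).obj s,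
      (Hom.functor f).map (secPt s) ≫ app = transVal ζ ((sec S).obj s) ≫
        (Hom.functor g).map (secPt s) := fun s =>
    ⟨inv ((Hom.functor f).map (secPt s)) ≫ transVal ζ ((sec S).obj s) ≫
      (Hom.functor g).map (secPt s), by simp⟩
  choose app happ using happ
  have hn : ∀ {s s'} (v : s ⟶ s'), (Hom.functor f).map v ≫ app s' =
      app s ≫ (Hom.functor g).map v := by
    intro s s' v
    have h1 := secPt_naturality v
    rw [← cancel_epi ((Hom.functor f).map (secPt s)), ← assoc, ← map_comp, ← assoc, happ, assoc,
      ← map_comp]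
    have h2 := congrArg (Hom.functor f).map h1
    have h3 := congrArg (Hom.functor g).map h1
    refine (congrArg (· ≫ app s') h2.symm).trans (Eq.trans ?_ (congrArg (_ ≫ ·) h3))
    rw [map_comp, assoc, happ, ← assoc, transVal_naturality, assoc, ← map_comp]
  let η : f ⟶ g := (⟨⟨app, fun _ _ v => hn v⟩, fun s => by
    have h1 := congrArg T.cone.map (happ s)
    rw [map_comp, map_comp] at h1
    have h2 : secCone s ≫ Hom.map f s ≫ T.cone.map (app s) = secCone s ≫ Hom.map g s := by
      rw [← markMap_sec, assoc, assoc, ← assoc (S.cone.map _),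
        Hom.naturality, Hom.naturality, assoc, h1,
        ← assoc, ← assoc, transVal_comm, assoc]
    exact (cancel_epi _).1 h2⟩ : CombConeStack.Hom₂ f g)
  refine ⟨η, trans_ext_marks (geom_fibered S) fun a => ?_⟩
  rw [valMap_geomMap₂]
  change app _ = transVal ζ a
  have h1 := transVal_naturality ζ (toSec a)
  have h2 := congrArg (Hom.functor f).map (valMap_toSec a)
  have h3 := congrArg (Hom.functor g).map (valMap_toSec a)
  rw [map_comp] at h2 h3
  rw [map_id] at h2 h3
  have h4 := congrArg ((Hom.functor f).map (valMap (toSec a)) ≫ ·) (happ _)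
  refine ((id_comp _).symm.trans ((congrArg (· ≫ app _) h2.symm).trans
    ((assoc _ _ _).trans h4))).trans ?_
  refine (assoc _ _ _).symm.trans ((congrArg (· ≫ _) h1).trans
    ((assoc _ _ _).trans ((congrArg (_ ≫ ·) h3).trans (comp_id _))))

lemma exists_geomMap_iso (K : S.geom ⟶ T.geom) : ∃ f : S ⟶ T, Nonempty (geomMap f ≅ K) := by
  let m : ∀ s, S.cone.obj s ⟶ T.cone.obj (val ((Chart.map K).obj ((sec S).obj s))) :=
    fun s => Mark.Hom.cone (secHom s).inv ≫ markMap ((Chart.map K).obj ((sec S).obj s))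
  have hm : ∀ {s s'} (v : s ⟶ s'), S.cone.map v ≫ m s' =
      m s ≫ T.cone.map (valMap ((Chart.map K).map ((sec S).map v))) := by
    intro s s' v
    have h1 : (selfMark S).map v ≫ (secHom s').inv = (secHom s).inv ≫ (mark S).map ((sec S).map v) := by
      rw [Iso.comp_inv_eq, assoc, secHom_naturality, Iso.inv_hom_id_assoc]
    have h2 : S.cone.map v ≫ Mark.Hom.cone (secHom s').inv = Mark.Hom.cone (secHom s).inv ≫
        (Chart.cone S.geom).map ((sec S).map v) := congrArg Mark.Hom.cone h1
    have h3 := markMap_naturality ((Chart.map K).map ((sec S).map v))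
    rw [Chart.cone_map] at h3
    have h4 : Mark.Hom.cone (secHom s).inv ≫ (Chart.cone S.geom).map ((sec S).map v) ≫
        markMap ((Chart.map K).obj ((sec S).obj s')) = m s ≫ T.cone.map _ :=
      (congrArg (_ ≫ ·) h3).trans (assoc _ _ _).symm
    refine Eq.trans ?_ h4
    exact (assoc _ _ _).symm.trans ((congrArg (· ≫ _) h2).trans (assoc _ _ _))
  let f : S ⟶ T := (⟨sec S ⋙ Chart.map K ⋙ mark T ⋙ Mark.ptFunctor T, m, hm, fun s => by
    have : IsIso (Mark.Hom.cone (secHom s).inv) := isIso_secCone_inv s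
    exact (IsDominant.of_isIso (Mark.Hom.cone (secHom s).inv)).comp
      (show IsDominant (markMap ((Chart.map K).obj ((sec S).obj s))) from
        ((mark T).obj _).dominant)⟩ : CombConeStack.Hom S T)
  let θ : Chart.map K ⋙ mark T ⟶ Chart.map (geomMap f) ⋙ mark T :=
    { app := fun a => (⟨𝟙 ((Chart.cone S.geom).obj a), valMap ((Chart.map K).map (toSec a)), by
        have h1 := markMap_naturality ((Chart.map K).map (toSec a))
        rw [Chart.cone_map] at h1
        have h2 : (Chart.cone S.geom).map (toSec a) =
            markMap a ≫ Mark.Hom.cone (secHom (val a)).inv := by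
          have h3 : (mark S).map (toSec a) = Mark.toSelf ((mark S).obj a) ≫ (secHom _).inv :=
            (mark S).map_preimage _
          exact congrArg Mark.Hom.cone h3
        rw [h2] at h1
        exact (id_comp _).trans ((markMap_geomMap f a).trans ((assoc _ _ _).symm.trans h1))⟩ :
          Mark.Hom ((mark T).obj ((Chart.map K).obj a)) ((mark T).obj ((Chart.map (geomMap f)).obj a)))
      naturality := fun a b n => by
        refine Mark.hom_ext ?_ ?_
        · have h1 : (Chart.cone T.geom).map ((Chart.map K).map n) ≫ 𝟙 _ =
              𝟙 _ ≫ (Chart.cone T.geom).map ((Chart.map (geomMap f)).map n) := by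
            rw [Chart.cone_map, Chart.cone_map]
            exact (comp_id _).trans (id_comp _).symm
          exact h1
        · have h1 := congrArg (fun k => valMap ((Chart.map K).map k)) (toSec_naturality n)
          simp only [map_comp, valMap_comp] at h1
          refine h1.trans ?_
          exact congrArg (valMap ((Chart.map K).map (toSec a)) ≫ ·) (valMap_geomMap f n).symm }
  obtain ⟨η, -⟩ := exists_trans_of_marks (geom_fibered S) θ fun a => rfl
  have := (geom_fibered T).isIso_trans η
  exact ⟨f, ⟨(asIso η).symm⟩⟩

end CombConeStack

section Local

variable {𝒳 𝒴 : Based.{u}} (Φ : 𝒳 ⟶ 𝒴)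

lemma exists_chart_over_face (h𝒳 : IsFiberedInGroupoids 𝒳) (c : Topped.{u}) {x : 𝒳.obj}
    (r : c.cx ⟶ 𝒳.p.obj x) : ∃ (b : Chart 𝒳) (m : b.pt ⟶ x) (k : c ⟶ b.dom),
      Topped.hom k ≫ b.iso.hom ≫ 𝒳.p.map m = r := by
  let α : (𝒳.p.obj x).obj.Index := ⟨r.hom.idx c.top⟩
  obtain ⟨k, hk⟩ := Topped.exists_hom_over (c := c) (c' := (𝒳.p.obj x).faceTop α.idx)
    r ((𝒳.p.obj x).faceIncl α.idx) ⟨_, (𝒳.p.obj x).obj.id_mem _⟩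
  exact ⟨h𝒳.chartAt x α, h𝒳.chartTo x α, k,
    (congrArg (Topped.hom k ≫ ·) (h𝒳.chartTo_spec x α)).trans hk⟩

lemma exists_chart_factorization (h𝒳 : IsFiberedInGroupoids 𝒳) (h𝒴 : IsFiberedInGroupoids 𝒴)
    (a : Chart 𝒳) {x : 𝒳.obj}
    (g : ⟪Φ⟫.obj a.pt ⟶ ⟪Φ⟫.obj x) :
    ∃ (b : Chart 𝒳) (m : b.pt ⟶ x) (n : (Chart.map Φ).obj a ⟶ (Chart.map Φ).obj b),
      Chart.hom n ≫ ⟪Φ⟫.map m = g := by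
  obtain ⟨b, m, k, hk⟩ := exists_chart_over_face h𝒳 a.dom
    (a.iso.hom ≫ (baseIso Φ a.pt).inv ≫ 𝒴.p.map g ≫ (baseIso Φ x).hom)
  obtain ⟨n, -, hn⟩ := h𝒴.exists_hom_chart (a := (Chart.map Φ).obj b)
    (a' := (Chart.map Φ).obj a) (⟪Φ⟫.map m) g k (by
      have h2 : Topped.hom k ≫ (b.iso.hom ≫ (baseIso Φ _).inv) ≫ 𝒴.p.map (⟪Φ⟫.map m) =
          (a.iso.hom ≫ (baseIso Φ a.pt).inv) ≫ 𝒴.p.map g := by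
        rw [p_map_map, assoc, Iso.inv_hom_id_assoc, ← assoc b.iso.hom, ← assoc, hk]
        simp
      exact h2)
  exact ⟨_, _, n, hn⟩

lemma p_map_eq_of_map_eq {x y : 𝒳.obj} {f g : x ⟶ y} (h : ⟪Φ⟫.map f = ⟪Φ⟫.map g) :
    𝒳.p.map f = 𝒳.p.map g := by
  have := congrArg 𝒴.p.map h
  rw [p_map_map, p_map_map] at this
  simpa using this

lemma chart_faithful (h𝒳 : IsFiberedInGroupoids 𝒳) (h𝒴 : IsFiberedInGroupoids 𝒴)
    [(Chart.map Φ).Faithful] (a : Chart 𝒳) {x : 𝒳.obj} {f g : a.pt ⟶ x}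
    (h : ⟪Φ⟫.map f = ⟪Φ⟫.map g) : f = g := by
  have hp := p_map_eq_of_map_eq Φ h
  obtain ⟨b, m, k, hk⟩ := exists_chart_over_face h𝒳 a.dom (a.iso.hom ≫ 𝒳.p.map f)
  obtain ⟨n, hn, hn'⟩ := h𝒳.exists_hom_chart m f k hk
  obtain ⟨n', hm, hm'⟩ := h𝒳.exists_hom_chart m g k (hk.trans (by rw [hp]))
  have h1 : 𝒳.p.map (Chart.hom n) = 𝒳.p.map (Chart.hom n') := by
    rw [Chart.p_map, Chart.p_map, hn, hm]
  have h2 : (Chart.map Φ).map n = (Chart.map Φ).map n' := by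
    refine h𝒴.hom_cancel (⟪Φ⟫.map m) (a' := ((Chart.map Φ).obj a).pt) ?_ ?_
    · exact (p_map_map Φ _).trans ((congrArg (fun k => _ ≫ k ≫ _) h1).trans (p_map_map Φ _).symm)
    · refine (⟪Φ⟫.map_comp (Chart.hom n) m).symm.trans (Eq.trans ?_ (⟪Φ⟫.map_comp (Chart.hom n') m))
      rw [hn', hm', h]
  rw [← hn', ← hm', (Chart.map Φ).map_injective h2]

lemma exists_chart_of_mem (h𝒳 : IsFiberedInGroupoids 𝒳) {z x : 𝒳.obj} (m : z ⟶ x)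
    (hm : faceSieve (𝒳.p.obj x) (𝒳.p.map m)) :
    ∃ (a : Chart 𝒳) (n : z ⟶ a.pt) (m' : a.pt ⟶ x), n ≫ m' = m := by
  obtain ⟨c, k, r, hk⟩ := hm
  obtain ⟨b, i, m', hm'⟩ := h𝒳.exists_chart x c r
  obtain ⟨n, -, hn⟩ := h𝒳.exists_hom m' m (k ≫ i.hom) (by rw [assoc, hm', hk])
  exact ⟨⟨b, c, i⟩, n, m', hn⟩

lemma faithful_of_charts (h𝒳 : IsStack faceTopology 𝒳) (h𝒴 : IsFiberedInGroupoids 𝒴)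
    [(Chart.map Φ).Faithful] : ⟪Φ⟫.Faithful where
  map_injective {x y f g} h := by
    refine h𝒳.hom_ext (p_map_eq_of_map_eq Φ h) (faceSieve_mem _) fun z m hm => ?_
    obtain ⟨a, n, m', rfl⟩ := exists_chart_of_mem h𝒳.fibered m hm
    rw [assoc, assoc, chart_faithful Φ h𝒳.fibered h𝒴 a (f := m' ≫ f)
      (g := m' ≫ g) (by rw [map_comp, map_comp, h])]

lemma exists_chart_of_mem_map (h𝒳 : IsFiberedInGroupoids 𝒳) (h𝒴 : IsFiberedInGroupoids 𝒴)
    {z : 𝒴.obj} {x : 𝒳.obj} (m : z ⟶ ⟪Φ⟫.obj x)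
    (hm : faceSieve (𝒴.p.obj _) (𝒴.p.map m)) :
    ∃ (a : Chart 𝒳) (n : z ⟶ ⟪Φ⟫.obj a.pt) (m' : a.pt ⟶ x),
      faceSieve (𝒳.p.obj x) (𝒳.p.map m') ∧ n ≫ ⟪Φ⟫.map m' = m := by
  obtain ⟨c, k, r, hk⟩ := hm
  obtain ⟨b, i, m', hm'⟩ := h𝒳.exists_chart x c (r ≫ (baseIso Φ x).hom)
  obtain ⟨n, -, hn⟩ := h𝒴.exists_hom (⟪Φ⟫.map m') m (k ≫ i.hom ≫ (baseIso Φ b).inv) (by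
      rw [p_map_map, assoc, assoc, Iso.inv_hom_id_assoc, reassoc_of% hm', ← hk]
      simp)
  exact ⟨⟨b, c, i⟩, n, m', ⟨c, i.inv, r ≫ (baseIso Φ x).hom, by rw [← hm', i.inv_hom_id_assoc]⟩, hn⟩

lemma full_of_charts (h𝒳 : IsStack faceTopology 𝒳) (h𝒴 : IsStack faceTopology 𝒴)
    [(Chart.map Φ).Faithful] [(Chart.map Φ).Full] : ⟪Φ⟫.Full where
  map_surjective {x y} g := by
    have hf := faithful_of_charts Φ h𝒳 h𝒴.fibered
    have key : ∀ (z : 𝒳.obj) (m : z ⟶ x), faceSieve (𝒳.p.obj x) (𝒳.p.map m) → ∃ f : z ⟶ y,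
        ⟪Φ⟫.map f = ⟪Φ⟫.map m ≫ g := by
      intro z m hm
      obtain ⟨a, n, m', rfl⟩ := exists_chart_of_mem h𝒳.fibered m hm
      obtain ⟨b, k, l, hl⟩ := exists_chart_factorization Φ h𝒳.fibered h𝒴.fibered a (⟪Φ⟫.map m' ≫ g)
      obtain ⟨l, rfl⟩ := (Chart.map Φ).map_surjective l
      rw [Chart.hom_map] at hl
      exact ⟨n ≫ Chart.hom l ≫ k, by
        rw [map_comp, map_comp, map_comp, assoc]
        exact congrArg (_ ≫ ·) hl⟩
    choose F hF using key
    have hFb : ∀ z m hm, 𝒳.p.map (F z m hm) = 𝒳.p.map m ≫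
        (baseIso Φ x).inv ≫ 𝒴.p.map g ≫ (baseIso Φ y).hom := fun z m hm => by
      have := congrArg 𝒴.p.map (hF z m hm)
      rw [map_comp, p_map_map, p_map_map, ← Iso.eq_inv_comp, Iso.comp_inv_eq] at this
      simpa using this
    obtain ⟨f, hf0, hf'⟩ := h𝒳.exists_glue _ (faceSieve_mem _) F hFb fun z z' n m hm hm' =>
      ⟪Φ⟫.map_injective (by
        rw [hF, map_comp, map_comp, hF, assoc])
    refine ⟨f, h𝒴.hom_ext ?_ (faceSieve_mem _) fun z m hm => ?_⟩
    · rw [p_map_map, hf0]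
      simp
    · obtain ⟨a, n, m', hm', rfl⟩ := exists_chart_of_mem_map Φ h𝒳.fibered h𝒴.fibered m hm
      rw [assoc, assoc, ← map_comp, hf' _ _ hm', hF]

lemma exists_equivalence_of_charts (h𝒳 : IsStack faceTopology 𝒳) (h𝒴 : IsStack faceTopology 𝒴)
    [(Chart.map Φ).Faithful] [(Chart.map Φ).Full] [(Chart.map Φ).EssSurj] :
    ∃ e : Bicategory.Equivalence 𝒳 𝒴, e.hom = Φ := by
  have hf := faithful_of_charts Φ h𝒳 h𝒴.fibered
  have hf' := full_of_charts Φ h𝒳 h𝒴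
  refine h𝒳.fibered.exists_equivalence Φ fun y => ?_
  obtain ⟨Y, φ, hφ, hφn⟩ := h𝒴.fibered.exists_functor (𝒜 := overBased (𝒴.p.obj y)) y
    overHom overHom_w
  have hY : IsIso (φ (overId _)) := by
    have : IsIso (𝒴.p.map (φ (overId (𝒴.p.obj y)))) := by
      rw [hφ]
      infer_instance
    exact h𝒴.fibered.isIso _
  obtain ⟨D, ⟨ε⟩⟩ := h𝒳.fibered.exists_functor_lift Φ (sieveIncl (faceSieve (𝒴.p.obj y)) ≫ Y)
    fun u => by
      obtain ⟨b, n, m', hm'⟩ := exists_chart_of_mem h𝒴.fibered (φ (sieveObj u)) (by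
        rw [hφ]
        exact (faceSieve _).downward_closed (sieveObj_mem u) _)
      let a := (Chart.map Φ).objPreimage b
      let i : ⟪Φ⟫.obj a.pt ≅ b.pt := Chart.isoPt ((Chart.map Φ).objObjPreimageIso b)
      obtain ⟨x, ψ, e, hψ⟩ := h𝒳.fibered.exists_pullback a.pt
        ((baseIso Y (sieveObj u)).inv ≫ 𝒴.p.map (n ≫ i.inv) ≫ (baseIso Φ a.pt).hom)
      obtain ⟨χ, hχ, -⟩ := h𝒴.fibered.exists_hom (n ≫ i.inv) (⟪Φ⟫.map ψ)
        ((baseIso Φ x).hom ≫ eqToHom e ≫ (baseIso Y (sieveObj u)).inv) (by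
          rw [p_map_map, hψ]
          simp)
      have : IsIso (𝒴.p.map χ) := by
        rw [hχ]
        infer_instance
      exact ⟨x, ⟨@asIso _ _ _ _ χ (h𝒴.fibered.isIso χ)⟩⟩
  obtain ⟨K, ⟨κ⟩⟩ := h𝒳.exists_functor (faceSieve_mem _) D
  obtain ⟨θ, -⟩ := h𝒴.exists_trans (faceSieve_mem _) (K := K ≫ Φ) (K' := Y)
    ((Bicategory.associator _ _ _).inv ≫ Bicategory.whiskerRight κ.hom Φ ≫ ε.hom)
  have := h𝒴.fibered.isIso_trans θ
  have := isIso_appAt θ (overId _)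
  exact ⟨⟪K⟫.obj (overId _), ⟨@asIso _ _ _ _ (appAt θ (overId _)) this ≪≫ asIso (φ (overId _))⟩⟩

end Local

section Minimal

variable {𝒳 : Based.{u}}

/-- The map of cones underlying a morphism of charts is dominant. -/
def Chart.IsDom {a b : Chart 𝒳} (f : a ⟶ b) : Prop := IsDominant ((Chart.cone 𝒳).map f)

/-- The map of cones underlying a morphism of charts is a face morphism. -/
def Chart.IsFc {a b : Chart 𝒳} (f : a ⟶ b) : Prop := IsFaceMorphism ((Chart.cone 𝒳).map f)

lemma Chart.IsDom.comp {a b c : Chart 𝒳} {f : a ⟶ b} {g : b ⟶ c} (hf : Chart.IsDom f)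
    (hg : Chart.IsDom g) : Chart.IsDom (f ≫ g) := by
  rw [Chart.IsDom, map_comp]
  exact IsDominant.comp hf hg

lemma Chart.IsDom.of_comp {a b c : Chart 𝒳} {f : a ⟶ b} {g : b ⟶ c} (h : Chart.IsDom (f ≫ g)) :
    Chart.IsDom g := by
  rw [Chart.IsDom, map_comp] at h
  exact IsDominant.of_comp h

lemma Chart.IsDom.of_isIso {a b : Chart 𝒳} (f : a ⟶ b) [IsIso f] : Chart.IsDom f :=
  IsDominant.of_isIso ((Chart.cone 𝒳).map f)

lemma Chart.IsFc.comp {a b c : Chart 𝒳} {f : a ⟶ b} {g : b ⟶ c} (hf : Chart.IsFc f)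
    (hg : Chart.IsFc g) : Chart.IsFc (f ≫ g) := by
  rw [Chart.IsFc, map_comp]
  exact IsFaceMorphism.comp hf hg

lemma Chart.IsFc.of_isIso {a b : Chart 𝒳} (f : a ⟶ b) [IsIso f] : Chart.IsFc f :=
  IsFaceMorphism.of_isIso ((Chart.cone 𝒳).map f)

/-- A chart to which all charts under a chart dominantly mapping to it map. -/
structure Chart.IsMinimal (x : Chart 𝒳) : Prop where
  existsUnique : ∀ {y z : Chart 𝒳} (f : y ⟶ x) (g : y ⟶ z), Chart.IsDom f → Chart.IsDom g →
    ∃! h : z ⟶ x, g ≫ h = f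

lemma Chart.IsMinimal.of_iso {x x' : Chart 𝒳} (e : x ≅ x') (h : x.IsMinimal) : x'.IsMinimal := by
  refine ⟨fun {y z} f g hf hg => ?_⟩
  obtain ⟨k, hk, hk'⟩ := h.existsUnique (f ≫ e.inv) g (hf.comp (.of_isIso _)) hg
  refine ⟨k ≫ e.hom, by simp [reassoc_of% hk], fun k' h' => ?_⟩
  rw [← hk' (k' ≫ e.inv) (by simp [reassoc_of% h'])]
  simp

lemma Chart.IsMinimal.hom_ext {x y z : Chart 𝒳} (h : x.IsMinimal) (g : y ⟶ z) {k k' : z ⟶ x}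
    (hg : Chart.IsDom g) (hk : Chart.IsDom (g ≫ k)) (e : g ≫ k = g ≫ k') : k = k' :=
  (h.existsUnique (g ≫ k) g hk hg).unique rfl e.symm

lemma Chart.IsMinimal.isIso {x y : Chart 𝒳} (hx : x.IsMinimal) (hy : y.IsMinimal) (f : x ⟶ y)
    (hf : Chart.IsDom f) : IsIso f := by
  obtain ⟨g, hg, -⟩ := hx.existsUnique (𝟙 x) f (.of_isIso _) hf
  have h1 : f ≫ g ≫ f = f := by rw [reassoc_of% hg]
  have h2 : g ≫ f = 𝟙 y := hy.hom_ext f hf (by rwa [h1]) (h1.trans (comp_id f).symm)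
  exact ⟨g, hg, h2⟩

variable (𝒳) in
/-- A category over cone complexes whose charts have universal dominant maps to charts which are
closed under faces and form a set up to isomorphism. -/
structure IsConelike : Prop where
  fibered : IsFiberedInGroupoids 𝒳
  exists_minimal : ∀ a : Chart 𝒳, ∃ (x : Chart 𝒳) (f : a ⟶ x), x.IsMinimal ∧ Chart.IsDom f
  face : ∀ {x y : Chart 𝒳} (f : x ⟶ y), y.IsMinimal → Chart.IsFc f → x.IsMinimal
  small : ∃ (ι : Type u) (m : ι → Chart 𝒳), ∀ x : Chart 𝒳, x.IsMinimal → ∃ i, Nonempty (x ≅ m i)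

lemma IsFiberedInGroupoids.exists_chart_factorization (h : IsFiberedInGroupoids 𝒳)
    {a b : Chart 𝒳} (f : a ⟶ b) : ∃ (c : Chart 𝒳) (d : a ⟶ c) (g : c ⟶ b), Chart.IsDom d ∧
      Chart.IsFc g ∧ d ≫ g = f := by
  obtain ⟨ρ, d, g, hd, hg, hdg⟩ := RPC.exists_factorization ((Chart.cone 𝒳).map f)
  obtain ⟨c, φ, e, hφ⟩ := h.exists_chart_over b g
  obtain ⟨χ, hχ, hχ'⟩ := h.exists_chart_hom φ f (d ≫ e.inv) (by
    rw [hφ, assoc, Iso.inv_hom_id_assoc, hdg])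
  refine ⟨c, χ, φ, ?_, ?_, hχ'⟩
  · rw [Chart.IsDom, hχ]
    exact hd.comp (IsDominant.of_isIso _)
  · rw [Chart.IsFc, hφ]
    exact (IsFaceMorphism.of_isIso _).comp hg

namespace IsConelike

lemma isFc (h : IsConelike 𝒳) {x y : Chart 𝒳} (f : x ⟶ y) (hx : x.IsMinimal) (hy : y.IsMinimal) : Chart.IsFc f := by
  obtain ⟨c, d, g, hd, hg, rfl⟩ := h.fibered.exists_chart_factorization f
  have := hx.isIso (h.face g hy hg) d hd
  exact (Chart.IsFc.of_isIso d).comp hg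

lemma existsUnique_hom (h : IsConelike 𝒳) {a x y : Chart 𝒳} (f : a ⟶ x) (g : a ⟶ y) (hf : Chart.IsDom f)
    (hx : x.IsMinimal) (hy : y.IsMinimal) : ∃! k : x ⟶ y, f ≫ k = g := by
  obtain ⟨c, d, m, hd, hm, rfl⟩ := h.fibered.exists_chart_factorization g
  obtain ⟨k, hk, -⟩ := (h.face m hy hm).existsUnique d f hd hf
  refine ⟨k ≫ m, by simp [reassoc_of% hk], fun k' hk' => ?_⟩
  have hkm : f ≫ k ≫ m = d ≫ m := by rw [reassoc_of% hk]
  have h1 : Chart.IsFc (k ≫ m) := h.isFc _ hx hy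
  have h2 : Chart.IsFc k' := h.isFc _ hx hy
  obtain ⟨e, he, he'⟩ := exists_iso_of_factorizations hf h2 hf h1 (by
    rw [← map_comp, ← map_comp, hk', hkm])
  obtain ⟨χ, hχ, hχ'⟩ := h.fibered.exists_chart_hom (k ≫ m) k' e.hom he
  have h3 : f ≫ χ = f := h.fibered.chart_cancel (k ≫ m)
    (by rw [map_comp, hχ, he']) (by rw [assoc, hχ', hk', hkm])
  have h4 : χ = 𝟙 x := hx.hom_ext f hf (by rwa [h3]) (by rw [h3, comp_id])
  rw [← hχ', h4, id_comp]

lemma hom_ext (h : IsConelike 𝒳) {a x y : Chart 𝒳} (f : a ⟶ x) {k k' : x ⟶ y} (hf : Chart.IsDom f)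
    (hx : x.IsMinimal) (hy : y.IsMinimal) (e : f ≫ k = f ≫ k') : k = k' :=
  (h.existsUnique_hom f (f ≫ k) hf hx hy).unique rfl e.symm

end IsConelike

/-- A cone with an isomorphism to the cone of a minimal chart. -/
structure MinChart (h : IsConelike 𝒳) : Type (u + 1) where
  base : RPC.{u}
  chart : Chart 𝒳
  minimal : chart.IsMinimal
  iso : base ≅ (Chart.cone 𝒳).obj chart

instance (h : IsConelike 𝒳) : Category.{u} (MinChart h) where
  Hom a b := a.chart ⟶ b.chart
  id a := 𝟙 a.chart
  comp f g := f ≫ g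
  id_comp _ := id_comp _
  comp_id _ := comp_id _
  assoc _ _ _ := assoc _ _ _

namespace MinChart

variable {h : IsConelike 𝒳}

/-- The underlying morphism of charts. -/
def hom {a b : MinChart h} (f : a ⟶ b) : a.chart ⟶ b.chart := f

/-- The morphism given by a morphism of charts. -/
def mkHom {a b : MinChart h} (f : a.chart ⟶ b.chart) : a ⟶ b := f

/-- The underlying map of cones. -/
def conMap {a b : MinChart h} (f : a ⟶ b) : a.base ⟶ b.base :=
  a.iso.hom ≫ (Chart.cone 𝒳).map (hom f) ≫ b.iso.inv

lemma isFaceMorphism_conMap {a b : MinChart h} (f : a ⟶ b) : IsFaceMorphism (conMap f) :=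
  (IsFaceMorphism.of_isIso _).comp
    (IsFaceMorphism.comp (h.isFc (hom f) a.minimal b.minimal) (.of_isIso _))

lemma conMap_comp {a b c : MinChart h} (f : a ⟶ b) (g : b ⟶ c) :
    conMap (f ≫ g) = conMap f ≫ conMap g := by
  have : (Chart.cone 𝒳).map (hom (f ≫ g)) =
    (Chart.cone 𝒳).map (hom f) ≫ (Chart.cone 𝒳).map (hom g) := (Chart.cone 𝒳).map_comp _ _
  rw [conMap, this]
  simp [conMap]

lemma conMap_id (a : MinChart h) : conMap (𝟙 a) = 𝟙 a.base := by
  have : (Chart.cone 𝒳).map (hom (𝟙 a)) = 𝟙 _ := (Chart.cone 𝒳).map_id _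
  rw [conMap, this]
  simp

variable (h) in
/-- The projection to cones. -/
def proj : MinChart h ⥤ RPCf.{u} where
  obj a := ⟨a.base⟩
  map f := ⟨conMap f, isFaceMorphism_conMap f⟩
  map_id a := WideSubcategory.hom_ext _ (conMap_id a)
  map_comp f g := WideSubcategory.hom_ext _ (conMap_comp f g)

lemma fibered : IsFiberedInGroupoids (BasedCategory.ofFunctor (proj h)) := by
  refine IsFiberedInGroupoids.mk' (fun (a : MinChart h) {R} f => ?_)
    (fun {a b a' : MinChart h} φ φ' k hk => ?_) (fun {a b a' : MinChart h} φ χ χ' h1 h2 => ?_)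
  · obtain ⟨R⟩ := R
    obtain ⟨f, hf⟩ := f
    change R ⟶ a.base at f
    change IsFaceMorphism f at hf
    obtain ⟨c, φ, e, hφ⟩ := h.fibered.exists_chart_over a.chart (f ≫ a.iso.hom)
    have hc : c.IsMinimal := h.face φ a.minimal (by
      rw [Chart.IsFc, hφ]
      exact (IsFaceMorphism.of_isIso _).comp (hf.comp (.of_isIso _)))
    let b : MinChart h := ⟨R, c, hc, e.symm⟩
    refine ⟨b, mkHom (a := b) φ, rfl, WideSubcategory.hom_ext _ ?_⟩
    have h1 : e.inv ≫ (Chart.cone 𝒳).map φ ≫ a.iso.inv = f := by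
      rw [hφ]
      simp
    exact h1.trans (id_comp _).symm
  · obtain ⟨k, hk'⟩ := k
    change a'.base ⟶ a.base at k
    have h0 : k ≫ conMap φ = conMap φ' := congrArg (fun f => f.hom) hk
    obtain ⟨χ, h1, h2⟩ := h.fibered.exists_chart_hom (hom φ) (hom φ') (a'.iso.inv ≫ k ≫ a.iso.hom) (by
      have := congrArg (fun m => a'.iso.inv ≫ m ≫ b.iso.hom) h0
      simpa [conMap] using this)
    refine ⟨mkHom χ, WideSubcategory.hom_ext _ ?_, h2⟩
    have : a'.iso.hom ≫ (Chart.cone 𝒳).map χ ≫ a.iso.inv = k := by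
      rw [h1]
      simp
    exact this
  · have h0 : conMap χ = conMap χ' := congrArg (fun f => f.hom) h1
    refine h.fibered.chart_cancel (hom φ) (χ := hom χ) (χ' := hom χ') ?_ h2
    have := congrArg (fun m => a'.iso.inv ≫ m ≫ a.iso.hom) h0
    simpa [conMap] using this

/-- An isomorphism given by an isomorphism of charts. -/
def mkIso {a b : MinChart h} (e : a.chart ≅ b.chart) : a ≅ b :=
  ⟨mkHom e.hom, mkHom e.inv, e.hom_inv_id, e.inv_hom_id⟩

lemma essentiallySmall : EssentiallySmall.{u} (MinChart h) := by
  obtain ⟨ι, m, hm⟩ := h.small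
  have hm' : ∀ a : MinChart h, ∃ i, Nonempty (a.chart ≅ m i) := fun a => hm _ a.minimal
  choose i e using hm'
  refine (essentiallySmall_iff _).2 ⟨?_, inferInstance⟩
  refine small_of_injective (f := fun X : Skeleton (MinChart h) => i ((fromSkeleton _).obj X))
    fun X Y hXY => ?_
  obtain ⟨e₁⟩ := e ((fromSkeleton _).obj X)
  obtain ⟨e₂⟩ := e ((fromSkeleton _).obj Y)
  exact skeleton_skeletal _ ⟨(fromSkeleton _).preimageIso
    (mkIso (e₁ ≪≫ eqToIso (congrArg m hXY) ≪≫ e₂.symm))⟩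

end MinChart

/-- The combinatorial cone stack of minimal charts. -/
def IsConelike.stack (h : IsConelike 𝒳) : CombConeStack.{u} where
  based := BasedCategory.ofFunctor (MinChart.proj h)
  fibered := MinChart.fibered
  small := MinChart.essentiallySmall

end Minimal

namespace IsConelike

variable {𝒳 : Based.{u}} (h : IsConelike 𝒳)

/-- The minimal chart under a chart. -/
def minimal (a : Chart 𝒳) : Chart 𝒳 := (h.exists_minimal a).choose

/-- The dominant map to the minimal chart. -/
def toMinimal (a : Chart 𝒳) : a ⟶ h.minimal a := (h.exists_minimal a).choose_spec.choose

lemma isMinimal_minimal (a : Chart 𝒳) : (h.minimal a).IsMinimal :=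
  (h.exists_minimal a).choose_spec.choose_spec.1

lemma isDom_toMinimal (a : Chart 𝒳) : Chart.IsDom (h.toMinimal a) :=
  (h.exists_minimal a).choose_spec.choose_spec.2

/-- The morphism of minimal charts under a morphism of charts. -/
def minimalMap {a b : Chart 𝒳} (n : a ⟶ b) : h.minimal a ⟶ h.minimal b :=
  (h.existsUnique_hom (h.toMinimal a) (n ≫ h.toMinimal b) (h.isDom_toMinimal a)
    (h.isMinimal_minimal a) (h.isMinimal_minimal b)).choose

lemma toMinimal_comp {a b : Chart 𝒳} (n : a ⟶ b) :
    h.toMinimal a ≫ h.minimalMap n = n ≫ h.toMinimal b :=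
  (h.existsUnique_hom (h.toMinimal a) (n ≫ h.toMinimal b) (h.isDom_toMinimal a)
    (h.isMinimal_minimal a) (h.isMinimal_minimal b)).choose_spec.1

lemma minimalMap_eq {a b : Chart 𝒳} (n : a ⟶ b) (k : h.minimal a ⟶ h.minimal b)
    (hk : h.toMinimal a ≫ k = n ≫ h.toMinimal b) : h.minimalMap n = k :=
  h.hom_ext (h.toMinimal a) (h.isDom_toMinimal a) (h.isMinimal_minimal a) (h.isMinimal_minimal b)
    ((h.toMinimal_comp n).trans hk.symm)

/-- The object of the combinatorial cone stack given by a minimal chart. -/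
def point (x : Chart 𝒳) (hx : x.IsMinimal) : h.stack.based.obj :=
  (⟨(Chart.cone 𝒳).obj x, x, hx, Iso.refl _⟩ : MinChart h)

/-- The morphism of the combinatorial cone stack given by a morphism of minimal charts. -/
def pointMap {x y : Chart 𝒳} {hx hy} (f : x ⟶ y) : h.point x hx ⟶ h.point y hy :=
  MinChart.mkHom (a := h.point x hx) (b := h.point y hy) f

lemma cone_pointMap {x y : Chart 𝒳} {hx hy} (f : x ⟶ y) :
    h.stack.cone.map (h.pointMap f : h.point x hx ⟶ h.point y hy) = (Chart.cone 𝒳).map f :=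
  (id_comp _).trans (comp_id _)

/-- The marking of a chart by the minimal chart. -/
def toMark : Chart 𝒳 ⥤ h.stack.Mark where
  obj a := ⟨(Chart.cone 𝒳).obj a, h.point (h.minimal a) (h.isMinimal_minimal a),
    (Chart.cone 𝒳).map (h.toMinimal a), h.isDom_toMinimal a⟩
  map {a b} n := ⟨(Chart.cone 𝒳).map n, h.pointMap (h.minimalMap n), by
    refine Eq.trans ?_ (congrArg ((Chart.cone 𝒳).map (h.toMinimal a) ≫ ·)
      (h.cone_pointMap (hx := h.isMinimal_minimal a) (hy := h.isMinimal_minimal b)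
        (h.minimalMap n)).symm)
    exact ((Chart.cone 𝒳).map_comp _ _).symm.trans
      ((congrArg (Chart.cone 𝒳).map (h.toMinimal_comp n).symm).trans ((Chart.cone 𝒳).map_comp _ _))⟩
  map_id a := CombConeStack.Mark.hom_ext ((Chart.cone 𝒳).map_id a)
    (h.minimalMap_eq (𝟙 a) (𝟙 _) ((comp_id _).trans (id_comp _).symm))
  map_comp {a b c} m n := CombConeStack.Mark.hom_ext ((Chart.cone 𝒳).map_comp m n)
    (h.minimalMap_eq (m ≫ n) (h.minimalMap m ≫ h.minimalMap n) (by
      rw [← assoc, toMinimal_comp, assoc, toMinimal_comp, assoc]))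

instance : h.toMark.Faithful where
  map_injective {a b n n'} e := by
    have h1 : (Chart.cone 𝒳).map n = (Chart.cone 𝒳).map n' := congrArg CombConeStack.Mark.Hom.cone e
    have h2 : h.minimalMap n = h.minimalMap n' :=
      congrArg (fun k : h.toMark.obj a ⟶ h.toMark.obj b =>
        MinChart.hom (h := h) (CombConeStack.Mark.Hom.pt k)) e
    exact h.fibered.chart_cancel (h.toMinimal b) h1 (by rw [← toMinimal_comp, ← toMinimal_comp, h2])

instance : h.toMark.Full where
  map_surjective {a b} := by
    rintro ⟨k, q, e⟩
    obtain ⟨q, rfl⟩ : ∃ q', h.pointMap q' = q := ⟨MinChart.hom q, rfl⟩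
    change (Chart.cone 𝒳).obj a ⟶ (Chart.cone 𝒳).obj b at k
    have e' : k ≫ (Chart.cone 𝒳).map (h.toMinimal b) =
        (Chart.cone 𝒳).map (h.toMinimal a) ≫ (Chart.cone 𝒳).map q :=
      e.trans (congrArg ((Chart.cone 𝒳).map (h.toMinimal a) ≫ ·) (h.cone_pointMap q))
    obtain ⟨χ, h1, h2⟩ := h.fibered.exists_chart_hom (h.toMinimal b) (h.toMinimal a ≫ q) k
      (by rw [map_comp, e'])
    exact ⟨χ, CombConeStack.Mark.hom_ext h1 (h.minimalMap_eq χ q h2.symm)⟩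

instance : h.toMark.EssSurj where
  mem_essImage := by
    rintro ⟨σ, x, d, hd⟩
    change MinChart h at x
    change σ ⟶ x.base at d
    have hi : IsIso (MinChart.iso x).hom := inferInstance
    have hx : (MinChart.chart x).IsMinimal := MinChart.minimal x
    let f : σ ⟶ (Chart.cone 𝒳).obj (MinChart.chart x) := d ≫ (MinChart.iso x).hom
    have hf : IsDominant f := IsDominant.comp hd (IsDominant.of_isIso x.iso.hom)
    obtain ⟨b, φ, e, hφ⟩ := h.fibered.exists_chart_over (MinChart.chart x) f
    have hφd : Chart.IsDom φ := by
      rw [Chart.IsDom, hφ]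
      exact (IsDominant.of_isIso _).comp hf
    obtain ⟨k, hk, -⟩ := h.existsUnique_hom (h.toMinimal b) φ (h.isDom_toMinimal b)
      (h.isMinimal_minimal b) (MinChart.minimal x)
    have hki := Chart.IsMinimal.isIso (h.isMinimal_minimal b) (MinChart.minimal x) k
      (Chart.IsDom.of_comp (f := h.toMinimal b) (by rwa [hk]))
    let k' : h.point (h.minimal b) (h.isMinimal_minimal b) ≅ x := MinChart.mkIso (@asIso _ _ _ _ k hki)
    have h0 : (Chart.cone 𝒳).map (h.toMinimal b) ≫ (Chart.cone 𝒳).map k = e.hom ≫ f := by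
      rw [← hφ, ← hk, map_comp]
    have h1 : e.hom ≫ d = (Chart.cone 𝒳).map (h.toMinimal b) ≫ (Chart.cone 𝒳).map k ≫
        (MinChart.iso x).inv := by
      rw [← assoc, h0, assoc, assoc, Iso.hom_inv_id, comp_id]
    let m : h.toMark.obj b ⟶ ⟨σ, x, d, hd⟩ := (⟨e.hom, k'.hom,
      h1.trans (congrArg _ (id_comp _).symm)⟩ : CombConeStack.Mark.Hom _ _)
    have hm1 : IsIso (CombConeStack.Mark.Hom.cone m) := inferInstanceAs (IsIso e.hom)
    have hm2 : IsIso (CombConeStack.Mark.Hom.pt m) := k'.isIso_hom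
    exact ⟨b, ⟨@asIso _ _ _ _ m (CombConeStack.Mark.isIso m)⟩⟩

instance : h.toMark.IsEquivalence where

lemma exists_equivalence (h𝒳 : IsStack faceTopology 𝒳) :
    Nonempty (Bicategory.Equivalence 𝒳 h.stack.geom) := by
  obtain ⟨K, i, -⟩ := CombConeStack.exists_functor_of_charts h.fibered h.toMark (Iso.refl _)
  have h1 : (Chart.map K ⋙ CombConeStack.mark h.stack).IsEquivalence :=
    Functor.isEquivalence_of_iso i.symm
  have h2 : (Chart.map K).IsEquivalence :=
    Functor.isEquivalence_of_comp_right _ (CombConeStack.mark h.stack)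
  obtain ⟨e, -⟩ := exists_equivalence_of_charts K h𝒳 (CombConeStack.geom_isStack _)
  exact ⟨e⟩

end IsConelike

namespace CombConeStack

variable {S : CombConeStack.{u}}

lemma cone_toSec (a : Chart S.geom) :
    (Chart.cone S.geom).map (toSec a) ≫ secCone (val a) = markMap a :=
  congrArg Mark.Hom.cone (mark_toSec a)

lemma hom_sec_eq {y : Chart S.geom} {s : S.based.obj} (f : y ⟶ (sec S).obj s) :
    f = toSec y ≫ (sec S).map (valMap f ≫ secPt s) := by
  apply (mark S).map_injective
  have h1 : (mark S).map f ≫ (secHom s).hom =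
      Mark.toSelf ((mark S).obj y) ≫ (selfMark S).map (valMap f ≫ secPt s) := by
    refine Mark.hom_ext ?_ (id_comp _).symm
    have h2 := markMap_naturality f
    have h3 : (Chart.cone S.geom).map f ≫ secCone s = markMap y ≫ S.cone.map (valMap f ≫ secPt s) := by
      rw [← markMap_sec, ← assoc, h2, assoc, map_comp]
    exact h3
  have h4 := secHom_naturality (S := S) (valMap f ≫ secPt s)
  have h5 : (mark S).map (toSec y ≫ (sec S).map (valMap f ≫ secPt s)) ≫ (secHom s).hom =
      ((mark S).map (toSec y) ≫ (secHom (val y)).hom) ≫ (selfMark S).map (valMap f ≫ secPt s) := by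
    rw [map_comp, assoc, h4, assoc]
  have h6 : ((mark S).map (toSec y) ≫ (secHom (val y)).hom) ≫
      (selfMark S).map (valMap f ≫ secPt s) = (mark S).map f ≫ (secHom s).hom :=
    (congrArg (· ≫ (selfMark S).map (valMap f ≫ secPt s)) (mark_toSec y)).trans h1.symm
  exact (cancel_mono (secHom s).hom).1 (h5.trans h6).symm

lemma isDominant_markMap (a : Chart S.geom) : IsDominant (markMap a) := ((mark S).obj a).dominant

lemma isIso_valMap {a b : Chart S.geom} (f : a ⟶ b) (hf : Chart.IsDom f) : IsIso (valMap f) := by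
  refine S.isIso_of_isDominant _ ?_
  have h := IsDominant.comp hf (isDominant_markMap b)
  rw [markMap_naturality] at h
  exact h.of_comp

lemma isMinimal_sec (s : S.based.obj) : ((sec S).obj s).IsMinimal := by
  refine ⟨fun {y z} f g hf hg => ?_⟩
  have := isIso_valMap f hf
  have := isIso_valMap g hg
  refine ⟨toSec z ≫ (sec S).map (inv (valMap g) ≫ valMap f ≫ secPt s), ?_, fun h' hh => ?_⟩
  · change g ≫ toSec z ≫ (sec S).map (inv (valMap g) ≫ valMap f ≫ secPt s) = f
    rw [← assoc, toSec_naturality, assoc, ← map_comp, IsIso.hom_inv_id_assoc]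
    exact (hom_sec_eq f).symm
  · rw [hom_sec_eq h']
    congr 2
    rw [IsIso.eq_inv_comp, ← assoc, ← valMap_comp, hh]

lemma isDom_toSec (a : Chart S.geom) : Chart.IsDom (toSec a) := by
  have h : (Chart.cone S.geom).map (toSec a) = markMap a ≫ inv (secCone (val a)) := by
    rw [IsIso.eq_comp_inv, cone_toSec]
  rw [Chart.IsDom, h]
  exact (isDominant_markMap a).comp (.of_isIso _)

lemma isIso_markMap {a : Chart S.geom} (ha : a.IsMinimal) : IsIso (markMap a) := by
  have := ha.isIso (isMinimal_sec (val a)) (toSec a) (isDom_toSec a)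
  rw [← cone_toSec]
  infer_instance

lemma isMinimal_of_isIso_markMap {a : Chart S.geom} [IsIso (markMap a)] : a.IsMinimal := by
  have : IsIso ((Chart.cone S.geom).map (toSec a)) := by
    have h : (Chart.cone S.geom).map (toSec a) = markMap a ≫ inv (secCone (val a)) := by
      rw [IsIso.eq_comp_inv, cone_toSec]
    rw [h]
    infer_instance
  have := (geom_fibered S).chart_isIso (toSec a)
  exact Chart.IsMinimal.of_iso (asIso (toSec a)).symm (isMinimal_sec (val a))

variable (S) in
lemma geom_isConelike : IsConelike S.geom where
  fibered := geom_fibered S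
  exists_minimal a := ⟨_, toSec a, isMinimal_sec _, isDom_toSec a⟩
  face {x y} f hy hf := by
    have := isIso_markMap (a := y) hy
    have h1 : IsFaceMorphism ((Chart.cone S.geom).map f ≫ markMap y) :=
      IsFaceMorphism.comp hf (IsFaceMorphism.of_isIso (markMap y))
    rw [markMap_naturality] at h1
    have h2 : IsFaceMorphism (markMap x) := h1.of_comp (S.isFace _)
    have := h2.isIso_of_isDominant (isDominant_markMap x)
    exact isMinimal_of_isIso_markMap
  small := by
    have := S.small
    let e := equivSmallModel.{u} S.based.obj
    refine ⟨SmallModel.{u} S.based.obj, fun i => (sec S).obj (e.inverse.obj i), fun x hx => ?_⟩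
    have := hx.isIso (isMinimal_sec (val x)) (toSec x) (isDom_toSec x)
    exact ⟨e.functor.obj (val x), ⟨asIso (toSec x) ≪≫ (sec S).mapIso (e.unitIso.app (val x))⟩⟩

end CombConeStack

lemma RPC.IsPB.iso_comp {e e' σ τ ξ : RPC.{u}} {p : e ⟶ σ} {q : e ⟶ τ} {a : σ ⟶ ξ} {b : τ ⟶ ξ}
    (H : RPC.IsPB p q a b) (i : e' ⟶ e) [IsIso i] : RPC.IsPB (i ≫ p) (i ≫ q) a b where
  w := by rw [assoc, H.w, assoc]
  inj z z' h1 h2 := by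
    have hi : ∀ z, RPC.real (inv i) (RPC.real i z) = z := fun z => by
      rw [← RPC.real_comp_apply, IsIso.hom_inv_id, RPC.real_id, LinearMap.id_apply]
    rw [RPC.real_comp_apply, RPC.real_comp_apply] at h1 h2
    rw [← hi z, ← hi z', H.inj _ _ h1 h2]
  points x hx y hy h := by
    obtain ⟨z, hz, h1, h2⟩ := H.points x hx y hy h
    have hi : RPC.real i (RPC.real (inv i) z) = z := by
      rw [← RPC.real_comp_apply, IsIso.inv_hom_id, RPC.real_id, LinearMap.id_apply]
    exact ⟨RPC.real (inv i) z, RPC.real_mem _ hz, by rw [RPC.real_comp_apply, hi, h1],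
      by rw [RPC.real_comp_apply, hi, h2]⟩
  lift f g h := by
    obtain ⟨k, h1, h2⟩ := H.lift f g h
    exact ⟨k ≫ inv i, by simp [h1], by simp [h2]⟩

lemma IsConelike.hom_ext' {𝒳 : Based.{u}} (h : IsConelike 𝒳)
    {a x y : Chart 𝒳} (f : a ⟶ x) {k k' : x ⟶ y} (hf : Chart.IsDom f) (hy : y.IsMinimal)
    (e : f ≫ k = f ≫ k') : k = k' := by
  obtain ⟨m, d, hm, hd⟩ := h.exists_minimal x
  obtain ⟨l, rfl, -⟩ := h.existsUnique_hom d k hd hm hy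
  obtain ⟨l', rfl, -⟩ := h.existsUnique_hom d k' hd hm hy
  have : l = l' := h.hom_ext (f ≫ d) (hf.comp hd) hm hy (by rw [assoc, e, assoc])
  rw [this]

section FiberProducts

variable {𝒳 𝒴 𝒵 : Based.{u}}

/-- The map of cones underlying a morphism from the image of a chart. -/
def Chart.con (K : 𝒳 ⟶ 𝒴) {a : Chart 𝒳} {y : Chart 𝒴} (t : (Chart.map K).obj a ⟶ y) :
    (Chart.cone 𝒳).obj a ⟶ (Chart.cone 𝒴).obj y := (Chart.cone 𝒴).map t

lemma Chart.con_comp (K : 𝒳 ⟶ 𝒴) {a : Chart 𝒳} {y y' : Chart 𝒴} (t : (Chart.map K).obj a ⟶ y)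
    (s : y ⟶ y') : Chart.con K (t ≫ s) = Chart.con K t ≫ (Chart.cone 𝒴).map s :=
  (Chart.cone 𝒴).map_comp t s

lemma Chart.con_map (K : 𝒳 ⟶ 𝒴) {a b : Chart 𝒳} (n : a ⟶ b) :
    Chart.con K ((Chart.map K).map n) = (Chart.cone 𝒳).map n := Chart.cone_map K n

lemma Chart.con_map_comp (K : 𝒳 ⟶ 𝒴) {a b : Chart 𝒳} {y : Chart 𝒴} (n : a ⟶ b)
    (t : (Chart.map K).obj b ⟶ y) : Chart.con K ((Chart.map K).map n ≫ t) =
      (Chart.cone 𝒳).map n ≫ Chart.con K t :=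
  ((Chart.cone 𝒴).map_comp _ t).trans (congrArg (· ≫ (Chart.cone 𝒴).map t) (Chart.cone_map K n))

lemma Chart.IsDom.map (K : 𝒳 ⟶ 𝒴) {a b : Chart 𝒳} {n : a ⟶ b} (h : Chart.IsDom n) :
    Chart.IsDom ((Chart.map K).map n) := by
  rw [Chart.IsDom, Chart.cone_map]
  exact h

variable {F : 𝒳 ⟶ 𝒵} {G : 𝒴 ⟶ 𝒵}

/-- The first component of a chart of a fibre product. -/
abbrev Chart.fst (a : Chart (fiberProd F G)) : Chart 𝒳 := (Chart.map (fiberProdFst F G)).obj a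

/-- The second component of a chart of a fibre product. -/
abbrev Chart.snd (a : Chart (fiberProd F G)) : Chart 𝒴 := (Chart.map (fiberProdSnd F G)).obj a

/-- The object underlying a chart of a fibre product. -/
def Chart.fp (a : Chart (fiberProd F G)) : FiberProdObj F G := a.pt

/-- The comparison of the components of a chart of a fibre product. -/
def Chart.cmp (a : Chart (fiberProd F G)) : (Chart.map F).obj a.fst ⟶ (Chart.map G).obj a.snd :=
  Chart.mkHom a.fp.iso.hom

instance (a : Chart (fiberProd F G)) : IsIso a.cmp :=
  ⟨Chart.mkHom a.fp.iso.inv, a.fp.iso.hom_inv_id, a.fp.iso.inv_hom_id⟩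

lemma Chart.cmp_naturality {a b : Chart (fiberProd F G)} (n : a ⟶ b) :
    (Chart.map F).map ((Chart.map (fiberProdFst F G)).map n) ≫ b.cmp =
      a.cmp ≫ (Chart.map G).map ((Chart.map (fiberProdSnd F G)).map n) :=
  FiberProdHom.comm (show FiberProdHom a.fp b.fp from Chart.hom n)

lemma Chart.domain_cmp (a : Chart (fiberProd F G)) : (Chart.domain 𝒵).map a.cmp = 𝟙 a.dom := by
  let i : a.dom.cx ≅ 𝒳.p.obj a.fp.fst := a.iso
  have h1 : (((i.hom ≫ 𝟙 (𝒳.p.obj a.fp.fst)) ≫ (baseIso F a.fp.fst).inv) ≫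
      𝒵.p.map a.fp.iso.hom) ≫ (baseIso G a.fp.snd).hom ≫ a.fp.bi.hom ≫ i.inv = 𝟙 a.dom.cx := by
    rw [FiberProdObj.p_iso]
    simp
  refine Eq.trans ?_ h1
  exact (assoc _ _ _).symm

lemma Chart.cone_cmp (a : Chart (fiberProd F G)) :
    Chart.con F a.cmp = 𝟙 ((Chart.cone (fiberProd F G)).obj a) :=
  (congrArg Topped.ev.map (Chart.domain_cmp a)).trans (Topped.ev.map_id _)

lemma Chart.con_cmp_comp (a : Chart (fiberProd F G)) {z : Chart 𝒵}
    (t : (Chart.map G).obj a.snd ⟶ z) : Chart.con F (a.cmp ≫ t) = Chart.con G t :=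
  ((Chart.cone 𝒵).map_comp a.cmp t).trans ((congrArg (· ≫ (Chart.cone 𝒵).map t)
    (Chart.cone_cmp a)).trans (id_comp _))

lemma fiberProd_hom_ext {a b : Chart (fiberProd F G)} {k k' : a ⟶ b}
    (h1 : (Chart.map (fiberProdFst F G)).map k = (Chart.map (fiberProdFst F G)).map k')
    (h2 : (Chart.map (fiberProdSnd F G)).map k = (Chart.map (fiberProdSnd F G)).map k') : k = k' :=
  FiberProdHom.ext h1 h2

lemma exists_fiberProd_hom {a b : Chart (fiberProd F G)} (f : a.fst ⟶ b.fst) (g : a.snd ⟶ b.snd)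
    (h : Chart.con (fiberProdFst F G) f = Chart.con (fiberProdSnd F G) g)
    (w : (Chart.map F).map f ≫ b.cmp = a.cmp ≫ (Chart.map G).map g) :
    ∃ k : a ⟶ b, (Chart.map (fiberProdFst F G)).map k = f ∧
      (Chart.map (fiberProdSnd F G)).map k = g := by
  have h0 : (Chart.domain 𝒳).map f = (Chart.domain 𝒴).map g := Topped.ev.map_injective h
  let i : a.dom.cx ≅ 𝒳.p.obj a.fp.fst := a.iso
  let j : b.dom.cx ≅ 𝒳.p.obj b.fp.fst := b.iso
  let f' : a.fp.fst ⟶ b.fp.fst := Chart.hom f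
  let g' : a.fp.snd ⟶ b.fp.snd := Chart.hom g
  have h1 : (i.hom ≫ 𝟙 (𝒳.p.obj a.fp.fst)) ≫ 𝒳.p.map f' ≫
      𝟙 (𝒳.p.obj b.fp.fst) ≫ j.inv = (i.hom ≫ a.fp.bi.inv) ≫ 𝒴.p.map g' ≫ b.fp.bi.hom ≫ j.inv := h0
  have h2 : 𝒴.p.map g' = a.fp.bi.hom ≫ 𝒳.p.map f' ≫ b.fp.bi.inv := by
    rw [comp_id, id_comp, assoc, cancel_epi, ← assoc, ← assoc, cancel_mono] at h1
    rw [h1]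
    simp
  exact ⟨Chart.mkHom (FiberProdHom.mk' (a := a.fp) (b := b.fp) f' g' h2 w), rfl, rfl⟩

lemma exists_fiberProd_chart (h𝒴 : IsFiberedInGroupoids 𝒴) (h𝒵 : IsFiberedInGroupoids 𝒵)
    {x : Chart 𝒳} {y : Chart 𝒴} (i : (Chart.map F).obj x ⟶ (Chart.map G).obj y) :
    ∃ (a : Chart (fiberProd F G)) (m : a.fst ⟶ x) (n : a.snd ⟶ y), IsIso m ∧
      (Chart.map F).map m ≫ i = a.cmp ≫ (Chart.map G).map n := by
  let i₀ : ⟪F⟫.obj x.pt ⟶ ⟪G⟫.obj y.pt := Chart.hom i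
  obtain ⟨y', φ, e, hφ⟩ := h𝒴.exists_pullback y.pt
    ((baseIso F x.pt).inv ≫ 𝒵.p.map i₀ ≫ (baseIso G y.pt).hom)
  obtain ⟨i', hi, hi'⟩ := h𝒵.exists_hom (⟪G⟫.map φ) i₀
    ((baseIso F x.pt).hom ≫ eqToHom e.symm ≫ (baseIso G y').inv) (by
      rw [p_map_map, hφ]
      simp only [assoc, Iso.inv_hom_id_assoc, eqToHom_trans_assoc, eqToHom_refl,
        id_comp, Iso.hom_inv_id_assoc, Iso.hom_inv_id, comp_id])
  obtain ⟨h1, -, h2⟩ := exists_fiberProdObj x.pt y' e i' hi h𝒵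
  let a : Chart (fiberProd F G) := ⟨(⟨x.pt, y', asIso i', h2⟩ : FiberProdObj F G), x.dom, x.iso⟩
  let m : a.fst ⟶ x := Chart.mkHom (a := a.fst) (𝟙 x.pt)
  have hm : IsIso m := ⟨Chart.mkHom (b := a.fst) (𝟙 x.pt), comp_id (𝟙 x.pt), comp_id (𝟙 x.pt)⟩
  refine ⟨a, m, Chart.mkHom (a := a.snd) φ, hm, ?_⟩
  have h3 : ⟪F⟫.map (𝟙 x.pt) ≫ i₀ = i' ≫ ⟪G⟫.map φ := by
    rw [map_id, id_comp, hi']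
  exact h3

end FiberProducts

lemma RPC.IsPB.change {e σ τ ξ σ' τ' ξ' : RPC.{u}} {p : e ⟶ σ} {q : e ⟶ τ} {a : σ ⟶ ξ} {b : τ ⟶ ξ}
    (H : RPC.IsPB p q a b) (i : σ ≅ σ') (j : τ ≅ τ') (k : ξ ≅ ξ') :
    RPC.IsPB (p ≫ i.hom) (q ≫ j.hom) (i.inv ≫ a ≫ k.hom) (j.inv ≫ b ≫ k.hom) := by
  have hi {σ σ' : RPC.{u}} (i : σ ≅ σ') (z) : RPC.real i.inv (RPC.real i.hom z) = z := by
    rw [← RPC.real_comp_apply, Iso.hom_inv_id, RPC.real_id, LinearMap.id_apply]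
  have hc {σ σ' : RPC.{u}} (i : σ ≅ σ') {z z'} (h : RPC.real i.hom z = RPC.real i.hom z') :
      z = z' := by rw [← hi i z, h, hi]
  refine ⟨by simp [reassoc_of% H.w], fun z z' h1 h2 => ?_, fun x hx y hy h => ?_, fun f g h => ?_⟩
  · rw [RPC.real_comp_apply, RPC.real_comp_apply] at h1 h2
    exact H.inj _ _ (hc i h1) (hc j h2)
  · simp only [RPC.real_comp_apply] at h
    obtain ⟨z, hz, h1, h2⟩ := H.points _ (RPC.real_mem i.inv hx) _ (RPC.real_mem j.inv hy) (hc k h)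
    exact ⟨z, hz, by rw [RPC.real_comp_apply, h1]; exact hi i.symm x,
      by rw [RPC.real_comp_apply, h2]; exact hi j.symm y⟩
  · obtain ⟨l, h1, h2⟩ := H.lift (f ≫ i.inv) (g ≫ j.inv) (by
      rw [← cancel_mono k.hom]
      simpa using h)
    exact ⟨l, by simp [reassoc_of% h1], by simp [reassoc_of% h2]⟩

section FiberProducts

variable {𝒳 𝒴 𝒵 : Based.{u}} {F : 𝒳 ⟶ 𝒵} {G : 𝒴 ⟶ 𝒵}

lemma exists_fiberProd_lift {c : Chart (fiberProd F G)} {x : Chart 𝒳} {y : Chart 𝒴} {z : Chart 𝒵}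
    {s : (Chart.map F).obj x ⟶ z} {t : (Chart.map G).obj y ⟶ z} {p : c.fst ⟶ x}
    {q : c.snd ⟶ y} (h𝒳 : IsFiberedInGroupoids 𝒳) (h𝒴 : IsFiberedInGroupoids 𝒴)
    (h𝒵 : IsFiberedInGroupoids 𝒵)
    (hw : (Chart.map F).map p ≫ s = c.cmp ≫ (Chart.map G).map q ≫ t)
    (hpb : RPC.IsPB (Chart.con (fiberProdFst F G) p) (Chart.con (fiberProdSnd F G) q)
      (Chart.con F s) (Chart.con G t)) {b : Chart (fiberProd F G)} (f : b.fst ⟶ x) (g : b.snd ⟶ y)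
    (h : (Chart.map F).map f ≫ s = b.cmp ≫ (Chart.map G).map g ≫ t) :
    ∃ k : b ⟶ c, (Chart.map (fiberProdFst F G)).map k ≫ p = f ∧
      (Chart.map (fiberProdSnd F G)).map k ≫ q = g := by
  have h0 : Chart.con (fiberProdFst F G) f ≫ Chart.con F s =
      Chart.con (fiberProdSnd F G) g ≫ Chart.con G t := by
    have := congrArg (Chart.con F) h
    rw [Chart.con_cmp_comp, Chart.con_map_comp, Chart.con_map_comp] at this
    exact this
  obtain ⟨l, hl, hl'⟩ := hpb.lift _ _ h0
  obtain ⟨k₁, h1, h1'⟩ := h𝒳.exists_chart_hom p f l hl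
  obtain ⟨k₂, h2, h2'⟩ := h𝒴.exists_chart_hom q g l hl'
  obtain ⟨k, rfl, rfl⟩ := exists_fiberProd_hom k₁ k₂ (h1.trans h2.symm) (by
    refine h𝒵.chart_cancel ((Chart.map G).map q ≫ t) ?_ ?_
    · have h3 : Chart.con F ((Chart.map F).map k₁ ≫ c.cmp) = Chart.con F (b.cmp ≫ (Chart.map G).map k₂) := by
        rw [Chart.con_cmp_comp, Chart.con_map_comp, Chart.con_map, Chart.cone_cmp]
        exact (comp_id _).trans (h1.trans h2.symm)
      exact h3
    · rw [assoc, ← hw, ← assoc, ← map_comp, h1', h, assoc,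
        ← Functor.map_comp_assoc, h2'])
  exact ⟨k, h1', h2'⟩

/-- A chart of a fibre product lying over a fibre product of cones of minimal charts. -/
structure Chart.IsPull (c : Chart (fiberProd F G)) {x : Chart 𝒳} {y : Chart 𝒴} {z : Chart 𝒵}
    (s : (Chart.map F).obj x ⟶ z) (t : (Chart.map G).obj y ⟶ z) (p : c.fst ⟶ x)
    (q : c.snd ⟶ y) : Prop where
  w : (Chart.map F).map p ≫ s = c.cmp ≫ (Chart.map G).map q ≫ t
  isPB : RPC.IsPB (Chart.con (fiberProdFst F G) p) (Chart.con (fiberProdSnd F G) q)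
    (Chart.con F s) (Chart.con G t)
  x_min : x.IsMinimal
  y_min : y.IsMinimal
  z_min : z.IsMinimal
  p_dom : Chart.IsDom p
  q_dom : Chart.IsDom q
  s_dom : Chart.IsDom s
  t_dom : Chart.IsDom t

namespace Chart.IsPull

variable {c : Chart (fiberProd F G)} {x : Chart 𝒳} {y : Chart 𝒴} {z : Chart 𝒵}
    {s : (Chart.map F).obj x ⟶ z} {t : (Chart.map G).obj y ⟶ z} {p : c.fst ⟶ x}
    {q : c.snd ⟶ y}

lemma hom_ext (H : c.IsPull s t p q) {b : Chart (fiberProd F G)} {k k' : b ⟶ c} (h𝒳 : IsFiberedInGroupoids 𝒳)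
    (h𝒴 : IsFiberedInGroupoids 𝒴)
    (h1 : (Chart.map (fiberProdFst F G)).map k ≫ p = (Chart.map (fiberProdFst F G)).map k' ≫ p)
    (h2 : (Chart.map (fiberProdSnd F G)).map k ≫ q = (Chart.map (fiberProdSnd F G)).map k' ≫ q) :
    k = k' := by
  have hc : (Chart.cone _).map k = (Chart.cone _).map k' := by
    refine H.isPB.ext ?_ ?_
    · rw [← Chart.con_map_comp, h1, Chart.con_map_comp]
    · rw [← Chart.con_map_comp, h2, Chart.con_map_comp]
  exact fiberProd_hom_ext (h𝒳.chart_cancel p (by rw [Chart.cone_map, Chart.cone_map, hc]) h1)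
    (h𝒴.chart_cancel q (by rw [Chart.cone_map, Chart.cone_map, hc]) h2)

lemma exists_hom (H : c.IsPull s t p q) (h𝒳 : IsFiberedInGroupoids 𝒳)
    (h𝒴 : IsFiberedInGroupoids 𝒴) (h𝒵 : IsFiberedInGroupoids 𝒵) {b : Chart (fiberProd F G)}
    (f : b.fst ⟶ x) (g : b.snd ⟶ y)
    (h : (Chart.map F).map f ≫ s = b.cmp ≫ (Chart.map G).map g ≫ t) :
    ∃ k : b ⟶ c, (Chart.map (fiberProdFst F G)).map k ≫ p = f ∧
      (Chart.map (fiberProdSnd F G)).map k ≫ q = g :=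
  exists_fiberProd_lift h𝒳 h𝒴 h𝒵 H.w H.isPB f g h

lemma isMinimal (H : c.IsPull s t p q) (h𝒳 : IsFiberedInGroupoids 𝒳) (h𝒴 : IsFiberedInGroupoids 𝒴)
    (h𝒵 : IsFiberedInGroupoids 𝒵) : c.IsMinimal where
  existsUnique {b b'} f g hf hg := by
    have hf1 := hf.map (fiberProdFst F G)
    have hf2 := hf.map (fiberProdSnd F G)
    have hg1 := hg.map (fiberProdFst F G)
    have hg2 := hg.map (fiberProdSnd F G)
    obtain ⟨m, hm, hm'⟩ := H.x_min.existsUnique _ _ (hf1.comp H.p_dom) hg1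
    obtain ⟨n, hn, hn'⟩ := H.y_min.existsUnique _ _ (hf2.comp H.q_dom) hg2
    have e : (Chart.map F).map m ≫ s = b'.cmp ≫ (Chart.map G).map n ≫ t := by
      have h1 : (Chart.map F).map ((Chart.map (fiberProdFst F G)).map g) ≫
          (Chart.map F).map m ≫ s = (Chart.map F).map ((Chart.map (fiberProdFst F G)).map f) ≫
            (Chart.map F).map p ≫ s := by
        rw [← Functor.map_comp_assoc, hm, Functor.map_comp_assoc]
      refine H.z_min.hom_ext _ (hg1.map F) ?_ ?_
      · rw [h1]
        exact (hf1.map F).comp ((H.p_dom.map F).comp H.s_dom)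
      · rw [h1, H.w, ← assoc, Chart.cmp_naturality, ← assoc _ b'.cmp,
          Chart.cmp_naturality, assoc, assoc, ← Functor.map_comp_assoc,
          ← Functor.map_comp_assoc, hn]
    obtain ⟨k, hk, hk'⟩ := H.exists_hom h𝒳 h𝒴 h𝒵 m n e
    refine ⟨k, H.hom_ext h𝒳 h𝒴 ?_ ?_, fun k' e' => H.hom_ext h𝒳 h𝒴 ?_ ?_⟩
    · rw [map_comp, assoc, hk, hm]
    · rw [map_comp, assoc, hk', hn]
    · rw [hk]
      exact hm' _ (by subst e'; simp)
    · rw [hk']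
      exact hn' _ (by subst e'; simp)

lemma of_iso (H : c.IsPull s t p q) {c' : Chart (fiberProd F G)} (e : c' ≅ c) : 
    c'.IsPull s t ((Chart.map (fiberProdFst F G)).map e.hom ≫ p)
      ((Chart.map (fiberProdSnd F G)).map e.hom ≫ q) where
  w := by
    rw [map_comp, assoc, H.w, ← assoc, Chart.cmp_naturality, assoc, ← Functor.map_comp_assoc]
  isPB := by
    rw [Chart.con_map_comp, Chart.con_map_comp]
    exact H.isPB.iso_comp _
  x_min := H.x_min
  y_min := H.y_min
  z_min := H.z_min
  p_dom := (Chart.IsDom.of_isIso _).comp H.p_dom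
  q_dom := (Chart.IsDom.of_isIso _).comp H.q_dom
  s_dom := H.s_dom
  t_dom := H.t_dom

end Chart.IsPull

lemma IsConelike.exists_cospan (h𝒵 : IsConelike 𝒵)
    (a : Chart (fiberProd F G)) {x : Chart 𝒳} {y : Chart 𝒴} (f : a.fst ⟶ x) (g : a.snd ⟶ y)
    (hf : Chart.IsDom f) (hg : Chart.IsDom g) :
    ∃ (z : Chart 𝒵) (s : (Chart.map F).obj x ⟶ z) (t : (Chart.map G).obj y ⟶ z),
      z.IsMinimal ∧ Chart.IsDom s ∧ Chart.IsDom t ∧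
      (Chart.map F).map f ≫ s = a.cmp ≫ (Chart.map G).map g ≫ t := by
  obtain ⟨z, s, hz, hs⟩ := h𝒵.exists_minimal ((Chart.map F).obj x)
  obtain ⟨t, ht, -⟩ := hz.existsUnique (inv a.cmp ≫ (Chart.map F).map f ≫ s)
    ((Chart.map G).map g) ((Chart.IsDom.of_isIso _).comp ((hf.map F).comp hs)) (hg.map G)
  refine ⟨z, s, t, hz, hs, Chart.IsDom.of_comp (f := (Chart.map G).map g) ?_, ?_⟩
  · rw [ht]
    exact (Chart.IsDom.of_isIso _).comp ((hf.map F).comp hs)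
  · rw [ht, IsIso.hom_inv_id_assoc]

lemma IsConelike.exists_isPull (h𝒳 : IsConelike 𝒳) (h𝒴 : IsConelike 𝒴) (h𝒵 : IsConelike 𝒵)
    (a : Chart (fiberProd F G)) : ∃ (c : Chart (fiberProd F G)) (x : Chart 𝒳) (y : Chart 𝒴)
      (z : Chart 𝒵) (s : (Chart.map F).obj x ⟶ z) (t : (Chart.map G).obj y ⟶ z) (p : c.fst ⟶ x)
      (q : c.snd ⟶ y) (k : a ⟶ c), c.IsPull s t p q ∧ Chart.IsDom k := by
  obtain ⟨x, f, hx, hf⟩ := h𝒳.exists_minimal a.fst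
  obtain ⟨y, g, hy, hg⟩ := h𝒴.exists_minimal a.snd
  obtain ⟨z, s, t, hz, hs, ht, hst⟩ := h𝒵.exists_cospan a f g hf hg
  obtain ⟨e, p, q, hpq⟩ := RPC.exists_isPB (Chart.con F s) (Chart.con G t)
  obtain ⟨b₁, φ₁, e₁, h₁⟩ := h𝒳.fibered.exists_chart_over x p
  obtain ⟨b₂, φ₂, e₂, h₂⟩ := h𝒴.fibered.exists_chart_over y q
  obtain ⟨i, hi, hi'⟩ := h𝒵.fibered.exists_chart_hom ((Chart.map G).map φ₂ ≫ t)
    ((Chart.map F).map φ₁ ≫ s) (e₁.hom ≫ e₂.inv) (by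
      have h3 : (e₁.hom ≫ e₂.inv) ≫ Chart.con G ((Chart.map G).map φ₂ ≫ t) =
          Chart.con F ((Chart.map F).map φ₁ ≫ s) := by
        rw [Chart.con_map_comp, Chart.con_map_comp, h₁, h₂]
        simp [hpq.w]
      exact h3)
  obtain ⟨c, m, n, hm, hmn⟩ := exists_fiberProd_chart h𝒴.fibered h𝒵.fibered i
  have hn : Chart.con (fiberProdSnd F G) n = Chart.con (fiberProdFst F G) m ≫ e₁.hom ≫ e₂.inv := by
    have h3 := congrArg (Chart.con F) hmn
    rw [Chart.con_map_comp, Chart.con_cmp_comp, Chart.con_map] at h3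
    exact h3.symm.trans (congrArg (_ ≫ ·) hi)
  have hm' : IsIso (Chart.con (fiberProdFst F G) m) :=
    inferInstanceAs (IsIso ((Chart.cone 𝒳).map m))
  have hw : (Chart.map F).map (m ≫ φ₁) ≫ s = c.cmp ≫ (Chart.map G).map (n ≫ φ₂) ≫ t := by
    rw [Functor.map_comp_assoc, Functor.map_comp_assoc, ← reassoc_of% hmn, hi']
  have hpb : RPC.IsPB (Chart.con (fiberProdFst F G) (m ≫ φ₁))
      (Chart.con (fiberProdSnd F G) (n ≫ φ₂)) (Chart.con F s) (Chart.con G t) := by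
    rw [Chart.con_comp, Chart.con_comp, h₁, h₂, hn]
    have h4 := hpq.iso_comp (Chart.con (fiberProdFst F G) m ≫ e₁.hom)
    simpa using h4
  obtain ⟨k, hk, hk'⟩ := exists_fiberProd_lift h𝒳.fibered h𝒴.fibered h𝒵.fibered hw hpb f g hst
  refine ⟨c, x, y, z, s, t, _, _, k, ⟨hw, hpb, hx, hy, hz, ?_, ?_, hs, ht⟩, ?_⟩
  · rw [← hk] at hf
    exact hf.of_comp
  · rw [← hk'] at hg
    exact hg.of_comp
  · refine hpb.isDominant ?_ ?_
    · rw [← Chart.con_map_comp, hk]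
      exact hf
    · rw [← Chart.con_map_comp, hk']
      exact hg

lemma Chart.IsMinimal.exists_isPull (h𝒳 : IsConelike 𝒳) (h𝒴 : IsConelike 𝒴) (h𝒵 : IsConelike 𝒵)
    {c : Chart (fiberProd F G)} (hc : c.IsMinimal) : ∃ (x : Chart 𝒳) (y : Chart 𝒴)
      (z : Chart 𝒵) (s : (Chart.map F).obj x ⟶ z) (t : (Chart.map G).obj y ⟶ z) (p : c.fst ⟶ x)
      (q : c.snd ⟶ y), c.IsPull s t p q := by
  obtain ⟨c', x, y, z, s, t, p, q, k, H, hk⟩ := h𝒳.exists_isPull h𝒴 h𝒵 c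
  have := hc.isIso (H.isMinimal h𝒳.fibered h𝒴.fibered h𝒵.fibered) k hk
  exact ⟨x, y, z, s, t, _, _, H.of_iso (asIso k)⟩

lemma Chart.IsPull.face {c : Chart (fiberProd F G)} {x : Chart 𝒳} {y : Chart 𝒴} {z : Chart 𝒵}
    {s : (Chart.map F).obj x ⟶ z} {t : (Chart.map G).obj y ⟶ z} {p : c.fst ⟶ x}
    {q : c.snd ⟶ y} (H : c.IsPull s t p q) (h𝒳 : IsConelike 𝒳) (h𝒴 : IsConelike 𝒴)
    (h𝒵 : IsConelike 𝒵) {b : Chart (fiberProd F G)} (g : b ⟶ c) (hg : Chart.IsFc g) :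
    b.IsMinimal := by
  obtain ⟨x', d₁, g₁, hd₁, hg₁, e₁⟩ := h𝒳.fibered.exists_chart_factorization
    ((Chart.map (fiberProdFst F G)).map g ≫ p)
  obtain ⟨y', d₂, g₂, hd₂, hg₂, e₂⟩ := h𝒴.fibered.exists_chart_factorization
    ((Chart.map (fiberProdSnd F G)).map g ≫ q)
  obtain ⟨z', s', t', hz', hs', ht', hst⟩ := h𝒵.exists_cospan b d₁ d₂ hd₁ hd₂
  obtain ⟨z'', d, hz'', hd⟩ := h𝒵.exists_minimal ((Chart.map F).obj x')
  obtain ⟨l, hl, -⟩ := hz''.existsUnique d s' hd hs'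
  have hl' := hz'.isIso hz'' l (Chart.IsDom.of_comp (f := s') (by rwa [hl]))
  obtain ⟨g₃, hg₃, -⟩ := h𝒵.existsUnique_hom s' ((Chart.map F).map g₁ ≫ s) hs' hz' H.z_min
  have ht₃ : t' ≫ g₃ = (Chart.map G).map g₂ ≫ t := by
    refine h𝒵.hom_ext' (b.cmp ≫ (Chart.map G).map d₂) ((Chart.IsDom.of_isIso _).comp (hd₂.map G))
      H.z_min ?_
    rw [assoc, ← reassoc_of% hst, hg₃, assoc, ← Functor.map_comp_assoc,
      ← Functor.map_comp_assoc, e₁, e₂, Functor.map_comp_assoc, H.w, ← assoc,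
      Chart.cmp_naturality, assoc, ← Functor.map_comp_assoc]
  have hpb : RPC.IsPB (Chart.con (fiberProdFst F G) d₁) (Chart.con (fiberProdSnd F G) d₂)
      (Chart.con F s') (Chart.con G t') := by
    refine H.isPB.face (g := (Chart.cone _).map g) (g₁ := (Chart.cone 𝒳).map g₁)
      (g₂ := (Chart.cone 𝒴).map g₂) (g₃ := (Chart.cone 𝒵).map g₃) hg hd₁ hd₂ hg₁ hg₂
      (h𝒵.isFc g₃ hz' H.z_min) ?_ ?_ ?_ ?_
    · rw [← Chart.con_comp, e₁, Chart.con_map_comp]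
    · rw [← Chart.con_comp, e₂, Chart.con_map_comp]
    · rw [← Chart.con_comp, hg₃, Chart.con_map_comp]
    · rw [← Chart.con_comp, ht₃, Chart.con_map_comp]
  exact Chart.IsPull.isMinimal ⟨hst, hpb, h𝒳.face g₁ H.x_min hg₁, h𝒴.face g₂ H.y_min hg₂, hz',
    hd₁, hd₂, hs', ht'⟩ h𝒳.fibered h𝒴.fibered h𝒵.fibered

lemma Chart.IsPull.change {c : Chart (fiberProd F G)} {x x' : Chart 𝒳} {y y' : Chart 𝒴}
    {z z' : Chart 𝒵} {s : (Chart.map F).obj x ⟶ z} {t : (Chart.map G).obj y ⟶ z} {p : c.fst ⟶ x}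
    {q : c.snd ⟶ y} (H : c.IsPull s t p q) (i : x ≅ x') (j : y ≅ y') (k : z ≅ z') :
    c.IsPull ((Chart.map F).map i.inv ≫ s ≫ k.hom) ((Chart.map G).map j.inv ≫ t ≫ k.hom)
      (p ≫ i.hom) (q ≫ j.hom) where
  w := by
    rw [← Functor.map_comp_assoc, ← Functor.map_comp_assoc, assoc, assoc,
      Iso.hom_inv_id, Iso.hom_inv_id, comp_id, comp_id, reassoc_of% H.w]
  isPB := by
    rw [Chart.con_map_comp, Chart.con_map_comp, Chart.con_comp, Chart.con_comp, Chart.con_comp,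
      Chart.con_comp]
    exact H.isPB.change ((Chart.cone 𝒳).mapIso i) ((Chart.cone 𝒴).mapIso j)
      ((Chart.cone 𝒵).mapIso k)
  x_min := H.x_min.of_iso i
  y_min := H.y_min.of_iso j
  z_min := H.z_min.of_iso k
  p_dom := H.p_dom.comp (.of_isIso _)
  q_dom := H.q_dom.comp (.of_isIso _)
  s_dom := (Chart.IsDom.of_isIso _).comp (H.s_dom.comp (.of_isIso _))
  t_dom := (Chart.IsDom.of_isIso _).comp (H.t_dom.comp (.of_isIso _))

lemma fiberProd_isConelike (h𝒳 : IsConelike 𝒳) (h𝒴 : IsConelike 𝒴) (h𝒵 : IsConelike 𝒵) :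
    IsConelike (fiberProd F G) where
  fibered := fiberProd_fibered h𝒳.fibered h𝒴.fibered h𝒵.fibered
  exists_minimal a := by
    obtain ⟨c, x, y, z, s, t, p, q, k, H, hk⟩ := h𝒳.exists_isPull h𝒴 h𝒵 a
    exact ⟨c, k, H.isMinimal h𝒳.fibered h𝒴.fibered h𝒵.fibered, hk⟩
  face f hy hf := by
    obtain ⟨x, y, z, s, t, p, q, H⟩ := hy.exists_isPull h𝒳 h𝒴 h𝒵
    exact H.face h𝒳 h𝒴 h𝒵 f hf
  small := by
    obtain ⟨ι₁, m₁, h₁⟩ := h𝒳.small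
    obtain ⟨ι₂, m₂, h₂⟩ := h𝒴.small
    obtain ⟨ι₃, m₃, h₃⟩ := h𝒵.small
    let ι := Σ (i : ι₁) (j : ι₂) (k : ι₃), ((Chart.map F).obj (m₁ i) ⟶ m₃ k) ×
      ((Chart.map G).obj (m₂ j) ⟶ m₃ k)
    let P (v : ι) (c : Chart (fiberProd F G)) : Prop :=
      ∃ p q, c.IsPull (x := m₁ v.1) (y := m₂ v.2.1) (z := m₃ v.2.2.1) v.2.2.2.1 v.2.2.2.2 p q
    refine ⟨{v : ι // ∃ c, P v c}, fun v => v.2.choose, fun c hc => ?_⟩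
    obtain ⟨x, y, z, s, t, p, q, H⟩ := hc.exists_isPull h𝒳 h𝒴 h𝒵
    obtain ⟨i, ⟨ei⟩⟩ := h₁ x H.x_min
    obtain ⟨j, ⟨ej⟩⟩ := h₂ y H.y_min
    obtain ⟨k, ⟨ek⟩⟩ := h₃ z H.z_min
    have H' := H.change ei ej ek
    have e : ∃ c, P ⟨i, j, k, _, _⟩ c := ⟨c, _, _, H'⟩
    refine ⟨⟨_, e⟩, ?_⟩
    obtain ⟨p', q', H''⟩ := e.choose_spec
    obtain ⟨l, hl, hl'⟩ := H''.exists_hom h𝒳.fibered h𝒴.fibered h𝒵.fibered _ _ H'.w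
    have hld : Chart.IsDom l := by
      refine H''.isPB.isDominant ?_ ?_
      · rw [← Chart.con_map_comp, hl]
        exact H'.p_dom
      · rw [← Chart.con_map_comp, hl']
        exact H'.q_dom
    have := hc.isIso (H''.isMinimal h𝒳.fibered h𝒴.fibered h𝒵.fibered) l hld
    exact ⟨asIso l⟩

end FiberProducts

section Elements

open Opposite

variable {C : Type (u + 1)} [Category.{u} C] {X Y : Cᵒᵖ ⥤ Type u}
  {𝒜 ℬ : BasedCategory.{u, u + 1} C} {J : GrothendieckTopology C}

/-- Restriction of sections of a presheaf. -/
def res (X : Cᵒᵖ ⥤ Type u) {S T : C} (k : S ⟶ T) (s : X.obj (op T)) : X.obj (op S) := X.map k.op s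

@[simp] lemma res_id (T : C) (s : X.obj (op T)) : res X (𝟙 T) s = s := by
  simp [res]

lemma res_comp {R S T : C} (k : R ⟶ S) (l : S ⟶ T) (s : X.obj (op T)) :
    res X (k ≫ l) s = res X k (res X l s) := by
  rw [res, op_comp]
  exact Functor.map_comp_apply X _ _ s

lemma app_res (q : X ⟶ Y) {S T : C} (k : S ⟶ T) (s : X.obj (op T)) :
    q.app (op S) (res X k s) = res Y k (q.app (op T) s) :=
  NatTrans.naturality_apply q k.op s

/-- The section underlying an object of `C/X`. -/
def elt (x : (elements X).obj) : X.obj (op ((elements X).p.obj x)) :=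
  let x' : CostructuredArrow yoneda X := x
  yonedaEquiv x'.hom

/-- The object of `C/X` given by a section. -/
def eltMk {T : C} (s : X.obj (op T)) : (elements X).obj :=
  CostructuredArrow.mk (Y := T) (yonedaEquiv.symm s)

@[simp] lemma elt_eltMk {T : C} (s : X.obj (op T)) : elt (eltMk s) = s :=
  (yonedaEquiv (X := T) (F := X)).apply_symm_apply s

lemma elt_map {x y : (elements X).obj} (f : x ⟶ y) :
    res X ((elements X).p.map f) (elt y) = elt x := by
  let y' : CostructuredArrow yoneda X := y
  let x' : CostructuredArrow yoneda X := x
  let f' : x' ⟶ y' := f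
  exact (yonedaEquiv_naturality y'.hom f'.left).trans (congrArg yonedaEquiv (CostructuredArrow.w f'))

/-- A morphism of `C/X`. -/
def eltHom {x y : (elements X).obj} (k : (elements X).p.obj x ⟶ (elements X).p.obj y)
    (h : res X k (elt y) = elt x) : x ⟶ y :=
  let y' : CostructuredArrow yoneda X := y
  let x' : CostructuredArrow yoneda X := x
  let k' : x'.left ⟶ y'.left := k
  (CostructuredArrow.homMk k' (yonedaEquiv.injective
    ((yonedaEquiv_naturality y'.hom k').symm.trans h)) : x' ⟶ y')

lemma p_map_eltHom {x y : (elements X).obj} (k : (elements X).p.obj x ⟶ (elements X).p.obj y)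
    (h : res X k (elt y) = elt x) : (elements X).p.map (eltHom k h) = k := rfl

/-- A morphism of `C/X` between objects given by sections. -/
def eltMkHom {S T : C} (k : S ⟶ T) {s : X.obj (op S)} {t : X.obj (op T)} (h : res X k t = s) :
    eltMk s ⟶ eltMk t :=
  eltHom (x := eltMk s) (y := eltMk t) k
    ((congrArg (res X k) (elt_eltMk t)).trans (h.trans (elt_eltMk s).symm))

lemma elements_hom_ext {x y : (elements X).obj} {f g : x ⟶ y}
    (h : (elements X).p.map f = (elements X).p.map g) : f = g :=
  CostructuredArrow.hom_ext _ _ h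

variable (X) in
lemma elements_fibered : IsFiberedInGroupoids (elements X) := IsFiberedInGroupoids.mk'
    (fun a R f => ⟨eltMk (res X f (elt a)), eltHom f (elt_eltMk _).symm, rfl, (id_comp f).symm⟩)
    (fun φ φ' k hk => ⟨eltHom k (by rw [← elt_map φ, ← elt_map φ', ← hk, res_comp]), rfl,
      elements_hom_ext (by rw [map_comp, p_map_eltHom, hk])⟩)
    (fun φ χ χ' hp _ => elements_hom_ext hp)

/-- The functor to `C/X` given by a compatible family of sections. -/
def toElements (s : ∀ a : 𝒜.obj, X.obj (op (𝒜.p.obj a)))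
    (hs : ∀ {a b : 𝒜.obj} (f : a ⟶ b), res X (𝒜.p.map f) (s b) = s a) : 𝒜 ⟶ elements X :=
  ({ obj := fun a => eltMk (s a)
     map := fun {a b} f => eltMkHom (𝒜.p.map f) (hs f)
     map_id := fun a => elements_hom_ext (𝒜.p.map_id a)
     map_comp := fun f g => elements_hom_ext (𝒜.p.map_comp f g)
     w := rfl } : BasedFunctor 𝒜 (elements X))

/-- The family of sections given by a functor to `C/X`. -/
def sect (K : 𝒜 ⟶ elements X) (a : 𝒜.obj) : X.obj (op (𝒜.p.obj a)) :=
  res X (baseIso K a).inv (elt (⟪K⟫.obj a))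

lemma sect_map (K : 𝒜 ⟶ elements X) {a b : 𝒜.obj} (f : a ⟶ b) :
    res X (𝒜.p.map f) (sect K b) = sect K a := by
  rw [sect, sect, ← elt_map (⟪K⟫.map f), p_map_map, ← res_comp, ← res_comp, Iso.inv_hom_id_assoc]

lemma sect_toElements (s : ∀ a : 𝒜.obj, X.obj (op (𝒜.p.obj a))) (hs) (a : 𝒜.obj) :
    sect (toElements s hs) a = s a :=
  (congrArg (res X (𝟙 (𝒜.p.obj a))) (elt_eltMk (s a))).trans (res_id _ _)

lemma sect_comp_elementsMap (K : 𝒜 ⟶ elements X) (q : X ⟶ Y) (a : 𝒜.obj) :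
    sect (K ≫ elementsMap q) a = q.app _ (sect K a) := by
  let x : CostructuredArrow yoneda X := ⟪K⟫.obj a
  have h : res Y (baseIso K a).inv (yonedaEquiv (x.hom ≫ q)) = _ :=
    congrArg (res Y (baseIso K a).inv) (yonedaEquiv_comp x.hom q)
  exact h.trans (app_res q _ _).symm

lemma sect_id (x : (elements X).obj) : sect (𝟙 (elements X)) x = elt x := res_id _ _

lemma sect_elementsMap (q : X ⟶ Y) (x : (elements X).obj) :
    sect (elementsMap q) x = q.app _ (elt x) := by
  rw [← sect_id]
  exact sect_comp_elementsMap (𝟙 (elements X)) q x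

lemma sect_eq_of_trans {K K' : 𝒜 ⟶ elements X} (η : K ⟶ K') : sect K = sect K' := by
  funext a
  rw [sect, sect, ← elt_map (appAt η a), p_map_appAt, ← res_comp, Iso.inv_hom_id_assoc]

lemma exists_iso_of_sect_eq {K K' : 𝒜 ⟶ elements X} (h : ∀ a, sect K a = sect K' a) :
    Nonempty (K ≅ K') := by
  let η : K ⟶ K' := mkTrans (fun a => eltHom ((baseIso K a).hom ≫ (baseIso K' a).inv) (by
      have h1 := congrArg (res X (baseIso K a).hom) (h a)
      rw [sect, sect, ← res_comp, ← res_comp, Iso.hom_inv_id, res_id] at h1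
      exact h1.symm))
    (fun f => elements_hom_ext (by
      rw [map_comp, map_comp, p_map_map, p_map_map]
      refine Eq.trans ?_ (assoc _ _ _)
      simp [p_map_eltHom])) (fun a => rfl)
  have := (elements_fibered X).isIso_trans η
  exact ⟨asIso η⟩

lemma exists_elementsMap_iso (K : elements X ⟶ elements Y) :
    ∃ q : X ⟶ Y, Nonempty (K ≅ elementsMap q) := by
  let q : X ⟶ Y :=
    { app := fun T => TypeCat.ofHom fun x => sect K (eltMk (T := T.unop) x)
      naturality := fun T T' f => by
        ext x
        exact (sect_map K (eltMkHom (S := T'.unop) (T := T.unop) f.unop (s := X.map f x)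
          (t := x) rfl)).symm }
  refine ⟨q, exists_iso_of_sect_eq fun a => ?_⟩
  rw [sect_elementsMap]
  have h := sect_map K (eltHom (x := a) (y := eltMk (elt a)) (𝟙 _)
    ((res_id _ _).trans (elt_eltMk _)))
  exact h.symm.trans (res_id _ _)

lemma eq_of_sect_eq {q q' : X ⟶ Y}
    (h : ∀ x, sect (elementsMap q) x = sect (elementsMap q') x) : q = q' := by
  ext T x
  have := h (eltMk (T := T.unop) x)
  rw [sect_elementsMap, sect_elementsMap, elt_eltMk] at this
  exact this

open Bicategory in
lemma comp_eq_id_of_iso {K : elements X ⟶ elements Y} {L : elements Y ⟶ elements X} {q : X ⟶ Y}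
    {r : Y ⟶ X} (i : K ≅ elementsMap q) (j : L ≅ elementsMap r) (e : K ≫ L ≅ 𝟙 _) :
    q ≫ r = 𝟙 X := by
  refine eq_of_sect_eq fun x => ?_
  have h1 : sect (elementsMap (q ≫ r)) = sect (K ≫ L) :=
    sect_eq_of_trans (show elementsMap q ≫ elementsMap r ⟶ K ≫ L from i.inv ▷ _ ≫ K ◁ j.inv)
  rw [h1, sect_eq_of_trans e.hom, sect_id, sect_elementsMap]
  rfl

lemma elements_isStack (h : Presheaf.IsSheaf J X) : IsStack J (elements X) := by
  rw [isSheaf_iff_isSheaf_of_type] at h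
  refine IsStack.mk' (elements_fibered X) (fun T S hS {K K' η θ} H => ?_)
    (fun T S hS {K K'} η => ?_) (fun T S hS D => ?_)
  · exact trans_ext fun a => elements_hom_ext (by rw [p_map_appAt, p_map_appAt])
  · have h0 : sect K (overId T) = sect K' (overId T) := by
      refine (h S hS).isSeparatedFor.ext fun R f hf => ?_
      have h1 := sect_map K (overTo (Over.mk f : (overBased T).obj))
      have h2 := sect_map K' (overTo (Over.mk f : (overBased T).obj))
      let v : (sieveBased S).obj := ⟨Over.mk f, hf⟩
      have h3 : sect K (Over.mk f : (overBased T).obj) = sect K' (Over.mk f : (overBased T).obj) :=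
        congrFun (sect_eq_of_trans η) v
      exact h1.trans (h3.trans h2.symm)
    obtain ⟨ε⟩ := exists_iso_of_sect_eq (K := K) (K' := K') fun u => by
      rw [← sect_map K (overTo u), h0, sect_map]
    exact ⟨ε.hom, fun u => elements_hom_ext ((p_map_appAt _ _).trans (p_map_appAt η u).symm)⟩
  · let x : Presieve.FamilyOfElements X S.arrows := fun R f hf =>
      sect D (⟨Over.mk f, hf⟩ : (sieveBased S).obj)
    have hx : x.Compatible := by
      rw [Presieve.compatible_iff_sieveCompatible]
      intro R R' f g hf
      let u : (sieveBased S).obj := ⟨Over.mk f, hf⟩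
      let v : (sieveBased S).obj := ⟨Over.mk (g ≫ f), S.downward_closed hf g⟩
      let k : v ⟶ u := ObjectProperty.homMk (Over.homMk g rfl)
      exact (sect_map D k).symm
    obtain ⟨t, ht, -⟩ := h S hS x hx
    have hs : ∀ {a b : (overBased T).obj} (f : a ⟶ b), res X ((overBased T).p.map f)
      (res X (overHom b) t) = res X (overHom a) t := fun f => by rw [← overHom_w f, res_comp]
    refine ⟨toElements _ hs, exists_iso_of_sect_eq fun u => ?_⟩
    exact (sect_toElements (X := X) (𝒜 := overBased T) (fun u => res X (overHom u) t) hs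
      (sieveObj u)).trans (ht _ (sieveObj_mem u))

end Elements

section Orthogonal

variable {𝒳 𝒴 𝒵 : Based.{u}}

/-- Unique lifting of dominant morphisms of charts. -/
structure IsOrthogonal (K : Chart 𝒳 ⥤ Chart 𝒴) : Prop where
  isDom_iff : ∀ {a b : Chart 𝒳} (n : a ⟶ b), Chart.IsDom (K.map n) ↔ Chart.IsDom n
  exists_lift : ∀ {w : Chart 𝒳} {b : Chart 𝒴} (d : K.obj w ⟶ b), Chart.IsDom d →
    ∃ (w' : Chart 𝒳) (d' : w ⟶ w') (e : K.obj w' ≅ b), K.map d' ≫ e.hom = d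
  exists_hom : ∀ {w w' w'' : Chart 𝒳} (d : w ⟶ w') (d' : w ⟶ w'') (k : K.obj w' ⟶ K.obj w''),
    Chart.IsDom d → Chart.IsDom d' → K.map d ≫ k = K.map d' → ∃ l, d ≫ l = d' ∧ K.map l = k

lemma Chart.isDom_map_iff (K : 𝒳 ⟶ 𝒴) {a b : Chart 𝒳} (n : a ⟶ b) :
    Chart.IsDom ((Chart.map K).map n) ↔ Chart.IsDom n := by
  rw [Chart.IsDom, Chart.cone_map]
  rfl

lemma Chart.isDom_iso_comp {a b c : Chart 𝒳} (i : a ⟶ b) [IsIso i] (n : b ⟶ c) :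
    Chart.IsDom (i ≫ n) ↔ Chart.IsDom n :=
  ⟨fun h => h.of_comp, fun h => (Chart.IsDom.of_isIso i).comp h⟩

lemma Chart.isDom_comp_iso {a b c : Chart 𝒳} (n : a ⟶ b) (i : b ⟶ c) [IsIso i] :
    Chart.IsDom (n ≫ i) ↔ Chart.IsDom n :=
  ⟨fun h => by simpa using h.comp (Chart.IsDom.of_isIso (inv i)), fun h => h.comp (.of_isIso i)⟩

/-- The action on charts of a composite. -/
def Chart.mapComp (K : 𝒳 ⟶ 𝒴) (L : 𝒴 ⟶ 𝒵) : Chart.map (K ≫ L) ≅ Chart.map K ⋙ Chart.map L where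
  hom :=
    { app := fun a => Chart.mkHom (a := (Chart.map (K ≫ L)).obj a)
        (b := (Chart.map L).obj ((Chart.map K).obj a)) (𝟙 _)
      naturality := fun a b f => (comp_id ((Chart.map (K ≫ L)).map f)).trans
        (id_comp ((Chart.map (K ≫ L)).map f)).symm }
  inv :=
    { app := fun a => Chart.mkHom (b := (Chart.map (K ≫ L)).obj a)
        (a := (Chart.map L).obj ((Chart.map K).obj a)) (𝟙 _)
      naturality := fun a b f => (comp_id ((Chart.map (K ≫ L)).map f)).trans
        (id_comp ((Chart.map (K ≫ L)).map f)).symm }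
  hom_inv_id := NatTrans.ext (funext fun a => comp_id (𝟙 ((Chart.map (K ≫ L)).obj a)))
  inv_hom_id := NatTrans.ext (funext fun a => comp_id (𝟙 ((Chart.map (K ≫ L)).obj a)))

/-- The action on charts of a 2-isomorphism. -/
def Chart.mapIso {K K' : 𝒳 ⟶ 𝒴} (e : K ≅ K') : Chart.map K ≅ Chart.map K' where
  hom := Chart.mapTrans e.hom
  inv := Chart.mapTrans e.inv
  hom_inv_id := NatTrans.ext (funext fun a => congrArg (appAt · a.pt) e.hom_inv_id)
  inv_hom_id := NatTrans.ext (funext fun a => congrArg (appAt · a.pt) e.inv_hom_id)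

namespace IsOrthogonal

lemma of_comp {K : Chart 𝒳 ⥤ Chart 𝒴} {L : Chart 𝒴 ⥤ Chart 𝒵} (hK : IsOrthogonal K)
    (hs : K.EssSurj) (hi : ∀ {a b : Chart 𝒴} (n : a ⟶ b), Chart.IsDom (L.map n) ↔ Chart.IsDom n)
    (hL : IsOrthogonal (K ⋙ L)) : IsOrthogonal L where
  isDom_iff := hi
  exists_lift {w b} d hd := by
    let i := K.objObjPreimageIso w
    obtain ⟨a', d', e, h⟩ := hL.exists_lift (w := K.objPreimage w) (b := b) (L.map i.hom ≫ d)
      ((Chart.isDom_iso_comp _ _).2 hd)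
    exact ⟨K.obj a', i.inv ≫ K.map d', e, by
      rw [map_comp, assoc, ← Functor.comp_map, h, ← Functor.map_comp_assoc]
      simp⟩
  exists_hom {w w' w''} d d' k hd hd' h := by
    let i := K.objObjPreimageIso w
    obtain ⟨b, m, e, hm⟩ := hK.exists_lift (i.hom ≫ d) ((Chart.isDom_iso_comp _ _).2 hd)
    obtain ⟨b', m', e', hm'⟩ := hK.exists_lift (i.hom ≫ d') ((Chart.isDom_iso_comp _ _).2 hd')
    have hmd : Chart.IsDom m := by
      rwa [← Chart.isDom_iso_comp i.hom, ← hm, Chart.isDom_comp_iso, hK.isDom_iff] at hd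
    have hmd' : Chart.IsDom m' := by
      rwa [← Chart.isDom_iso_comp i.hom, ← hm', Chart.isDom_comp_iso, hK.isDom_iff] at hd'
    obtain ⟨l, h1, h2⟩ := hL.exists_hom m m' (L.map e.hom ≫ k ≫ L.map e'.inv) hmd hmd' (by
      rw [Functor.comp_map, Functor.comp_map, ← Functor.map_comp_assoc, hm, Functor.map_comp_assoc,
        reassoc_of% h, ← map_comp, ← map_comp, ← assoc, ← hm',
        assoc, Iso.hom_inv_id, comp_id])
    have h2' : L.map (K.map l) = L.map e.hom ≫ k ≫ L.map e'.inv := h2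
    refine ⟨e.inv ≫ K.map l ≫ e'.hom, ?_, ?_⟩
    · rw [← cancel_epi i.hom, ← assoc, ← hm, assoc, e.hom_inv_id_assoc,
        ← Functor.map_comp_assoc, h1, hm']
    · rw [map_comp, map_comp, h2']
      simp [← map_comp, ← Functor.map_comp_assoc]

lemma of_iso {K K' : Chart 𝒳 ⥤ Chart 𝒴} (h : IsOrthogonal K) (i : K ≅ K') : IsOrthogonal K' where
  isDom_iff n := by
    rw [← h.isDom_iff n, ← Chart.isDom_iso_comp (i.hom.app _) (K'.map n), ← i.hom.naturality,
      Chart.isDom_comp_iso]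
  exists_lift {w b} d hd := by
    obtain ⟨w', d', e, h'⟩ := h.exists_lift (i.hom.app w ≫ d) ((Chart.isDom_iso_comp _ _).2 hd)
    exact ⟨w', d', (i.app w').symm ≪≫ e, by
      rw [← cancel_epi (i.hom.app w), ← h']
      simp⟩
  exists_hom {w w' w''} d d' k hd hd' e := by
    obtain ⟨l, h1, h2⟩ := h.exists_hom d d' (i.hom.app w' ≫ k ≫ i.inv.app w'') hd hd' (by
      rw [i.hom.naturality_assoc, reassoc_of% e]
      simp)
    refine ⟨l, h1, ?_⟩
    rw [← cancel_epi (i.hom.app w'), ← i.hom.naturality, h2]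
    simp

lemma of_isEquivalence (K : Chart 𝒳 ⥤ Chart 𝒴) [K.IsEquivalence]
    (hi : ∀ {a b : Chart 𝒳} (n : a ⟶ b), Chart.IsDom (K.map n) ↔ Chart.IsDom n) :
    IsOrthogonal K where
  isDom_iff := hi
  exists_lift {w b} d hd :=
    ⟨_, K.preimage (d ≫ (K.objObjPreimageIso b).inv), K.objObjPreimageIso b, by simp⟩
  exists_hom {w w' w''} d d' k hd hd' e := by
    obtain ⟨l, rfl⟩ := K.map_surjective k
    exact ⟨l, K.map_injective (by rw [map_comp, e]), rfl⟩

lemma isMinimal {K : Chart 𝒳 ⥤ Chart 𝒴} (hK : IsOrthogonal K) (hs : K.EssSurj)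
    (h𝒳 : IsConelike 𝒳) {m : Chart 𝒳} (hm : m.IsMinimal) : (K.obj m).IsMinimal where
  existsUnique {y z} f g hf hg := by
    have lift {w : Chart 𝒳} {b : Chart 𝒴} (d : K.obj w ⟶ b) (hd : Chart.IsDom d) :
        ∃ (w' : Chart 𝒳) (d' : w ⟶ w') (e : K.obj w' ≅ b), K.map d' = d ≫ e.inv ∧
          Chart.IsDom d' := by
      obtain ⟨w', d', e, h⟩ := hK.exists_lift d hd
      exact ⟨w', d', e, by rw [← h]; simp, by
        rwa [← h, Chart.isDom_comp_iso, hK.isDom_iff] at hd⟩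
    let i := K.objObjPreimageIso y
    obtain ⟨w₁, d₁, e₁, h₁, hd₁⟩ := lift (i.hom ≫ f) ((Chart.isDom_iso_comp _ _).2 hf)
    obtain ⟨w₂, d₂, e₂, h₂, hd₂⟩ := lift (i.hom ≫ g) ((Chart.isDom_iso_comp _ _).2 hg)
    have hw₁ : w₁.IsMinimal := by
      obtain ⟨n, d, hn, hd⟩ := h𝒳.exists_minimal w₁
      obtain ⟨w₃, d₃, e₃, h₃, hd₃⟩ := lift (e₁.inv ≫ K.map d)
        ((Chart.isDom_iso_comp _ _).2 ((hK.isDom_iff d).2 hd))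
      obtain ⟨r, hr, -⟩ := hm.existsUnique (𝟙 m) d₃ (.of_isIso _) hd₃
      obtain ⟨l, h1, -⟩ := hK.exists_hom d (𝟙 w₁) (e₃.inv ≫ K.map r ≫ e₁.inv) hd (.of_isIso _) (by
          have h4 : K.map d = e₁.hom ≫ K.map d₃ ≫ e₃.hom := by simp [h₃]
          rw [h4]
          simp [← Functor.map_comp_assoc, hr])
      have h2 : l ≫ d = 𝟙 n := hn.hom_ext d hd (by rw [reassoc_of% h1]; exact hd)
        (by rw [reassoc_of% h1, comp_id])
      exact hn.of_iso ⟨l, d, h2, h1⟩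
    obtain ⟨r, hr, hr'⟩ := hw₁.existsUnique d₁ d₂ hd₁ hd₂
    have key : ∀ k : z ⟶ K.obj m, g ≫ k = f ↔ K.map d₂ ≫ e₂.hom ≫ k ≫ e₁.inv = K.map d₁ :=
      fun k => by
        rw [h₁, h₂, ← cancel_epi i.hom, ← cancel_mono e₁.inv]
        simp
    refine ⟨e₂.inv ≫ K.map r ≫ e₁.hom, (key _).2 ?_, fun k hk => ?_⟩
    · simp [← map_comp, hr]
    · obtain ⟨l, h1, h2⟩ := hK.exists_hom d₂ d₁ (e₂.hom ≫ k ≫ e₁.inv) hd₂ hd₁ ((key k).1 hk)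
      obtain rfl := hr' l h1
      simp [h2]

lemma isConelike {K : 𝒳 ⟶ 𝒴} (hK : IsOrthogonal (Chart.map K)) (hs : (Chart.map K).EssSurj)
    (h𝒳 : IsConelike 𝒳) (h𝒴 : IsFiberedInGroupoids 𝒴) : IsConelike 𝒴 := by
  have hmin (a : Chart 𝒴) : ∃ (m : Chart 𝒳) (d : a ⟶ (Chart.map K).obj m), m.IsMinimal ∧
      Chart.IsDom d := by
    obtain ⟨m, d, hm, hd⟩ := h𝒳.exists_minimal ((Chart.map K).objPreimage a)
    exact ⟨m, ((Chart.map K).objObjPreimageIso a).inv ≫ (Chart.map K).map d, hm,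
      (Chart.isDom_iso_comp _ _).2 (hd.map K)⟩
  refine ⟨h𝒴, fun a => ?_, fun {x y} f hy hf => ?_, ?_⟩
  · obtain ⟨m, d, hm, hd⟩ := hmin a
    exact ⟨_, d, hK.isMinimal hs h𝒳 hm, hd⟩
  · obtain ⟨m, d, hm, hd⟩ := hmin y
    have := hy.isIso (hK.isMinimal hs h𝒳 hm) d hd
    have hf' : Chart.IsFc (f ≫ d) := hf.comp (.of_isIso d)
    obtain ⟨w, φ, e, h⟩ := h𝒳.fibered.exists_chart_over m ((Chart.cone 𝒴).map (f ≫ d))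
    obtain ⟨χ, h1, -⟩ := h𝒴.exists_chart_hom ((Chart.map K).map φ) (f ≫ d) e.inv (by
      rw [Chart.cone_map]
      exact (congrArg (e.inv ≫ ·) h).trans (e.inv_hom_id_assoc _))
    have : IsIso ((Chart.cone 𝒴).map χ) := by
      rw [h1]
      exact inferInstanceAs (IsIso e.inv)
    have : IsIso χ := by
      have h2 := h𝒴.chart_isIso χ
      exact h2
    have hφ : Chart.IsFc φ := by
      rw [Chart.IsFc, h]
      exact (IsFaceMorphism.of_isIso e.hom).comp hf'
    exact (hK.isMinimal hs h𝒳 (h𝒳.face φ hm hφ)).of_iso (asIso χ).symm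
  · obtain ⟨ι, m, h⟩ := h𝒳.small
    refine ⟨ι, fun i => (Chart.map K).obj (m i), fun x hx => ?_⟩
    obtain ⟨n, d, hn, hd⟩ := hmin x
    have := hx.isIso (hK.isMinimal hs h𝒳 hn) d hd
    obtain ⟨i, ⟨e⟩⟩ := h n hn
    exact ⟨i, ⟨asIso d ≪≫ (Chart.map K).mapIso e⟩⟩

end IsOrthogonal

end Orthogonal

section Equivalences

variable {𝒳 𝒴 : Based.{u}}

variable (𝒳) in
/-- The action on charts of the identity. -/
def Chart.mapId : Chart.map (𝟙 𝒳) ≅ 𝟭 (Chart 𝒳) where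
  hom :=
    { app := fun a => Chart.mkHom (a := (Chart.map (𝟙 𝒳)).obj a) (b := a) (𝟙 a.pt)
      naturality := fun a b f => (comp_id f).trans (id_comp f).symm }
  inv :=
    { app := fun a => Chart.mkHom (b := (Chart.map (𝟙 𝒳)).obj a) (a := a) (𝟙 a.pt)
      naturality := fun a b f => (comp_id f).trans (id_comp f).symm }
  hom_inv_id := NatTrans.ext (funext fun a => comp_id (𝟙 a))
  inv_hom_id := NatTrans.ext (funext fun a => comp_id (𝟙 a))

lemma Chart.isEquivalence_map (e : Bicategory.Equivalence 𝒳 𝒴) : (Chart.map e.hom).IsEquivalence :=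
  (CategoryTheory.Equivalence.mk (Chart.map e.hom) (Chart.map e.inv)
    ((Chart.mapId 𝒳).symm ≪≫ Chart.mapIso e.unit ≪≫ Chart.mapComp e.hom e.inv)
    ((Chart.mapComp e.inv e.hom).symm ≪≫ Chart.mapIso e.counit ≪≫
      Chart.mapId 𝒴)).isEquivalence_functor

lemma IsOrthogonal.of_equivalence (e : Bicategory.Equivalence 𝒳 𝒴) :
    IsOrthogonal (Chart.map e.hom) :=
  have := Chart.isEquivalence_map e
  .of_isEquivalence _ (Chart.isDom_map_iff e.hom)

lemma IsConelike.of_equivalence (h : IsConelike 𝒳) (e : Bicategory.Equivalence 𝒳 𝒴)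
    (h𝒴 : IsFiberedInGroupoids 𝒴) : IsConelike 𝒴 := by
  have := Chart.isEquivalence_map e
  exact (IsOrthogonal.of_equivalence e).isConelike Functor.IsEquivalence.essSurj h h𝒴

lemma Chart.IsMinimal.of_equivalence (h : IsConelike 𝒳) (e : Bicategory.Equivalence 𝒳 𝒴)
    {m : Chart 𝒳} (hm : m.IsMinimal) : ((Chart.map e.hom).obj m).IsMinimal := by
  have := Chart.isEquivalence_map e
  exact (IsOrthogonal.of_equivalence e).isMinimal Functor.IsEquivalence.essSurj h hm

end Equivalences

section Base

variable {C : Type (u + 1)} [Category.{u} C] {J : GrothendieckTopology C}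

variable (C) in
lemma baseBased_fibered : IsFiberedInGroupoids (baseBased C) :=
  .mk' (fun a R f => ⟨R, f, rfl, (id_comp f).symm⟩) (fun _ _ k hk => ⟨k, rfl, hk⟩)
    (fun _ _ _ hp _ => hp)

variable (J) in
lemma baseBased_isStack : IsStack J (baseBased C) := by
  have key {𝒜 : BasedCategory.{u, u + 1} C} (K K' : 𝒜 ⟶ baseBased C) : Nonempty (K ≅ K') := by
    let η : K ⟶ K' := mkTrans (𝒴 := baseBased C) (fun a => (baseIso K a).hom ≫ (baseIso K' a).inv)
      (fun {x y} f => by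
        have h1 := p_map_map K f
        have h2 := p_map_map K' f
        refine (congrArg (· ≫ (baseIso K y).hom ≫ (baseIso K' y).inv) h1).trans
          (Eq.trans ?_ (congrArg (((baseIso K x).hom ≫ (baseIso K' x).inv) ≫ ·) h2).symm)
        simp) (fun a => rfl)
    have := (baseBased_fibered C).isIso_trans η
    exact ⟨asIso η⟩
  have key' {𝒜 : BasedCategory.{u, u + 1} C} {K K' : 𝒜 ⟶ baseBased C} (η θ : K ⟶ K') (a : 𝒜.obj) :
      appAt η a = appAt θ a := (p_map_appAt η a).trans (p_map_appAt θ a).symm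
  refine IsStack.mk' (baseBased_fibered C) (fun T S hS {K K' η θ} H => trans_ext fun a => key' _ _ a)
    (fun T S hS {K K'} η => ?_) (fun T S hS D => ⟨toBase _, key _ _⟩)
  obtain ⟨ε⟩ := key K K'
  exact ⟨ε.hom, fun u => key' (K := sieveIncl S ≫ K) (K' := sieveIncl S ≫ K')
    (Bicategory.whiskerLeft (sieveIncl S) ε.hom) η u⟩

lemma exists_baseBased_hom {a b : Chart (baseBased RPCC.{u})}
    (k : (Chart.cone _).obj a ⟶ (Chart.cone _).obj b) : ∃ n : a ⟶ b, (Chart.cone _).map n = k := by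
  obtain ⟨l, hl⟩ := Topped.ev.map_surjective (X := a.dom) (Y := b.dom) k
  refine ⟨Chart.mkHom (a := a) (b := b) (a.iso.inv ≫ Topped.hom l ≫ b.iso.hom), ?_⟩
  refine Eq.trans (congrArg Topped.ev.map ?_) hl
  change a.iso.hom ≫ (a.iso.inv ≫ Topped.hom l ≫ b.iso.hom) ≫ b.iso.inv = Topped.hom l
  simp

lemma baseBased_hom_ext {a b : Chart (baseBased RPCC.{u})} {n n' : a ⟶ b}
    (h : (Chart.cone _).map n = (Chart.cone _).map n') : n = n' := Chart.p_map_eq h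

lemma isMinimal_of_iso_zero {a : Chart (baseBased RPCC.{u})}
    (e : (Chart.cone _).obj a ≅ RPC.zero) : a.IsMinimal where
  existsUnique {y z} f g _ _ := by
    have h {b : Chart (baseBased RPCC.{u})} (n n' : b ⟶ a) : n = n' := baseBased_hom_ext (by
      rw [← cancel_mono e.hom]
      exact RPC.hom_zero_ext _ _)
    obtain ⟨n, -⟩ := exists_baseBased_hom (a := z) (b := a) (RPC.toZero _ ≫ e.inv)
    exact ⟨n, h _ _, fun _ _ => h _ _⟩

lemma baseBased_isConelike : IsConelike (baseBased RPCC.{u}) := by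
  let T := Topped.ev.objPreimage RPC.zero
  let m : Chart (baseBased RPCC.{u}) := ⟨T.cx, T, Iso.refl _⟩
  let e : (Chart.cone _).obj m ≅ RPC.zero := Topped.ev.objObjPreimageIso RPC.zero
  have hd {σ : RPC.{u}} {τ : RPC.{u}} (e : τ ≅ RPC.zero) (f : σ ⟶ τ) : IsDominant f := by
    have := (RPC.isDominant_toZero (f ≫ e.hom)).comp (.of_isIso e.inv)
    simpa using this
  have hm (a) : ∃ f : a ⟶ m, Chart.IsDom f := by
    obtain ⟨n, -⟩ := exists_baseBased_hom (a := a) (b := m) (RPC.toZero _ ≫ e.inv)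
    exact ⟨n, hd e _⟩
  have hmin {x : Chart (baseBased RPCC.{u})} (hx : x.IsMinimal) : Nonempty (x ≅ m) := by
    obtain ⟨f, hf⟩ := hm x
    have := hx.isIso (isMinimal_of_iso_zero e) f hf
    exact ⟨asIso f⟩
  refine ⟨baseBased_fibered _, fun a => ?_, fun {x y} f hy hf => ?_, PUnit, fun _ => m,
    fun x hx => ⟨⟨⟩, hmin hx⟩⟩
  · obtain ⟨f, hf⟩ := hm a
    exact ⟨m, f, isMinimal_of_iso_zero e, hf⟩
  · obtain ⟨i⟩ := hmin hy
    have hi : (Chart.cone _).obj y ≅ RPC.zero := (Chart.cone _).mapIso i ≪≫ e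
    have := hf.isIso_of_isDominant (hd hi _)
    exact isMinimal_of_iso_zero (@asIso _ _ _ _ _ this ≪≫ hi)

end Base

section PresheafOfSpace

open Opposite

/-- The presheaf of morphisms from cone complexes to a combinatorial cone space. -/
def CombConeSpace.presheaf (Z : CombConeSpace.{u}) : RPCC.{u}ᵒᵖ ⥤ Type u :=
  IsConeComplex.ι.op ⋙ yoneda.obj Z

/-- A morphism to a combinatorial cone space, as a section. -/
def CombConeSpace.toSection {Z : CombConeSpace.{u}} {T : RPCC.{u}} (f : T.obj ⟶ Z) :
    Z.presheaf.obj (op T) := f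

/-- A section, as a morphism to a combinatorial cone space. -/
def CombConeSpace.ofSection {Z : CombConeSpace.{u}} {T : RPCC.{u}} (s : Z.presheaf.obj (op T)) :
    T.obj ⟶ Z := s

/-- The morphism between faces induced by a morphism of complexes. -/
def RPCC.faceMap {T T' : RPCC.{u}} (f : T ⟶ T') (α : T.obj.ι) :
    T.face α ⟶ T'.face (f.hom.idx α) :=
  ObjectProperty.homMk
    { idx := fun β => ⟨f.hom.idx β.1, by
        obtain ⟨φ, hφ⟩ := β.2
        obtain ⟨ψ, hψ, -⟩ := f.hom.compat φ hφ
        exact ⟨ψ, hψ⟩⟩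
      map := fun β => f.hom.map β.1
      dominant := fun β => f.hom.dominant β.1
      compat := fun φ hφ => f.hom.compat φ hφ }

lemma RPCC.faceMap_comp {T T' : RPCC.{u}} (f : T ⟶ T') (α : T.obj.ι) :
    RPCC.faceMap f α ≫ T'.faceIncl _ = T.faceIncl α ≫ f :=
  ObjectProperty.hom_ext _ (CombConeSpace.Hom.ext_map fun β => by
    have h : f.hom.map β.1 ≫ 𝟙 _ = 𝟙 _ ≫ f.hom.map β.1 := by simp
    exact congrArg (Sigma.mk _) h)

/-- The inclusion between faces. -/
def RPCC.faceSub (T : RPCC.{u}) {α β : T.obj.ι} {φ : T.obj.cone α ⟶ T.obj.cone β}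
    (hφ : φ ∈ T.obj.mor α β) : T.face α ⟶ T.face β :=
  ObjectProperty.homMk
    { idx := fun γ => ⟨γ.1, γ.2.choose ≫ φ, T.obj.comp_mem _ _ γ.2.choose_spec hφ⟩
      map := fun γ => 𝟙 _
      dominant := fun γ => .id _
      compat := fun φ hφ => ⟨φ, hφ, (comp_id φ).trans (id_comp φ).symm⟩ }

lemma RPCC.faceSub_comp (T : RPCC.{u}) {α β : T.obj.ι} {φ : T.obj.cone α ⟶ T.obj.cone β}
    (hφ : φ ∈ T.obj.mor α β) : T.faceSub hφ ≫ T.faceIncl β = T.faceIncl α :=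
  ObjectProperty.hom_ext _ (CombConeSpace.Hom.ext_map fun β =>
    congrArg (Sigma.mk _) (comp_id (𝟙 (T.obj.cone β.1))))

/-- The index of a face itself. -/
def RPCC.faceIdx (T : RPCC.{u}) (α : T.obj.ι) : (T.face α).obj.ι := ⟨α, 𝟙 _, T.obj.id_mem α⟩

lemma CombConeSpace.exists_glue (Z : CombConeSpace.{u}) {T : RPCC.{u}} (x : ∀ α, (T.face α).obj ⟶ Z)
    (hx : ∀ {α β : T.obj.ι} {φ : T.obj.cone α ⟶ T.obj.cone β} (hφ : φ ∈ T.obj.mor α β),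
      (T.faceSub hφ).hom ≫ x β = x α) :
    ∃ t : T.obj ⟶ Z, ∀ α, (⟨t.idx α, t.map α⟩ : Σ j, T.obj.cone α ⟶ Z.cone j) =
      ⟨(x α).idx (T.faceIdx α), (x α).map (T.faceIdx α)⟩ := by
  refine ⟨⟨fun α => (x α).idx (T.faceIdx α), fun α => (x α).map (T.faceIdx α),
    fun α => (x α).dominant _, fun {α β} φ hφ => ?_⟩, fun α => rfl⟩
  let P (p : Σ j, T.obj.cone α ⟶ Z.cone j) : Prop :=
    ∃ ψ ∈ Z.mor p.1 ((x β).idx (T.faceIdx β)), φ ≫ (x β).map (T.faceIdx β) = p.2 ≫ ψ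
  have h1 := CombConeSpace.Hom.congr_map (hx hφ) (T.faceIdx α)
  have h2 : P ⟨(x α).idx (T.faceIdx α), (x α).map (T.faceIdx α)⟩ := by
    refine h1 ▸ ?_
    let a' : (T.face β).obj.ι := (T.faceSub hφ).hom.idx (T.faceIdx α)
    let φ' : (T.face β).obj.cone a' ⟶ (T.face β).obj.cone (T.faceIdx β) := φ
    obtain ⟨ψ, hψ, h⟩ := (x β).compat φ' hφ
    exact ⟨ψ, hψ, h.trans (congrArg (· ≫ ψ) (id_comp _).symm)⟩
  exact h2

lemma CombConeSpace.presheaf_isSheaf (Z : CombConeSpace.{u}) :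
    Presheaf.IsSheaf faceTopology Z.presheaf := by
  rw [isSheaf_iff_isSheaf_of_type]
  intro T S hS x hx
  rw [Presieve.compatible_iff_sieveCompatible] at hx
  have hx' {R R' : RPCC.{u}} (f : R ⟶ T) (hf : S f) (g : R' ⟶ R) (h : R' ⟶ T) (hh : S h)
      (e : g ≫ f = h) : ofSection (x h hh) = g.hom ≫ ofSection (x f hf) := by
    subst e
    exact hx f g hf
  have hm := mem_faceTopology_iff.1 hS
  obtain ⟨t, ht⟩ := Z.exists_glue (fun α => ofSection (x (T.faceIncl α) (hm α)))
    (fun {α β φ} hφ => (hx' _ (hm β) _ _ (hm α) (T.faceSub_comp hφ)).symm)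
  have key (s : T.obj ⟶ Z) (R : RPCC.{u}) (f : R ⟶ T) (hf : S f) (β : R.obj.ι)
      (hs : (⟨s.idx (f.hom.idx β), s.map (f.hom.idx β)⟩ : Σ j, T.obj.cone _ ⟶ Z.cone j) =
        ⟨_, (ofSection (x (T.faceIncl (f.hom.idx β)) (hm _))).map (T.faceIdx _)⟩) :
      (⟨(f.hom ≫ s).idx β, (f.hom ≫ s).map β⟩ : Σ j, R.obj.cone β ⟶ Z.cone j) =
        ⟨(ofSection (x f hf)).idx β, (ofSection (x f hf)).map β⟩ := by
    have hβ := S.downward_closed hf (R.faceIncl β)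
    have h1 := CombConeSpace.Hom.congr_map ((hx' f hf (R.faceIncl β) _ hβ rfl).symm.trans
      (hx' _ (hm _) (RPCC.faceMap f β) _ hβ (RPCC.faceMap_comp f β))) (R.faceIdx β)
    have h2 := congrArg (fun p : Σ j, T.obj.cone (f.hom.idx β) ⟶ Z.cone j =>
      (⟨p.1, f.hom.map β ≫ p.2⟩ : Σ j, R.obj.cone β ⟶ Z.cone j)) hs
    refine h2.trans (h1.symm.trans ?_)
    exact congrArg (Sigma.mk _) (id_comp ((ofSection (x f hf)).map β))
  refine ⟨toSection t, fun R f hf => CombConeSpace.Hom.ext_map fun β => key t R f hf β (ht _),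
    fun s hs => CombConeSpace.Hom.ext_map fun α => ?_⟩
  have h1 := CombConeSpace.Hom.congr_map (hs _ (hm α)) (T.faceIdx α)
  refine Eq.trans ?_ (h1.trans (ht α).symm)
  exact congrArg (Sigma.mk _) (id_comp ((ofSection s).map α)).symm

end PresheafOfSpace

section Equivalences

open Bicategory

variable {B : Type*} [Bicategory B] {a b c : B}

/-- The inverse of an equivalence. -/
def equivSymm (e : Bicategory.Equivalence a b) : Bicategory.Equivalence b a :=
  .mkOfAdjointifyCounit e.counit.symm e.unit.symm

/-- The composite of equivalences. -/
def equivTrans (e : Bicategory.Equivalence a b) (e' : Bicategory.Equivalence b c) :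
    Bicategory.Equivalence a c :=
  .mkOfAdjointifyCounit (f := e.hom ≫ e'.hom) (g := e'.inv ≫ e.inv)
    (e.unit ≪⊗≫ whiskerLeftIso e.hom (whiskerRightIso e'.unit e.inv) ≪⊗≫ Iso.refl _)
    (Iso.refl _ ≪⊗≫ whiskerLeftIso e'.inv (whiskerRightIso e.counit e'.hom) ≪⊗≫ e'.counit)

end Equivalences

section ElementsOfSpace

open Opposite

variable {Z : CombConeSpace.{u}}

lemma CombConeSpace.existsUnique_mor {c c' : Topped.{u}} {f : c.cx.obj ⟶ Z} {f' : c'.cx.obj ⟶ Z}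
    (k : c ⟶ c') (h : (Topped.hom k).hom ≫ f' = f) :
    ∃! ψ : Z.mor (f.idx c.top) (f'.idx c'.top),
      Topped.ev.map k ≫ f'.map c'.top = f.map c.top ≫ ψ.1 := by
  subst h
  obtain ⟨χ, hχ⟩ := c'.isTop ((Topped.hom k).hom.idx c.top)
  obtain ⟨ψ, hψ, e⟩ := f'.compat χ hχ
  have h1 : Topped.ev.map k ≫ f'.map c'.top = ((Topped.hom k).hom ≫ f').map c.top ≫ ψ := by
    rw [Topped.ev_map k hχ]
    refine (assoc _ _ _).trans ((congrArg _ e).trans ?_)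
    exact (assoc _ _ _).symm
  refine ⟨⟨ψ, hψ⟩, h1, fun ψ' h' => Subtype.ext ?_⟩
  have h2 := CombConeSpace.factorization_unique (((Topped.hom k).hom ≫ f').dominant c.top)
    (((Topped.hom k).hom ≫ f').dominant c.top) ψ'.2 hψ (h'.symm.trans h1)
  simpa using h2

namespace CombConeSpace

/-- The morphism of complexes underlying a chart of the presheaf of a combinatorial cone space. -/
def chartHom (a : Chart (elements Z.presheaf)) : a.dom.cx.obj ⟶ Z :=
  ofSection (res Z.presheaf a.iso.hom (elt a.pt))

lemma chartHom_comp {a b : Chart (elements Z.presheaf)} (n : a ⟶ b) :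
    (Topped.hom ((Chart.domain _).map n)).hom ≫ chartHom b = chartHom a := by
  have h : res Z.presheaf (a.iso.hom ≫ (elements _).p.map (Chart.hom n) ≫ b.iso.inv)
      (res Z.presheaf b.iso.hom (elt b.pt)) = res Z.presheaf a.iso.hom (elt a.pt) := by
    rw [← res_comp, assoc, assoc, Iso.inv_hom_id, comp_id, res_comp, elt_map]
  exact h

lemma exists_chart_hom {a b : Chart (elements Z.presheaf)} (l : a.dom ⟶ b.dom)
    (h : (Topped.hom l).hom ≫ chartHom b = chartHom a) :
    ∃ n : a ⟶ b, (Chart.domain _).map n = l := by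
  refine ⟨Chart.mkHom (eltHom (a.iso.inv ≫ Topped.hom l ≫ b.iso.hom) ?_), ?_⟩
  · have h1 : res Z.presheaf (Topped.hom l ≫ b.iso.hom) (elt b.pt) =
      res Z.presheaf a.iso.hom (elt a.pt) := (res_comp _ _ _).trans h
    rw [res_comp, h1, ← res_comp, Iso.inv_hom_id, res_id]
  · change a.iso.hom ≫ (a.iso.inv ≫ Topped.hom l ≫ b.iso.hom) ≫ b.iso.inv = Topped.hom l
    simp

/-- The cone of the combinatorial cone space at a chart. -/
def chartPoint (a : Chart (elements Z.presheaf)) : Z.toCombConeStack.based.obj :=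
  (⟨Z.cone ((chartHom a).idx a.dom.top), _, Iso.refl _⟩ : Z.Point)

lemma cone_toCombConeStack {a b : Chart (elements Z.presheaf)}
    (ψ : Z.mor ((chartHom a).idx a.dom.top) ((chartHom b).idx b.dom.top)) :
    Z.toCombConeStack.cone.map (show chartPoint a ⟶ chartPoint b from ψ) = ψ.1 :=
  (id_comp _).trans (comp_id _)

/-- The morphism of the combinatorial cone space at a morphism of charts. -/
def chartMor {a b : Chart (elements Z.presheaf)} (n : a ⟶ b) :
    Z.mor ((chartHom a).idx a.dom.top) ((chartHom b).idx b.dom.top) :=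
  (existsUnique_mor _ (chartHom_comp n)).choose

lemma chartMor_spec {a b : Chart (elements Z.presheaf)} (n : a ⟶ b) :
    (Chart.cone _).map n ≫ (chartHom b).map b.dom.top =
      (chartHom a).map a.dom.top ≫ (chartMor n).1 :=
  (existsUnique_mor _ (chartHom_comp n)).choose_spec.1

lemma chartMor_eq {a b : Chart (elements Z.presheaf)} (n : a ⟶ b)
    (ψ : Z.mor ((chartHom a).idx a.dom.top) ((chartHom b).idx b.dom.top))
    (h : (Chart.cone _).map n ≫ (chartHom b).map b.dom.top =
      (chartHom a).map a.dom.top ≫ ψ.1) : chartMor n = ψ :=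
  (existsUnique_mor _ (chartHom_comp n)).unique (chartMor_spec n) h

variable (Z) in
/-- The marking of charts by cones of the combinatorial cone space. -/
def toMark : Chart (elements Z.presheaf) ⥤ Z.toCombConeStack.Mark where
  obj a := ⟨(Chart.cone _).obj a, chartPoint a, (chartHom a).map a.dom.top,
    (chartHom a).dominant a.dom.top⟩
  map {a b} n := ⟨(Chart.cone _).map n, chartMor n, (chartMor_spec n).trans
    (congrArg ((chartHom a).map a.dom.top ≫ ·) (cone_toCombConeStack (chartMor n)).symm)⟩
  map_id a := CombConeStack.Mark.hom_ext ((Chart.cone _).map_id a)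
    (chartMor_eq (𝟙 a) ⟨𝟙 _, Z.id_mem _⟩ (by
      rw [map_id]
      exact (id_comp _).trans (comp_id _).symm))
  map_comp {a b c} m n := CombConeStack.Mark.hom_ext ((Chart.cone _).map_comp m n)
    (chartMor_eq (m ≫ n) ⟨_, Z.comp_mem _ _ (chartMor m).2 (chartMor n).2⟩ (by
      rw [map_comp]
      refine (assoc _ _ _).trans ((congrArg (_ ≫ ·) (chartMor_spec n)).trans ?_)
      refine (assoc _ _ _).symm.trans ((congrArg (· ≫ _) (chartMor_spec m)).trans ?_)
      exact assoc _ _ _))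

instance : (toMark Z).Faithful where
  map_injective {a b n n'} e :=
    Chart.hom_ext (elements_hom_ext (Chart.p_map_eq (congrArg CombConeStack.Mark.Hom.cone e)))

instance : (toMark Z).Full where
  map_surjective {a b} := by
    rintro ⟨k, ψ, e⟩
    change (Chart.cone _).obj a ⟶ (Chart.cone _).obj b at k
    change Z.mor ((chartHom a).idx a.dom.top) ((chartHom b).idx b.dom.top) at ψ
    have e' : k ≫ (chartHom b).map b.dom.top = (chartHom a).map a.dom.top ≫ ψ.1 :=
      e.trans (congrArg ((chartHom a).map a.dom.top ≫ ·) (cone_toCombConeStack ψ))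
    obtain ⟨l, hl⟩ := Topped.ev.map_surjective (X := a.dom) (Y := b.dom) k
    obtain ⟨ψ', h', -⟩ := existsUnique_mor (f' := chartHom b) l rfl
    have h0 : (Topped.hom l).hom ≫ chartHom b = chartHom a := by
      refine a.dom.isTop.hom_ext ψ'.2 ψ.2 (h'.symm.trans ?_)
      rw [hl]
      exact e'
    obtain ⟨n, hn⟩ := exists_chart_hom l h0
    have hk : (Chart.cone _).map n = k := (congrArg Topped.ev.map hn).trans hl
    exact ⟨n, CombConeStack.Mark.hom_ext hk (chartMor_eq n ψ (by rw [hk, e']))⟩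

instance : (toMark Z).EssSurj where
  mem_essImage := by
    rintro ⟨σ, x, d, hd⟩
    change Z.Point at x
    change σ ⟶ x.base at d
    let c := Topped.ev.objPreimage σ
    let e : c.cx.obj.cone c.top ≅ σ := Topped.ev.objObjPreimageIso σ
    obtain ⟨f, ψ, hψ, h⟩ := c.isTop.exists_hom (e.hom ≫ d ≫ x.iso.hom)
    let a : Chart (elements Z.presheaf) := ⟨eltMk (toSection f), c, Iso.refl _⟩
    have ha : chartHom a = f :=
      (congrArg (res Z.presheaf (𝟙 c.cx)) (elt_eltMk (X := Z.presheaf) (toSection f))).trans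
        (res_id _ _)
    obtain ⟨ψ', h'⟩ : ∃ ψ : Z.mor ((chartHom a).idx a.dom.top) x.idx,
        (chartHom a).map a.dom.top ≫ ψ.1 = e.hom ≫ d ≫ x.iso.hom := by
      rw [ha]
      exact ⟨⟨ψ, hψ⟩, h⟩
    let p : chartPoint a ⟶ x := ψ'
    have hp : Z.toCombConeStack.cone.map p = ψ'.1 ≫ x.iso.inv := id_comp _
    have h1 : e.hom ≫ d = (chartHom a).map a.dom.top ≫ ψ'.1 ≫ x.iso.inv := by
      rw [← assoc, h']
      simp
    let m : (toMark Z).obj a ⟶ ⟨σ, x, d, hd⟩ := (⟨e.hom, p,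
      h1.trans (congrArg ((chartHom a).map a.dom.top ≫ ·) hp.symm)⟩ : CombConeStack.Mark.Hom _ _)
    have hm1 : IsIso (CombConeStack.Mark.Hom.cone m) := inferInstanceAs (IsIso e.hom)
    have hm2 : IsIso (CombConeStack.Mark.Hom.pt m) := by
      refine Z.toCombConeStack.isIso_of_isDominant p ?_
      rw [hp]
      refine IsDominant.of_comp (f := (chartHom a).map a.dom.top) ?_
      have h2 := (IsDominant.of_isIso e.hom).comp hd
      exact (congrArg IsDominant h1).mp h2
    exact ⟨a, ⟨@asIso _ _ _ _ m (CombConeStack.Mark.isIso m)⟩⟩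

instance : (toMark Z).IsEquivalence where

variable (Z) in
lemma exists_equivalence :
    Nonempty (Bicategory.Equivalence (elements Z.presheaf) Z.toCombConeStack.geom) := by
  obtain ⟨K, i, -⟩ := CombConeStack.exists_functor_of_charts (elements_fibered _) (toMark Z)
    (Iso.refl _)
  have h1 : (Chart.map K ⋙ CombConeStack.mark _).IsEquivalence :=
    Functor.isEquivalence_of_iso i.symm
  have h2 : (Chart.map K).IsEquivalence :=
    Functor.isEquivalence_of_comp_right _ (CombConeStack.mark Z.toCombConeStack)
  obtain ⟨e, -⟩ := exists_equivalence_of_charts K (elements_isStack Z.presheaf_isSheaf)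
    (CombConeStack.geom_isStack _)
  exact ⟨e⟩

end CombConeSpace

lemma elements_presheaf_isConelike (Z : CombConeSpace.{u}) : IsConelike (elements Z.presheaf) := by
  obtain ⟨e⟩ := Z.exists_equivalence
  exact Z.toCombConeStack.geom_isConelike.of_equivalence (equivSymm e) (elements_fibered _)

end ElementsOfSpace

namespace CombConeStack

section Equivalence

lemma exists_equivalence {T S : CombConeStack.{u}} (g : CombConeStack.Hom T S)
    [g.functor.IsEquivalence] [∀ a, IsIso (g.map a)] : Nonempty (Bicategory.Equivalence T S) := by
  let G := g.functor.asEquivalence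
  have hG : G.functor = g.functor := rfl
  let ε (a : S.based.obj) : g.functor.obj (G.inverse.obj a) ≅ a := G.counitIso.app a
  have hε {a b : S.based.obj} (v : a ⟶ b) : v ≫ (ε b).inv =
    (ε a).inv ≫ g.functor.map (G.inverse.map v) := (G.counitIso.inv.naturality v)
  let f : CombConeStack.Hom S T :=
    { functor := G.inverse
      map := fun a => S.cone.map (ε a).inv ≫ inv (g.map (G.inverse.obj a))
      naturality := fun {a b} v => by
        rw [← cancel_mono (g.map (G.inverse.obj b)), assoc, assoc, assoc,
          assoc, g.naturality, IsIso.inv_hom_id, IsIso.inv_hom_id_assoc, comp_id,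
          ← map_comp, ← map_comp, hε]
      dominant := fun a => (IsDominant.of_isIso _).comp (.of_isIso _) }
  have h1 (α : T.based.obj) : g.functor.map (G.unitIso.hom.app α) = (ε (g.functor.obj α)).inv :=
    (G.counitInv_app_functor α).symm
  refine ⟨Bicategory.Equivalence.mkOfAdjointifyCounit (f := g) (g := f)
    (Hom.isoMk G.unitIso fun α => ?_) (Hom.isoMk G.counitIso fun α => ?_)⟩
  · let u : α ⟶ G.inverse.obj (g.functor.obj α) := G.unitIso.hom.app α
    have h1 : g.functor.map u = (ε (g.functor.obj α)).inv := h1 α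
    have h3 : T.cone.map u = g.map α ≫ S.cone.map (ε (g.functor.obj α)).inv ≫
        inv (g.map (G.inverse.obj (g.functor.obj α))) := by
      rw [← assoc, IsIso.eq_comp_inv, ← h1]
      exact g.naturality u
    exact (id_comp _).trans h3
  · have h3 : ((S.cone.map (ε α).inv ≫ inv (g.map (G.inverse.obj α))) ≫ g.map (G.inverse.obj α)) ≫
        S.cone.map (ε α).hom = 𝟙 _ := by
      rw [assoc, assoc, IsIso.inv_hom_id_assoc, ← map_comp, Iso.inv_hom_id, map_id]
    exact h3

end Equivalence

section Skeleton

variable (S : CombConeStack.{u})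

lemma exists_skeleton : ∃ (ι : Type u) (r : ι → S.based.obj), (∀ a, ∃ i, Nonempty (r i ≅ a)) ∧
    ∀ i j, Nonempty (r i ≅ r j) → i = j := by
  have := S.small
  let E := equivSmallModel.{u} S.based.obj
  refine ⟨Skeleton (SmallModel.{u} S.based.obj), fun i => E.inverse.obj ((fromSkeleton _).obj i),
    fun a => ⟨toSkeleton (E.functor.obj a), ⟨E.inverse.mapIso (fromSkeletonToSkeletonIso _) ≪≫
      (E.unitIso.app a).symm⟩⟩, fun i j ⟨e⟩ => ?_⟩
  exact skeleton_skeletal _ ⟨(fromSkeleton _).preimageIso (E.inverse.preimageIso e)⟩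

variable {S}

lemma hom_ext_of_aut (hS : ∀ (a : S.based.obj) (k : a ≅ a), k.hom = 𝟙 a)
    {a b : S.based.obj} {v v' : a ⟶ b} (h : S.cone.map v = S.cone.map v') :
    v = v' := by
  obtain ⟨χ, h1, h2⟩ := S.exists_hom v' v (𝟙 _) (by rw [id_comp, h])
  have : IsIso (S.cone.map χ) := by
    rw [h1]
    infer_instance
  have := S.isIso_of_isIso χ
  have h3 : χ = 𝟙 a := hS a (asIso χ)
  rw [← h2, h3, id_comp]

lemma _root_.ConeStacks.RPC.image_iso_comp {ρ σ τ : RPC.{u}} (e : ρ ⟶ σ) [IsIso e] (f : σ ⟶ τ) :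
    RPC.image (e ≫ f) = RPC.image f := by
  have key {ρ σ : RPC.{u}} (e : ρ ⟶ σ) (f : σ ⟶ τ) : RPC.image (e ≫ f) ≤ RPC.image f := by
    rw [RPC.image_comp]
    exact Submodule.map_mono (RPC.image_le e)
  refine le_antisymm (key e f) ?_
  have := key (inv e) (e ≫ f)
  rwa [IsIso.inv_hom_id_assoc] at this

/-- The combinatorial cone space of a skeleton of a combinatorial cone stack without
automorphisms. -/
def skeletonSpace {ι : Type u} (r : ι → S.based.obj) (h1 : ∀ a, ∃ i, Nonempty (r i ≅ a))
    (h2 : ∀ i j, Nonempty (r i ≅ r j) → i = j)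
    (hS : ∀ (a : S.based.obj) (k : a ≅ a), k.hom = 𝟙 a) : CombConeSpace.{u} where
  ι := ι
  cone i := S.cone.obj (r i)
  mor i j := Set.range fun v : r i ⟶ r j => S.cone.map v
  isFace := by
    rintro i j _ ⟨v, rfl⟩
    exact S.isFace v
  comp_mem := by
    rintro i j k _ _ ⟨v, rfl⟩ ⟨w, rfl⟩
    exact ⟨v ≫ w, S.cone.map_comp v w⟩
  id_mem i := ⟨𝟙 _, S.cone.map_id _⟩
  existsUnique_face j F hF := by
    obtain ⟨b, φ, e, hφ⟩ := S.exists_pullback (r j) _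
      (RPC.isFaceMorphism_faceHom (S.cone.obj (r j)) F hF)
    obtain ⟨i, ⟨k⟩⟩ := h1 b
    have hi : RPC.image (S.cone.map (k.hom ≫ φ)) = F := by
      rw [map_comp, RPC.image_iso_comp, hφ, RPC.image_iso_comp, RPC.image_faceHom]
    refine ⟨⟨i, S.cone.map (k.hom ≫ φ)⟩, ⟨⟨k.hom ≫ φ, rfl⟩, hi⟩, ?_⟩
    suffices key : ∀ i' (v : r i' ⟶ r j), RPC.image (S.cone.map v) = F →
        (⟨i', S.cone.map v⟩ : Σ i, S.cone.obj (r i) ⟶ S.cone.obj (r j)) =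
          ⟨i, S.cone.map (k.hom ≫ φ)⟩ by
      rintro ⟨i', w⟩ ⟨hw, hv⟩
      change w ∈ Set.range (fun v : r i' ⟶ r j => S.cone.map v) at hw
      obtain ⟨v, rfl⟩ := hw
      exact key i' v hv
    intro i' v hv
    obtain ⟨l, hl⟩ := (S.isFace v).exists_iso (S.isFace (k.hom ≫ φ)) (hv.trans hi.symm)
    obtain ⟨χ, hχ, hχ'⟩ := S.exists_hom (k.hom ≫ φ) v l.hom hl
    have : IsIso (S.cone.map χ) := by
      rw [hχ]
      infer_instance
    have := S.isIso_of_isIso χ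
    obtain rfl := h2 _ _ ⟨asIso χ⟩
    have h3 : χ = 𝟙 _ := hS _ (asIso χ)
    rw [← hχ', h3, id_comp]

lemma exists_space (hS : ∀ (a : S.based.obj) (k : a ≅ a), k.hom = 𝟙 a) :
    ∃ Z : CombConeSpace.{u}, Nonempty (Bicategory.Equivalence S Z.toCombConeStack) ∧
      ((∀ a b : S.based.obj, Subsingleton (a ⟶ b)) → IsConeComplex Z) := by
  obtain ⟨ι, r, h1, h2⟩ := S.exists_skeleton
  let Z := skeletonSpace r h1 h2 hS
  have hm {p q : Z.Point} (f : p ⟶ q) : ∃ v : r p.idx ⟶ r q.idx, S.cone.map v = f.1 := f.2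
  choose m hm using @hm
  let G : Z.Point ⥤ S.based.obj :=
    { obj := fun p => r p.idx
      map := fun f => m f
      map_id := fun p => hom_ext_of_aut hS ((hm (𝟙 p)).trans (S.cone.map_id _).symm)
      map_comp := fun f g => hom_ext_of_aut hS (by
        rw [hm, map_comp, hm, hm]
        rfl) }
  let g : CombConeStack.Hom Z.toCombConeStack S :=
    { functor := G
      map := fun p => (CombConeSpace.Point.iso p).hom
      naturality := fun {p q} f => by
        let p' : Z.Point := p
        let q' : Z.Point := q
        have h3 : (p'.iso.hom ≫ f.1 ≫ q'.iso.inv) ≫ q'.iso.hom = p'.iso.hom ≫ S.cone.map (m f) := by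
          rw [assoc, assoc, Iso.inv_hom_id, comp_id]
          exact congrArg (p'.iso.hom ≫ ·) (hm f).symm
        exact h3
      dominant := fun p => IsDominant.of_isIso (CombConeSpace.Point.iso p).hom }
  have : G.Faithful := ⟨fun {p q f f'} h => Subtype.ext (by
    rw [← hm f, ← hm f']
    exact congrArg _ h)⟩
  have : G.Full := ⟨fun {p q} v => by
    let f : p ⟶ q := (⟨S.cone.map v, v, rfl⟩ : Z.mor p.idx q.idx)
    exact ⟨f, hom_ext_of_aut hS (hm f)⟩⟩
  have : G.EssSurj := ⟨fun a => by
    obtain ⟨i, e⟩ := h1 a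
    exact ⟨(⟨S.cone.obj (r i), i, Iso.refl _⟩ : Z.Point), e⟩⟩
  have : G.IsEquivalence := {}
  have : g.functor.IsEquivalence := inferInstanceAs G.IsEquivalence
  have : ∀ p, IsIso (g.map p) := fun p => (CombConeSpace.Point.iso p).isIso_hom
  obtain ⟨e⟩ := exists_equivalence g
  refine ⟨Z, ⟨equivSymm e⟩, fun h i j => ?_⟩
  rintro _ ⟨v, rfl⟩ _ ⟨v', rfl⟩
  have := h (r i) (r j)
  rw [Subsingleton.elim v v']

end Skeleton

end CombConeStack

section Equivalences

open Bicategory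

/-- Pseudofunctors preserve equivalences. -/
def mapEquivalence {B C : Type*} [Bicategory B] [Bicategory C] (F : Pseudofunctor B C) {a b : B}
    (e : Bicategory.Equivalence a b) : Bicategory.Equivalence (F.obj a) (F.obj b) :=
  .mkOfAdjointifyCounit (f := F.map e.hom) (g := F.map e.inv)
    ((F.mapId a).symm ≪≫ F.map₂Iso e.unit ≪≫ F.mapComp e.hom e.inv)
    ((F.mapComp e.inv e.hom).symm ≪≫ F.map₂Iso e.counit ≪≫ F.mapId b)

end Equivalences

section ElementsIso

variable {C : Type (u + 1)} [Category.{u} C] {X Y : Cᵒᵖ ⥤ Type u}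

lemma exists_elements_equivalence (i : X ≅ Y) :
    ∃ e : Bicategory.Equivalence (elements X) (elements Y), e.hom = elementsMap i.hom := by
  have key {X Y : Cᵒᵖ ⥤ Type u} (i : X ≅ Y) :
      Nonempty (elementsMap i.hom ≫ elementsMap i.inv ≅ 𝟙 (elements X)) := by
    refine exists_iso_of_sect_eq fun a => ?_
    rw [sect_comp_elementsMap, sect_elementsMap, sect_id]
    exact ConcreteCategory.congr_hom (i.hom_inv_id_app _) (elt a)
  obtain ⟨η⟩ := key i
  obtain ⟨ε⟩ := key i.symm
  exact ⟨.mkOfAdjointifyCounit (f := elementsMap i.hom) (g := elementsMap i.inv) η.symm ε, rfl⟩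

end ElementsIso

section Thin

variable {𝒳 𝒴 : Based.{u}}

variable (𝒳) in
/-- Charts have no non-trivial automorphisms over the identity of their cones. -/
def IsThin : Prop :=
  ∀ ⦃a b : Chart 𝒳⦄ (f g : a ⟶ b), (Chart.cone 𝒳).map f = (Chart.cone 𝒳).map g → f = g

variable (𝒳) in
/-- There is at most one morphism from any chart to any minimal chart. -/
def IsComplexlike : Prop := ∀ ⦃a b : Chart 𝒳⦄, b.IsMinimal → ∀ f g : a ⟶ b, f = g

lemma IsThin.of_equivalence (h : IsThin 𝒴) (e : Bicategory.Equivalence 𝒳 𝒴) : IsThin 𝒳 := by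
  intro a b f g hfg
  have := Chart.isEquivalence_map e
  refine (Chart.map e.hom).map_injective (h _ _ ?_)
  rw [Chart.cone_map, Chart.cone_map, hfg]

lemma IsComplexlike.of_equivalence (h : IsComplexlike 𝒴) (e : Bicategory.Equivalence 𝒳 𝒴)
    (h𝒳 : IsConelike 𝒳) : IsComplexlike 𝒳 := by
  intro a b hb f g
  have := Chart.isEquivalence_map e
  exact (Chart.map e.hom).map_injective (h (hb.of_equivalence h𝒳 e) _ _)

lemma IsComplexlike.isThin (h : IsComplexlike 𝒳) (h𝒳 : IsConelike 𝒳) : IsThin 𝒳 := by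
  intro a b f g hfg
  exact h𝒳.fibered.chart_cancel (h𝒳.toMinimal b) hfg (h (h𝒳.isMinimal_minimal b) _ _)

lemma elements_isThin (X : RPCC.{u}ᵒᵖ ⥤ Type u) : IsThin (elements X) := fun _ _ _ _ h =>
  elements_hom_ext (Chart.p_map_eq h)

lemma CombConeStack.aut_eq_id_of_isThin {S : CombConeStack.{u}} (h : IsThin S.geom)
    (a : S.based.obj) (k : a ≅ a) : k.hom = 𝟙 a := by
  obtain ⟨d, hd, hd'⟩ := RPC.exists_isDominant_comp_eq (S.cone.map k.hom)
  let x : S.Mark := ⟨S.cone.obj a, a, d, hd⟩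
  let f : Mark.Hom x x := ⟨𝟙 _, k.hom, (id_comp _).trans hd'.symm⟩
  let f' : x ⟶ x := f
  let e : (mark S).obj ((mark S).objPreimage x) ≅ x := (mark S).objObjPreimageIso x
  obtain ⟨g, hg⟩ := (mark S).map_surjective (e.hom ≫ f' ≫ e.inv)
  have h1 : (Chart.cone S.geom).map g = 𝟙 _ := by
    have h2 : Mark.Hom.cone (e.hom ≫ f' ≫ e.inv) = Mark.Hom.cone (e.hom ≫ 𝟙 x ≫ e.inv) := rfl
    rw [← mark_map_cone, hg, h2, id_comp, Iso.hom_inv_id]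
    rfl
  have h2 : g = 𝟙 _ := h _ _ (h1.trans (map_id _ _).symm)
  rw [h2, map_id] at hg
  have h3 : f' = 𝟙 x := by
    rw [← cancel_mono e.inv, ← cancel_epi e.hom, ← hg, id_comp, Iso.hom_inv_id]
  exact congrArg Mark.Hom.pt h3

lemma CombConeSpace.isComplexlike {Z : CombConeSpace.{u}} (hZ : IsConeComplex Z) :
    IsComplexlike (elements Z.presheaf) := by
  obtain ⟨e⟩ := CombConeSpace.exists_equivalence Z
  refine IsComplexlike.of_equivalence ?_ e (elements_presheaf_isConelike Z)
  intro a b hb f g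
  have := CombConeStack.isIso_markMap hb
  have h1 : CombConeStack.valMap f = CombConeStack.valMap g :=
    Subtype.ext (hZ _ _ (Subtype.property _) (Subtype.property _))
  have h2 : (Chart.cone _).map f = (Chart.cone _).map g := by
    rw [← cancel_mono (CombConeStack.markMap b), CombConeStack.markMap_naturality,
      CombConeStack.markMap_naturality, h1]
  exact (CombConeStack.mark _).map_injective (CombConeStack.Mark.hom_ext h2 h1)

/-- The sheaf of a cone complex is representable. -/
def CombConeSpace.presheafIso (W : RPCC.{u}) : W.obj.presheaf ≅ yoneda.obj W :=
  NatIso.ofComponents (fun T => Equiv.toIso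
    { toFun := fun f : T.unop.obj ⟶ W.obj => (ObjectProperty.homMk f : T.unop ⟶ W)
      invFun := fun f : T.unop ⟶ W => f.hom
      left_inv := fun _ => rfl
      right_inv := fun _ => rfl }) (fun _ => rfl)

lemma yoneda_isSheaf (W : RPCC.{u}) : Presheaf.IsSheaf faceTopology (yoneda.obj W) :=
  (Presheaf.isSheaf_of_iso_iff (CombConeSpace.presheafIso W)).mp W.obj.presheaf_isSheaf

lemma elements_yoneda_isConelike (W : RPCC.{u}) : IsConelike (elements (yoneda.obj W)) := by
  obtain ⟨e, -⟩ := exists_elements_equivalence (CombConeSpace.presheafIso W)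
  exact (elements_presheaf_isConelike W.obj).of_equivalence e (elements_fibered _)

lemma elements_yoneda_isComplexlike (W : RPCC.{u}) : IsComplexlike (elements (yoneda.obj W)) := by
  obtain ⟨e, -⟩ := exists_elements_equivalence (CombConeSpace.presheafIso W)
  exact (CombConeSpace.isComplexlike W.property).of_equivalence (equivSymm e)
    (elements_yoneda_isConelike W)

lemma IsConelike.exists_combConeSpace (h : IsConelike 𝒳) (hs : IsStack faceTopology 𝒳)
    (ht : IsThin 𝒳) : ∃ Z : CombConeSpace.{u},
      Nonempty (Bicategory.Equivalence 𝒳 (elements Z.presheaf)) ∧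
      (IsComplexlike 𝒳 → IsConeComplex Z) := by
  obtain ⟨e⟩ := h.exists_equivalence hs
  obtain ⟨Z, ⟨e'⟩, hZ⟩ := CombConeStack.exists_space
    (CombConeStack.aut_eq_id_of_isThin (ht.of_equivalence (equivSymm e)))
  obtain ⟨e''⟩ := CombConeSpace.exists_equivalence Z
  refine ⟨Z, ⟨equivTrans e (equivTrans (mapEquivalence CombConeStack.geomPseudofunctor e')
    (equivSymm e''))⟩, fun hc => hZ fun a b => ⟨fun f g => ?_⟩⟩
  exact hc (MinChart.minimal b) (MinChart.hom f) (MinChart.hom g)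

lemma IsConelike.exists_complex (h : IsConelike 𝒳) (hs : IsStack faceTopology 𝒳)
    (hc : IsComplexlike 𝒳) : ∃ W : RPCC.{u},
      Nonempty (Bicategory.Equivalence 𝒳 (elements (yoneda.obj W))) := by
  obtain ⟨Z, ⟨e⟩, hZ⟩ := h.exists_combConeSpace hs (hc.isThin h)
  obtain ⟨e', -⟩ := exists_elements_equivalence (CombConeSpace.presheafIso ⟨Z, hZ hc⟩)
  exact ⟨⟨Z, hZ hc⟩, ⟨equivTrans e e'⟩⟩

end Thin

section FiberProducts

variable {𝒳 𝒴 𝒵 : Based.{u}} {F : 𝒳 ⟶ 𝒵} {G : 𝒴 ⟶ 𝒵}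

lemma fiberProd_isComplexlike (h𝒳 : IsConelike 𝒳) (h𝒴 : IsConelike 𝒴) (h𝒵 : IsConelike 𝒵)
    (c𝒳 : IsComplexlike 𝒳) (c𝒴 : IsComplexlike 𝒴) : IsComplexlike (fiberProd F G) := by
  intro a b hb f g
  obtain ⟨x, y, z, s, t, p, q, H⟩ := hb.exists_isPull h𝒳 h𝒴 h𝒵
  exact H.hom_ext h𝒳.fibered h𝒴.fibered (c𝒳 H.x_min _ _) (c𝒴 H.y_min _ _)

variable (F) in
/-- A morphism sending minimal charts to minimal charts. -/
def PreservesMinimal : Prop := ∀ ⦃a : Chart 𝒳⦄, a.IsMinimal → ((Chart.map F).obj a).IsMinimal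

lemma PreservesMinimal.of_iso {F' : 𝒳 ⟶ 𝒵} (h : PreservesMinimal F) (e : F ≅ F') :
    PreservesMinimal F' := fun a ha => (h ha).of_iso ((Chart.mapIso e).app a)

lemma PreservesMinimal.comp {H : 𝒵 ⟶ 𝒴} (hF : PreservesMinimal F) (hH : PreservesMinimal H) :
    PreservesMinimal (F ≫ H) := fun a ha => (hH (hF ha)).of_iso ((Chart.mapComp F H).symm.app a)

lemma PreservesMinimal.of_equivalence (h𝒳 : IsConelike 𝒳) (e : Bicategory.Equivalence 𝒳 𝒴) :
    PreservesMinimal e.hom := fun _ ha => ha.of_equivalence h𝒳 e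

lemma PreservesMinimal.fiberProdSnd (h : PreservesMinimal F) (h𝒳 : IsConelike 𝒳)
    (h𝒴 : IsConelike 𝒴) (h𝒵 : IsConelike 𝒵) : PreservesMinimal (fiberProdSnd F G) := by
  intro a ha
  obtain ⟨x, y, z, s, t, p, q, H⟩ := ha.exists_isPull h𝒳 h𝒴 h𝒵
  have := (h H.x_min).isIso H.z_min s H.s_dom
  have hs : IsIso (Chart.con F s) := inferInstanceAs (IsIso ((Chart.cone 𝒵).map s))
  obtain ⟨l, h1, h2⟩ := H.isPB.lift (Chart.con G t ≫ inv (Chart.con F s)) (𝟙 _) (by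
    rw [assoc, IsIso.inv_hom_id, comp_id, id_comp])
  have h3 : Chart.con (ConeStacks.fiberProdSnd F G) q ≫ l = 𝟙 _ := by
    refine H.isPB.ext ?_ ?_
    · rw [assoc, h1, ← assoc, ← H.isPB.w, assoc, IsIso.hom_inv_id,
        comp_id, id_comp]
    · rw [assoc, h2, comp_id, id_comp]
  have : IsIso ((Chart.cone 𝒴).map q) := ⟨l, h3, h2⟩
  have := h𝒴.fibered.chart_isIso q
  exact H.y_min.of_iso (asIso q).symm

end FiberProducts

section Complexes

variable {V W : RPCC.{u}}

lemma Topped.idx_top {c c' : Topped.{u}} (k : c ⟶ c') (hk : IsDominant (Topped.ev.map k)) :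
    (Topped.hom k).hom.idx c.top = c'.top := by
  obtain ⟨χ, hχ⟩ := c'.isTop ((Topped.hom k).hom.idx c.top)
  rw [Topped.ev_map k hχ] at hk
  exact congrArg Sigma.fst (CombConeSpace.factorization_unique (i := c'.top)
    ((Topped.hom k).hom.dominant c.top) hk hχ (c'.cx.obj.id_mem _) (comp_id _).symm)

/-- The morphism to `V` underlying a chart. -/
def Chart.toComplex (a : Chart (elements (yoneda.obj V))) : a.dom.cx ⟶ V := a.iso.hom ≫ elt a.pt

lemma Chart.toComplex_comp {a b : Chart (elements (yoneda.obj V))} (n : a ⟶ b) :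
    Topped.hom ((Chart.domain _).map n) ≫ b.toComplex = a.toComplex := by
  have h : (elements (yoneda.obj V)).p.map (Chart.hom n) ≫ elt b.pt = elt a.pt :=
    elt_map (Chart.hom n)
  have h' : (a.iso.hom ≫ (elements (yoneda.obj V)).p.map (Chart.hom n) ≫ b.iso.inv) ≫
      b.iso.hom ≫ elt b.pt = a.iso.hom ≫ elt a.pt := by
    rw [assoc, assoc, Iso.inv_hom_id_assoc]
    exact congrArg (a.iso.hom ≫ ·) h
  exact h'

lemma Chart.exists_hom_of_toComplex {a b : Chart (elements (yoneda.obj V))} (k : a.dom ⟶ b.dom)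
    (h : Topped.hom k ≫ b.toComplex = a.toComplex) : ∃ n : a ⟶ b, (Chart.domain _).map n = k := by
  refine ⟨Chart.mkHom (eltHom (a.iso.inv ≫ Topped.hom k ≫ b.iso.hom) ?_), ?_⟩
  · change (a.iso.inv ≫ Topped.hom k ≫ b.iso.hom) ≫ elt b.pt = elt a.pt
    rw [assoc, assoc]
    exact (congrArg (a.iso.inv ≫ ·) h).trans (Iso.inv_hom_id_assoc _ _)
  · change a.iso.hom ≫ (a.iso.inv ≫ Topped.hom k ≫ b.iso.hom) ≫ b.iso.inv = Topped.hom k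
    rw [assoc, assoc, Iso.hom_inv_id_assoc, Iso.hom_inv_id, comp_id]

/-- The chart given by a morphism to `V`. -/
def Chart.ofComplex (c : Topped.{u}) (r : c.cx ⟶ V) : Chart (elements (yoneda.obj V)) where
  pt := eltMk (X := yoneda.obj V) r
  dom := c
  iso := Iso.refl _

lemma Chart.toComplex_ofComplex (c : Topped.{u}) (r : c.cx ⟶ V) :
    (Chart.ofComplex c r).toComplex = r :=
  (id_comp _).trans (elt_eltMk (X := yoneda.obj V) r)

lemma Chart.toComplex_map (q : W ⟶ V) (a : Chart (elements (yoneda.obj W))) :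
    ((Chart.map (elementsMap (yoneda.map q))).obj a).toComplex = a.toComplex ≫ q := by
  have h : elt ((elementsMap (yoneda.map q) : BasedFunctor _ _).obj a.pt) = elt a.pt ≫ q :=
    sect_elementsMap (yoneda.map q) a.pt
  exact (congrArg (a.iso.hom ≫ ·) h).trans (assoc _ _ _).symm

lemma Chart.idx_toComplex {a b : Chart (elements (yoneda.obj V))} {n : a ⟶ b}
    (hn : Chart.IsDom n) : a.toComplex.hom.idx a.dom.top = b.toComplex.hom.idx b.dom.top := by
  rw [← Chart.toComplex_comp n]
  exact congrArg b.toComplex.hom.idx (Topped.idx_top _ hn)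

lemma Chart.isMinimal_of_isIso (a : Chart (elements (yoneda.obj V)))
    [IsIso (a.dom.atTop a.toComplex)] : a.IsMinimal where
  existsUnique {y z} f g hf hg := by
    have hi := (Chart.idx_toComplex hg).symm.trans (Chart.idx_toComplex hf)
    obtain ⟨k, hk⟩ := Topped.exists_hom_over z.toComplex a.toComplex (hi ▸ ⟨𝟙 _, V.obj.id_mem _⟩)
    obtain ⟨n, hn⟩ := Chart.exists_hom_of_toComplex k hk
    have key {b : Chart (elements (yoneda.obj V))} (n n' : b ⟶ a) : n = n' :=
      elements_isThin _ _ _ (congrArg Topped.ev.map (Topped.hom_over_ext a.toComplex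
        ((Chart.toComplex_comp n).trans (Chart.toComplex_comp n').symm)))
    exact ⟨n, key _ _, fun _ _ => key _ _⟩

/-- The chart given by a cone of a complex. -/
def Chart.ofCone (α : V.obj.ι) : Chart (elements (yoneda.obj V)) :=
  Chart.ofComplex (V.faceTop α) (V.faceIncl α : V.face α ⟶ V)

/-- The inclusion of a cone. -/
def RPCC.topIncl (V : RPCC.{u}) (α : V.obj.ι) : (V.faceTop α).cx ⟶ V := V.faceIncl α

lemma Chart.toComplex_ofCone (α : V.obj.ι) : (Chart.ofCone α).toComplex = V.topIncl α :=
  Chart.toComplex_ofComplex (V.faceTop α) (V.topIncl α)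

lemma Chart.isMinimal_ofCone (α : V.obj.ι) : (Chart.ofCone α).IsMinimal := by
  have : IsIso ((Chart.ofCone α).dom.atTop (Chart.ofCone α).toComplex) := by
    rw [Chart.toComplex_ofCone]
    exact inferInstanceAs (IsIso (𝟙 (V.obj.cone α)))
  exact Chart.isMinimal_of_isIso _

lemma Topped.ev_eq_atTop {c c' : Topped.{u}} (k : c ⟶ c') (r : c'.cx ⟶ V) (r' : c.cx ⟶ V)
    (h : Topped.hom k ≫ r = r') {ψ : V.obj.cone (r'.hom.idx c.top) ⟶ V.obj.cone (r.hom.idx c'.top)}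
    (hψ : ψ ∈ V.obj.mor _ _) : Topped.ev.map k ≫ c'.atTop r = c.atTop r' ≫ ψ := by
  subst h
  exact (congrArg _ (comp_id _).symm).trans (Topped.ev_comp_atTop k r (V.obj.id_mem _) hψ)

lemma Chart.IsMinimal.isIso_atTop {a : Chart (elements (yoneda.obj V))} (ha : a.IsMinimal) :
    IsIso (a.dom.atTop a.toComplex) := by
  let α := a.toComplex.hom.idx a.dom.top
  obtain ⟨k, hk⟩ := a.dom.exists_face_factorization a.toComplex
  let k' : a.dom ⟶ V.faceTop α := k
  have hk' : Topped.hom k' ≫ V.topIncl α = a.toComplex := hk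
  obtain ⟨n, hn⟩ := Chart.exists_hom_of_toComplex (b := Chart.ofCone α) k'
    ((congrArg (Topped.hom k' ≫ ·) (Chart.toComplex_ofCone α)).trans hk')
  have h1 : (Chart.cone _).map n = a.dom.atTop a.toComplex := (congrArg Topped.ev.map hn).trans
    ((comp_id _).symm.trans ((Topped.ev_eq_atTop k' (V.topIncl α) a.toComplex hk'
      (V.obj.id_mem α)).trans (comp_id _)))
  have hd : Chart.IsDom n := by
    rw [Chart.IsDom, h1]
    exact a.toComplex.hom.dominant _
  have := ha.isIso (Chart.isMinimal_ofCone _) n hd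
  exact h1 ▸ inferInstanceAs (IsIso ((Chart.cone _).map n))

lemma strict_of_preservesMinimal (q : W ⟶ V)
    (h : PreservesMinimal (elementsMap (yoneda.map q))) : strict q := by
  intro α
  have key (r : (W.faceTop α).cx ⟶ V) (hr : r = W.topIncl α ≫ q)
      (hi : IsIso ((W.faceTop α).atTop r)) : IsIso (q.hom.map α) := by
    subst hr
    have h1 : 𝟙 _ ≫ q.hom.map α = q.hom.map α := id_comp _
    exact h1 ▸ hi
  exact key _ ((Chart.toComplex_map q _).trans (congrArg (· ≫ q) (Chart.toComplex_ofCone α)))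
    (h (Chart.isMinimal_ofCone α)).isIso_atTop

end Complexes

section Pullbacks

open Opposite Limits

variable {C : Type (u + 1)} [Category.{u} C] {X A B : Cᵒᵖ ⥤ Type u}

lemma pullback_section_ext {a : A ⟶ X} {b : B ⟶ X} {T : C} {s t : (pullback a b).obj (op T)}
    (h1 : (pullback.fst a b).app _ s = (pullback.fst a b).app _ t)
    (h2 : (pullback.snd a b).app _ s = (pullback.snd a b).app _ t) : s = t := by
  apply yonedaEquiv.symm.injective
  apply pullback.hom_ext <;> apply yonedaEquiv.injective <;>
    rw [yonedaEquiv_comp, yonedaEquiv_comp, Equiv.apply_symm_apply, Equiv.apply_symm_apply] <;>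
    assumption

lemma exists_pullback_section {a : A ⟶ X} {b : B ⟶ X} {T : C} (s : A.obj (op T)) (t : B.obj (op T))
    (h : a.app _ s = b.app _ t) : ∃ r : (pullback a b).obj (op T),
      (pullback.fst a b).app _ r = s ∧ (pullback.snd a b).app _ r = t := by
  let l := pullback.lift (f := a) (g := b) (yonedaEquiv.symm s) (yonedaEquiv.symm t)
    (yonedaEquiv.injective (by
      rw [yonedaEquiv_comp, yonedaEquiv_comp, Equiv.apply_symm_apply, Equiv.apply_symm_apply, h]))
  refine ⟨yonedaEquiv l, ?_, ?_⟩
  · rw [← yonedaEquiv_comp, pullback.lift_fst, Equiv.apply_symm_apply]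
  · rw [← yonedaEquiv_comp, pullback.lift_snd, Equiv.apply_symm_apply]

lemma exists_pullback_equivalence (a : A ⟶ X) (b : B ⟶ X) :
    ∃ e : Bicategory.Equivalence (elements (pullback a b))
        (fiberProd (elementsMap a) (elementsMap b)),
      e.hom ≫ fiberProdSnd _ _ = elementsMap (pullback.snd a b) := by
  obtain ⟨α⟩ := exists_iso_of_sect_eq (K := elementsMap (pullback.fst a b) ≫ elementsMap a)
    (K' := elementsMap (pullback.snd a b) ≫ elementsMap b) (fun x => by
      rw [sect_comp_elementsMap, sect_comp_elementsMap, sect_elementsMap, sect_elementsMap]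
      exact ConcreteCategory.congr_hom (NatTrans.congr_app (pullback.condition (f := a) (g := b)) _)
        (elt x))
  let Φ := fiberProdLift _ _ α.hom
  have : ⟪Φ⟫.Faithful := ⟨fun {x y f g} h =>
    elements_hom_ext (congrArg (fun k => (elements A).p.map (FiberProdHom.fst k)) h)⟩
  have : ⟪Φ⟫.Full := ⟨fun {x y} f => by
    let k : (elements (pullback a b)).p.obj x ⟶ (elements (pullback a b)).p.obj y :=
      (elements A).p.map (FiberProdHom.fst f)
    have hk : (elements B).p.map (FiberProdHom.snd f) = k := by
      refine (FiberProdHom.p_snd f).trans ?_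
      exact (id_comp _).trans (comp_id _)
    have h1 : res A k ((pullback.fst a b).app _ (elt y)) = (pullback.fst a b).app _ (elt x) :=
      elt_map (FiberProdHom.fst f)
    have h2 : res B k ((pullback.snd a b).app _ (elt y)) = (pullback.snd a b).app _ (elt x) :=
      (congrArg (res B · _) hk).symm.trans (elt_map (FiberProdHom.snd f))
    refine ⟨eltHom k (pullback_section_ext ?_ ?_), FiberProdHom.ext (elements_hom_ext rfl)
      (elements_hom_ext hk.symm)⟩
    · rw [app_res, h1]
    · rw [app_res, h2]⟩
  obtain ⟨e, he⟩ := (elements_fibered (pullback a b)).exists_equivalence Φ (fun c => by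
    let c' : FiberProdObj (elementsMap a) (elementsMap b) := c
    have h0 := elt_map c'.iso.hom
    have h1 : (elements X).p.map c'.iso.hom = c'.bi.inv :=
      c'.p_iso.trans ((id_comp _).trans (comp_id _))
    have h2 : b.app _ (res B c'.bi.inv (elt c'.snd)) = a.app _ (elt c'.fst) := by
      rw [app_res]
      exact (congrArg (res X · _) h1).symm.trans h0
    obtain ⟨r, hr1, hr2⟩ := exists_pullback_section (a := a) (b := b) _ _ h2.symm
    let f : (elementsMap (pullback.fst a b) : BasedFunctor _ _).obj (eltMk r) ⟶ c'.fst :=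
      eltHom (𝟙 _) ((res_id _ _).trans (hr1.symm.trans
        (congrArg ((pullback.fst a b).app _) (elt_eltMk r).symm)))
    let g : (elementsMap (pullback.snd a b) : BasedFunctor _ _).obj (eltMk r) ⟶ c'.snd :=
      eltHom c'.bi.inv (hr2.symm.trans (congrArg ((pullback.snd a b).app _) (elt_eltMk r).symm))
    have hg : (elements B).p.map g = 𝟙 _ ≫ (elements A).p.map f ≫ c'.bi.inv :=
      ((id_comp _).trans (id_comp _)).symm
    have hΦ : (elements X).p.map (FiberProdObj.iso (⟪Φ⟫.obj (eltMk r))).hom =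
        𝟙 _ := (FiberProdObj.p_iso (⟪Φ⟫.obj (eltMk r))).trans
      ((id_comp _).trans (comp_id _))
    let m := FiberProdHom.mk' (a := ⟪Φ⟫.obj (eltMk r)) (b := c') f g hg
      (elements_hom_ext (((elements X).p.map_comp _ _).trans (((congrArg (𝟙 _ ≫ ·) h1).trans
        (congrArg (· ≫ c'.bi.inv) hΦ.symm)).trans ((elements X).p.map_comp
          (FiberProdObj.iso (⟪Φ⟫.obj (eltMk r))).hom
          ((elementsMap b : BasedFunctor _ _).map g)).symm)))
    have hm : IsIso ((fiberProd (elementsMap a) (elementsMap b)).p.map m) :=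
      inferInstanceAs (IsIso (𝟙 _))
    have := (fiberProd_fibered (F := elementsMap a) (G := elementsMap b) (elements_fibered A)
      (elements_fibered B) (elements_fibered X)).isIso m
    exact ⟨_, ⟨asIso m⟩⟩)
  exact ⟨e, by rw [he]; rfl⟩

end Pullbacks

section Representability

lemma exists_iso_of_equivalence {C : Type (u + 1)} [Category.{u} C] {X Y : Cᵒᵖ ⥤ Type u}
    (e : Bicategory.Equivalence (elements X) (elements Y)) :
    ∃ i : X ≅ Y, Nonempty (e.hom ≅ elementsMap i.hom) := by
  obtain ⟨q, ⟨i⟩⟩ := exists_elementsMap_iso e.hom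
  obtain ⟨r, ⟨j⟩⟩ := exists_elementsMap_iso e.inv
  exact ⟨⟨q, r, comp_eq_id_of_iso i j e.unit.symm, comp_eq_id_of_iso j i e.counit⟩, ⟨i⟩⟩

open Limits Bicategory

variable {𝒵 : Based.{u}} {U V : RPCC.{u}}

lemma exists_fiberProd_complex (h : IsConelike 𝒵) (hs : IsStack faceTopology 𝒵)
    (F : elements (yoneda.obj U) ⟶ 𝒵) (G : elements (yoneda.obj V) ⟶ 𝒵) :
    ∃ (W : RPCC.{u}) (e : Bicategory.Equivalence (elements (yoneda.obj W)) (fiberProd F G))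
      (q : W ⟶ V), Nonempty (e.hom ≫ fiberProdSnd F G ≅ elementsMap (yoneda.map q)) ∧
        (PreservesMinimal F → strict q) := by
  have hU := elements_yoneda_isConelike U
  have hV := elements_yoneda_isConelike V
  obtain ⟨W, ⟨e⟩⟩ := (fiberProd_isConelike (F := F) (G := G) hU hV h).exists_complex
    (fiberProd_isStack (elements_isStack (yoneda_isSheaf U)) (elements_isStack (yoneda_isSheaf V)) hs)
    (fiberProd_isComplexlike hU hV h (elements_yoneda_isComplexlike U)
      (elements_yoneda_isComplexlike V))
  let e' := equivSymm e
  obtain ⟨q, ⟨i⟩⟩ := exists_elementsMap_iso (e'.hom ≫ fiberProdSnd F G)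
  obtain ⟨q, rfl⟩ := yoneda.map_surjective q
  refine ⟨W, e', q, ⟨i⟩, fun hF => strict_of_preservesMinimal q ?_⟩
  exact ((PreservesMinimal.of_equivalence (elements_yoneda_isConelike W) e').comp
    (hF.fiberProdSnd hU hV h)).of_iso i

lemma exists_isPullback_complex {X : RPCC.{u}ᵒᵖ ⥤ Type u} (h : IsConelike (elements X))
    (hX : Presheaf.IsSheaf faceTopology X) (a : yoneda.obj U ⟶ X) (b : yoneda.obj V ⟶ X) :
    ∃ (W : RPCC.{u}) (p : yoneda.obj W ⟶ yoneda.obj U) (q : W ⟶ V),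
      IsPullback p (yoneda.map q) a b ∧ (PreservesMinimal (elementsMap a) → strict q) := by
  obtain ⟨W, e, q, ⟨i⟩, hq⟩ := exists_fiberProd_complex h (elements_isStack hX)
    (elementsMap a) (elementsMap b)
  obtain ⟨e', he'⟩ := exists_pullback_equivalence a b
  obtain ⟨k, ⟨j⟩⟩ := exists_iso_of_equivalence (equivTrans e (equivSymm e'))
  let j' : e.hom ≫ e'.inv ≅ elementsMap k.hom := j
  let i' : elementsMap k.hom ≫ elementsMap (pullback.snd a b) ≅ elementsMap (yoneda.map q) :=
    whiskerRightIso j'.symm (elementsMap (pullback.snd a b)) ≪≫ eqToIso (by rw [← he']) ≪≫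
      (Iso.refl _ ≪⊗≫ whiskerLeftIso e.hom (whiskerRightIso e'.counit (fiberProdSnd _ _)) ≪⊗≫
        Iso.refl _ : (e.hom ≫ e'.inv) ≫ e'.hom ≫ fiberProdSnd _ _ ≅ e.hom ≫ fiberProdSnd _ _) ≪≫ i
  have hk : k.hom ≫ pullback.snd a b = yoneda.map q := eq_of_sect_eq fun x =>
    congrFun (sect_eq_of_trans (show elementsMap (k.hom ≫ pullback.snd a b) ⟶ _ from i'.hom)) x
  refine ⟨W, k.hom ≫ pullback.fst a b, q, ?_, hq⟩
  exact IsPullback.of_iso_pullback ⟨by rw [← hk, assoc, assoc, pullback.condition]⟩ k rfl hk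

end Representability

namespace CombConeStack

variable {S : CombConeStack.{u}}

/-- A chosen face of every face of a family of objects. -/
structure FaceSystem {ι : Type u} (r : ι → S.based.obj) where
  obj (p : Σ i, {F // PointedCone.IsFaceOf F (S.cone.obj (r i)).cone}) : S.based.obj
  hom (p) : obj p ⟶ r p.1
  image_hom (p) : RPC.image (S.cone.map (hom p)) = p.2.1

lemma nonempty_faceSystem {ι : Type u} (r : ι → S.based.obj) : Nonempty (FaceSystem r) := by
  have h (p : Σ i, {F // PointedCone.IsFaceOf F (S.cone.obj (r i)).cone}) :
      ∃ (b : S.based.obj) (φ : b ⟶ r p.1), RPC.image (S.cone.map φ) = p.2.1 := by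
    obtain ⟨b, φ, e, hφ⟩ := S.exists_pullback (r p.1) _
      (RPC.isFaceMorphism_faceHom (S.cone.obj (r p.1)) p.2.1 p.2.2)
    exact ⟨b, φ, by rw [hφ, RPC.image_iso_comp, RPC.image_faceHom]⟩
  choose b φ hφ using h
  exact ⟨⟨b, φ, hφ⟩⟩

variable {ι : Type u} {r : ι → S.based.obj} (B : FaceSystem r)

namespace FaceSystem

/-- The face, with its morphism to the family. -/
def pair (p) : Σ i, B.obj p ⟶ r i := ⟨p.1, B.hom p⟩

/-- Morphisms of faces. -/
def Over {p q} (v : B.obj p ⟶ B.obj q) : Prop := B.pair p = ⟨q.1, v ≫ B.hom q⟩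

variable {B}

lemma Over.id (p) : B.Over (𝟙 (B.obj p)) := by
  rw [Over, id_comp]
  rfl

lemma Over.comp {p q t} {v : B.obj p ⟶ B.obj q} {w : B.obj q ⟶ B.obj t} (hv : B.Over v)
    (hw : B.Over w) : B.Over (v ≫ w) := by
  have h : (⟨q.1, v ≫ B.hom q⟩ : Σ i, B.obj p ⟶ r i) = ⟨t.1, v ≫ w ≫ B.hom t⟩ :=
    congrArg (fun x : Σ i, B.obj q ⟶ r i => (⟨x.1, v ≫ x.2⟩ : Σ i, B.obj p ⟶ r i)) hw
  rw [Over, hv, h, assoc]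

lemma Over.eq {p q} {v v' : B.obj p ⟶ B.obj q} (h : B.Over v) (h' : B.Over v') : v = v' :=
  S.cancel (B.hom q) (by simpa using h.symm.trans h')

lemma Over.index_eq {p q} {v : B.obj p ⟶ B.obj q} (h : B.Over v) {F}
    (hF : RPC.image (S.cone.map (v ≫ B.hom q)) = F.1) : p = ⟨q.1, F⟩ := by
  obtain ⟨i, G⟩ := p
  obtain rfl : i = q.1 := congrArg Sigma.fst h
  have h1 : B.hom ⟨q.1, G⟩ = v ≫ B.hom q := by simpa [Over, pair] using h
  have h2 := B.image_hom ⟨q.1, G⟩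
  rw [h1, hF] at h2
  exact congrArg _ (Subtype.ext h2.symm)

end FaceSystem

/-- The disjoint union of the complexes of faces of a family of objects. -/
def FaceSystem.complex : RPCC.{u} where
  obj :=
    { ι := Σ i, {F // PointedCone.IsFaceOf F (S.cone.obj (r i)).cone}
      cone p := S.cone.obj (B.obj p)
      mor p q := {k | ∃ v : B.obj p ⟶ B.obj q, B.Over v ∧ S.cone.map v = k}
      isFace := by
        rintro p q _ ⟨v, -, rfl⟩
        exact S.isFace v
      comp_mem := by
        rintro p q t _ _ ⟨v, hv, rfl⟩ ⟨w, hw, rfl⟩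
        exact ⟨v ≫ w, hv.comp hw, S.cone.map_comp v w⟩
      id_mem p := ⟨𝟙 _, .id p, S.cone.map_id _⟩
      existsUnique_face q F hF := by
        have hF' : (F.map (RPC.real (S.cone.map (B.hom q)))).IsFaceOf (S.cone.obj (r q.1)).cone :=
          (hF.map _ (S.isFace _).real_injective).trans (S.isFace (B.hom q)).face
        let p : Σ i, {F // PointedCone.IsFaceOf F (S.cone.obj (r i)).cone} := ⟨q.1, _, hF'⟩
        obtain ⟨b, ψ, e, hψ⟩ := S.exists_pullback (B.obj q) _ (RPC.isFaceMorphism_faceHom _ F hF)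
        have h1 : RPC.image (S.cone.map ψ) = F := by
          rw [hψ, RPC.image_iso_comp, RPC.image_faceHom]
        have key {c : S.based.obj} (v : c ⟶ B.obj q) (hv : RPC.image (S.cone.map v) = F) :
            RPC.image (S.cone.map (v ≫ B.hom q)) = p.2.1 := by
          rw [map_comp, RPC.image_comp, hv]
        obtain ⟨l, hl⟩ := (S.isFace (B.hom p)).exists_iso (S.isFace (ψ ≫ B.hom q))
          ((B.image_hom p).trans (key ψ h1).symm)
        obtain ⟨χ, hχ, hχ'⟩ := S.exists_hom _ _ _ hl
        have hv : B.Over (χ ≫ ψ : B.obj p ⟶ B.obj q) := by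
          rw [FaceSystem.Over, assoc, hχ']
          rfl
        refine ⟨⟨p, S.cone.map (χ ≫ ψ)⟩, ⟨⟨_, hv, rfl⟩, ?_⟩, ?_⟩
        · rw [map_comp, hχ, RPC.image_iso_comp, h1]
        · suffices H : ∀ p' (v' : B.obj p' ⟶ B.obj q), B.Over v' →
              RPC.image (S.cone.map v') = F → (⟨p', S.cone.map v'⟩ :
                Σ p, S.cone.obj (B.obj p) ⟶ S.cone.obj (B.obj q)) = ⟨p, S.cone.map (χ ≫ ψ)⟩ by
            rintro ⟨p', k⟩ ⟨hk, hk'⟩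
            change ∃ v : B.obj p' ⟶ B.obj q, B.Over v ∧ S.cone.map v = k at hk
            obtain ⟨v', hv', rfl⟩ := hk
            exact H p' v' hv' hk'
          intro p' v' hv' hF''
          obtain rfl : p' = p := hv'.index_eq (key v' hF'')
          rw [hv'.eq hv] }
  property := by
    rintro p q _ ⟨v, hv, rfl⟩ _ ⟨v', hv', rfl⟩
    rw [hv.eq hv']

lemma exists_cover (S : CombConeStack.{u}) :
    ∃ (U : RPCC.{u}) (g : CombConeStack.Hom U.obj.toCombConeStack S),
      (∀ p, IsIso (g.map p)) ∧ ∀ s, ∃ p, Nonempty (g.functor.obj p ≅ s) := by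
  obtain ⟨ι, r, h1, -⟩ := S.exists_skeleton
  obtain ⟨B⟩ := nonempty_faceSystem r
  let U := B.complex
  have hm {p q : U.obj.Point} (f : p ⟶ q) :
    ∃ v : B.obj p.idx ⟶ B.obj q.idx, B.Over v ∧ S.cone.map v = f.1 := f.2
  choose m hm hm' using @hm
  let G : U.obj.Point ⥤ S.based.obj :=
    { obj := fun p => B.obj p.idx
      map := fun f => m f
      map_id := fun p => (hm (𝟙 p)).eq (.id p.idx)
      map_comp := fun f g => (hm (f ≫ g)).eq ((hm f).comp (hm g)) }
  let g : CombConeStack.Hom U.obj.toCombConeStack S :=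
    { functor := G
      map := fun p => (CombConeSpace.Point.iso p).hom
      naturality := fun {p q} f => by
        let p' : U.obj.Point := p
        let q' : U.obj.Point := q
        have h3 : (p'.iso.hom ≫ f.1 ≫ q'.iso.inv) ≫ q'.iso.hom = p'.iso.hom ≫ S.cone.map (m f) := by
          rw [assoc, assoc, Iso.inv_hom_id, comp_id]
          exact congrArg (p'.iso.hom ≫ ·) (hm' f).symm
        exact h3
      dominant := fun p => IsDominant.of_isIso (CombConeSpace.Point.iso p).hom }
  refine ⟨U, g, fun p => (CombConeSpace.Point.iso p).isIso_hom, fun s => ?_⟩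
  obtain ⟨i, ⟨e⟩⟩ := h1 s
  let p : Σ i, {F // PointedCone.IsFaceOf F (S.cone.obj (r i)).cone} :=
    ⟨i, _, PointedCone.IsFaceOf.refl _⟩
  have : IsIso (B.hom p) := S.isIso_of_isDominant _ fun F _ hF' =>
    le_antisymm ‹F.IsFaceOf _›.le ((B.image_hom p).symm.le.trans hF')
  exact ⟨(⟨S.cone.obj (B.obj p), p, Iso.refl _⟩ : U.obj.Point), ⟨asIso (B.hom p) ≪≫ e⟩⟩

section Geom

variable {T : CombConeStack.{u}} (g : CombConeStack.Hom T S) [∀ p, IsIso (g.map p)]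

lemma preservesMinimal_geomMap : PreservesMinimal (geomMap (S := T) (T := S) g) := by
  intro a ha
  have h1 := isIso_markMap ha
  have h2 : IsIso (markMap a ≫ g.map (val a)) := inferInstance
  have : IsIso (markMap ((Chart.map (geomMap (S := T) (T := S) g)).obj a)) :=
    markMap_geomMap (S := T) (T := S) g a ▸ h2
  exact isMinimal_of_isIso_markMap

lemma essSurj_geomMap (hg : ∀ s, ∃ p, Nonempty (g.functor.obj p ≅ s)) :
    (Chart.map (geomMap (S := T) (T := S) g)).EssSurj where
  mem_essImage a := by
    obtain ⟨p, ⟨t⟩⟩ := hg (val a)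
    let x : T.Mark := ⟨(Chart.cone S.geom).obj a, p, markMap a ≫ S.cone.map t.inv ≫ inv (g.map p),
      (isDominant_markMap a).comp ((IsDominant.of_isIso _).comp (.of_isIso _))⟩
    let b := (mark T).objPreimage x
    let E : (mark T).obj b ≅ x := (mark T).objObjPreimageIso x
    let E1 := (Mark.coneFunctor T).mapIso E
    let E2 : val b ≅ p := (Mark.ptFunctor T).mapIso E
    have h1 : E1.hom ≫ x.map = markMap b ≫ T.cone.map E2.hom := Mark.Hom.comm E.hom
    have h2 := g.naturality E2.hom
    let c := (Chart.map (geomMap (S := T) (T := S) g)).obj b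
    let E3 : g.functor.obj (val b) ≅ val a := g.functor.mapIso E2 ≪≫ t
    have h3 : E1.hom ≫ markMap a = (markMap b ≫ g.map (val b)) ≫ S.cone.map E3.hom := by
      have h4 : (E1.hom ≫ x.map) ≫ g.map p ≫ S.cone.map t.hom = E1.hom ≫ markMap a := by
        have : (markMap a ≫ S.cone.map t.inv ≫ inv (g.map p)) ≫ g.map p ≫ S.cone.map t.hom =
            markMap a := by
          rw [assoc, assoc, IsIso.inv_hom_id_assoc, ← map_comp, Iso.inv_hom_id, map_id, comp_id]
        exact (assoc _ _ _).trans (congrArg (E1.hom ≫ ·) this)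
      have h5 : S.cone.map E3.hom = S.cone.map (g.functor.map E2.hom) ≫ S.cone.map t.hom :=
        S.cone.map_comp _ _
      have h6 : (markMap b ≫ T.cone.map E2.hom) ≫ g.map p ≫ S.cone.map t.hom =
          (markMap b ≫ g.map (val b)) ≫ S.cone.map E3.hom := by
        rw [h5, assoc, assoc, ← assoc (T.cone.map E2.hom), h2, assoc]
      exact h4.symm.trans ((congrArg (· ≫ g.map p ≫ S.cone.map t.hom) h1).trans h6)
    let f : (mark S).obj c ⟶ (mark S).obj a :=
      (⟨E1.hom, E3.hom, h3.trans (congrArg (· ≫ S.cone.map E3.hom)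
        (markMap_geomMap (S := T) (T := S) g b).symm)⟩ : Mark.Hom _ _)
    have i1 : IsIso (Mark.Hom.cone f) := E1.isIso_hom
    have i2 : IsIso (Mark.Hom.pt f) := E3.isIso_hom
    have := Mark.isIso f
    exact ⟨b, ⟨(mark S).preimageIso (asIso f)⟩⟩

end Geom

end CombConeStack

section Covers

open Opposite

variable {𝒳 𝒴 𝒵 : Based.{u}}

lemma Chart.essSurj_comp (K : 𝒳 ⟶ 𝒴) (L : 𝒴 ⟶ 𝒵) [(Chart.map K).EssSurj]
    [(Chart.map L).EssSurj] : (Chart.map (K ≫ L)).EssSurj :=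
  Functor.essSurj_of_iso (Chart.mapComp K L).symm

lemma IsConelike.exists_cover (h : IsConelike 𝒳) (hs : IsStack faceTopology 𝒳) :
    ∃ (U : RPCC.{u}) (K : elements (yoneda.obj U) ⟶ 𝒳), PreservesMinimal K ∧
      (Chart.map K).EssSurj := by
  obtain ⟨e⟩ := h.exists_equivalence hs
  obtain ⟨U, g, hg, hg'⟩ := h.stack.exists_cover
  obtain ⟨e', -⟩ := exists_elements_equivalence (CombConeSpace.presheafIso U)
  obtain ⟨e''⟩ := CombConeSpace.exists_equivalence U.obj
  let E := equivTrans (equivSymm e') e''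
  let E' := equivSymm e
  have := Chart.isEquivalence_map E
  have := Chart.isEquivalence_map E'
  have := CombConeStack.essSurj_geomMap g hg'
  refine ⟨U, E.hom ≫ CombConeStack.geomMap (S := U.obj.toCombConeStack) (T := h.stack) g ≫ E'.hom,
    (PreservesMinimal.of_equivalence (elements_yoneda_isConelike U) E).comp
      ((CombConeStack.preservesMinimal_geomMap g).comp (PreservesMinimal.of_equivalence
        h.stack.geom_isConelike E')), ?_⟩
  have := Chart.essSurj_comp (CombConeStack.geomMap (S := U.obj.toCombConeStack) (T := h.stack) g)
    E'.hom
  exact Chart.essSurj_comp _ _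

lemma isCovering_of_essSurj (h𝒴 : IsFiberedInGroupoids 𝒴) (K : 𝒳 ⟶ 𝒴) [(Chart.map K).EssSurj] :
    IsCovering faceTopology K := by
  intro y
  rw [mem_faceTopology_iff]
  intro α
  obtain ⟨b, i, m, hm⟩ := h𝒴.exists_chart y ((𝒴.p.obj y).faceTop α) ((𝒴.p.obj y).topIncl α)
  let B : Chart 𝒴 := ⟨b, _, i⟩
  let E := (Chart.map K).objObjPreimageIso B
  let ψ := Chart.hom E.hom ≫ m
  have h1 : Chart.hom E.inv ≫ ψ = m := (assoc _ _ _).symm.trans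
    ((congrArg (· ≫ m) E.inv_hom_id).trans (id_comp m))
  refine ⟨_, i.hom ≫ 𝒴.p.map (Chart.hom E.inv), 𝒴.p.map ψ,
    ⟨((Chart.map K).objPreimage B).pt, ψ, IsHomLift.map 𝒴.p ψ⟩, ?_⟩
  have h2 : i.hom ≫ 𝒴.p.map (Chart.hom E.inv) ≫ 𝒴.p.map ψ = (𝒴.p.obj y).topIncl α := by
    rw [← map_comp, h1, hm]
  exact (assoc _ _ _).trans h2

lemma isLocallySurjective_of_essSurj {X Y : RPCC.{u}ᵒᵖ ⥤ Type u} (q : X ⟶ Y)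
    [(Chart.map (elementsMap q)).EssSurj] : Presheaf.IsLocallySurjective faceTopology q where
  imageSieve_mem {T} s := by
    rw [mem_faceTopology_iff]
    intro α
    let B : Chart (elements Y) := ⟨eltMk (res Y (T.faceIncl α) s), T.faceTop α, Iso.refl _⟩
    let E := (Chart.map (elementsMap q)).objObjPreimageIso B
    let a := (Chart.map (elementsMap q)).objPreimage B
    let k : T.face α ⟶ (elements X).p.obj a.pt := (elements Y).p.map (Chart.hom E.inv)
    refine ⟨res X k (elt a.pt), ?_⟩
    have h1 : q.app _ (elt a.pt) = elt (Chart.pt ((Chart.map (elementsMap q)).obj a)) :=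
      (sect_elementsMap q a.pt).symm.trans (res_id _ _)
    rw [app_res, h1]
    exact (elt_map (Chart.hom E.inv)).trans (elt_eltMk _)

end Covers

section Limits

open Limits

instance : HasPullbacks RPCC.{u} :=
  have {U V Z : RPCC.{u}} {a : U ⟶ Z} {b : V ⟶ Z} : HasLimit (cospan a b) := by
    obtain ⟨W, p, q, H, -⟩ := exists_isPullback_complex (elements_yoneda_isConelike Z)
      (yoneda_isSheaf Z) (yoneda.map a) (yoneda.map b)
    obtain ⟨p, rfl⟩ := yoneda.map_surjective p
    exact (IsPullback.of_map yoneda (yoneda.map_injective (by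
      rw [map_comp, map_comp, H.w])) H).hasPullback
  hasPullbacks_of_hasLimit_cospan _

/-- The terminal cone complex. -/
def zeroComplex : RPCC.{u} where
  obj :=
    { ι := PUnit
      cone _ := RPC.zero
      mor _ _ := Set.univ
      isFace f _ := by
        rw [RPC.hom_zero_ext f (𝟙 _)]
        exact .of_isIso _
      comp_mem _ _ _ _ := trivial
      id_mem _ := trivial
      existsUnique_face _ F hF := by
        refine ⟨⟨⟨⟩, 𝟙 _⟩, ⟨trivial, ?_⟩, fun p _ => Sigma.ext rfl (heq_of_eq (RPC.hom_zero_ext _ _))⟩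
        have h : RPC.image (𝟙 RPC.zero.{u}) ≤ F := by
          rw [RPC.hom_zero_ext (𝟙 RPC.zero.{u}) (RPC.toZero _)]
          rintro _ ⟨x, _, rfl⟩
          simp [RPC.real, RPC.toZero]
        exact le_antisymm h (hF.le.trans (RPC.image_id _).ge) }
  property _ _ f _ g _ := RPC.hom_zero_ext f g

instance : HasTerminal RPCC.{u} :=
  (IsTerminal.ofUniqueHom (Y := zeroComplex.{u}) (fun T => ObjectProperty.homMk
    { idx := fun _ => ⟨⟩
      map := fun α => RPC.toZero _
      dominant := fun _ => RPC.isDominant_toZero _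
      compat := fun _ _ => ⟨𝟙 _, trivial, RPC.hom_zero_ext _ _⟩ }) fun T m =>
        ObjectProperty.hom_ext _ (CombConeSpace.Hom.ext_map fun α =>
          Sigma.ext rfl (heq_of_eq (RPC.hom_zero_ext _ _)))).hasTerminal

instance : HasBinaryProducts RPCC.{u} := hasBinaryProducts_of_hasTerminal_and_pullbacks _

end Limits

section ConeSpaces

lemma strict_of_isIso {T T' : RPCC.{u}} (f : T ⟶ T') [IsIso f] : strict f := fun α =>
  RPCC.isIso_mapAt f ⟨α⟩

instance : strict.{u}.RespectsIso := by
  have h {X Y Z : RPCC.{u}} (f : X ⟶ Y) (g : Y ⟶ Z) (hf : strict f) (hg : strict g) :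
      strict (f ≫ g) := fun α => by
    have := hf α
    have := hg (f.hom.idx α)
    exact inferInstanceAs (IsIso (f.hom.map α ≫ g.hom.map (f.hom.idx α)))
  exact MorphismProperty.RespectsIso.mk _ (fun e f hf => h _ _ (strict_of_isIso e.hom) hf)
    (fun e f hf => h _ _ hf (strict_of_isIso e.hom))

lemma isConeSpace_of_isConelike {X : RPCC.{u}ᵒᵖ ⥤ Type u} (hX : Presheaf.IsSheaf faceTopology X)
    (h : IsConelike (elements X)) : IsConeSpace X where
  isSheaf := hX
  diag := Functor.relativelyRepresentable.diag_of_map_from_obj fun U a V b => by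
    obtain ⟨W, p, q, H, -⟩ := exists_isPullback_complex h hX a b
    exact ⟨W, q, p, H⟩
  cover := by
    obtain ⟨U, K, hK, hK'⟩ := h.exists_cover (elements_isStack hX)
    obtain ⟨f, ⟨i⟩⟩ := exists_elementsMap_iso K
    have : (Chart.map (elementsMap f)).EssSurj := Functor.essSurj_of_iso (Chart.mapIso i)
    refine ⟨U, f, MorphismProperty.relative.of_exists fun V b => ?_,
      isLocallySurjective_of_essSurj f⟩
    obtain ⟨W, p, q, H, hq⟩ := exists_isPullback_complex h hX f b
    exact ⟨W, p, q, H, hq (hK.of_iso i)⟩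

end ConeSpaces

section Orthogonality

variable {𝒳 𝒴 𝒵 : Based.{u}}

lemma PreservesMinimal.isOrthogonal {K : 𝒳 ⟶ 𝒴} (hK : PreservesMinimal K) (h𝒳 : IsConelike 𝒳)
    (h𝒴 : IsFiberedInGroupoids 𝒴) : IsOrthogonal (Chart.map K) where
  isDom_iff := Chart.isDom_map_iff K
  exists_lift {w b} d hd := by
    obtain ⟨m, n, hm, hn⟩ := h𝒳.exists_minimal w
    obtain ⟨h, hh, -⟩ := (hK hm).existsUnique ((Chart.map K).map n) d (hn.map K) hd
    let cd : (Chart.cone 𝒳).obj w ⟶ (Chart.cone 𝒴).obj b := (Chart.cone 𝒴).map d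
    let ch : (Chart.cone 𝒴).obj b ⟶ (Chart.cone 𝒳).obj m := (Chart.cone 𝒴).map h
    have hc : cd ≫ ch = (Chart.cone 𝒳).map n :=
      ((Chart.cone 𝒴).map_comp _ _).symm.trans ((congrArg _ hh).trans (Chart.cone_map K n))
    obtain ⟨w', φ, e, hφ⟩ := h𝒳.fibered.exists_chart_over m ch
    obtain ⟨E, hE, hE'⟩ := h𝒴.exists_chart_hom h ((Chart.map K).map φ) e.hom
      ((Chart.cone_map K φ).trans hφ).symm
    obtain ⟨d', hd', hd''⟩ := h𝒳.fibered.exists_chart_hom φ n (cd ≫ e.inv) (by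
      rw [hφ, assoc, Iso.inv_hom_id_assoc, hc])
    have : IsIso ((Chart.cone 𝒴).map E) := hE ▸ e.isIso_hom
    have := h𝒴.chart_isIso E
    refine ⟨w', d', asIso E, h𝒴.chart_cancel h ?_ ?_⟩
    · have h1 : (Chart.cone 𝒳).map d' ≫ e.hom = cd := by
        rw [hd', assoc, Iso.inv_hom_id, comp_id]
      exact ((Chart.cone 𝒴).map_comp _ _).trans ((congrArg₂ (· ≫ ·) (Chart.cone_map K d') hE).trans h1)
    · rw [asIso_hom, assoc, hE', ← map_comp, hd'', hh]
  exists_hom {w w' w''} d d' k hd hd' hk := by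
    obtain ⟨m, n, hm, hn⟩ := h𝒳.exists_minimal w''
    obtain ⟨h, hh, -⟩ := hm.existsUnique (d' ≫ n) d (hd'.comp hn) hd
    have h1 : (Chart.map K).map h = k ≫ (Chart.map K).map n := by
      refine (hK hm).hom_ext _ (hd.map K) ?_ ?_
      · rw [← map_comp, hh]
        exact (hd'.comp hn).map K
      · rw [← map_comp, hh, ← assoc, hk, map_comp]
    have h2 : (Chart.cone 𝒴).map k ≫ (Chart.cone 𝒳).map n = (Chart.cone 𝒳).map h :=
      (congrArg (_ ≫ ·) (Chart.cone_map K n).symm).trans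
        (((Chart.cone 𝒴).map_comp _ _).symm.trans ((congrArg _ h1.symm).trans (Chart.cone_map K h)))
    obtain ⟨l, hl, hl'⟩ := h𝒳.fibered.exists_chart_hom n h _ h2
    refine ⟨l, h𝒳.fibered.chart_cancel n ?_ ?_, h𝒴.chart_cancel ((Chart.map K).map n)
      ((Chart.cone_map K l).trans hl) ?_⟩
    · rw [map_comp, hl]
      exact (congrArg (· ≫ _) (Chart.cone_map K d).symm).trans
        (((Chart.cone 𝒴).map_comp _ _).symm.trans ((congrArg _ hk).trans (Chart.cone_map K d')))
    · rw [assoc, hl', hh]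
    · rw [← map_comp, hl', h1]

lemma IsOrthogonal.of_equivalence_comp (e : Bicategory.Equivalence 𝒳 𝒴) {K : 𝒴 ⟶ 𝒵}
    (h : IsOrthogonal (Chart.map (e.hom ≫ K))) : IsOrthogonal (Chart.map K) :=
  have := Chart.isEquivalence_map e
  (IsOrthogonal.of_equivalence e).of_comp inferInstance (Chart.isDom_map_iff K)
    (h.of_iso (Chart.mapComp e.hom K))

lemma strict.preservesMinimal {W V : RPCC.{u}} {q : W ⟶ V} (hq : strict q) :
    PreservesMinimal (elementsMap (yoneda.map q)) := by
  intro a ha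
  have h1 := ha.isIso_atTop
  have h2 := hq (a.toComplex.hom.idx a.dom.top)
  have h3 : IsIso (a.dom.atTop (a.toComplex ≫ q)) :=
    inferInstanceAs (IsIso (a.dom.atTop a.toComplex ≫ q.hom.map _))
  have : IsIso (((Chart.map (elementsMap (yoneda.map q))).obj a).dom.atTop
      ((Chart.map (elementsMap (yoneda.map q))).obj a).toComplex) := by
    rw [Chart.toComplex_map]
    exact h3
  exact Chart.isMinimal_of_isIso _

lemma exists_classifying (h : IsFiberedInGroupoids 𝒴) (b : Chart 𝒴) :
    ∃ (G : elements (yoneda.obj b.dom.cx) ⟶ 𝒴) (Φ : ∀ a, (Chart.map G).obj a ⟶ b),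
      (∀ a, Topped.hom ((Chart.domain 𝒴).map (Φ a)) = a.toComplex) ∧
      ∀ {a a'} (n : a ⟶ a'), (Chart.map G).map n ≫ Φ a' = Φ a := by
  obtain ⟨G, φ, hφ, hφ'⟩ := h.exists_functor (𝒜 := elements (yoneda.obj b.dom.cx)) b.pt
    (fun a => elt a ≫ b.iso.hom) (fun {a a'} f => by
      rw [← assoc]
      exact congrArg (· ≫ b.iso.hom) (elt_map f))
  refine ⟨G, fun a => Chart.mkHom (φ a.pt), fun a => ?_, fun {a a'} n =>
    Chart.hom_ext (hφ' (Chart.hom n))⟩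
  have h1 : (a.iso.hom ≫ (baseIso G a.pt).inv) ≫ 𝒴.p.map (φ a.pt) ≫ b.iso.inv =
      a.iso.hom ≫ elt a.pt := by
    rw [hφ, assoc, assoc, assoc, Iso.hom_inv_id, comp_id, Iso.inv_hom_id_assoc]
  exact h1

end Orthogonality

section BaseChange

variable {𝒳 𝒴 : Based.{u}}

lemma exists_base_change (h𝒴 : IsFiberedInGroupoids 𝒴) {K : 𝒳 ⟶ 𝒴}
    (H : ∀ (V : RPCC.{u}) (G : elements (yoneda.obj V) ⟶ 𝒴), ∃ G' : elements (yoneda.obj V) ⟶ 𝒴,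
      Nonempty (G' ≅ G) ∧ IsOrthogonal (Chart.map (fiberProdSnd K G'))) (b : Chart 𝒴) :
    ∃ (G : elements (yoneda.obj b.dom.cx) ⟶ 𝒴)
      (Ψ : ∀ c : Chart (fiberProd K G), (Chart.map K).obj c.fst ⟶ b),
      IsOrthogonal (Chart.map (fiberProdSnd K G)) ∧
      (∀ c, Topped.hom ((Chart.domain 𝒴).map (Ψ c)) = c.snd.toComplex) ∧
      (∀ {c c' : Chart (fiberProd K G)} (δ : c ⟶ c'),
        (Chart.map K).map ((Chart.map (fiberProdFst K G)).map δ) ≫ Ψ c' = Ψ c) ∧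
      (∀ {w : Chart 𝒳} (t : (Chart.map K).obj w ⟶ b), ∃ (c : Chart (fiberProd K G))
        (m : c.fst ⟶ w), IsIso m ∧ (Chart.map K).map m ≫ t = Ψ c) ∧
      ∀ {c c' : Chart (fiberProd K G)} (f : c.fst ⟶ c'.fst), (Chart.map K).map f ≫ Ψ c' = Ψ c →
        ∃ δ : c ⟶ c', (Chart.map (fiberProdFst K G)).map δ = f := by
  obtain ⟨G₀, Φ₀, hΦ₀, hΦ₀'⟩ := exists_classifying h𝒴 b
  obtain ⟨G, ⟨i⟩, hG⟩ := H _ G₀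
  let Φ : ∀ a, (Chart.map G).obj a ⟶ b := fun a => (Chart.mapTrans i.hom).app a ≫ Φ₀ a
  have hΦ : ∀ a, Topped.hom ((Chart.domain 𝒴).map (Φ a)) = a.toComplex := fun a => by
    refine (congrArg Topped.hom ?_).trans (hΦ₀ a)
    exact ((Chart.domain 𝒴).map_comp _ _).trans
      ((congrArg (· ≫ (Chart.domain 𝒴).map (Φ₀ a)) (Chart.domain_mapTrans i.hom a)).trans
        (id_comp _))
  have hΦ' : ∀ {a a'} (n : a ⟶ a'), (Chart.map G).map n ≫ Φ a' = Φ a := fun {a a'} n => by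
    refine Eq.trans ?_ (congrArg ((Chart.mapTrans i.hom).app a ≫ ·) (hΦ₀' n))
    exact (assoc _ _ _).symm.trans ((congrArg (· ≫ Φ₀ a')
      ((Chart.mapTrans i.hom).naturality n)).trans (assoc _ _ _))
  have hΨ : ∀ c : Chart (fiberProd K G),
      Topped.hom ((Chart.domain 𝒴).map (c.cmp ≫ Φ c.snd)) = c.snd.toComplex := fun c => by
    refine (congrArg Topped.hom ?_).trans (hΦ c.snd)
    exact ((Chart.domain 𝒴).map_comp _ _).trans
      ((congrArg (· ≫ (Chart.domain 𝒴).map (Φ c.snd)) (Chart.domain_cmp c)).trans (id_comp _))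
  refine ⟨G, fun c => c.cmp ≫ Φ c.snd, hG, hΨ, ?_, ?_, ?_⟩
  · intro c c' δ
    rw [← assoc, Chart.cmp_naturality, assoc, hΦ']
  · intro w t
    let k : w.dom ⟶ b.dom := (Chart.domain 𝒴).map t
    let a : Chart (elements (yoneda.obj b.dom.cx)) := Chart.ofComplex w.dom (Topped.hom k)
    have h1 : (Chart.domain 𝒴).map (Φ a) = k := ((hΦ a).trans (Chart.toComplex_ofComplex _ _))
    obtain ⟨χ, -, hχ⟩ := h𝒴.exists_chart_hom (Φ a) t (𝟙 (Topped.ev.obj w.dom))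
      ((id_comp _).trans (congrArg (fun k => Topped.ev.map k) h1))
    obtain ⟨c, m, n, hm, e⟩ := exists_fiberProd_chart (elements_fibered _) h𝒴 χ
    refine ⟨c, m, hm, ?_⟩
    rw [← hχ, ← assoc, e, assoc, hΦ']
  · intro c c' f hf
    let k : c.snd.dom ⟶ c'.snd.dom := (Chart.domain 𝒳).map f
    have h1 : Topped.hom k ≫ c'.snd.toComplex = c.snd.toComplex := by
      refine (congrArg₂ (· ≫ ·) (congrArg Topped.hom (Chart.domain_map K f).symm)
        (hΨ c').symm).trans (Eq.trans ?_ (hΨ c))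
      exact congrArg Topped.hom (((Chart.domain 𝒴).map_comp _ _).symm.trans (congrArg _ hf))
    obtain ⟨n, hn⟩ := Chart.exists_hom_of_toComplex k h1
    have h2 : (Chart.cone 𝒴).map ((Chart.map K).map f ≫ c'.cmp) =
        (Chart.cone 𝒴).map (c.cmp ≫ (Chart.map G).map n) := by
      refine congrArg (fun k => Topped.ev.map k) ?_
      refine (((Chart.domain 𝒴).map_comp _ _).trans (congrArg₂ (· ≫ ·) (Chart.domain_map K f)
        (Chart.domain_cmp c'))).trans ?_
      refine Eq.trans ?_ (((Chart.domain 𝒴).map_comp _ _).trans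
        (congrArg₂ (· ≫ ·) (Chart.domain_cmp c) (Chart.domain_map G n))).symm
      exact (comp_id _).trans (hn.symm.trans (id_comp _).symm)
    obtain ⟨δ, hδ, -⟩ := exists_fiberProd_hom f n
      (congrArg (fun k => Topped.ev.map k) hn.symm) (h𝒴.chart_cancel (Φ c'.snd) h2 (by
        rw [assoc, hf, assoc, hΦ']))
    exact ⟨δ, hδ⟩

lemma IsOrthogonal.of_baseChange (h𝒴 : IsFiberedInGroupoids 𝒴) {K : 𝒳 ⟶ 𝒴}
    (H : ∀ (V : RPCC.{u}) (G : elements (yoneda.obj V) ⟶ 𝒴), ∃ G' : elements (yoneda.obj V) ⟶ 𝒴,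
      Nonempty (G' ≅ G) ∧ IsOrthogonal (Chart.map (fiberProdSnd K G'))) :
    IsOrthogonal (Chart.map K) where
  isDom_iff := Chart.isDom_map_iff K
  exists_lift {w b} d hd := by
    obtain ⟨G, Ψ, hG, hΨ, hnat, hA, -⟩ := exists_base_change h𝒴 H b
    obtain ⟨c, m, hm, hc⟩ := hA d
    let v : Chart (elements (yoneda.obj b.dom.cx)) := Chart.ofComplex b.dom (𝟙 _)
    have hv : v.toComplex = 𝟙 b.dom.cx := Chart.toComplex_ofComplex _ _
    let k : c.snd.dom ⟶ v.dom := (Chart.domain 𝒴).map (Ψ c)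
    obtain ⟨n, hn⟩ := Chart.exists_hom_of_toComplex k
      ((congrArg (Topped.hom k ≫ ·) hv).trans ((comp_id _).trans (hΨ c)))
    have hdom : Chart.IsDom (Ψ c) := by
      rw [← hc, Chart.isDom_iso_comp]
      exact hd
    obtain ⟨c', δ, e, he⟩ := hG.exists_lift n
      ((congrArg (fun k => IsDominant (Topped.ev.map k)) hn).mpr hdom)
    have h1 : (Chart.domain 𝒴).map (Ψ c') = (Chart.domain _).map e.hom :=
      ((hΨ c').trans ((Chart.toComplex_comp e.hom).symm.trans
        ((congrArg (_ ≫ ·) hv).trans (comp_id _))))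
    have h2 : (Chart.cone 𝒴).map (Ψ c') = (Chart.cone _).map e.hom :=
      congrArg (fun k => Topped.ev.map k) h1
    have : IsIso ((Chart.cone 𝒴).map (Ψ c')) := by
      have : IsIso ((Chart.cone (elements (yoneda.obj b.dom.cx))).map e.hom) := inferInstance
      exact (congrArg (fun k => IsIso k) h2).mpr this
    have := h𝒴.chart_isIso (Ψ c')
    refine ⟨c'.fst, inv m ≫ (Chart.map (fiberProdFst K G)).map δ, asIso (Ψ c'), ?_⟩
    rw [asIso_hom, map_comp, assoc, hnat, Functor.map_inv, IsIso.inv_comp_eq, hc]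
  exists_hom {w w' w''} d d' k hd hd' hk := by
    obtain ⟨G, Ψ, hG, hΨ, hnat, hA, hB⟩ := exists_base_change h𝒴 H ((Chart.map K).obj w'')
    obtain ⟨c'', m'', hm'', hc''⟩ := hA (𝟙 ((Chart.map K).obj w''))
    obtain ⟨c', m', hm', hc'⟩ := hA k
    obtain ⟨c, m, hm, hc⟩ := hA ((Chart.map K).map d')
    rw [comp_id] at hc''
    have : IsIso (Ψ c'') := by rw [← hc'']; infer_instance
    obtain ⟨δ, hδ⟩ := hB (c := c) (c' := c') (m ≫ d ≫ inv m') (by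
      rw [← hc', map_comp, map_comp, Functor.map_inv, assoc, assoc, IsIso.inv_hom_id_assoc, hk, hc])
    obtain ⟨δ', hδ'⟩ := hB (c := c) (c' := c'') (m ≫ d' ≫ inv m'') (by
      rw [← hc'', map_comp, map_comp, Functor.map_inv, assoc, assoc, IsIso.inv_hom_id, comp_id, hc])
    let t : (Chart.map K).obj c'.fst ⟶ (Chart.map K).obj c''.fst := Ψ c' ≫ inv (Ψ c'')
    let k₀ : c'.snd.dom ⟶ c''.snd.dom := (Chart.domain 𝒴).map t
    obtain ⟨n, hn⟩ := Chart.exists_hom_of_toComplex k₀ (by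
      rw [← hΨ c', ← hΨ c'']
      refine congrArg Topped.hom (((Chart.domain 𝒴).map_comp _ _).symm.trans
        (congrArg (Chart.domain 𝒴).map ?_))
      rw [assoc, IsIso.inv_hom_id, comp_id])
    have hdom : Chart.IsDom δ := by
      rw [← Chart.isDom_map_iff (fiberProdFst K G), hδ, Chart.isDom_iso_comp, Chart.isDom_comp_iso]
      exact hd
    have hdom' : Chart.IsDom δ' := by
      rw [← Chart.isDom_map_iff (fiberProdFst K G), hδ', Chart.isDom_iso_comp, Chart.isDom_comp_iso]
      exact hd'
    have h1 : (Chart.map K).map ((Chart.map (fiberProdFst K G)).map δ) ≫ t =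
        (Chart.map K).map ((Chart.map (fiberProdFst K G)).map δ') := by
      rw [← assoc, hnat, IsIso.comp_inv_eq, hnat]
    have h2 : (Chart.domain _).map ((Chart.map (fiberProdSnd K G)).map δ ≫ n) =
        (Chart.domain _).map ((Chart.map (fiberProdSnd K G)).map δ') := by
      refine ((Chart.domain _).map_comp _ _).trans ((congrArg₂ (· ≫ ·) ?_ hn).trans
        (((Chart.domain 𝒴).map_comp _ t).symm.trans ((congrArg (Chart.domain 𝒴).map h1).trans ?_)))
      · exact (Chart.domain_map (fiberProdSnd K G) δ).trans
          ((Chart.domain_map (fiberProdFst K G) δ).symm.trans (Chart.domain_map K _).symm)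
      · exact (Chart.domain_map K _).trans ((Chart.domain_map (fiberProdFst K G) δ').trans
          (Chart.domain_map (fiberProdSnd K G) δ').symm)
    obtain ⟨l, hl, hl'⟩ := hG.exists_hom δ δ' n hdom hdom'
      (elements_isThin _ _ _ (congrArg (fun k => Topped.ev.map k) h2))
    refine ⟨inv m' ≫ (Chart.map (fiberProdFst K G)).map l ≫ m'', ?_, ?_⟩
    · rw [← cancel_epi m]
      have h3 := congrArg (· ≫ m'') (congrArg (Chart.map (fiberProdFst K G)).map hl)
      rw [map_comp, hδ, hδ'] at h3
      simpa using h3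
    · rw [map_comp, map_comp, hc'', hnat, ← hc', Functor.map_inv,
        IsIso.inv_hom_id_assoc]

end BaseChange

section Coverings

open Opposite

variable {𝒳 𝒴 : Based.{u}}

lemma exists_elementsMap_comp_iso {C : Type (u + 1)} [Category.{u} C] {X Y Z : Cᵒᵖ ⥤ Type u}
    (p : X ⟶ Y) (q : Y ⟶ Z) : Nonempty (elementsMap p ≫ elementsMap q ≅ elementsMap (p ≫ q)) :=
  exists_iso_of_sect_eq fun a => by
    rw [sect_comp_elementsMap, sect_elementsMap, sect_elementsMap]
    rfl

lemma essSurj_of_isCovering (h𝒳 : IsFiberedInGroupoids 𝒳) (h𝒴 : IsFiberedInGroupoids 𝒴)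
    {K : 𝒳 ⟶ 𝒴} (hK : IsCovering faceTopology K) : (Chart.map K).EssSurj where
  mem_essImage b := by
    obtain ⟨T, g, h, ⟨x, ψ, hψ⟩, e⟩ := Topped.mem_of_covering (hK b.pt) b.dom b.iso.hom
    obtain rfl : 𝒴.p.obj (⟪K⟫.obj x) = T := IsHomLift.domain_eq 𝒴.p h ψ
    have hh : 𝒴.p.map ψ = h := (IsHomLift.eq_of_isHomLift 𝒴.p h ψ).symm
    obtain ⟨x', i, m, hm⟩ := h𝒳.exists_chart x b.dom (g ≫ (baseIso K x).hom)
    let a : Chart 𝒳 := ⟨x', b.dom, i⟩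
    obtain ⟨χ, hχ, -⟩ := h𝒴.exists_hom_chart (a := b) (a' := (Chart.map K).obj a) (𝟙 b.pt)
      (⟪K⟫.map m ≫ ψ) (𝟙 b.dom) (by
        refine (id_comp _).trans ?_
        have h1 : (i.hom ≫ (baseIso K x').inv) ≫ 𝒴.p.map (⟪K⟫.map m ≫ ψ) = b.iso.hom := by
          rw [map_comp, p_map_map, hh, assoc, assoc,
            Iso.inv_hom_id_assoc, ← assoc i.hom, ← assoc i.hom, hm,
            assoc, assoc, Iso.hom_inv_id_assoc, e]
        refine Eq.trans ?_ h1.symm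
        rw [map_id, comp_id])
    have : IsIso ((Chart.cone 𝒴).map χ) := (congrArg (fun k => IsIso (Topped.ev.map k)) hχ).mpr
        (inferInstanceAs (IsIso (Topped.ev.map (𝟙 b.dom))))
    have := h𝒴.chart_isIso χ
    exact ⟨a, ⟨asIso χ⟩⟩

lemma isCovering_of_isLocallySurjective {C : Type (u + 1)} [Category.{u} C]
    {J : GrothendieckTopology C} {X Y : Cᵒᵖ ⥤ Type u} (q : X ⟶ Y)
    [Presheaf.IsLocallySurjective J q] : IsCovering J (elementsMap q) := by
  intro y
  refine J.superset_covering ?_ (Presheaf.imageSieve_mem J q (U := op _) (elt y))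
  rintro T h ⟨t, ht⟩
  let x : (elements Y).obj := ((elementsMap q : BasedFunctor (elements X) (elements Y))).obj (eltMk t)
  have hx : res Y h (elt y) = elt x := by
    have h1 := sect_elementsMap q (eltMk t)
    rw [elt_eltMk] at h1
    exact ht.symm.trans (h1.symm.trans (res_id _ _))
  let ψ : x ⟶ y := eltHom (x := x) h hx
  exact ⟨T, 𝟙 T, h, ⟨eltMk t, ψ, IsHomLift.map (elements Y).p ψ⟩, id_comp h⟩

lemma isOrthogonal_of_presheaf {U : RPCC.{u}} {X : RPCC.{u}ᵒᵖ ⥤ Type u} (f : yoneda.obj U ⟶ X)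
    (hf : strict.presheaf f) : IsOrthogonal (Chart.map (elementsMap f)) := by
  refine .of_baseChange (elements_fibered X) fun V G => ?_
  obtain ⟨b, ⟨i⟩⟩ := exists_elementsMap_iso G
  refine ⟨elementsMap b, ⟨i.symm⟩, ?_⟩
  have H := hf.rep.isPullback b
  have hq : strict (hf.rep.snd b) := hf.property_snd b
  obtain ⟨e, he⟩ := exists_elements_equivalence H.isoPullback
  obtain ⟨e', he'⟩ := exists_pullback_equivalence f b
  obtain ⟨j⟩ := exists_elementsMap_comp_iso H.isoPullback.hom (Limits.pullback.snd f b)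
  rw [H.isoPullback_hom_snd, ← he] at j
  refine .of_equivalence_comp e' ?_
  rw [he']
  exact .of_equivalence_comp e ((hq.preservesMinimal.isOrthogonal (elements_yoneda_isConelike _)
    (elements_fibered _)).of_iso (Chart.mapIso j.symm))

lemma isOrthogonal_of_spaceMorphismIn {R : RPCC.{u}ᵒᵖ ⥤ Type u} {V : RPCC.{u}}
    {q : R ⟶ yoneda.obj V} (hq : SpaceMorphismIn faceTopology strict q) :
    IsOrthogonal (Chart.map (elementsMap q)) := by
  obtain ⟨W, g, hg, _, hs⟩ := hq
  obtain ⟨r, hr⟩ := yoneda.map_surjective (g ≫ q)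
  rw [← hr, yonedaEquiv_yoneda_map] at hs
  obtain ⟨j⟩ := exists_elementsMap_comp_iso g q
  rw [← hr] at j
  exact (isOrthogonal_of_presheaf g hg).of_comp
    (essSurj_of_isCovering (elements_fibered _) (elements_fibered _)
      (isCovering_of_isLocallySurjective g)) (Chart.isDom_map_iff _)
    ((hs.preservesMinimal.isOrthogonal (elements_yoneda_isConelike _)
      (elements_fibered _)).of_iso (Chart.mapIso j.symm ≪≫ Chart.mapComp _ _))

lemma MorphismIn.isOrthogonal {K : 𝒳 ⟶ 𝒴} (hK : MorphismIn faceTopology strict K)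
    (h𝒴 : IsFiberedInGroupoids 𝒴) : IsOrthogonal (Chart.map K) :=
  .of_baseChange h𝒴 fun V G => by
    obtain ⟨R, -, e, q, ⟨i⟩, hq⟩ := hK V G
    exact ⟨G, ⟨Iso.refl _⟩, .of_equivalence_comp e
      ((isOrthogonal_of_spaceMorphismIn hq).of_iso (Chart.mapIso i.symm))⟩

lemma IsConeSpace.isConelike {X : RPCC.{u}ᵒᵖ ⥤ Type u} (h : IsConeSpace X) :
    IsConelike (elements X) := by
  obtain ⟨U, f, hf, _⟩ := h.cover
  exact (isOrthogonal_of_presheaf f hf).isConelike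
    (essSurj_of_isCovering (elements_fibered _) (elements_fibered _)
      (isCovering_of_isLocallySurjective f)) (elements_yoneda_isConelike U) (elements_fibered X)

lemma IsConeStack.isConelike (h : IsConeStack 𝒳) : IsConelike 𝒳 := by
  obtain ⟨U, hU, f, hf, hf'⟩ := h.cover
  exact (hf'.isOrthogonal h.isStack.fibered).isConelike
    (essSurj_of_isCovering (elements_fibered _) h.isStack.fibered hf) (IsConeSpace.isConelike hU)
    h.isStack.fibered

end Coverings

section ConeStacks

open Limits Bicategory

variable {𝒳 𝒴 : Based.{u}}

lemma chart_map_diagBased_injective {a b : Chart 𝒳} {f g : a ⟶ b}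
    (h : (Chart.map (diagBased 𝒳)).map f = (Chart.map (diagBased 𝒳)).map g) : f = g :=
  let P : ((Chart.map (diagBased 𝒳)).obj a ⟶ (Chart.map (diagBased 𝒳)).obj b) → (a.pt ⟶ b.pt) :=
    fun k => FiberProdHom.fst (Chart.hom k)
  (congrArg P h : P _ = P _)

lemma isThin_fiberProd_diagBased {V : RPCC.{u}ᵒᵖ ⥤ Type u}
    (G : elements V ⟶ prodBased 𝒳 𝒳) : IsThin (fiberProd (diagBased 𝒳) G) := by
  intro a b f g hfg
  have h1 : (Chart.map (fiberProdSnd (diagBased 𝒳) G)).map f =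
      (Chart.map (fiberProdSnd (diagBased 𝒳) G)).map g :=
    elements_isThin _ _ _ (by
      have e1 := Chart.cone_map (fiberProdSnd (diagBased 𝒳) G) f
      have e2 := Chart.cone_map (fiberProdSnd (diagBased 𝒳) G) g
      exact e1.trans (hfg.trans e2.symm))
  refine fiberProd_hom_ext ?_ h1
  have h2 : (Chart.map (diagBased 𝒳)).map ((Chart.map (fiberProdFst (diagBased 𝒳) G)).map f) =
      (Chart.map (diagBased 𝒳)).map ((Chart.map (fiberProdFst (diagBased 𝒳) G)).map g) := by
    rw [← cancel_mono b.cmp, Chart.cmp_naturality, Chart.cmp_naturality, h1]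
  exact chart_map_diagBased_injective h2

lemma isConeStack_of_isConelike (h : IsConelike 𝒳) (hs : IsStack faceTopology 𝒳) :
    IsConeStack 𝒳 where
  isStack := hs
  diag V hV G := by
    have hs' : IsStack faceTopology (prodBased 𝒳 𝒳) := fiberProd_isStack hs hs (baseBased_isStack _)
    have h' : IsConelike (prodBased 𝒳 𝒳) := fiberProd_isConelike h h baseBased_isConelike
    have hF := fiberProd_isConelike (F := diagBased 𝒳) (G := G) h (IsConeSpace.isConelike hV) h'
    obtain ⟨Z, ⟨e⟩, -⟩ := hF.exists_combConeSpace
      (fiberProd_isStack hs (elements_isStack hV.isSheaf) hs')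
      (isThin_fiberProd_diagBased G)
    exact ⟨Z.presheaf, isConeSpace_of_isConelike Z.presheaf_isSheaf
      (elements_presheaf_isConelike Z), ⟨e⟩⟩
  cover := by
    obtain ⟨U, K, hK, _⟩ := h.exists_cover hs
    refine ⟨yoneda.obj U, isConeSpace_of_isConelike (yoneda_isSheaf U)
      (elements_yoneda_isConelike U), K, isCovering_of_essSurj hs.fibered K, fun V G => ?_⟩
    obtain ⟨W, e, q, i, hq⟩ := exists_fiberProd_complex h hs K G
    refine ⟨yoneda.obj W, isConeSpace_of_isConelike (yoneda_isSheaf W)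
      (elements_yoneda_isConelike W), e, yoneda.map q, i, W, 𝟙 _, ?_, inferInstance, ?_⟩
    · exact .of_exists fun V b => ⟨V, b, 𝟙 V, by
        rw [map_id]
        exact IsPullback.of_vert_isIso ⟨by simp⟩, strict_of_isIso _⟩
    · rw [id_comp, yonedaEquiv_yoneda_map]
      exact hq hK

end ConeStacks

section Biequivalence

open Bicategory InducedBicategory

/-- The cone stack of a combinatorial cone stack. -/
def CombConeStack.coneStack (S : CombConeStack.{u}) : ConeStack.{u} :=
  (⟨S.geom, isConeStack_of_isConelike S.geom_isConelike (CombConeStack.geom_isStack S)⟩ :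
    {𝒳 : Based.{u} // IsConeStack 𝒳})

/-- The pseudofunctor from combinatorial cone stacks to cone stacks. -/
def toConeStacks : Pseudofunctor CombConeStack.{u} ConeStack.{u} where
  obj S := S.coneStack
  map {S T} f := mkHom (X := S.coneStack) (Y := T.coneStack) (CombConeStack.geomPseudofunctor.map f)
  map₂ η := ⟨CombConeStack.geomPseudofunctor.map₂ η⟩
  map₂_id f := hom₂_ext (CombConeStack.geomPseudofunctor.map₂_id f)
  map₂_comp η θ := hom₂_ext (CombConeStack.geomPseudofunctor.map₂_comp η θ)
  mapId S := isoMk (CombConeStack.geomPseudofunctor.mapId S)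
  mapComp f g := isoMk (CombConeStack.geomPseudofunctor.mapComp f g)
  map₂_whisker_left f _ _ η := hom₂_ext (CombConeStack.geomPseudofunctor.map₂_whisker_left f η)
  map₂_whisker_right η h := hom₂_ext (CombConeStack.geomPseudofunctor.map₂_whisker_right η h)
  map₂_associator f g h := hom₂_ext (CombConeStack.geomPseudofunctor.map₂_associator f g h)
  map₂_left_unitor f := hom₂_ext (CombConeStack.geomPseudofunctor.map₂_left_unitor f)
  map₂_right_unitor f := hom₂_ext (CombConeStack.geomPseudofunctor.map₂_right_unitor f)

lemma ConeStack.nonempty_equivalence {𝒳 𝒴 : ConeStack.{u}} (e : Bicategory.Equivalence 𝒳.1 𝒴.1) :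
    Nonempty (Bicategory.Equivalence 𝒳 𝒴) :=
  ⟨.mkOfAdjointifyCounit (f := mkHom (X := 𝒳) (Y := 𝒴) e.hom)
    (g := mkHom (X := 𝒴) (Y := 𝒳) e.inv) (isoMk e.unit) (isoMk e.counit)⟩

lemma isBiequivalence_toConeStacks : IsBiequivalence toConeStacks.{u} where
  isEquivalence S T :=
    { faithful := ⟨fun {f g} η θ h => by
        have h' : toConeStacks.map₂ η = toConeStacks.map₂ θ := h
        exact CombConeStack.geomMap₂_injective
          (congrArg (fun k : toConeStacks.map f ⟶ toConeStacks.map g => k.hom) h')⟩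
      full := ⟨fun {f g} ζ => by
        let ζ' : toConeStacks.map f ⟶ toConeStacks.map g := ζ
        obtain ⟨η, hη⟩ := CombConeStack.geomMap₂_surjective (f := f) (g := g) ζ'.hom
        have h : toConeStacks.map₂ η = ζ' := hom₂_ext hη
        exact ⟨η, h⟩⟩
      essSurj := ⟨fun K => by
        let K' : S.coneStack ⟶ T.coneStack := K
        obtain ⟨f, ⟨i⟩⟩ := CombConeStack.exists_geomMap_iso (S := S) (T := T) K'.hom
        let j : toConeStacks.map f ≅ K' := isoMk i
        exact ⟨f, ⟨j⟩⟩⟩ }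
  essSurj 𝒳 := by
    have h := IsConeStack.isConelike 𝒳.2
    obtain ⟨e⟩ := h.exists_equivalence 𝒳.2.isStack
    exact ⟨h.stack, ConeStack.nonempty_equivalence (𝒳 := h.stack.coneStack) (equivSymm e)⟩

lemma isSpace_toConeStacks (S : CombConeStack.{u}) : (toConeStacks.obj S).IsSpace ↔ S.IsSpace := by
  constructor
  · rintro ⟨X, -, ⟨e⟩⟩
    have e' : Bicategory.Equivalence S.geom (elements X) := e
    obtain ⟨Z, hZ, -⟩ := CombConeStack.exists_space
      (CombConeStack.aut_eq_id_of_isThin ((elements_isThin X).of_equivalence e'))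
    exact ⟨Z, hZ⟩
  · rintro ⟨Z, ⟨e⟩⟩
    obtain ⟨e'⟩ := Z.exists_equivalence
    exact ⟨Z.presheaf, isConeSpace_of_isConelike Z.presheaf_isSheaf
      (elements_presheaf_isConelike Z),
      ⟨equivTrans (mapEquivalence CombConeStack.geomPseudofunctor e) (equivSymm e')⟩⟩

end Biequivalence

end

end ConeStacks

theorem mainTheorem3 :
    ∃ F : Pseudofunctor ConeStacks.CombConeStack.{u} ConeStacks.ConeStack.{u},
      ConeStacks.IsBiequivalence F ∧
      ∀ S : ConeStacks.CombConeStack.{u}, (F.obj S).IsSpace ↔ S.IsSpace :=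
  ⟨ConeStacks.toConeStacks, ConeStacks.isBiequivalence_toConeStacks,
    ConeStacks.isSpace_toConeStacks⟩
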